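/- Let $k$ be a field, $A$ a Hopf algebra over $k$ with invertible antipode, and $\Lambda^1$ a finite-dimensional right $A$-crossed (Drinfeld--Yetter) module, i.e. a right module and right comodule $v\mapsto v_0\otimes v_1$ with $\Delta_R(v\triangleleft a)=v_0\triangleleft a_{(2)}\otimes (Sa_{(1)})v_1a_{(3)}$. Crossed modules are braided by $\Psi(v\otimes w)=w_0\otimes v\triangleleft w_1$. Let $[m,-\Psi]!$ be the braided factorials on $(\Lambda^1)^{\otimes m}$, given by $[m,-\Psi]!=({\rm id}\otimes[m-1,-\Psi]!)\,[m,-\Psi]$, $[m,-\Psi]=\sum_{j=0}^{m-1}(-1)^j\Psi_1\cdots\Psi_j$, and let $$B=B_-(\Lambda^1)=T\Lambda^1/\oplus_m\ker[m,-\Psi]!,$$ a graded super-braided Hopf algebra (the elements of $\Lambda^1$ are primitive) with super-braided antipode $S$; $D$ denotes the degree. Let $B^\star=B_-(\Lambda^{1*})$, where $\Lambda^{1*}$ is the dual crossed module with ${\rm ev}:\Lambda^{1*}\otimes\Lambda^1\to k$, paired with $B$ by $\langle\varphi,b\rangle={\rm ev}(\varphi,[m,-\Psi]!\,b)$ in degree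 $m$ (nested evaluation), and by zero in different degrees. Assume that $g\in\Lambda^1\otimes\Lambda^1$ is a bi-invariant metric: $g$ is invariant under $\Delta_R$, and there is an $A$-bimodule map $(\ ,\ ):\Omega^1\otimes_A\Omega^1\to A$ with $(\omega,g_1)g_2=\omega=g_1(g_2,\omega)$ for all $\omega\in\Omega^1=A\otimes\Lambda^1$ (with right action $(av)b=ab_{(1)}(v\triangleleft b_{(2)})$). Assume that $B$ has a top degree $n$, of dimension $1$, and let ${\rm Vol}\in B$ be a nonzero element of degree $n$ which is bi-invariant and central, i.e. $\Delta_R{\rm Vol}={\rm Vol}\otimes 1$, and ${\rm Vol}$ commutes with $A$ in $\Omega=A\otimes B$, where $\omega a=a_{(1)}(\omega\triangleleft a_{(2)})$. Write $g:B^\star\to B$ also for the algebra isomorphism that extends $\Lambda^{1*}\to\Lambda^1$, $f\mapsto f(g_1)g_2$, and put ${\rm Vol}^*=g^{-1}({\rm Vol})$, $\langle{\rm Vol},{\rm Vol}\rangle=\langle {\rm Vol}^*,{\rm Vol}\rangle$. Let $\int:B\to k$ and $\int^*:B^\star\to k$ be the functionals that vanish in degrees other than $n$ and satisfy $\int{\rm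 Vol}=1$, $\int^*{\rm Vol}^*=1$. Let $\exp=\exp_1\otimes\exp_2\in B\otimes B^\star$ be the coevaluation for $\langle\ ,\ \rangle$, and $y=y_1\otimes y_2=\Psi_{sup}^{-1}\exp\in B^\star\otimes B$, where $\Psi_{sup}:B^\star\otimes B\to B\otimes B^\star$ is the braiding times $(-1)^{ij}$ on elements of degrees $i,j$. Define $$\mathcal F(b)=\Big(\int b\,\exp_1\Big)\exp_2,\quad \mathcal F^\star(\varphi)=\Big(\int^*\varphi\, y_1\Big)y_2,\quad \mu=\Big(\int\otimes\int^*\Big)\exp,$$ $$\sharp=g\circ\mathcal F,\qquad \sharp^\star=(-1)^D\circ\mathcal F^\star\circ g^{-1}.$$ Then $\langle{\rm Vol},{\rm Vol}\rangle\neq0$ and $\mu=\langle{\rm Vol},{\rm Vol}\rangle^{-1}\in k^\times$; the map $\sharp:B\to B$ is invertible; and $\sharp S=(-1)^nS\sharp$. If moreover $g$ is quantum symmetric, i.e. its image $g_1g_2$ under the product of $B$ vanishes, then $S=(-1)^D$, $\sharp^\star=\sharp$ and $\sharp^2=\mu$ on the degrees $D=0,1,n-1,n$ of $B$. -/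

import Mathlib

open scoped TensorProduct DirectSum

namespace BraidedHodge

noncomputable section

/-! ### Linear algebra preliminaries -/

open Classical in
/-- The inverse of a bijective linear map (and `0` if the map is not bijective). -/
def linInverse {k M N : Type*} [Field k] [AddCommGroup M] [Module k M] [AddCommGroup N]
    [Module k N] (f : M →ₗ[k] N) : N →ₗ[k] M :=
  if h : Function.Bijective f then ((LinearEquiv.ofBijective f h).symm : N →ₗ[k] M) else 0

open Classical in
/-- The element with the property `P` (and `0` if there is none). It is only used for properties
that single out one element. -/
def theElement {M : Type*} [Zero M] (P : M → Prop) : M :=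
  if h : ∃ x, P x then h.choose else 0

/-! ### Right crossed modules over a Hopf algebra -/

/-- A right action `v ⊗ a ↦ v ◁ a` and a right coaction `v ↦ v₀ ⊗ v₁` of `A` on `V`
(without the axioms). -/
structure CrossedData (k A V : Type*) [Field k] [Ring A] [HopfAlgebra k A]
    [AddCommGroup V] [Module k V] where
  act : V →ₗ[k] A →ₗ[k] V
  coact : V →ₗ[k] V ⊗[k] A

section Braiding

variable {k A : Type*} [Field k] [Ring A] [HopfAlgebra k A]
  {X Y : Type*} [AddCommGroup X] [Module k X] [AddCommGroup Y] [Module k Y]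

/-- The crossed module braiding `Ψ : X ⊗ Y → Y ⊗ X`, `Ψ (x ⊗ y) = y₀ ⊗ (x ◁ y₁)`. -/
def braid (actX : X →ₗ[k] A →ₗ[k] X) (coactY : Y →ₗ[k] Y ⊗[k] A) : X ⊗[k] Y →ₗ[k] Y ⊗[k] X :=
  TensorProduct.lift ((LinearMap.lTensorHom Y ∘ₗ actX).compl₂ coactY)

variable (k A) in
/-- The inverse of the antipode of `A`. -/
def antipodeInv : A →ₗ[k] A := linInverse (HopfAlgebra.antipode k (A := A))

/-- The inverse braiding `Ψ⁻¹ : Y ⊗ X → X ⊗ Y`, `Ψ⁻¹ (y ⊗ x) = (x ◁ S⁻¹ y₁) ⊗ y₀`. -/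
def braidInv (actX : X →ₗ[k] A →ₗ[k] X) (coactY : Y →ₗ[k] Y ⊗[k] A) :
    Y ⊗[k] X →ₗ[k] X ⊗[k] Y :=
  (TensorProduct.comm k Y X).toLinearMap ∘ₗ braid (actX.compl₂ (antipodeInv k A)) coactY ∘ₗ
    (TensorProduct.comm k Y X).toLinearMap

end Braiding

namespace CrossedData

variable {k A V : Type*} [Field k] [Ring A] [HopfAlgebra k A] [AddCommGroup V] [Module k V]

/-- `(v₀ ⊗ v₁) (a ⊗ b) ↦ (v₀ ◁ a) ⊗ v₁ b`. -/
def actTensor (X : CrossedData k A V) : V ⊗[k] A →ₗ[k] A ⊗[k] A →ₗ[k] V ⊗[k] A :=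
  TensorProduct.homTensorHomMap (RingHom.id k) A A V A ∘ₗ
    TensorProduct.map X.act (LinearMap.mul k A)

/-- The right-hand side `(v₀ ◁ a₂) ⊗ (S a₁) v₁ a₃` of the crossed module condition. -/
def crossedRHS (X : CrossedData k A V) (v : V) (a : A) : V ⊗[k] A :=
  TensorProduct.lift
    ((LinearMap.lTensorHom V ∘ₗ LinearMap.mul k A ∘ₗ HopfAlgebra.antipode k (A := A)).compl₂
      (X.actTensor (X.coact v)))
    (LinearMap.lTensor A Coalgebra.comul (Coalgebra.comul (R := k) a))

/-- The axioms of a right crossed (Drinfeld-Yetter) module: right module, right comodule, and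
`Δ_R (v ◁ a) = (v₀ ◁ a₂) ⊗ (S a₁) v₁ a₃`. -/
structure IsCrossedModule (X : CrossedData k A V) : Prop where
  act_one : ∀ v, X.act v 1 = v
  act_mul : ∀ v a b, X.act v (a * b) = X.act (X.act v a) b
  coact_counit : ∀ v, TensorProduct.rid k V (LinearMap.lTensor V Coalgebra.counit (X.coact v)) = v
  coact_coassoc : ∀ v, TensorProduct.assoc k V A A (LinearMap.rTensor A X.coact (X.coact v)) =
    LinearMap.lTensor V Coalgebra.comul (X.coact v)
  crossed : ∀ v a, X.coact (X.act v a) = X.crossedRHS v a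

/-- The braiding of `V` with itself. -/
def braiding (X : CrossedData k A V) : V ⊗[k] V →ₗ[k] V ⊗[k] V := braid X.act X.coact

/-- The dual `V^*` (with `ev : V^* ⊗ V → k`), with `(f ◁ a)(v) = f (v ◁ S⁻¹ a)` and
`f₀(v) f₁ = f(v₀) S v₁`. -/
def dual [Module.Finite k V] (X : CrossedData k A V) : CrossedData k A (Module.Dual k V) where
  act := (LinearMap.llcomp k V V k).compl₂ (X.act.flip ∘ₗ antipodeInv k A)
  coact := (dualTensorHomEquiv k V A).symm.toLinearMap ∘ₗ LinearMap.lcomp k A X.coact ∘ₗ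
    LinearMap.llcomp k (V ⊗[k] A) (k ⊗[k] A) A
      (HopfAlgebra.antipode k (A := A) ∘ₗ (TensorProduct.lid k A).toLinearMap) ∘ₗ
    LinearMap.rTensorHom A

/-- The tensor product right coaction `v ⊗ w ↦ v₀ ⊗ w₀ ⊗ v₁ w₁` on `V ⊗ V`. -/
def coactTwo (X : CrossedData k A V) : V ⊗[k] V →ₗ[k] (V ⊗[k] V) ⊗[k] A :=
  LinearMap.lTensor (V ⊗[k] V) (LinearMap.mul' k A) ∘ₗ
    (TensorProduct.tensorTensorTensorComm k V A V A).toLinearMap ∘ₗ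
    TensorProduct.map X.coact X.coact

end CrossedData

/-! ### Braided integers and factorials on tensor powers -/

section Factorials

variable {k V : Type*} [Field k] [AddCommGroup V] [Module k V]

variable (k V) in
/-- `V ⊗ V^{⊗ m} = V^{⊗ (m+1)}`. -/
def consEquiv (m : ℕ) : V ⊗[k] (⨂[k]^m V) ≃ₗ[k] ⨂[k]^(m + 1) V :=
  TensorProduct.congr (PiTensorProduct.subsingletonEquiv (R := k) (s := fun _ => V) (0 : Fin 1)).symm
      (LinearEquiv.refl k _) ≪≫ₗ
    TensorPower.mulEquiv ≪≫ₗ TensorPower.cast k V (add_comm 1 m)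

/-- `id ⊗ f` on `V ⊗ V^{⊗ m} = V^{⊗ (m+1)}`. -/
def shift {m : ℕ} (f : ⨂[k]^m V →ₗ[k] ⨂[k]^m V) : ⨂[k]^(m + 1) V →ₗ[k] ⨂[k]^(m + 1) V :=
  (consEquiv k V m).toLinearMap ∘ₗ LinearMap.lTensor V f ∘ₗ (consEquiv k V m).symm.toLinearMap

/-- `Ψ₁`: the operator `ψ` in the first two tensor factors. -/
def braidFirst (ψ : V ⊗[k] V →ₗ[k] V ⊗[k] V) (m : ℕ) : ⨂[k]^(m + 2) V →ₗ[k] ⨂[k]^(m + 2) V :=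
  let e : (V ⊗[k] V) ⊗[k] (⨂[k]^m V) ≃ₗ[k] ⨂[k]^(m + 2) V :=
    TensorProduct.assoc k V V (⨂[k]^m V) ≪≫ₗ
      TensorProduct.congr (LinearEquiv.refl k V) (consEquiv k V m) ≪≫ₗ consEquiv k V (m + 1)
  e.toLinearMap ∘ₗ LinearMap.rTensor (⨂[k]^m V) ψ ∘ₗ e.symm.toLinearMap

/-- The braided integers `[m; ψ] = id + ψ₁ + ψ₁ψ₂ + ⋯ + ψ₁ ⋯ ψ_{m-1}`, written as
`[m+1; ψ] = id + ψ₁ (id ⊗ [m; ψ])`. -/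
def braidedInt (ψ : V ⊗[k] V →ₗ[k] V ⊗[k] V) : ∀ m : ℕ, ⨂[k]^m V →ₗ[k] ⨂[k]^m V
  | 0 => 0
  | 1 => LinearMap.id
  | m + 2 => LinearMap.id + braidFirst ψ m ∘ₗ shift (braidedInt ψ (m + 1))

/-- The braided factorials `[m+1; ψ]! = (id ⊗ [m; ψ]!) [m+1; ψ]`. -/
def braidedFactorial (ψ : V ⊗[k] V →ₗ[k] V ⊗[k] V) : ∀ m : ℕ, ⨂[k]^m V →ₗ[k] ⨂[k]^m V
  | 0 => LinearMap.id
  | m + 1 => shift (braidedFactorial ψ m) ∘ₗ braidedInt ψ (m + 1)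

end Factorials

namespace CrossedData

/-! ### The braided exterior algebra -/

section Exterior

variable {k A V : Type*} [Field k] [Ring A] [HopfAlgebra k A] [AddCommGroup V] [Module k V]

/-- The relations of `B_-(V)`: all elements of `⊕_m ker [m; -Ψ]!` are set to zero. -/
inductive ExtRel (X : CrossedData k A V) : TensorAlgebra k V → TensorAlgebra k V → Prop
  | of (m : ℕ) (t : ⨂[k]^m V) (ht : braidedFactorial (-X.braiding) m t = 0) :
      ExtRel X (TensorPower.toTensorAlgebra t) 0

/-- The braided exterior algebra `B_-(V) = T V / ⊕_m ker [m; -Ψ]!`. -/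
def Ext (X : CrossedData k A V) : Type _ := RingQuot X.ExtRel

instance (X : CrossedData k A V) : Ring X.Ext := inferInstanceAs (Ring (RingQuot X.ExtRel))

instance (X : CrossedData k A V) : Algebra k X.Ext :=
  inferInstanceAs (Algebra k (RingQuot X.ExtRel))

/-- The quotient map `T V → B_-(V)`. -/
def toExt (X : CrossedData k A V) : TensorAlgebra k V →ₐ[k] X.Ext := RingQuot.mkAlgHom k X.ExtRel

/-- A linear choice of representatives for `B_-(V) = T V / ⊕_m ker [m; -Ψ]!`. -/
def rep (X : CrossedData k A V) : X.Ext →ₗ[k] TensorAlgebra k V :=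
  (X.toExt.toLinearMap.exists_rightInverse_of_surjective
    (LinearMap.range_eq_top.2 (RingQuot.mkAlgHom_surjective k X.ExtRel))).choose

/-- The map on `B_-(V)` induced by a linear map on `T V`: the value of `φ` on a representative.
It is only used for `φ` that vanish on `⊕_m ker [m; -Ψ]!`, when it does not depend on the choice
of the representatives. -/
def induced (X : CrossedData k A V) {M : Type*} [AddCommMonoid M] [Module k M]
    (φ : TensorAlgebra k V →ₗ[k] M) : X.Ext →ₗ[k] M := φ ∘ₗ X.rep

/-- The inclusion of `V` as the degree one part. -/
def incl (X : CrossedData k A V) : V →ₗ[k] X.Ext := X.toExt.toLinearMap ∘ₗ TensorAlgebra.ι k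

/-- The degree `m` part of `B_-(V)`. -/
def degree (X : CrossedData k A V) (m : ℕ) : Submodule k X.Ext :=
  LinearMap.range (X.toExt.toLinearMap ∘ₗ TensorPower.toTensorAlgebra (n := m))

/-- The projection of `B_-(V)` to its degree `m` part. -/
def proj (X : CrossedData k A V) (m : ℕ) : X.Ext →ₗ[k] X.Ext :=
  X.induced (X.toExt.toLinearMap ∘ₗ TensorPower.toTensorAlgebra ∘ₗ
    DirectSum.component k ℕ (fun n => ⨂[k]^n V) m ∘ₗ TensorAlgebra.toDirectSum.toLinearMap)

variable (k V) in
/-- `(-1)^D` on `T V`, where `D` is the degree. -/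
def tensorSign : TensorAlgebra k V →ₐ[k] TensorAlgebra k V :=
  TensorAlgebra.lift k (-TensorAlgebra.ι k)

/-- `(-1)^D` on `B_-(V)`, where `D` is the degree. -/
def signD (X : CrossedData k A V) : X.Ext →ₗ[k] X.Ext :=
  X.induced (X.toExt.toLinearMap ∘ₗ (tensorSign k V).toLinearMap)

/-! #### The crossed module structure of `B_-(V)` -/

/-- `v ⊗ φ ↦ (a ↦ (v ◁ a₁) φ(a₂))`. -/
def actStep (X : CrossedData k A V) : V →ₗ[k] Module.End k (A →ₗ[k] TensorAlgebra k V) :=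
  LinearMap.mk₂ k
    (fun v φ => LinearMap.mul' k (TensorAlgebra k V) ∘ₗ
      TensorProduct.map (TensorAlgebra.ι k ∘ₗ X.act v) φ ∘ₗ Coalgebra.comul)
    (fun v w φ => by
      rw [map_add, LinearMap.comp_add, TensorProduct.map_add_left, LinearMap.add_comp,
        LinearMap.comp_add])
    (fun c v φ => by
      rw [map_smul, LinearMap.comp_smul, TensorProduct.map_smul_left, LinearMap.smul_comp,
        LinearMap.comp_smul])
    (fun v φ χ => by
      rw [TensorProduct.map_add_right, LinearMap.add_comp, LinearMap.comp_add])
    (fun c v φ => by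
      rw [TensorProduct.map_smul_right, LinearMap.smul_comp, LinearMap.comp_smul])

/-- The right action of `A` on `T V`: `1 ◁ a = ε(a) 1` and `(v t) ◁ a = (v ◁ a₁) (t ◁ a₂)`. -/
def tensorAct (X : CrossedData k A V) : TensorAlgebra k V →ₗ[k] A →ₗ[k] TensorAlgebra k V :=
  LinearMap.applyₗ (Algebra.linearMap k (TensorAlgebra k V) ∘ₗ Coalgebra.counit) ∘ₗ
    (TensorAlgebra.lift k X.actStep).toLinearMap

/-- The right coaction of `A` on `T V`, the algebra map that extends the coaction on `V`. -/
def tensorCoact (X : CrossedData k A V) :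
    TensorAlgebra k V →ₐ[k] TensorAlgebra k V ⊗[k] A :=
  TensorAlgebra.lift k (LinearMap.rTensor A (TensorAlgebra.ι k) ∘ₗ X.coact)

/-- The right action of `A` on `B_-(V)`. -/
def extAct (X : CrossedData k A V) : X.Ext →ₗ[k] A →ₗ[k] X.Ext :=
  X.induced (X.tensorAct.compr₂ X.toExt.toLinearMap)

/-- The right coaction of `A` on `B_-(V)`. -/
def extCoact (X : CrossedData k A V) : X.Ext →ₗ[k] X.Ext ⊗[k] A :=
  X.induced (LinearMap.rTensor A X.toExt.toLinearMap ∘ₗ X.tensorCoact.toLinearMap)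

/-! #### The super-braided Hopf algebra structure of `B_-(V)` -/

/-- Left multiplication by `v ⊗ 1 + 1 ⊗ v` in the super-braided tensor product algebra
`T V ⊗ T V`: `x ⊗ y ↦ v x ⊗ y + (-1)^|x| x₀ ⊗ (v ◁ x₁) y`. -/
def coprodStep (X : CrossedData k A V) :
    V →ₗ[k] Module.End k (TensorAlgebra k V ⊗[k] TensorAlgebra k V) where
  toFun v :=
    LinearMap.rTensor (TensorAlgebra k V) (LinearMap.mulLeft k (TensorAlgebra.ι k v)) +
    LinearMap.lTensor (TensorAlgebra k V)
        (LinearMap.mul' k (TensorAlgebra k V) ∘ₗ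
          LinearMap.rTensor (TensorAlgebra k V) (TensorAlgebra.ι k ∘ₗ X.act v)) ∘ₗ
      (TensorProduct.assoc k (TensorAlgebra k V) A (TensorAlgebra k V)).toLinearMap ∘ₗ
      LinearMap.rTensor (TensorAlgebra k V)
        (X.tensorCoact.toLinearMap ∘ₗ (tensorSign k V).toLinearMap)
  map_add' v w := by
    ext x y
    simp only [map_add, LinearMap.comp_add, LinearMap.rTensor_add, LinearMap.lTensor_add,
      LinearMap.add_comp, TensorProduct.AlgebraTensorModule.curry_apply, LinearMap.restrictScalars_self,
      TensorProduct.curry_apply, LinearMap.add_apply, LinearMap.rTensor_tmul,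
      LinearMap.mulLeft_apply, add_mul, TensorProduct.add_tmul]
    abel
  map_smul' c v := by
    ext x y
    simp only [map_smul, LinearMap.comp_smul, LinearMap.rTensor_smul, LinearMap.lTensor_smul,
      LinearMap.smul_comp, TensorProduct.AlgebraTensorModule.curry_apply,
      LinearMap.restrictScalars_self, TensorProduct.curry_apply, LinearMap.add_apply,
      LinearMap.smul_apply, LinearMap.rTensor_tmul, LinearMap.mulLeft_apply, smul_mul_assoc,
      TensorProduct.smul_tmul', smul_add, RingHom.id_apply]

/-- The coproduct of `T_- V`: `Δ 1 = 1 ⊗ 1` and `Δ (v t) = (v ⊗ 1 + 1 ⊗ v) Δ t`, the product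
being taken in the super-braided tensor product algebra. -/
def tensorCoprod (X : CrossedData k A V) :
    TensorAlgebra k V →ₗ[k] TensorAlgebra k V ⊗[k] TensorAlgebra k V :=
  LinearMap.applyₗ (1 ⊗ₜ[k] 1) ∘ₗ (TensorAlgebra.lift k X.coprodStep).toLinearMap

/-- The coproduct of `B_-(V)`. -/
def coprod (X : CrossedData k A V) : X.Ext →ₗ[k] X.Ext ⊗[k] X.Ext :=
  X.induced (TensorProduct.map X.toExt.toLinearMap X.toExt.toLinearMap ∘ₗ X.tensorCoprod)

/-- The counit of `B_-(V)`, which vanishes in positive degrees. -/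
def counit (X : CrossedData k A V) : X.Ext →ₗ[k] k :=
  X.induced (TensorAlgebra.algebraMapInv (R := k) (M := V)).toLinearMap

/-- The antipode axioms for `B_-(V)`. -/
def IsAntipode (X : CrossedData k A V) (S : X.Ext →ₗ[k] X.Ext) : Prop :=
  LinearMap.mul' k X.Ext ∘ₗ TensorProduct.map S LinearMap.id ∘ₗ X.coprod =
      Algebra.linearMap k X.Ext ∘ₗ X.counit ∧
    LinearMap.mul' k X.Ext ∘ₗ TensorProduct.map LinearMap.id S ∘ₗ X.coprod =
      Algebra.linearMap k X.Ext ∘ₗ X.counit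

/-- The super-braided antipode `S` of `B_-(V)`. -/
def antipode (X : CrossedData k A V) : X.Ext →ₗ[k] X.Ext := theElement X.IsAntipode

/-- `B_-(V)` has a one-dimensional top degree, equal to `n`. -/
def HasTopDegree (X : CrossedData k A V) (n : ℕ) : Prop :=
  Module.finrank k (X.degree n) = 1 ∧ ∀ m, n < m → X.degree m = ⊥

/-- The integral `∫ : B_-(V) → k` with `∫ vol = 1`, zero in the degrees other than `n`. -/
def integral (X : CrossedData k A V) (n : ℕ) (vol : X.Ext) : X.Ext →ₗ[k] k :=
  theElement fun I => I vol = 1 ∧ ∀ m, m ≠ n → ∀ x ∈ X.degree m, I x = 0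

/-- The element `vol` is bi-invariant and central in `Ω = A ⊗ B_-(V)`, the bosonisation with
`ω a = a₁ (ω ◁ a₂)`: `Δ_R vol = vol ⊗ 1`, and `vol a = a vol` for all `a` in `A`. -/
def IsCentralBiinvariant (X : CrossedData k A V) (vol : X.Ext) : Prop :=
  X.extCoact vol = vol ⊗ₜ[k] 1 ∧
    ∀ a : A, LinearMap.lTensor A (X.extAct vol) (Coalgebra.comul (R := k) a) = a ⊗ₜ[k] vol

end Exterior

/-! ### Metrics -/

section Metric

variable {k A V : Type*} [Field k] [Ring A] [HopfAlgebra k A] [AddCommGroup V] [Module k V]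

/-- The right action `(a v) b = a b₁ (v ◁ b₂)` of `A` on `Ω¹ = A ⊗ V`. -/
def formMul (X : CrossedData k A V) (b : A) : A ⊗[k] V →ₗ[k] A ⊗[k] V :=
  (TensorProduct.homTensorHomMap (RingHom.id k) A A A V ∘ₗ
    TensorProduct.map (LinearMap.mul k A) X.act).flip (Coalgebra.comul (R := k) b)

/-- `β` is an `A`-bimodule map `( , ) : Ω¹ ⊗_A Ω¹ → A` that is inverse to the element `g` of
`V ⊗ V ⊆ Ω¹ ⊗_A Ω¹`: `(ω, g₁) g₂ = ω = g₁ (g₂, ω)` for all `ω` in `Ω¹`. -/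
structure IsInverseMetric (X : CrossedData k A V) (g : V ⊗[k] V)
    (β : A ⊗[k] V →ₗ[k] A ⊗[k] V →ₗ[k] A) : Prop where
  left_linear : ∀ (a : A) (ω η : A ⊗[k] V), β (a • ω) η = a * β ω η
  right_linear : ∀ (ω η : A ⊗[k] V) (b : A), β ω (X.formMul b η) = β ω η * b
  balanced : ∀ (ω : A ⊗[k] V) (b : A) (η : A ⊗[k] V), β (X.formMul b ω) η = β ω (b • η)
  left_inverse : ∀ ω : A ⊗[k] V,
    TensorProduct.map (β ω ∘ₗ TensorProduct.mk k A V 1) LinearMap.id g = ω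
  right_inverse : ∀ ω : A ⊗[k] V,
    TensorProduct.lift (LinearMap.mk₂ k (fun v w => X.formMul (β (1 ⊗ₜ w) ω) (1 ⊗ₜ v))
      (by intros; simp [TensorProduct.tmul_add]) (by intros; simp)
      (by intros; simp [formMul, TensorProduct.tmul_add]) (by intros; simp [formMul])) g = ω

/-- A bi-invariant metric: an element `g` of `V ⊗ V` (so left-invariant) which is right-invariant
and is a metric, i.e. has an inverse `( , ) : Ω¹ ⊗_A Ω¹ → A`. -/
def IsBiinvariantMetric (X : CrossedData k A V) (g : V ⊗[k] V) : Prop :=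
  X.coactTwo g = g ⊗ₜ[k] 1 ∧ ∃ β, X.IsInverseMetric g β

/-- The metric is quantum symmetric: its product vanishes in degree two. -/
def IsQuantumSymmetric (X : CrossedData k A V) (g : V ⊗[k] V) : Prop :=
  LinearMap.mul' k X.Ext (TensorProduct.map X.incl X.incl g) = 0

/-- The metric as a map `V^* → V`, `f ↦ f(g₁) g₂`. -/
def metricMap (g : V ⊗[k] V) : Module.Dual k V →ₗ[k] V :=
  (TensorProduct.lid k V).toLinearMap ∘ₗ (LinearMap.rTensorHom V).flip g

end Metric

/-! ### Duality, Fourier transform and the Hodge star -/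

section Hodge

variable {k A V : Type*} [Field k] [Ring A] [HopfAlgebra k A] [AddCommGroup V] [Module k V]
  [Module.Finite k V]

/-- The pairing of `T V^*` and `T V`: `⟨φ, t⟩ = ev (φ, [m; -Ψ]! t)` in degree `m`, where `ev` is
the nested evaluation of `(V^*)^{⊗ m}` on `V^{⊗ m}` (last factor against first factor and so on),
and zero between different degrees. -/
def tensorPairing (X : CrossedData k A V) :
    TensorAlgebra k (Module.Dual k V) →ₗ[k] TensorAlgebra k V →ₗ[k] k :=
  DirectSum.toModule k ℕ (TensorAlgebra k V →ₗ[k] k) (fun m =>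
    LinearMap.lcomp k k (braidedFactorial (-X.braiding) m ∘ₗ
        DirectSum.component k ℕ (fun n => ⨂[k]^n V) m ∘ₗ
        TensorAlgebra.toDirectSum.toLinearMap) ∘ₗ
      TensorPower.pairingDual k V m ∘ₗ
      (PiTensorProduct.reindex k (fun _ => Module.Dual k V) (Fin.revPerm (n := m))).toLinearMap) ∘ₗ
    TensorAlgebra.toDirectSum.toLinearMap

/-- The pairing `⟨ , ⟩` of `B_-(V^*)` and `B_-(V)`. -/
def pairing (X : CrossedData k A V) : X.dual.Ext →ₗ[k] X.Ext →ₗ[k] k :=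
  X.tensorPairing.compl₁₂ X.dual.rep X.rep

/-- The coevaluation `exp` in `B_-(V) ⊗ B_-(V^*)` for the pairing: it is characterised by
`exp₁ ⟨exp₂, b⟩ = b` and `⟨φ, exp₁⟩ exp₂ = φ`. -/
def exp (X : CrossedData k A V) : X.Ext ⊗[k] X.dual.Ext :=
  theElement fun e =>
    (∀ b, TensorProduct.rid k X.Ext (LinearMap.lTensor X.Ext (X.pairing.flip b) e) = b) ∧
    ∀ φ, TensorProduct.lid k X.dual.Ext (LinearMap.rTensor X.dual.Ext (X.pairing φ) e) = φ

/-- The super-braided Fourier transform `F : B_-(V) → B_-(V^*)`, `F b = ∫ (b exp₁) exp₂`. -/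
def fourier (X : CrossedData k A V) (I : X.Ext →ₗ[k] k) : X.Ext →ₗ[k] X.dual.Ext :=
  (TensorProduct.lid k X.dual.Ext).toLinearMap ∘ₗ (LinearMap.rTensorHom X.dual.Ext).flip X.exp ∘ₗ
    (LinearMap.mul k X.Ext).compr₂ I

/-- The inverse super-braiding `Ψ_sup⁻¹ : B_-(V) ⊗ B_-(V^*) → B_-(V^*) ⊗ B_-(V)`, i.e. `Ψ⁻¹` times
the sign `(-1)^(i j)` on elements of degrees `i` and `j` (where degrees above `n` vanish). -/
def superBraidInv (X : CrossedData k A V) (n : ℕ) :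
    X.Ext ⊗[k] X.dual.Ext →ₗ[k] X.dual.Ext ⊗[k] X.Ext :=
  ∑ i ∈ Finset.range (n + 1), ∑ j ∈ Finset.range (n + 1),
    (-1 : k) ^ (i * j) • (braidInv X.dual.extAct X.extCoact ∘ₗ
      TensorProduct.map (X.proj i) (X.dual.proj j))

/-- The adjoint Fourier transform `F^⋆ : B_-(V^*) → B_-(V)`, `F^⋆ φ = ∫^* (φ y₁) y₂` with
`y = Ψ_sup⁻¹ exp`. -/
def fourierStar (X : CrossedData k A V) (n : ℕ) (J : X.dual.Ext →ₗ[k] k) :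
    X.dual.Ext →ₗ[k] X.Ext :=
  (TensorProduct.lid k X.Ext).toLinearMap ∘ₗ
    (LinearMap.rTensorHom X.Ext).flip (X.superBraidInv n X.exp) ∘ₗ
    (LinearMap.mul k X.dual.Ext).compr₂ J

/-- The extension `g : B_-(V^*) → B_-(V)` of the metric, by `g^{⊗ m}` in degree `m`. -/
def metricExt (X : CrossedData k A V) (g : V ⊗[k] V) : X.dual.Ext →ₗ[k] X.Ext :=
  X.dual.induced (X.toExt.toLinearMap ∘ₗ
    (TensorAlgebra.lift k (TensorAlgebra.ι k ∘ₗ metricMap g)).toLinearMap)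

/-- The top form `Vol^*` of `B_-(V^*)` that corresponds to `vol` under the metric. -/
def volStar (X : CrossedData k A V) (g : V ⊗[k] V) (vol : X.Ext) : X.dual.Ext :=
  linInverse (X.metricExt g) vol

/-- The integral `∫^*` on `B_-(V^*)`, with `∫^* Vol^* = 1`. -/
def integralStar (X : CrossedData k A V) (g : V ⊗[k] V) (n : ℕ) (vol : X.Ext) :
    X.dual.Ext →ₗ[k] k :=
  X.dual.integral n (X.volStar g vol)

/-- The Hodge star `♯ = g ∘ F`. -/
def hodge (X : CrossedData k A V) (g : V ⊗[k] V) (n : ℕ) (vol : X.Ext) : X.Ext →ₗ[k] X.Ext :=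
  X.metricExt g ∘ₗ X.fourier (X.integral n vol)

/-- The adjoint Hodge star `♯^⋆ = (-1)^D ∘ F^⋆ ∘ g⁻¹`. -/
def hodgeStar (X : CrossedData k A V) (g : V ⊗[k] V) (n : ℕ) (vol : X.Ext) :
    X.Ext →ₗ[k] X.Ext :=
  X.signD ∘ₗ X.fourierStar n (X.integralStar g n vol) ∘ₗ linInverse (X.metricExt g)

/-- `μ = (∫ ⊗ ∫^*) exp`. -/
def mu (X : CrossedData k A V) (g : V ⊗[k] V) (n : ℕ) (vol : X.Ext) : k :=
  LinearMap.mul' k k (TensorProduct.map (X.integral n vol) (X.integralStar g n vol) X.exp)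

/-- The metric pairing `⟨ω, η⟩` on `B_-(V)`: the pairing of `g⁻¹ ω` with `η`. -/
def metricPairing (X : CrossedData k A V) (g : V ⊗[k] V) (ω η : X.Ext) : k :=
  X.pairing (linInverse (X.metricExt g) ω) η

end Hodge

end CrossedData

end

end BraidedHodge

/-! B = B_-(Λ¹) and B^⋆ are braided Hopf algebras in duality, and Vol is a two-sided integral
element of B. The theorem is the theory of integrals on finite-dimensional Hopf algebras in braided
form, followed by a special argument in the extreme degrees.

The signs are absorbed first. Over the group algebra A[±1], the group element -1 acts on Λ¹ by -1,
and the coaction is multiplied by it. The braiding becomes -Ψ, and super-braided objects become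
ordinary braided ones (`super`). The tensor algebra is then a braided Hopf algebra with primitive
generators, and braided partial derivatives define a Hopf pairing with the tensor algebra of the
dual (`diffPairing`). In each degree this is the pairing through [m,-Ψ]!, so the relations of B form
its radical (`toExt_eq_zero_iff`). All structure descends to B and B^⋆, where the pairing is
nondegenerate.

Write ψ ▷ t = ⟨ψ, t₁⟩ t₂. As b Vol = ε(b) Vol = Vol b, the coproduct gives (1 ⊗ b) ΔVol = (Sb ⊗ 1)
ΔVol and ΔVol (b ⊗ 1) = ΔVol (1 ⊗ Sb). Together with (id ⊗ ∫) ΔVol = 1 these yield ∫ b (ψ ▷ Vol) =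
⟨ψ₀, Sb ◁ ψ₁⟩ and ∫ (ψ ▷ Vol) Sb = ⟨ψ, b ◁ c⟩, where c is the group element (-1)^n
(`integral_mul_leftOp`, `integral_leftOp_mul`). The second identity makes ψ ↦ ψ ▷ Vol bijective and
the form ∫ xy nondegenerate, so F and ♯ are invertible. Comparing the two gives ∫ xy = ∫ y₀ (S²x ◁
y₁), and from this F S = (-1)^n S F once S Vol = (-1)^n Vol is known. The metric is an isomorphism
of crossed modules, so its extension commutes with S. The element F(1) is a multiple of Vol^*, with
coefficient the inverse of ⟨Vol, Vol⟩, and this coefficient is μ. The first identity also yields F^⋆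
F = μ S, that is ♯^⋆ ♯ = μ (-1)^D S.

In degrees 0 and 1, S = (-1)^D because generators are primitive; degree n is S Vol; degree n-1 is
carried over from degree 1 by ♯. So ♯^⋆ ♯ = μ in these degrees. For ω of degree n-1, both ♯ω and
♯^⋆ω lie in Λ¹, and the formulas for them differ by exchanging g with Ψ(g). As [2,-Ψ]! = id - Ψ, the
condition g₁g₂ = 0 says Ψ(g) = g. Hence ♯^⋆ = ♯ in degree n-1, so ♯² = μ in degree 1, then in degree
n-1 since ♯ commutes with ♯², and then ♯^⋆ = ♯ in degree 1. Degrees 0 and n follow from ♯1 = μ Vol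
and ♯Vol = 1. -/

namespace BraidedHodge

noncomputable section

/-! ### Comatrices and families in comodules -/

section Comatrix

variable {k A : Type*} [Field k] [Ring A] [HopfAlgebra k A]
  {M N : Type*} [AddCommGroup M] [Module k M] [AddCommGroup N] [Module k N]
  {ι κ : Type*} [Fintype ι] [Fintype κ]

variable (k) in
/-- A matrix of elements of `A` with `Δ c i j = ∑ l, c i l ⊗ c l j` and `ε (c i j) = δ i j`. -/
structure IsComatrix [DecidableEq ι] (c : Matrix ι ι A) : Prop where
  comul : ∀ i j, Coalgebra.comul (R := k) (c i j) = ∑ l, c i l ⊗ₜ[k] c l j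
  counit : ∀ i j, Coalgebra.counit (R := k) (c i j) = (1 : Matrix ι ι k) i j

/-- A right comodule structure on `M`. -/
structure IsComodule (ρ : M →ₗ[k] M ⊗[k] A) : Prop where
  counit : ∀ v, TensorProduct.rid k M (LinearMap.lTensor M Coalgebra.counit (ρ v)) = v
  coassoc : ∀ v, TensorProduct.assoc k M A A (LinearMap.rTensor A ρ (ρ v)) =
    LinearMap.lTensor M Coalgebra.comul (ρ v)

/-- A finite family in a comodule that is closed under the coaction. -/
structure IsFamily [DecidableEq ι] (ρ : M →ₗ[k] M ⊗[k] A) (x : ι → M) (c : Matrix ι ι A) :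
    Prop where
  comatrix : IsComatrix k c
  coact : ∀ j, ρ (x j) = ∑ i, x i ⊗ₜ[k] c i j

/-- The coordinate functionals are precomposed with a linear retraction of `M` onto `W`, so that
they can be applied to coactions with values in `M ⊗ A`. -/
theorem exists_dual_family (W : Submodule k M) [Module.Finite k W] :
    ∃ (n : ℕ) (x : Fin n → M) (f : Fin n → M →ₗ[k] k), Submodule.span k (Set.range x) = W ∧
      ∀ i j, f i (x j) = (1 : Matrix (Fin n) (Fin n) k) i j := by
  let b := Module.finBasis k W
  obtain ⟨q, hq⟩ := W.subtype.exists_leftInverse_of_injective (by simp)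
  refine ⟨_, fun i => (b i : M), fun i => b.coord i ∘ₗ q, ?_, fun i j => ?_⟩
  · have := b.span_eq
    rw [show (Set.range fun i => (b i : M)) = W.subtype '' Set.range b by
      rw [← Set.range_comp]; rfl, Submodule.span_image, this]
    simp
  · have : q (b j) = b j := congrArg (fun f => f (b j)) hq
    simp [this, Matrix.one_apply, Finsupp.single_apply, eq_comm]

/-- In a basis of the right factor the coefficients of `z` are slices of `z`; each slice is
rewritten in the spanning family, and the coefficients are then collected on the right. -/
theorem tensor_eq_sum_of_mem {n : ℕ} {x : Fin n → M} (z : M ⊗[k] A)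
    (hz : ∀ α : A →ₗ[k] k, TensorProduct.rid k M (LinearMap.lTensor M α z) ∈
      Submodule.span k (Set.range x)) :
    ∃ c : Fin n → A, z = ∑ i, x i ⊗ₜ[k] c i := by
  classical
  let b := Module.Basis.ofVectorSpace k A
  have key : ∀ z : M ⊗[k] A, z = ((TensorProduct.equivFinsuppOfBasisRight b z).sum
      fun i m => m ⊗ₜ[k] b i) := by
    intro z
    conv_lhs => rw [← (TensorProduct.equivFinsuppOfBasisRight b (M := M)).symm_apply_apply z]
    rw [TensorProduct.equivFinsuppOfBasisRight_symm_apply]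
  have coeff : ∀ (z : M ⊗[k] A) i, TensorProduct.equivFinsuppOfBasisRight b z i =
      TensorProduct.rid k M (LinearMap.lTensor M (b.coord i) z) := by
    intro z i
    induction z with
    | zero => simp
    | add a b ha hb => simp [ha, hb]
    | tmul a b => simp
  rw [key z]
  choose r hr using fun i => (Submodule.mem_span_range_iff_exists_fun k).1 (hz (b.coord i))
  refine ⟨fun j => (TensorProduct.equivFinsuppOfBasisRight b z).sum fun i _ => r i j • b i, ?_⟩
  simp only [Finsupp.sum, TensorProduct.tmul_sum]
  rw [Finset.sum_comm]
  refine Finset.sum_congr rfl fun i _ => ?_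
  rw [coeff, ← hr i, TensorProduct.sum_tmul]
  simp [TensorProduct.smul_tmul]

/-- Local finiteness of comodules. The slices of `ρ m` by functionals on `A` form a
finite-dimensional subcomodule that contains `m`. This replaces Sweedler notation throughout:
identities are checked on finite families, where coassociativity is matrix multiplication. -/
theorem IsComodule.exists_family {ρ : M →ₗ[k] M ⊗[k] A} (h : IsComodule ρ) (m : M) :
    ∃ (n : ℕ) (x : Fin n → M) (c : Matrix (Fin n) (Fin n) A),
      IsFamily ρ x c ∧ m ∈ Submodule.span k (Set.range x) := by
  let Φ : M →ₗ[k] (A →ₗ[k] k) →ₗ[k] M := (LinearMap.mk₂ k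
    (fun m α => TensorProduct.rid k M (LinearMap.lTensor M α (ρ m)))
    (by simp) (by simp) (by simp [LinearMap.lTensor_add]) (by simp [LinearMap.lTensor_smul]))
  have hΦ : ∀ m α, Φ m α = TensorProduct.rid k M (LinearMap.lTensor M α (ρ m)) := fun _ _ => rfl
  let W : Submodule k M := LinearMap.range (Φ m)
  have hfin : Module.Finite k W := by
    have : ∀ z : M ⊗[k] A, ∃ W' : Submodule k M, Module.Finite k W' ∧
        ∀ α : A →ₗ[k] k, TensorProduct.rid k M (LinearMap.lTensor M α z) ∈ W' := by
      intro z
      induction z with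
      | zero => exact ⟨⊥, inferInstance, by simp⟩
      | tmul a b => exact ⟨Submodule.span k {a}, inferInstance, fun α => by
          simpa using Submodule.smul_mem _ _ (Submodule.mem_span_singleton_self a)⟩
      | add a b ha hb =>
        obtain ⟨W1, _, h1⟩ := ha
        obtain ⟨W2, _, h2⟩ := hb
        refine ⟨W1 ⊔ W2, inferInstance, fun α => ?_⟩
        rw [map_add, map_add]
        exact Submodule.add_mem_sup (h1 α) (h2 α)
    obtain ⟨W', _, hW'⟩ := this (ρ m)
    have hle : W ≤ W' := by
      rintro _ ⟨α, rfl⟩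
      exact hW' α
    exact Submodule.finiteDimensional_of_le hle
  -- Coassociativity turns a slice of a slice into a slice by the convolution of the functionals, so
  -- the space of slices is stable under the coaction.
  have hcomp : ∀ α β : A →ₗ[k] k, Φ (Φ m α) β =
      Φ m (LinearMap.mul' k k ∘ₗ TensorProduct.map β α ∘ₗ Coalgebra.comul) := by
    intro α β
    have h1 := congrArg (fun z => TensorProduct.rid k M
      (LinearMap.lTensor M (LinearMap.mul' k k ∘ₗ TensorProduct.map β α) z)) (h.coassoc m)
    rw [← LinearMap.lTensor_comp_apply] at h1
    rw [hΦ, hΦ, hΦ, ← LinearMap.comp_assoc, ← h1]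
    generalize ρ m = z
    induction z with
    | zero => simp
    | add a b ha hb => simp only [map_add, ha, hb]
    | tmul a b =>
      simp only [LinearMap.lTensor_tmul, TensorProduct.rid_tmul, LinearMap.rTensor_tmul, map_smul]
      generalize ρ a = y
      induction y with
      | zero => simp
      | add a b ha hb => simp only [map_add, ha, hb, smul_add, TensorProduct.add_tmul]
      | tmul a b => simp [smul_smul, mul_comm]
  obtain ⟨n, x, f, hx, hf⟩ := exists_dual_family W
  have hmem : ∀ j (α : A →ₗ[k] k), TensorProduct.rid k M (LinearMap.lTensor M α (ρ (x j))) ∈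
      Submodule.span k (Set.range x) := by
    intro j α
    have hj : x j ∈ W := hx ▸ Submodule.subset_span ⟨j, rfl⟩
    obtain ⟨β, hβ⟩ := hj
    rw [hx, ← hβ, ← hΦ, hcomp]
    exact ⟨_, rfl⟩
  choose c hc using fun j => tensor_eq_sum_of_mem (ρ (x j)) (hmem j)
  refine ⟨n, x, fun i j => c j i, ⟨⟨fun i j => ?_, fun i j => ?_⟩, hc⟩, ?_⟩
  · have h1 := congrArg (fun z => TensorProduct.lid k _ (LinearMap.rTensor (A ⊗[k] A) (f i) z))
      (h.coassoc (x j))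
    simp only [hc, map_sum, LinearMap.rTensor_tmul, LinearMap.lTensor_tmul,
      TensorProduct.sum_tmul, TensorProduct.assoc_tmul, TensorProduct.lid_tmul, hf,
      Matrix.one_apply, ite_smul, one_smul, zero_smul, Finset.sum_ite_eq, Finset.mem_univ,
      if_true] at h1
    exact h1.symm
  · have h1 := congrArg (f i) (h.counit (x j))
    simpa [hc, hf, Matrix.one_apply] using h1
  · rw [hx]
    -- The element `m` is its own slice by the counit.
    exact ⟨Coalgebra.counit, by rw [hΦ]; exact h.counit m⟩

theorem IsComodule.ext {ρ : M →ₗ[k] M ⊗[k] A} (h : IsComodule ρ) {f g : M →ₗ[k] N}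
    (hfg : ∀ (n : ℕ) (x : Fin n → M) (c : Matrix (Fin n) (Fin n) A), IsFamily ρ x c →
      ∀ j, f (x j) = g (x j)) : f = g := by
  ext m
  obtain ⟨n, x, c, hx, hm⟩ := h.exists_family m
  induction hm using Submodule.span_induction with
  | mem _ h =>
    obtain ⟨j, rfl⟩ := h
    exact hfg n x c hx j
  | zero => simp
  | add a b _ _ ha hb => simp [ha, hb]
  | smul a b _ hb => simp [hb]

theorem IsComodule.induction {ρ : M →ₗ[k] M ⊗[k] A} (h : IsComodule ρ) {p : M → Prop}
    (zero : p 0) (add : ∀ a b, p a → p b → p (a + b))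
    (family : ∀ (n : ℕ) (x : Fin n → M) (c : Matrix (Fin n) (Fin n) A), IsFamily ρ x c →
      ∀ (r : k) j, p (r • x j)) (m : M) : p m := by
  obtain ⟨n, x, c, hx, hm⟩ := h.exists_family m
  obtain ⟨r, rfl⟩ := (Submodule.mem_span_range_iff_exists_fun k).1 hm
  exact Finset.sum_induction _ p add zero fun j _ => family n x c hx (r j) j

theorem IsComodule.tensor_induction {ρ : M →ₗ[k] M ⊗[k] A} (h : IsComodule ρ)
    {p : M ⊗[k] N → Prop} (zero : p 0) (add : ∀ a b, p a → p b → p (a + b))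
    (family : ∀ (n : ℕ) (x : Fin n → M) (c : Matrix (Fin n) (Fin n) A), IsFamily ρ x c →
      ∀ j y, p (x j ⊗ₜ[k] y)) (z : M ⊗[k] N) : p z := by
  induction z with
  | zero => exact zero
  | add a b ha hb => exact add a b ha hb
  | tmul m y =>
    refine h.induction (p := fun m => p (m ⊗ₜ[k] y)) (by simpa using zero)
      (fun a b ha hb => by rw [TensorProduct.add_tmul]; exact add _ _ ha hb)
      (fun n x c hx r j => by rw [TensorProduct.smul_tmul]; exact family n x c hx j _) m

variable (k A) in
theorem isComodule_comul : IsComodule (Coalgebra.comul (R := k) (A := A)) :=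
  ⟨fun v => by simp, fun v => Coalgebra.coassoc_apply v⟩

/-- Families in the regular comodule show that `A` is spanned by entries of comatrices: by the
counit axiom an element of a family is the combination `x j = ∑ ε(x i) c i j`. A linear identity in
a variable of `A` may therefore be checked on such entries. -/
theorem comatrix_ext {f g : A →ₗ[k] N}
    (hfg : ∀ (n : ℕ) (c : Matrix (Fin n) (Fin n) A), IsComatrix k c →
      ∀ i j, f (c i j) = g (c i j)) : f = g := by
  refine (isComodule_comul k A).ext fun n x c hx j => ?_
  have : x j = ∑ i, Coalgebra.counit (R := k) (x i) • c i j := by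
    have h1 := Coalgebra.rTensor_counit_comul (R := k) (x j)
    rw [hx.coact] at h1
    have h2 := congrArg (TensorProduct.lid k A) h1
    simpa using h2.symm
  rw [this]
  simp [hfg n c hx.comatrix]

variable [DecidableEq ι] [DecidableEq κ]

theorem IsComatrix.counit_smul {c : Matrix ι ι A} (hc : IsComatrix k c) (f : ι → M) (j : ι) :
    ∑ i, Coalgebra.counit (R := k) (c i j) • f i = f j := by
  simp [hc.counit, Matrix.one_apply]

theorem IsComatrix.counit_smul_right {c : Matrix ι ι A} (hc : IsComatrix k c) (f : ι → M)
    (i : ι) : ∑ j, Coalgebra.counit (R := k) (c i j) • f j = f i := by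
  simp [hc.counit, Matrix.one_apply]

/-- The comatrix of the products of the entries of two comatrices. -/
def comatrixMul (c : Matrix ι ι A) (d : Matrix κ κ A) : Matrix (ι × κ) (ι × κ) A :=
  fun p q => c p.1 q.1 * d p.2 q.2

theorem IsComatrix.mul {c : Matrix ι ι A} {d : Matrix κ κ A} (hc : IsComatrix k c)
    (hd : IsComatrix k d) : IsComatrix k (comatrixMul c d) := by
  constructor
  · intro i j
    simp only [comatrixMul, Bialgebra.comul_mul, hc.comul, hd.comul, Fintype.sum_prod_type,
      Finset.sum_mul, Finset.mul_sum, Algebra.TensorProduct.tmul_mul_tmul]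
    rw [Finset.sum_comm]
  · intro i j
    simp only [comatrixMul, Bialgebra.counit_mul, hc.counit, hd.counit, Matrix.one_apply,
      Prod.ext_iff]
    split_ifs <;> simp_all

theorem IsComatrix.antipode_mul {c : Matrix ι ι A} (hc : IsComatrix k c) (i j : ι) :
    ∑ l, HopfAlgebra.antipode k (c i l) * c l j = (1 : Matrix ι ι A) i j := by
  have := HopfAlgebra.mul_antipode_rTensor_comul_apply (R := k) (c i j)
  rw [hc.comul, hc.counit] at this
  simpa [Matrix.one_apply, apply_ite (algebraMap k A)] using this

theorem IsComatrix.mul_antipode {c : Matrix ι ι A} (hc : IsComatrix k c) (i j : ι) :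
    ∑ l, c i l * HopfAlgebra.antipode k (c l j) = (1 : Matrix ι ι A) i j := by
  have := HopfAlgebra.mul_antipode_lTensor_comul_apply (R := k) (c i j)
  rw [hc.comul, hc.counit] at this
  simpa [Matrix.one_apply, apply_ite (algebraMap k A)] using this

/-- Uniqueness of inverse matrices over `A ⊗ A`. The matrix `Δ(c)` factors as `c ⊗ 1` times `1 ⊗ c`,
so `Δ(S c)` and the product of `1 ⊗ S c` with `S c ⊗ 1` are both inverse to it. -/
theorem IsComatrix.comul_antipode {c : Matrix ι ι A} (hc : IsComatrix k c) (i j : ι) :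
    Coalgebra.comul (R := k) (HopfAlgebra.antipode k (c i j)) =
      ∑ l, HopfAlgebra.antipode k (c l j) ⊗ₜ[k] HopfAlgebra.antipode k (c i l) := by
  let L : Matrix ι ι A → Matrix ι ι (A ⊗[k] A) :=
    fun c => c.map (Algebra.TensorProduct.includeLeft : A →ₐ[k] A ⊗[k] A)
  let R : Matrix ι ι A → Matrix ι ι (A ⊗[k] A) :=
    fun c => c.map (Algebra.TensorProduct.includeRight : A →ₐ[k] A ⊗[k] A)
  let s : Matrix ι ι A := c.map (HopfAlgebra.antipode k)
  have hs : s * c = 1 := by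
    ext i j
    rw [Matrix.mul_apply, ← hc.antipode_mul]
    rfl
  have hs' : c * s = 1 := by
    ext i j
    rw [Matrix.mul_apply, ← hc.mul_antipode]
    rfl
  have hD : c.map (Bialgebra.comulAlgHom k A) = L c * R c := by
    ext i j
    simp [L, R, Matrix.mul_apply, hc.comul]
  have hL : L c * L s = 1 := by
    simp only [L, ← AlgHom.coe_toRingHom, ← Matrix.map_mul, hs']
    exact Matrix.map_one _ (map_zero _) (map_one _)
  have hR : R c * R s = 1 := by
    simp only [R, ← AlgHom.coe_toRingHom, ← Matrix.map_mul, hs']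
    exact Matrix.map_one _ (map_zero _) (map_one _)
  have hP : s.map (Bialgebra.comulAlgHom k A) * (L c * R c) = 1 := by
    rw [← hD]
    simp only [← AlgHom.coe_toRingHom, ← Matrix.map_mul, hs]
    exact Matrix.map_one _ (map_zero _) (map_one _)
  have hQ : (L c * R c) * (R s * L s) = 1 := by
    rw [mul_assoc, ← mul_assoc (R c), hR, one_mul, hL]
  have h := congrArg (fun m : Matrix ι ι (A ⊗[k] A) => m i j) (left_inv_eq_right_inv hP hQ)
  rw [Matrix.mul_apply] at h
  simpa [L, R, s] using h

end Comatrix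

/-! ### Yetter-Drinfeld modules and algebras -/

theorem sum_rev₃ {M α β γ : Type*} [AddCommMonoid M] [Fintype α] [Fintype β] [Fintype γ]
    (f : α → β → γ → M) : ∑ a, ∑ b, ∑ c, f a b c = ∑ c, ∑ b, ∑ a, f a b c := by
  rw [Finset.sum_comm]
  simp only [Finset.sum_comm (t := (Finset.univ : Finset γ)) (s := (Finset.univ : Finset α))]
  rw [Finset.sum_comm]

theorem sum_rot₃ {M α β γ : Type*} [AddCommMonoid M] [Fintype α] [Fintype β] [Fintype γ]
    (f : α → β → γ → M) : ∑ a, ∑ b, ∑ c, f a b c = ∑ c, ∑ a, ∑ b, f a b c := by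
  rw [sum_rev₃]
  exact Finset.sum_congr rfl fun _ _ => Finset.sum_comm

theorem sum_rev₄ {M α β γ δ : Type*} [AddCommMonoid M] [Fintype α] [Fintype β] [Fintype γ]
    [Fintype δ] (f : α → β → γ → δ → M) :
    ∑ a, ∑ b, ∑ c, ∑ d, f a b c d = ∑ d, ∑ c, ∑ b, ∑ a, f a b c d := by
  rw [sum_rev₃]
  simp only [sum_rot₃ (γ := δ)]
  rw [Finset.sum_comm]

namespace CrossedData

section YD

variable {k A V : Type*} [Field k] [Ring A] [HopfAlgebra k A] [AddCommGroup V] [Module k V]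
  {ι κ : Type*} [Fintype ι] [Fintype κ] [DecidableEq ι] [DecidableEq κ]

/-- `a ⊗ b ↦ (v ◁ b)₀ ⊗ a (v ◁ b)₁`. -/
def coactAct (X : CrossedData k A V) : V →ₗ[k] A ⊗[k] A →ₗ[k] V ⊗[k] A :=
  LinearMap.mk₂ k (fun v z => TensorProduct.lift (LinearMap.lTensorHom V ∘ₗ LinearMap.mul k A)
      (LinearMap.lTensor A (X.coact ∘ₗ X.act v) z))
    (by simp [LinearMap.comp_add, LinearMap.lTensor_add])
    (by simp [LinearMap.comp_smul, LinearMap.lTensor_smul]) (by simp) (by simp)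

/-- The axioms of a right crossed module, with the compatibility in the antipode-free form
`(v ◁ a₂)₀ ⊗ a₁ (v ◁ a₂)₁ = v₀ ◁ a₁ ⊗ v₁ a₂`. -/
structure IsYD (X : CrossedData k A V) : Prop where
  act_one : ∀ v, X.act v 1 = v
  act_mul : ∀ v a b, X.act v (a * b) = X.act (X.act v a) b
  comodule : IsComodule X.coact
  yd : ∀ v a, X.coactAct v (Coalgebra.comul (R := k) a) =
    X.actTensor (X.coact v) (Coalgebra.comul (R := k) a)

/-- The compatibility evaluated on a family and on an entry of a comatrix; this is the form in which
it enters all later computations. -/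
theorem IsYD.sum_coact_act {X : CrossedData k A V} (hX : X.IsYD) {x : κ → V} {d : Matrix κ κ A}
    (hx : IsFamily X.coact x d) {c : Matrix ι ι A} (hc : IsComatrix k c) (s : κ) (i j : ι) :
    ∑ l, LinearMap.lTensor V (LinearMap.mul k A (c i l)) (X.coact (X.act (x s) (c l j))) =
      ∑ l, ∑ r, X.act (x r) (c i l) ⊗ₜ[k] (d r s * c l j) := by
  have h := hX.yd (x s) (c i j)
  rw [hc.comul, map_sum, map_sum, hx.coact, map_sum] at h
  simpa [coactAct, actTensor, TensorProduct.homTensorHomMap_apply] using h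

theorem isYD_of_sum {X : CrossedData k A V} (act_one : ∀ v, X.act v 1 = v)
    (act_mul : ∀ v a b, X.act v (a * b) = X.act (X.act v a) b) (comodule : IsComodule X.coact)
    (h : ∀ (m : ℕ) (x : Fin m → V) (d : Matrix (Fin m) (Fin m) A), IsFamily X.coact x d →
      ∀ (n : ℕ) (c : Matrix (Fin n) (Fin n) A), IsComatrix k c → ∀ s i j,
      ∑ l, LinearMap.lTensor V (LinearMap.mul k A (c i l)) (X.coact (X.act (x s) (c l j))) =
        ∑ l, ∑ r, X.act (x r) (c i l) ⊗ₜ[k] (d r s * c l j)) : X.IsYD := by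
  refine ⟨act_one, act_mul, comodule, fun v a => ?_⟩
  refine comodule.induction (p := fun v => X.coactAct v (Coalgebra.comul (R := k) a) =
    X.actTensor (X.coact v) (Coalgebra.comul (R := k) a)) ?_ ?_ ?_ v
  · simp
  · intro v w hv hw
    simp only [map_add, LinearMap.add_apply, hv, hw]
  · intro m x d hx r s
    have : X.coactAct (x s) ∘ₗ Coalgebra.comul = X.actTensor (X.coact (x s)) ∘ₗ Coalgebra.comul := by
      refine comatrix_ext fun n c hc i j => ?_
      have h := h m x d hx n c hc s i j
      rw [LinearMap.comp_apply, LinearMap.comp_apply, hc.comul, map_sum, map_sum, hx.coact, map_sum]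
      simpa [coactAct, actTensor, TensorProduct.homTensorHomMap_apply] using h
    have h2 := congrArg (fun f => f a) this
    simp only [LinearMap.comp_apply] at h2
    simp only [map_smul, LinearMap.smul_apply, h2]

end YD

/-! ### Algebras in the category of crossed modules and their braided tensor square -/

section YDAlg

variable {k A C : Type*} [Field k] [Ring A] [HopfAlgebra k A] [Ring C] [Algebra k C]
  {ι κ ν : Type*} [Fintype ι] [Fintype κ] [Fintype ν] [DecidableEq ι] [DecidableEq κ]
  [DecidableEq ν]

/-- An algebra in the category of crossed modules. -/
structure IsYDAlg (X : CrossedData k A C) : Prop extends IsYD X where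
  one_act : ∀ a, X.act 1 a = algebraMap k C (Coalgebra.counit a)
  mul_act : ∀ x y a, X.act (x * y) a =
    LinearMap.mul' k C (TensorProduct.map (X.act x) (X.act y) (Coalgebra.comul (R := k) a))
  coact_one : X.coact 1 = 1 ⊗ₜ 1
  coact_mul : ∀ x y, X.coact (x * y) = X.coact x * X.coact y

variable {X : CrossedData k A C}

theorem IsYDAlg.mul_act_comatrix (hX : X.IsYDAlg) {c : Matrix ι ι A} (hc : IsComatrix k c)
    (x y : C) (i j : ι) : X.act (x * y) (c i j) = ∑ l, X.act x (c i l) * X.act y (c l j) := by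
  simp [hX.mul_act, hc.comul]

theorem IsYDAlg.family_mul (hX : X.IsYDAlg) {x : ι → C} {c : Matrix ι ι A} {y : κ → C}
    {d : Matrix κ κ A} (hx : IsFamily X.coact x c) (hy : IsFamily X.coact y d) :
    IsFamily X.coact (fun p : ι × κ => x p.1 * y p.2) (comatrixMul c d) := by
  refine ⟨hx.comatrix.mul hy.comatrix, fun j => ?_⟩
  rw [hX.coact_mul, hx.coact, hy.coact, Finset.sum_mul_sum, Fintype.sum_prod_type]
  simp [comatrixMul]

theorem IsYDAlg.sum_coact_act' (hX : X.IsYDAlg) {x : κ → C} {d : Matrix κ κ A}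
    (hx : IsFamily X.coact x d) {c : Matrix ι ι A} (hc : IsComatrix k c) (s : κ) (i j : ι) :
    ∑ l, (1 ⊗ₜ[k] c i l) * X.coact (X.act (x s) (c l j)) =
      ∑ l, ∑ r, X.act (x r) (c i l) ⊗ₜ[k] (d r s * c l j) := by
  rw [← hX.sum_coact_act hx hc]
  refine Finset.sum_congr rfl fun l _ => ?_
  generalize X.coact (X.act (x s) (c l j)) = z
  induction z with
  | zero => simp
  | add a b ha hb => rw [mul_add, map_add, ha, hb]
  | tmul a b => simp

/-- `z ⊗ a ↦ x z ⊗ (y ◁ a) w`. -/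
def bmAux (X : CrossedData k A C) (x y w : C) : C ⊗[k] A →ₗ[k] C ⊗[k] C :=
  TensorProduct.map (LinearMap.mulLeft k x) (LinearMap.mulRight k w ∘ₗ X.act y)

/-- The product `(x ⊗ y) (x' ⊗ y') = x x'₀ ⊗ (y ◁ x'₁) y'` of the braided tensor square. -/
def bm (X : CrossedData k A C) : C ⊗[k] C →ₗ[k] C ⊗[k] C →ₗ[k] C ⊗[k] C :=
  TensorProduct.lift (LinearMap.mk₂ k
    (fun x y => TensorProduct.map (LinearMap.mulLeft k x)
      (LinearMap.mul' k C ∘ₗ LinearMap.rTensor C (X.act y)) ∘ₗ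
      (TensorProduct.assoc k C A C).toLinearMap ∘ₗ LinearMap.rTensor C X.coact)
    (fun x x' y => by
      rw [← LinearMap.add_comp, ← TensorProduct.map_add_left]
      congr 2
      ext z
      simp [add_mul])
    (fun r x y => by
      rw [← LinearMap.smul_comp, ← TensorProduct.map_smul_left]
      congr 2
      ext z
      simp)
    (fun x y y' => by
      rw [map_add, LinearMap.rTensor_add, LinearMap.comp_add, TensorProduct.map_add_right,
        LinearMap.add_comp])
    (fun r x y => by
      rw [map_smul, LinearMap.rTensor_smul, LinearMap.comp_smul, TensorProduct.map_smul_right,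
        LinearMap.smul_comp]))

theorem bm_tmul_tmul (x y z w : C) :
    X.bm (x ⊗ₜ y) (z ⊗ₜ w) = X.bmAux x y w (X.coact z) := by
  simp only [bm, TensorProduct.lift.tmul, LinearMap.mk₂_apply, LinearMap.comp_apply,
    LinearMap.rTensor_tmul]
  generalize X.coact z = t
  induction t with
  | zero => simp
  | add a b ha hb => simp only [TensorProduct.add_tmul, map_add, ha, hb]
  | tmul a b => simp [bmAux]

/-- Acting on `y` beforehand is the same as multiplying the `A`-leg of `t` from the left, which is
the shape `a₁ (z ◁ a₂)₁` of the crossed module compatibility. -/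
theorem bmAux_act (hX : X.IsYD) (x y w : C) (a : A) (t : C ⊗[k] A) :
    X.bmAux x (X.act y a) w t = X.bmAux x y w ((1 ⊗ₜ a) * t) := by
  induction t with
  | zero => simp
  | add s t hs ht => simp only [mul_add, map_add, hs, ht]
  | tmul z b => simp [bmAux, hX.act_mul]

theorem bm_family {z : ι → C} {c : Matrix ι ι A} (hz : IsFamily X.coact z c) (x y w : C) (j : ι) :
    X.bm (x ⊗ₜ y) (z j ⊗ₜ w) = ∑ i, (x * z i) ⊗ₜ (X.act y (c i j) * w) := by
  simp [bm_tmul_tmul, hz.coact, bmAux]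

theorem IsYDAlg.isFamily_one (hX : X.IsYDAlg) :
    IsFamily X.coact (fun _ : Unit => (1 : C)) (fun _ _ => 1) :=
  ⟨⟨fun i j => by simp [Algebra.TensorProduct.one_def], fun i j => by simp⟩,
    fun j => by simp [hX.coact_one]⟩

theorem IsYDAlg.bm_one_left (hX : X.IsYDAlg) (x y w : C) :
    X.bm (x ⊗ₜ y) (1 ⊗ₜ w) = x ⊗ₜ (y * w) := by
  simp [bm_tmul_tmul, hX.coact_one, bmAux, hX.act_one]

theorem IsYDAlg.bm_tmul_one (hX : X.IsYDAlg) (x z w : C) :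
    X.bm (x ⊗ₜ 1) (z ⊗ₜ w) = (x * z) ⊗ₜ w := by
  have h := hX.comodule.counit z
  rw [bm_tmul_tmul]
  have : ∀ t, X.bmAux x 1 w t = (x * TensorProduct.rid k C (LinearMap.lTensor C
      Coalgebra.counit t)) ⊗ₜ w := by
    intro t
    induction t with
    | zero => simp
    | add s t hs ht => simp only [map_add, mul_add, TensorProduct.add_tmul, hs, ht]
    | tmul a b =>
      simp [bmAux, hX.one_act, Algebra.algebraMap_eq_smul_one, TensorProduct.smul_tmul]
  rw [this, h]

theorem IsYDAlg.one_bm (hX : X.IsYDAlg) (p : C ⊗[k] C) : X.bm (1 ⊗ₜ 1) p = p := by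
  induction p with
  | zero => simp
  | add a b ha hb => rw [map_add, ha, hb]
  | tmul a b => rw [hX.bm_tmul_one, one_mul]

theorem IsYDAlg.bm_one (hX : X.IsYDAlg) (p : C ⊗[k] C) : X.bm p (1 ⊗ₜ 1) = p := by
  induction p with
  | zero => simp
  | add a b ha hb => rw [map_add, LinearMap.add_apply, ha, hb]
  | tmul a b => rw [hX.bm_one_left, mul_one]

/-- On families both bracketings become the same triple sum: one uses that the action on a product
goes through the coproduct of `A`, the other that the coaction is multiplicative. -/
theorem IsYDAlg.bm_assoc (hX : X.IsYDAlg) (p q r : C ⊗[k] C) :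
    X.bm (X.bm p q) r = X.bm p (X.bm q r) := by
  induction p with
  | zero => simp
  | add a b ha hb => simp only [map_add, LinearMap.add_apply, ha, hb]
  | tmul x y =>
  refine hX.comodule.tensor_induction (p := fun q => X.bm (X.bm (x ⊗ₜ y) q) r =
    X.bm (x ⊗ₜ y) (X.bm q r)) (by simp)
    (fun a b ha hb => by simp only [map_add, LinearMap.add_apply, ha, hb]) ?_ q
  intro n z c hz j w
  refine hX.comodule.tensor_induction (p := fun r => X.bm (X.bm (x ⊗ₜ y) (z j ⊗ₜ w)) r =
    X.bm (x ⊗ₜ y) (X.bm (z j ⊗ₜ w) r)) (by simp)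
    (fun a b ha hb => by simp only [map_add, ha, hb]) ?_ r
  intro m u d hu s v
  have hzu := hX.family_mul hz hu
  rw [bm_family hz, bm_family hu, map_sum, map_sum, LinearMap.sum_apply]
  have h1 : ∀ i, X.bm (x ⊗ₜ y) ((z j * u i) ⊗ₜ (X.act w (d i s) * v)) =
      ∑ l, ∑ l', (x * (z l * u l')) ⊗ₜ (X.act y (c l j * d l' i) * (X.act w (d i s) * v)) := by
    intro i
    rw [bm_family hzu x y _ (j, i), Fintype.sum_prod_type]
    rfl
  simp only [h1, bm_family hu, hX.mul_act_comatrix hu.comatrix, hX.act_mul]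
  rw [← sum_rot₃]
  simp only [Finset.sum_mul, TensorProduct.tmul_sum, mul_assoc]

/-- The diagonal action on `C ⊗ C`. -/
def actTwo (X : CrossedData k A C) : C ⊗[k] C →ₗ[k] A →ₗ[k] C ⊗[k] C :=
  (TensorProduct.homTensorHomMap (RingHom.id k) A A C C ∘ₗ TensorProduct.map X.act X.act).compl₂
    Coalgebra.comul

theorem actTwo_comatrix {c : Matrix ι ι A} (hc : IsComatrix k c) (x y : C) (i j : ι) :
    X.actTwo (x ⊗ₜ y) (c i j) = ∑ l, X.act x (c i l) ⊗ₜ X.act y (c l j) := by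
  simp [actTwo, hc.comul, TensorProduct.homTensorHomMap_apply]

/-- The braided product is equivariant. The element `z` is acted on and then coacted on, in the
wrong order, and `sum_coact_act'` exchanges the two. -/
theorem IsYDAlg.actTwo_bm (hX : X.IsYDAlg) {c : Matrix ι ι A} (hc : IsComatrix k c)
    (p q : C ⊗[k] C) (i j : ι) :
    X.actTwo (X.bm p q) (c i j) = ∑ l, X.bm (X.actTwo p (c i l)) (X.actTwo q (c l j)) := by
  induction p with
  | zero => simp
  | add a b ha hb => simp only [map_add, LinearMap.add_apply, ha, hb, Finset.sum_add_distrib]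
  | tmul x y =>
  refine hX.comodule.tensor_induction (p := fun q => X.actTwo (X.bm (x ⊗ₜ y) q) (c i j) =
    ∑ l, X.bm (X.actTwo (x ⊗ₜ y) (c i l)) (X.actTwo q (c l j))) (by simp)
    (fun a b ha hb => by simp only [map_add, LinearMap.add_apply, ha, hb,
      Finset.sum_add_distrib]) ?_ q
  intro n z e hz s w
  simp only [bm_family hz, actTwo_comatrix hc, map_sum, LinearMap.sum_apply, bm_tmul_tmul,
    bmAux_act hX.toIsYD, hX.mul_act_comatrix hc]
  have h1 : ∀ a b, ∑ l, X.bmAux (X.act x (c i a)) y (X.act w (c b j))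
      ((1 ⊗ₜ[k] c a l) * X.coact (X.act (z s) (c l b))) =
      ∑ l, ∑ r, (X.act x (c i a) * X.act (z r) (c a l)) ⊗ₜ
        (X.act (X.act y (e r s)) (c l b) * X.act w (c b j)) := by
    intro a b
    rw [← map_sum, hX.sum_coact_act' hz hc]
    simp [bmAux, hX.act_mul]
  calc _ = ∑ a, ∑ b, ∑ l, ∑ r, (X.act x (c i a) * X.act (z r) (c a l)) ⊗ₜ
        (X.act (X.act y (e r s)) (c l b) * X.act w (c b j)) := by
        simp only [TensorProduct.sum_tmul, TensorProduct.tmul_sum]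
        exact sum_rev₄ _
    _ = _ := by
        simp only [← h1]
        exact sum_rev₃ _

theorem coactTwo_family {x : ι → C} {c : Matrix ι ι A} (hx : IsFamily X.coact x c) (y : C)
    (j : ι) : X.coactTwo (x j ⊗ₜ y) = ∑ i, (TensorProduct.assoc k C C A).symm
      (x i ⊗ₜ[k] ((1 ⊗ₜ[k] c i j) * X.coact y)) := by
  simp only [coactTwo, LinearMap.comp_apply, TensorProduct.map_tmul, hx.coact]
  generalize X.coact y = t
  induction t with
  | zero => simp
  | add s t hs ht => simp only [TensorProduct.tmul_add, map_add, hs, ht, mul_add,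
      Finset.sum_add_distrib]
  | tmul a b => simp [TensorProduct.sum_tmul]

theorem coactTwo_family_family {x : ι → C} {c : Matrix ι ι A} (hx : IsFamily X.coact x c)
    {y : κ → C} {d : Matrix κ κ A} (hy : IsFamily X.coact y d) (j : ι) (q : κ) :
    X.coactTwo (x j ⊗ₜ y q) = ∑ i, ∑ p, (x i ⊗ₜ[k] y p) ⊗ₜ[k] (c i j * d p q) := by
  simp [coactTwo_family hx, hy.coact, Finset.mul_sum, TensorProduct.tmul_sum]

theorem map₂_bm_family {z : ι → C} {e : Matrix ι ι A} (hz : IsFamily X.coact z e) (x y : C)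
    (a : A) (r : ι) (t : C ⊗[k] A) :
    TensorProduct.map₂ X.bm (LinearMap.mul k A) ((x ⊗ₜ y) ⊗ₜ a)
      ((TensorProduct.assoc k C C A).symm (z r ⊗ₜ t)) =
    ∑ u, (TensorProduct.assoc k C C A).symm
      ((x * z u) ⊗ₜ[k] ((X.act y (e u r) ⊗ₜ[k] a) * t)) := by
  induction t with
  | zero => simp
  | add s t hs ht => simp only [TensorProduct.tmul_add, map_add, hs, ht, mul_add,
      Finset.sum_add_distrib]
  | tmul w b =>
    simp [bm_family hz, TensorProduct.sum_tmul]

/-- The braided product is colinear. Here `y` is acted on by the coaction of `z` before being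
coacted on; `h2` exchanges the two by the crossed module compatibility. -/
theorem IsYDAlg.coactTwo_bm (hX : X.IsYDAlg) (p q : C ⊗[k] C) :
    X.coactTwo (X.bm p q) =
      TensorProduct.map₂ X.bm (LinearMap.mul k A) (X.coactTwo p) (X.coactTwo q) := by
  refine hX.comodule.tensor_induction (p := fun p => X.coactTwo (X.bm p q) =
      TensorProduct.map₂ X.bm (LinearMap.mul k A) (X.coactTwo p) (X.coactTwo q)) (by simp)
    (fun a b ha hb => by simp only [map_add, LinearMap.add_apply, ha, hb]) ?_ p
  intro n x c hx j y
  refine hX.comodule.induction (p := fun y => X.coactTwo (X.bm (x j ⊗ₜ y) q) =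
      TensorProduct.map₂ X.bm (LinearMap.mul k A) (X.coactTwo (x j ⊗ₜ y)) (X.coactTwo q)) (by simp)
    (fun a b ha hb => by
      simp only [TensorProduct.tmul_add, map_add, LinearMap.add_apply, ha, hb]) ?_ y
  intro m y d hy r₀ q₀
  simp only [TensorProduct.tmul_smul, map_smul, LinearMap.smul_apply]
  congr 1
  refine hX.comodule.tensor_induction (p := fun q => X.coactTwo (X.bm (x j ⊗ₜ y q₀) q) =
      TensorProduct.map₂ X.bm (LinearMap.mul k A) (X.coactTwo (x j ⊗ₜ y q₀)) (X.coactTwo q))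
    (by simp) (fun a b ha hb => by simp only [map_add, ha, hb]) ?_ q
  intro l z e hz s w
  have h1 : ∀ r, X.coactTwo ((x j * z r) ⊗ₜ (X.act (y q₀) (e r s) * w)) =
      ∑ i, ∑ u, (TensorProduct.assoc k C C A).symm ((x i * z u) ⊗ₜ[k]
        ((1 ⊗ₜ[k] c i j) * ((1 ⊗ₜ[k] e u r) * X.coact (X.act (y q₀) (e r s))) * X.coact w)) := by
    intro r
    rw [coactTwo_family (hX.family_mul hx hz) _ (j, r), Fintype.sum_prod_type]
    refine Finset.sum_congr rfl fun i _ => Finset.sum_congr rfl fun u _ => ?_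
    simp only [comatrixMul, hX.coact_mul, ← mul_assoc, Algebra.TensorProduct.tmul_mul_tmul, one_mul]
  have h2 : ∀ i u, ∑ r, (TensorProduct.assoc k C C A).symm ((x i * z u) ⊗ₜ[k]
        ((1 ⊗ₜ[k] c i j) * ((1 ⊗ₜ[k] e u r) * X.coact (X.act (y q₀) (e r s))) * X.coact w)) =
      ∑ r, ∑ p, (TensorProduct.assoc k C C A).symm ((x i * z u) ⊗ₜ[k]
        ((X.act (y p) (e u r) ⊗ₜ[k] (c i j * d p q₀)) * ((1 ⊗ₜ[k] e r s) * X.coact w))) := by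
    intro i u
    simp only [← map_sum, ← TensorProduct.tmul_sum, ← Finset.sum_mul, ← Finset.mul_sum]
    rw [hX.sum_coact_act' hy hz.comatrix]
    simp only [Finset.sum_mul, Finset.mul_sum, ← mul_assoc, Algebra.TensorProduct.tmul_mul_tmul,
      one_mul, mul_one]
  simp only [bm_family hz, map_sum, h1, coactTwo_family_family hx hy, LinearMap.sum_apply,
    coactTwo_family hz, map₂_bm_family hz]
  rw [← sum_rot₃]
  simp only [h2]
  conv_rhs => rw [Finset.sum_comm]
  exact Finset.sum_congr rfl fun i _ => (sum_rot₃ _).symm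

end YDAlg

end CrossedData

/-! ### The tensor algebra of a crossed module -/

section TensorInduction

variable {k V : Type*} [Field k] [AddCommGroup V] [Module k V]

theorem tensorAlgebra_left_induction {p : TensorAlgebra k V → Prop} (one : p 1)
    (add : ∀ s t, p s → p t → p (s + t)) (smul : ∀ (r : k) t, p t → p (r • t))
    (mul : ∀ v t, p t → p (TensorAlgebra.ι k v * t)) (t : TensorAlgebra k V) : p t := by
  suffices h : ∀ s, p s → p (t * s) by simpa using h 1 one
  induction t using TensorAlgebra.induction with
  | algebraMap r => intro s hs; rw [← Algebra.smul_def]; exact smul r s hs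
  | ι v => exact mul v
  | mul a b ha hb => intro s hs; rw [mul_assoc]; exact ha _ (hb _ hs)
  | add a b ha hb => intro s hs; rw [add_mul]; exact add _ _ (ha _ hs) (hb _ hs)

theorem tensorAlgebra_right_induction {p : TensorAlgebra k V → Prop} (one : p 1)
    (add : ∀ s t, p s → p t → p (s + t)) (smul : ∀ (r : k) t, p t → p (r • t))
    (mul : ∀ t v, p t → p (t * TensorAlgebra.ι k v)) (t : TensorAlgebra k V) : p t := by
  suffices h : ∀ s, p s → p (s * t) by simpa using h 1 one
  induction t using TensorAlgebra.induction with
  | algebraMap r =>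
    intro s hs
    rw [← Algebra.commutes, ← Algebra.smul_def]
    exact smul r s hs
  | ι v => exact fun s hs => mul s v hs
  | mul a b ha hb => intro s hs; rw [← mul_assoc]; exact hb _ (ha _ hs)
  | add a b ha hb => intro s hs; rw [mul_add]; exact add _ _ (ha _ hs) (hb _ hs)

end TensorInduction

namespace CrossedData

section TensorData

variable {k A V : Type*} [Field k] [Ring A] [HopfAlgebra k A] [AddCommGroup V] [Module k V]
  {ι κ : Type*} [Fintype ι] [Fintype κ] [DecidableEq ι] [DecidableEq κ]

/-- The crossed module structure of the tensor algebra. -/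
def tensorData (X : CrossedData k A V) : CrossedData k A (TensorAlgebra k V) :=
  ⟨X.tensorAct, X.tensorCoact.toLinearMap⟩

variable {X : CrossedData k A V}

local notation "𝓲" => TensorAlgebra.ι k

theorem tensorData_act_one (a : A) : X.tensorData.act 1 a =
    algebraMap k (TensorAlgebra k V) (Coalgebra.counit a) := by
  simp [tensorData, tensorAct]

theorem tensorData_act_ι_mul {c : Matrix ι ι A} (hc : IsComatrix k c) (v : V)
    (t : TensorAlgebra k V) (i j : ι) : X.tensorData.act (𝓲 v * t) (c i j) =
      ∑ l, 𝓲 (X.act v (c i l)) * X.tensorData.act t (c l j) := by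
  simp [tensorData, tensorAct, actStep, hc.comul]

theorem tensorData_act_ι (v : V) (a : A) :
    X.tensorData.act (𝓲 v) a = 𝓲 (X.act v a) := by
  suffices h : X.tensorData.act (𝓲 v) = TensorAlgebra.ι k ∘ₗ X.act v by rw [h]; rfl
  refine comatrix_ext fun n c hc i j => ?_
  have h := tensorData_act_ι_mul (X := X) hc v 1 i j
  rw [mul_one] at h
  rw [h]
  simp [tensorData_act_one, hc.counit, Matrix.one_apply, apply_ite (algebraMap k _)]

theorem tensorData_coact_one : X.tensorData.coact 1 = 1 ⊗ₜ 1 := by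
  simp [tensorData, Algebra.TensorProduct.one_def]

theorem tensorData_coact_mul (s t : TensorAlgebra k V) :
    X.tensorData.coact (s * t) = X.tensorData.coact s * X.tensorData.coact t := by
  simp [tensorData]

theorem tensorData_coact_ι (v : V) : X.tensorData.coact (𝓲 v) =
    LinearMap.rTensor A (TensorAlgebra.ι k) (X.coact v) := by
  simp [tensorData, tensorCoact]

theorem family_ι {x : ι → V} {c : Matrix ι ι A} (hx : IsFamily X.coact x c) :
    IsFamily X.tensorData.coact (fun i => 𝓲 (x i)) c :=
  ⟨hx.comatrix, fun j => by simp [tensorData_coact_ι, hx.coact]⟩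

theorem IsYD.tensorData_comodule (hX : X.IsYD) : IsComodule X.tensorData.coact := by
  constructor
  · intro t
    have h : ((Algebra.TensorProduct.rid k k (TensorAlgebra k V)).toAlgHom.comp
        ((Algebra.TensorProduct.map (AlgHom.id k _) (Bialgebra.counitAlgHom k A)).comp
          X.tensorCoact)) = AlgHom.id k _ := by
      refine TensorAlgebra.hom_ext (hX.comodule.ext fun n x c hx j => ?_)
      have h1 := (family_ι hx).coact j
      simp only [tensorData, AlgHom.toLinearMap_apply] at h1
      simp [h1, hx.comatrix.counit, Matrix.one_apply]
    have h2 := congrArg (fun f => f t) h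
    refine Eq.trans ?_ h2
    simp only [tensorData, AlgHom.toLinearMap_apply, AlgHom.comp_apply]
    generalize X.tensorCoact t = z
    induction z with
    | zero => simp
    | add a b ha hb => simp only [map_add, ha, hb]
    | tmul a b => simp
  · intro t
    have h : ((Algebra.TensorProduct.assoc k k k (TensorAlgebra k V) A A).toAlgHom.comp
        ((Algebra.TensorProduct.map X.tensorCoact (AlgHom.id k A)).comp X.tensorCoact)) =
        (Algebra.TensorProduct.map (AlgHom.id k _) (Bialgebra.comulAlgHom k A)).comp
          X.tensorCoact := by
      refine TensorAlgebra.hom_ext (hX.comodule.ext fun n x c hx j => ?_)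
      have h1 := (family_ι hx).coact
      simp only [tensorData, AlgHom.toLinearMap_apply] at h1
      simp only [LinearMap.comp_apply, AlgHom.toLinearMap_apply, AlgHom.comp_apply, h1, map_sum,
        Algebra.TensorProduct.map_tmul, AlgHom.coe_id, id_eq, TensorProduct.sum_tmul,
        Bialgebra.comulAlgHom_apply, hx.comatrix.comul, TensorProduct.tmul_sum]
      rw [Finset.sum_comm]
      rfl
    have h2 := congrArg (fun f => f t) h
    refine Eq.trans ?_ (h2.trans ?_)
    · simp only [tensorData, AlgHom.toLinearMap_apply, AlgHom.comp_apply]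
      generalize X.tensorCoact t = z
      induction z with
      | zero => simp
      | add a b ha hb => simp only [map_add, ha, hb]
      | tmul a b => rfl
    · simp only [tensorData, AlgHom.toLinearMap_apply, AlgHom.comp_apply]
      generalize X.tensorCoact t = z
      induction z with
      | zero => simp
      | add a b ha hb => simp only [map_add, ha, hb]
      | tmul a b => rfl

theorem tensorData_mul_act {c : Matrix ι ι A} (hc : IsComatrix k c) (s t : TensorAlgebra k V)
    (i j : ι) : X.tensorData.act (s * t) (c i j) =
      ∑ l, X.tensorData.act s (c i l) * X.tensorData.act t (c l j) := by
  induction s using tensorAlgebra_left_induction generalizing i j with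
  | one => simp [tensorData_act_one, hc.counit, Matrix.one_apply, apply_ite (algebraMap k _)]
  | add a b ha hb => simp [add_mul, ha, hb, Finset.sum_add_distrib]
  | smul r a ha => simp [ha, Finset.smul_sum]
  | mul v s hs =>
    simp only [mul_assoc, tensorData_act_ι_mul hc, hs, Finset.mul_sum, Finset.sum_mul]
    rw [Finset.sum_comm]

theorem IsYD.tensorData_act_mul (hX : X.IsYD) (t : TensorAlgebra k V) (a b : A) :
    X.tensorData.act t (a * b) = X.tensorData.act (X.tensorData.act t a) b := by
  suffices h : ∀ (n : ℕ) (c : Matrix (Fin n) (Fin n) A), IsComatrix k c → ∀ i j,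
      ∀ (m : ℕ) (d : Matrix (Fin m) (Fin m) A), IsComatrix k d → ∀ p q,
      X.tensorData.act t (c i j * d p q) =
        X.tensorData.act (X.tensorData.act t (c i j)) (d p q) by
    have h1 : (LinearMap.mul k A).compr₂ (X.tensorData.act t) =
        X.tensorData.act ∘ₗ X.tensorData.act t := by
      refine comatrix_ext fun n c hc i j => comatrix_ext fun m d hd p q => ?_
      simpa using h n c hc i j m d hd p q
    exact congrArg (fun f => f a b) h1
  intro n c hc i j m d hd p q
  induction t using tensorAlgebra_left_induction generalizing i j p q with
  | one =>
    simp [tensorData_act_one, Algebra.algebraMap_eq_smul_one, smul_smul]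
  | add a b ha hb => simp [ha, hb]
  | smul r a ha => simp [ha]
  | mul v t ht =>
    have h1 := tensorData_act_ι_mul (X := X) (hc.mul hd) v t (i, p) (j, q)
    simp only [comatrixMul, Fintype.sum_prod_type] at h1
    rw [h1, tensorData_act_ι_mul hc]
    simp only [map_sum, LinearMap.sum_apply, tensorData_act_ι_mul hd, hX.act_mul, ht]

theorem actTensor_mul {x : V} {b : A} {c : Matrix ι ι A} (hc : IsComatrix k c)
    (z : TensorAlgebra k V ⊗[k] A) (i l : ι) (a : A) :
    X.tensorData.actTensor ((𝓲 x ⊗ₜ[k] b) * z) (c i l ⊗ₜ a) =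
      ∑ m, (𝓲 (X.act x (c i m)) ⊗ₜ[k] b) * X.tensorData.actTensor z (c m l ⊗ₜ a) := by
  induction z with
  | zero => simp
  | add s t hs ht => simp only [mul_add, map_add, LinearMap.add_apply, hs, ht,
      Finset.sum_add_distrib]
  | tmul y d =>
    simp [actTensor, TensorProduct.homTensorHomMap_apply, tensorData_act_ι_mul hc,
      TensorProduct.sum_tmul, mul_assoc]

theorem coactAct_tmul {C : Type*} [Ring C] [Algebra k C] (X : CrossedData k A C) (t : C)
    (a b : A) : X.coactAct t (a ⊗ₜ b) = (1 ⊗ₜ a) * X.coact (X.act t b) := by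
  simp only [coactAct, LinearMap.mk₂_apply, LinearMap.lTensor_tmul, TensorProduct.lift.tmul,
    LinearMap.comp_apply, LinearMap.coe_lTensorHom]
  generalize X.coact (X.act t b) = z
  induction z with
  | zero => simp
  | add s t hs ht => simp only [mul_add, map_add, hs, ht]
  | tmul y d => simp

/-- Induction on the length of `t`. The compatibility of `V` handles the first letter and the
induction hypothesis the remaining ones, with an intermediate entry of the comatrix passed from one
to the other. -/
theorem IsYD.tensorData_yd (hX : X.IsYD) (t : TensorAlgebra k V) {c : Matrix ι ι A}
    (hc : IsComatrix k c) (i j : ι) :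
    ∑ l, (1 ⊗ₜ[k] c i l) * X.tensorData.coact (X.tensorData.act t (c l j)) =
      ∑ l, X.tensorData.actTensor (X.tensorData.coact t) (c i l ⊗ₜ c l j) := by
  induction t using tensorAlgebra_left_induction generalizing i j with
  | one =>
    simp only [tensorData_act_one, tensorData_coact_one, Algebra.algebraMap_eq_smul_one, map_smul,
      actTensor, TensorProduct.homTensorHomMap_apply, LinearMap.comp_apply, TensorProduct.map_tmul,
      TensorProduct.map_tmul, LinearMap.mul_apply', one_mul, mul_smul_comm,
      Algebra.TensorProduct.tmul_mul_tmul, mul_one, TensorProduct.smul_tmul,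
      TensorProduct.tmul_smul]
    rw [hc.counit_smul (fun x => (1 : TensorAlgebra k V) ⊗ₜ[k] c i x),
      hc.counit_smul_right (fun x => (1 : TensorAlgebra k V) ⊗ₜ[k] c x j)]
  | add a b ha hb => simp only [map_add, LinearMap.add_apply, mul_add, Finset.sum_add_distrib,
      ha, hb]
  | smul r a ha => simp only [map_smul, LinearMap.smul_apply, mul_smul_comm, ← Finset.smul_sum, ha]
  | mul v t ht =>
    refine hX.comodule.induction (p := fun v =>
      ∑ l, (1 ⊗ₜ[k] c i l) * X.tensorData.coact (X.tensorData.act (𝓲 v * t) (c l j)) =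
      ∑ l, X.tensorData.actTensor (X.tensorData.coact (𝓲 v * t)) (c i l ⊗ₜ c l j)) (by simp)
      (fun a b ha hb => by simp only [map_add, add_mul, LinearMap.add_apply, mul_add,
        Finset.sum_add_distrib, ha, hb]) ?_ v
    intro n x e hx r s
    simp only [map_smul, smul_mul_assoc, LinearMap.smul_apply, mul_smul_comm, ← Finset.smul_sum]
    congr 1
    have h1 : ∀ m, ∑ l, (1 ⊗ₜ[k] c i l) * X.tensorData.coact (𝓲 (X.act (x s) (c l m))) =
        ∑ l, ∑ r, 𝓲 (X.act (x r) (c i l)) ⊗ₜ[k] (e r s * c l m) := by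
      intro m
      have h2 := congrArg (LinearMap.rTensor A (TensorAlgebra.ι k)) (hX.sum_coact_act hx hc s i m)
      simp only [map_sum, LinearMap.rTensor_tmul] at h2
      rw [← h2]
      refine Finset.sum_congr rfl fun l _ => ?_
      rw [tensorData_coact_ι]
      generalize X.coact (X.act (x s) (c l m)) = z
      induction z with
      | zero => simp
      | add s t hs ht => simp only [mul_add, map_add, hs, ht]
      | tmul y d => simp
    calc _ = ∑ m, (∑ l, (1 ⊗ₜ[k] c i l) * X.tensorData.coact (𝓲 (X.act (x s) (c l m)))) *
          X.tensorData.coact (X.tensorData.act t (c m j)) := by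
          simp only [tensorData_act_ι_mul hc, map_sum, tensorData_coact_mul, Finset.mul_sum,
            Finset.sum_mul, mul_assoc]
          rw [Finset.sum_comm]
      _ = ∑ l, ∑ r, (𝓲 (X.act (x r) (c i l)) ⊗ₜ[k] e r s) *
          ∑ m, (1 ⊗ₜ[k] c l m) * X.tensorData.coact (X.tensorData.act t (c m j)) := by
          simp only [h1, Finset.sum_mul, Finset.mul_sum, ← mul_assoc,
            Algebra.TensorProduct.tmul_mul_tmul, mul_one]
          rw [← sum_rot₃]
      _ = _ := by
          simp only [ht, tensorData_coact_mul, (family_ι hx).coact, Finset.sum_mul, map_sum,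
            LinearMap.sum_apply, actTensor_mul hc, Finset.mul_sum]
          rw [sum_rev₃]

theorem IsYD.tensorData_isYDAlg (hX : X.IsYD) : X.tensorData.IsYDAlg where
  act_one t := by
    -- The 1 × 1 comatrix with entry 1 specialises the product rule for the action to `a = 1`.
    have hc : IsComatrix k (1 : Matrix Unit Unit A) :=
      ⟨fun i j => by simp [Algebra.TensorProduct.one_def], fun i j => by simp⟩
    induction t using tensorAlgebra_left_induction with
    | one => simp [tensorData_act_one]
    | add a b ha hb => simp only [map_add, LinearMap.add_apply, ha, hb]
    | smul r a ha => simp only [map_smul, LinearMap.smul_apply, ha]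
    | mul v t ht => simpa [hX.act_one, ht] using tensorData_act_ι_mul (X := X) hc v t () ()
  act_mul := hX.tensorData_act_mul
  comodule := hX.tensorData_comodule
  yd t a := by
    suffices h : X.tensorData.coactAct t ∘ₗ Coalgebra.comul =
        X.tensorData.actTensor (X.tensorData.coact t) ∘ₗ Coalgebra.comul by
      exact congrArg (fun f => f a) h
    refine comatrix_ext fun n c hc i j => ?_
    simpa [hc.comul, coactAct_tmul] using hX.tensorData_yd t hc i j
  one_act := tensorData_act_one
  mul_act s t a := by
    suffices h : X.tensorData.act (s * t) = LinearMap.mul' k _ ∘ₗ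
        TensorProduct.map (X.tensorData.act s) (X.tensorData.act t) ∘ₗ Coalgebra.comul by
      exact congrArg (fun f => f a) h
    refine comatrix_ext fun n c hc i j => ?_
    simpa [hc.comul] using tensorData_mul_act hc s t i j
  coact_one := tensorData_coact_one
  coact_mul := tensorData_coact_mul

end TensorData

end CrossedData

/-! ### Braided Hopf algebras -/

/-- A Hopf algebra in the category of crossed modules. -/
structure BraidedHopf (k A C : Type*) [Field k] [Ring A] [HopfAlgebra k A] [Ring C]
    [Algebra k C] where
  X : CrossedData k A C
  cop : C →ₗ[k] C ⊗[k] C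
  counit : C →ₗ[k] k
  anti : C →ₗ[k] C
  ydAlg : X.IsYDAlg
  cop_one : cop 1 = 1 ⊗ₜ 1
  cop_mul : ∀ x y, cop (x * y) = X.bm (cop x) (cop y)
  coassoc : ∀ x, TensorProduct.assoc k C C C (LinearMap.rTensor C cop (cop x)) =
    LinearMap.lTensor C cop (cop x)
  counit_left : ∀ x, TensorProduct.lid k C (LinearMap.rTensor C counit (cop x)) = x
  counit_right : ∀ x, TensorProduct.rid k C (LinearMap.lTensor C counit (cop x)) = x
  cop_act : ∀ x a, cop (X.act x a) = X.actTwo (cop x) a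
  cop_coact : ∀ x, X.coactTwo (cop x) = LinearMap.rTensor A cop (X.coact x)
  anti_one : anti 1 = 1
  anti_mul : ∀ x y, anti (x * y) =
    LinearMap.mul' k C (TensorProduct.map anti (anti ∘ₗ X.act x) (X.coact y))
  anti_act : ∀ x a, anti (X.act x a) = X.act (anti x) a
  anti_coact : ∀ x, X.coact (anti x) = LinearMap.rTensor A anti (X.coact x)
  anti_left : ∀ x, LinearMap.mul' k C (TensorProduct.map anti LinearMap.id (cop x)) =
    algebraMap k C (counit x)
  anti_right : ∀ x, LinearMap.mul' k C (TensorProduct.map LinearMap.id anti (cop x)) =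
    algebraMap k C (counit x)

/-! ### The tensor algebra of a crossed module as a braided Hopf algebra -/

namespace CrossedData

section TensorHopf

variable {k A V : Type*} [Field k] [Ring A] [HopfAlgebra k A] [AddCommGroup V] [Module k V]
  {ι κ : Type*} [Fintype ι] [Fintype κ] [DecidableEq ι] [DecidableEq κ]

local notation "𝓲" => TensorAlgebra.ι k

variable (k V) in
/-- The primitive element `v ⊗ 1 + 1 ⊗ v`. -/
def prim : V →ₗ[k] TensorAlgebra k V ⊗[k] TensorAlgebra k V :=
  ((TensorProduct.mk k _ _).flip 1 + TensorProduct.mk k _ _ 1) ∘ₗ TensorAlgebra.ι k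

theorem prim_apply (v : V) : prim k V v = 𝓲 v ⊗ₜ 1 + 1 ⊗ₜ 𝓲 v := rfl

/-- The coproduct of the tensor algebra with `Δ v = v ⊗ 1 + 1 ⊗ v`, multiplicative for the
braided product on the tensor square. -/
def tensorCop (X : CrossedData k A V) :
    TensorAlgebra k V →ₗ[k] TensorAlgebra k V ⊗[k] TensorAlgebra k V :=
  LinearMap.applyₗ (1 ⊗ₜ[k] 1) ∘ₗ
    (TensorAlgebra.lift k (X.tensorData.bm ∘ₗ prim k V)).toLinearMap

variable {X : CrossedData k A V}

theorem tensorCop_one : X.tensorCop 1 = 1 ⊗ₜ 1 := by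
  simp [tensorCop]

theorem tensorCop_ι_mul (v : V) (t : TensorAlgebra k V) :
    X.tensorCop (𝓲 v * t) = X.tensorData.bm (prim k V v) (X.tensorCop t) := by
  simp [tensorCop]

theorem bm_prim_family (hX : X.IsYD) {x : ι → TensorAlgebra k V} {c : Matrix ι ι A}
    (hx : IsFamily X.tensorData.coact x c) (v : V) (y : TensorAlgebra k V) (j : ι) :
    X.tensorData.bm (prim k V v) (x j ⊗ₜ y) =
      (𝓲 v * x j) ⊗ₜ y + ∑ i, x i ⊗ₜ (𝓲 (X.act v (c i j)) * y) := by
  rw [prim_apply, map_add, LinearMap.add_apply, hX.tensorData_isYDAlg.bm_tmul_one, bm_family hx]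
  simp [tensorData_act_ι]

theorem bm_prim_right (hX : X.IsYD) {x : ι → V} {c : Matrix ι ι A}
    (hx : IsFamily X.coact x c) (s t : TensorAlgebra k V) (j : ι) :
    X.tensorData.bm (s ⊗ₜ t) (prim k V (x j)) =
      (∑ i, (s * 𝓲 (x i)) ⊗ₜ X.tensorData.act t (c i j)) + s ⊗ₜ (t * 𝓲 (x j)) := by
  rw [prim_apply, map_add, hX.tensorData_isYDAlg.bm_one_left, bm_family (family_ι hx)]
  simp

theorem tensorCop_ι (hX : X.IsYD) (v : V) : X.tensorCop (𝓲 v) = prim k V v := by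
  have h := tensorCop_ι_mul (X := X) v 1
  rwa [mul_one, tensorCop_one, hX.tensorData_isYDAlg.bm_one] at h

/-- The coproduct is defined by successive left multiplication with primitive elements, so
multiplicativity is associativity of the braided product. -/
theorem tensorCop_mul (hX : X.IsYD) (s t : TensorAlgebra k V) :
    X.tensorCop (s * t) = X.tensorData.bm (X.tensorCop s) (X.tensorCop t) := by
  have hT := hX.tensorData_isYDAlg
  induction s using tensorAlgebra_left_induction with
  | one => simp [tensorCop_one, hT.one_bm]
  | add a b ha hb => simp [add_mul, ha, hb]
  | smul r a ha => simp [ha]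
  | mul v s hs => rw [mul_assoc, tensorCop_ι_mul, hs, tensorCop_ι_mul, hT.bm_assoc]

local notation "ε" => TensorAlgebra.algebraMapInv (R := k) (M := V)

theorem counit_ι_mul (v : V) (t : TensorAlgebra k V) : ε (𝓲 v * t) = 0 := by
  simp [TensorAlgebra.algebraMapInv]

theorem counit_tensorAct (t : TensorAlgebra k V) (a : A) :
    ε (X.tensorData.act t a) = ε t * Coalgebra.counit (R := k) a := by
  suffices h : (ε).toLinearMap ∘ₗ X.tensorData.act t = (ε t) • Coalgebra.counit (R := k) by
    exact congrArg (fun f => f a) h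
  refine comatrix_ext fun n c hc i j => ?_
  induction t using tensorAlgebra_left_induction with
  | one => simp [tensorData_act_one, TensorAlgebra.algebraMapInv]
  | add a b ha hb => simp_all [add_mul]
  | smul r a ha => simp_all [mul_assoc]
  | mul v t _ =>
    simp [tensorData_act_ι_mul hc, TensorAlgebra.algebraMapInv]

/-- Colinearity of the counit. It lets the coaction of a first tensor leg be discarded when the
counit is applied to that leg, as in the left counit axiom. -/
theorem counit_tensorCoact (hX : X.IsYD) (t : TensorAlgebra k V) :
    TensorProduct.lid k A (LinearMap.rTensor A (ε).toLinearMap (X.tensorData.coact t)) =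
      algebraMap k A (ε t) := by
  induction t using tensorAlgebra_left_induction with
  | one => simp [tensorData_coact_one]
  | add a b ha hb => simp only [map_add, ha, hb]
  | smul r a ha => simp only [map_smul, ha]; simp [Algebra.smul_def]
  | mul v t _ =>
    refine hX.comodule.induction (p := fun v => TensorProduct.lid k A (LinearMap.rTensor A
      (ε).toLinearMap (X.tensorData.coact (𝓲 v * t))) = algebraMap k A (ε (𝓲 v * t))) (by simp)
      (fun a b ha hb => by simp only [map_add, add_mul, ha, hb]) ?_ v
    intro n x c hx r j
    simp only [map_smul, smul_mul_assoc, counit_ι_mul, smul_zero, map_zero, tensorData_coact_mul,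
      (family_ι hx).coact, Finset.sum_mul, map_sum]
    rw [Finset.sum_eq_zero, smul_zero]
    intro i _
    generalize X.tensorData.coact t = z
    induction z with
    | zero => simp
    | add s t hs ht => simp only [mul_add, map_add, hs, ht, add_zero]
    | tmul y d => simp [TensorAlgebra.algebraMapInv]

theorem counit_family (hX : X.IsYD) {x : ι → TensorAlgebra k V} {c : Matrix ι ι A}
    (hx : IsFamily X.tensorData.coact x c) (j : ι) :
    ∑ i, ε (x i) • c i j = algebraMap k A (ε (x j)) := by
  rw [← counit_tensorCoact hX, hx.coact]
  simp

theorem tensorCop_counit_left (hX : X.IsYD) (t : TensorAlgebra k V) :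
    TensorProduct.lid k _ (LinearMap.rTensor _ (ε).toLinearMap (X.tensorCop t)) = t := by
  induction t using tensorAlgebra_left_induction with
  | one => simp [tensorCop_one]
  | add a b ha hb => simp only [map_add, ha, hb]
  | smul r a ha => simp only [map_smul, ha]
  | mul v t ht =>
    rw [tensorCop_ι_mul]
    conv_rhs => rw [← ht]
    refine hX.tensorData_comodule.tensor_induction (p := fun z => TensorProduct.lid k _
      (LinearMap.rTensor _ (ε).toLinearMap (X.tensorData.bm (prim k V v) z)) =
      𝓲 v * TensorProduct.lid k _ (LinearMap.rTensor _ (ε).toLinearMap z)) (by simp)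
      (fun a b ha hb => by simp only [map_add, ha, hb, mul_add]) ?_ _
    intro n x c hx j y
    have h := congrArg (fun a => 𝓲 (X.act v a) * y) (counit_family hX hx j)
    simp only [map_sum, map_smul, Finset.sum_mul, smul_mul_assoc, Algebra.algebraMap_eq_smul_one,
      hX.act_one] at h
    rw [bm_prim_family hX hx]
    simp [counit_ι_mul, h]

theorem tensorCop_counit_right (hX : X.IsYD) (t : TensorAlgebra k V) :
    TensorProduct.rid k _ (LinearMap.lTensor _ (ε).toLinearMap (X.tensorCop t)) = t := by
  induction t using tensorAlgebra_left_induction with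
  | one => simp [tensorCop_one]
  | add a b ha hb => simp only [map_add, ha, hb]
  | smul r a ha => simp only [map_smul, ha]
  | mul v t ht =>
    rw [tensorCop_ι_mul]
    conv_rhs => rw [← ht]
    refine hX.tensorData_comodule.tensor_induction (p := fun z => TensorProduct.rid k _
      (LinearMap.lTensor _ (ε).toLinearMap (X.tensorData.bm (prim k V v) z)) =
      𝓲 v * TensorProduct.rid k _ (LinearMap.lTensor _ (ε).toLinearMap z)) (by simp)
      (fun a b ha hb => by simp only [map_add, ha, hb, mul_add]) ?_ _
    intro n x c hx j y
    rw [bm_prim_family hX hx]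
    simp [counit_ι_mul]

theorem actTwo_prim {c : Matrix ι ι A} (hc : IsComatrix k c) (v : V) (i j : ι) :
    X.tensorData.actTwo (prim k V v) (c i j) = prim k V (X.act v (c i j)) := by
  rw [prim_apply, prim_apply, map_add, LinearMap.add_apply, actTwo_comatrix hc, actTwo_comatrix hc]
  simp only [tensorData_act_ι, tensorData_act_one, Algebra.algebraMap_eq_smul_one,
    TensorProduct.tmul_smul, ← TensorProduct.smul_tmul']
  rw [hc.counit_smul (fun l => 𝓲 (X.act v (c i l)) ⊗ₜ[k] (1 : TensorAlgebra k V)),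
    hc.counit_smul_right (fun l => (1 : TensorAlgebra k V) ⊗ₜ[k] 𝓲 (X.act v (c l j)))]

theorem tensorCop_act_comatrix (hX : X.IsYD) {c : Matrix ι ι A} (hc : IsComatrix k c)
    (t : TensorAlgebra k V) (i j : ι) :
    X.tensorCop (X.tensorData.act t (c i j)) = X.tensorData.actTwo (X.tensorCop t) (c i j) := by
  induction t using tensorAlgebra_left_induction generalizing i j with
  | one =>
    simp only [tensorData_act_one, tensorCop_one, actTwo_comatrix hc, map_smul,
      Algebra.algebraMap_eq_smul_one, TensorProduct.tmul_smul, ← TensorProduct.smul_tmul']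
    rw [hc.counit_smul (fun l => Coalgebra.counit (R := k) (c i l) •
      ((1 : TensorAlgebra k V) ⊗ₜ[k] (1 : TensorAlgebra k V)))]
  | add a b ha hb => simp only [map_add, LinearMap.add_apply, ha, hb]
  | smul r a ha => simp only [map_smul, LinearMap.smul_apply, ha]
  | mul v t ht =>
    rw [tensorData_act_ι_mul hc, tensorCop_ι_mul, hX.tensorData_isYDAlg.actTwo_bm hc]
    simp only [map_sum, tensorCop_ι_mul, ht, actTwo_prim hc]

/-- Primitive elements form a comodule under the diagonal coaction, and the braided product is
colinear, so colinearity passes along the letters. -/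
theorem tensorCop_coact (hX : X.IsYD) (t : TensorAlgebra k V) :
    X.tensorData.coactTwo (X.tensorCop t) =
      LinearMap.rTensor A X.tensorCop (X.tensorData.coact t) := by
  induction t using tensorAlgebra_left_induction with
  | one => simp [tensorCop_one, tensorData_coact_one, coactTwo]
  | add a b ha hb => simp only [map_add, ha, hb]
  | smul r a ha => simp only [map_smul, ha]
  | mul v t ht =>
    refine hX.comodule.induction (p := fun v => X.tensorData.coactTwo (X.tensorCop (𝓲 v * t)) =
      LinearMap.rTensor A X.tensorCop (X.tensorData.coact (𝓲 v * t))) (by simp)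
      (fun a b ha hb => by simp only [map_add, add_mul, ha, hb]) ?_ v
    intro n x c hx r j
    simp only [map_smul, smul_mul_assoc]
    congr 1
    have h1 : X.tensorData.coactTwo (prim k V (x j)) = ∑ i, prim k V (x i) ⊗ₜ[k] c i j := by
      have hone := hX.tensorData_isYDAlg.isFamily_one
      rw [prim_apply, map_add, coactTwo_family_family (family_ι hx) hone j (),
        coactTwo_family_family hone (family_ι hx) () j]
      simp [prim_apply, TensorProduct.add_tmul, Finset.sum_add_distrib]
    rw [tensorCop_ι_mul, hX.tensorData_isYDAlg.coactTwo_bm, h1, ht, tensorData_coact_mul,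
      (family_ι hx).coact]
    simp only [map_sum, LinearMap.sum_apply, Finset.sum_mul]
    refine Finset.sum_congr rfl fun i _ => ?_
    generalize X.tensorData.coact t = z
    induction z with
    | zero => simp
    | add s t hs ht => simp only [mul_add, map_add, hs, ht]
    | tmul y d => simp [tensorCop_ι_mul]

/-- Left multiplication by `v ⊗ 1 ⊗ 1 + 1 ⊗ v ⊗ 1 + 1 ⊗ 1 ⊗ v`. -/
def primThree (X : CrossedData k A V) (v : V) :
    Module.End k (TensorAlgebra k V ⊗[k] (TensorAlgebra k V ⊗[k] TensorAlgebra k V)) :=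
  LinearMap.rTensor _ (LinearMap.mulLeft k (𝓲 v)) +
    LinearMap.lTensor _ (TensorProduct.lift (X.tensorData.bm ∘ₗ prim k V ∘ₗ X.act v)) ∘ₗ
      (TensorProduct.assoc k _ _ _).toLinearMap ∘ₗ LinearMap.rTensor _ X.tensorData.coact

theorem primThree_family {x : ι → TensorAlgebra k V} {c : Matrix ι ι A}
    (hx : IsFamily X.tensorData.coact x c) (v : V)
    (w : TensorAlgebra k V ⊗[k] TensorAlgebra k V) (j : ι) :
    X.primThree v (x j ⊗ₜ w) = (𝓲 v * x j) ⊗ₜ w +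
      ∑ i, x i ⊗ₜ X.tensorData.bm (prim k V (X.act v (c i j))) w := by
  simp [primThree, hx.coact, TensorProduct.sum_tmul]

/-- Both `(Δ ⊗ id)Δ` and `(id ⊗ Δ)Δ` turn left multiplication by `v` into the same operator
`primThree v`, so they agree by induction on length. -/
theorem tensorCop_coassoc (hX : X.IsYD) (t : TensorAlgebra k V) :
    TensorProduct.assoc k _ _ _ (LinearMap.rTensor _ X.tensorCop (X.tensorCop t)) =
      LinearMap.lTensor _ X.tensorCop (X.tensorCop t) := by
  induction t using tensorAlgebra_left_induction with
  | one => simp [tensorCop_one]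
  | add a b ha hb => simp only [map_add, ha, hb]
  | smul r a ha => simp only [map_smul, ha]
  | mul v t ht =>
    have hl : ∀ z, LinearMap.lTensor _ X.tensorCop (X.tensorData.bm (prim k V v) z) =
        X.primThree v (LinearMap.lTensor _ X.tensorCop z) := by
      intro z
      refine hX.tensorData_comodule.tensor_induction (p := fun z => LinearMap.lTensor _ X.tensorCop
        (X.tensorData.bm (prim k V v) z) = X.primThree v (LinearMap.lTensor _ X.tensorCop z))
        (by simp) (fun a b ha hb => by simp only [map_add, ha, hb]) ?_ z
      intro n x c hx j y
      rw [bm_prim_family hX hx, LinearMap.lTensor_tmul, primThree_family hx]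
      simp [tensorCop_ι_mul]
    have hr : ∀ z, TensorProduct.assoc k _ _ _
        (LinearMap.rTensor _ X.tensorCop (X.tensorData.bm (prim k V v) z)) =
        X.primThree v (TensorProduct.assoc k _ _ _ (LinearMap.rTensor _ X.tensorCop z)) := by
      intro z
      refine hX.tensorData_comodule.tensor_induction (p := fun z => TensorProduct.assoc k _ _ _
        (LinearMap.rTensor _ X.tensorCop (X.tensorData.bm (prim k V v) z)) =
        X.primThree v (TensorProduct.assoc k _ _ _ (LinearMap.rTensor _ X.tensorCop z)))
        (by simp) (fun a b ha hb => by simp only [map_add, ha, hb]) ?_ z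
      intro n x c hx j y
      -- In the term where `v` is braided past the first leg, that leg is about to be split;
      -- colinearity of Δ lets the coaction be taken after splitting it.
      have h1 := tensorCop_coact hX (x j)
      rw [hx.coact, map_sum] at h1
      simp only [LinearMap.rTensor_tmul] at h1
      let Ξ : (TensorAlgebra k V ⊗[k] TensorAlgebra k V) ⊗[k] A →ₗ[k]
          TensorAlgebra k V ⊗[k] (TensorAlgebra k V ⊗[k] TensorAlgebra k V) :=
        (TensorProduct.assoc k _ _ _).toLinearMap ∘ₗ LinearMap.lTensor _
          (LinearMap.mulRight k y ∘ₗ TensorAlgebra.ι k ∘ₗ X.act v)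
      have h2 := congrArg Ξ h1
      -- The operator `primThree` has three terms according to the leg that receives `v`: the
      -- primitive product accounts for the first two legs and `Ξ` for the last.
      have h3 : ∀ u : TensorAlgebra k V ⊗[k] TensorAlgebra k V,
          TensorProduct.assoc k _ _ _ (X.tensorData.bm (prim k V v) u ⊗ₜ y) +
            Ξ (X.tensorData.coactTwo u) =
          X.primThree v (TensorProduct.assoc k _ _ _ (u ⊗ₜ y)) := by
        intro u
        refine hX.tensorData_comodule.tensor_induction (p := fun u =>
          TensorProduct.assoc k _ _ _ (X.tensorData.bm (prim k V v) u ⊗ₜ y) +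
            Ξ (X.tensorData.coactTwo u) =
          X.primThree v (TensorProduct.assoc k _ _ _ (u ⊗ₜ y))) (by simp)
          (fun a b ha hb => by
            simp only [map_add, TensorProduct.add_tmul, ← ha, ← hb]; abel) ?_ u
        intro n p c hp j q
        refine hX.tensorData_comodule.induction (p := fun q =>
          TensorProduct.assoc k _ _ _ (X.tensorData.bm (prim k V v) (p j ⊗ₜ q) ⊗ₜ y) +
            Ξ (X.tensorData.coactTwo (p j ⊗ₜ q)) =
          X.primThree v (TensorProduct.assoc k _ _ _ ((p j ⊗ₜ q) ⊗ₜ y))) (by simp)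
          (fun a b ha hb => by
            simp only [map_add, TensorProduct.add_tmul, TensorProduct.tmul_add, ← ha, ← hb]
            abel) ?_ q
        intro m q d hq r s
        simp only [TensorProduct.tmul_smul, map_smul, ← TensorProduct.smul_tmul', ← smul_add]
        congr 1
        rw [bm_prim_family hX hp, coactTwo_family_family hp hq, TensorProduct.assoc_tmul,
          primThree_family hp]
        simp only [bm_prim_family hX hq, Ξ, map_sum, LinearMap.comp_apply, LinearMap.lTensor_tmul,
          LinearMap.mulRight_apply, LinearEquiv.coe_coe, TensorProduct.assoc_tmul,
          TensorProduct.add_tmul, TensorProduct.sum_tmul, map_add, TensorProduct.tmul_add,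
          TensorProduct.tmul_sum, Finset.sum_add_distrib, hX.act_mul, add_assoc]
      rw [LinearMap.rTensor_tmul, ← h3, h2, bm_prim_family hX hx]
      simp [tensorCop_ι_mul, Ξ]
    rw [tensorCop_ι_mul, hl, hr, ht]

/-- `x ↦ - x₀ (v ◁ x₁)`. -/
def antiStep (X : CrossedData k A V) : V →ₗ[k] Module.End k (TensorAlgebra k V) :=
  LinearMap.mk₂ k (fun v t => -LinearMap.mul' k _
      (LinearMap.lTensor _ (TensorAlgebra.ι k ∘ₗ X.act v) (X.tensorData.coact t)))
    (by intros; simp [LinearMap.comp_add, LinearMap.lTensor_add]; abel)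
    (by intros; simp [LinearMap.comp_smul, LinearMap.lTensor_smul])
    (by intros; simp; abel) (by intros; simp)

/-- The antipode of the tensor algebra: `S (v t) = - (S t)₀ (v ◁ (S t)₁)`. -/
def tensorAnti (X : CrossedData k A V) : TensorAlgebra k V →ₗ[k] TensorAlgebra k V :=
  LinearMap.applyₗ 1 ∘ₗ (TensorAlgebra.lift k X.antiStep).toLinearMap

theorem antiStep_family {x : ι → TensorAlgebra k V} {c : Matrix ι ι A}
    (hx : IsFamily X.tensorData.coact x c) (v : V) (j : ι) :
    X.antiStep v (x j) = -∑ i, x i * 𝓲 (X.act v (c i j)) := by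
  simp [antiStep, hx.coact]

theorem tensorAnti_one : X.tensorAnti 1 = 1 := by
  simp [tensorAnti]

theorem tensorAnti_ι_mul (v : V) (t : TensorAlgebra k V) :
    X.tensorAnti (𝓲 v * t) = X.antiStep v (X.tensorAnti t) := by
  simp [tensorAnti]

theorem tensorAnti_ι (hX : X.IsYD) (v : V) : X.tensorAnti (𝓲 v) = -𝓲 v := by
  have h := tensorAnti_ι_mul (X := X) v 1
  rw [mul_one, tensorAnti_one, antiStep_family hX.tensorData_isYDAlg.isFamily_one v ()] at h
  simpa [hX.act_one] using h

/-- One step in the recursion of the antipode is colinear; again a letter is acted on and then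
coacted on, which is resolved by `sum_coact_act'`. -/
theorem coact_antiStep (hX : X.IsYD) {x : ι → V} {c : Matrix ι ι A}
    (hx : IsFamily X.coact x c) (j : ι) (t : TensorAlgebra k V) :
    X.tensorData.coact (X.antiStep (x j) t) =
      ∑ i, TensorProduct.map (X.antiStep (x i)) (LinearMap.mulLeft k (c i j))
        (X.tensorData.coact t) := by
  refine hX.tensorData_comodule.induction (p := fun t => X.tensorData.coact (X.antiStep (x j) t) =
      ∑ i, TensorProduct.map (X.antiStep (x i)) (LinearMap.mulLeft k (c i j))
        (X.tensorData.coact t)) (by simp)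
      (fun a b ha hb => by simp only [map_add, ha, hb, Finset.sum_add_distrib]) ?_ t
  intro n y d hy r s
  simp only [map_smul, ← Finset.smul_sum]
  congr 1
  have h1 : ∀ p, ∑ r, (1 ⊗ₜ[k] d p r) * X.tensorData.coact (𝓲 (X.act (x j) (d r s))) =
      ∑ r, ∑ i, 𝓲 (X.act (x i) (d p r)) ⊗ₜ[k] (c i j * d r s) := by
    intro p
    have := hX.tensorData_isYDAlg.sum_coact_act' (family_ι hx) hy.comatrix j p s
    simpa only [tensorData_act_ι] using this
  calc _ = -∑ p, (y p ⊗ₜ[k] 1) *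
        ∑ r, (1 ⊗ₜ[k] d p r) * X.tensorData.coact (𝓲 (X.act (x j) (d r s))) := by
        simp only [antiStep_family hy, map_neg, map_sum, tensorData_coact_mul, hy.coact,
          Finset.sum_mul, Finset.mul_sum, ← mul_assoc, Algebra.TensorProduct.tmul_mul_tmul,
          mul_one, one_mul]
        rw [Finset.sum_comm]
    _ = _ := by
        simp only [h1, hy.coact, map_sum, TensorProduct.map_tmul, antiStep_family hy,
          LinearMap.mulLeft_apply, TensorProduct.neg_tmul, Finset.sum_neg_distrib,
          TensorProduct.sum_tmul, Finset.mul_sum, Algebra.TensorProduct.tmul_mul_tmul, one_mul]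
        rw [sum_rev₃]

theorem tensorAnti_coact (hX : X.IsYD) (t : TensorAlgebra k V) :
    X.tensorData.coact (X.tensorAnti t) =
      LinearMap.rTensor A X.tensorAnti (X.tensorData.coact t) := by
  induction t using tensorAlgebra_left_induction with
  | one => simp [tensorAnti_one, tensorData_coact_one]
  | add a b ha hb => simp only [map_add, ha, hb]
  | smul r a ha => simp only [map_smul, ha]
  | mul v t ht =>
    refine hX.comodule.induction (p := fun v => X.tensorData.coact (X.tensorAnti (𝓲 v * t)) =
      LinearMap.rTensor A X.tensorAnti (X.tensorData.coact (𝓲 v * t))) (by simp)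
      (fun a b ha hb => by simp only [map_add, add_mul, ha, hb]) ?_ v
    intro n x c hx r j
    simp only [map_smul, smul_mul_assoc]
    congr 1
    rw [tensorAnti_ι_mul, coact_antiStep hX hx, ht, tensorData_coact_mul, (family_ι hx).coact]
    simp only [map_sum, Finset.sum_mul]
    refine Finset.sum_congr rfl fun i _ => ?_
    generalize X.tensorData.coact t = z
    induction z with
    | zero => simp
    | add s t hs ht => simp only [mul_add, map_add, hs, ht]
    | tmul y d => simp [tensorAnti_ι_mul]

theorem family_anti (hX : X.IsYD) {x : ι → TensorAlgebra k V} {c : Matrix ι ι A}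
    (hx : IsFamily X.tensorData.coact x c) :
    IsFamily X.tensorData.coact (fun i => X.tensorAnti (x i)) c :=
  ⟨hx.comatrix, fun j => by simp [tensorAnti_coact hX, hx.coact]⟩

theorem act_antiStep (hX : X.IsYD) {c : Matrix ι ι A} (hc : IsComatrix k c) (v : V)
    (t : TensorAlgebra k V) (i j : ι) :
    X.tensorData.act (X.antiStep v t) (c i j) =
      ∑ l, X.antiStep (X.act v (c i l)) (X.tensorData.act t (c l j)) := by
  refine hX.tensorData_comodule.induction (p := fun t =>
    X.tensorData.act (X.antiStep v t) (c i j) =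
      ∑ l, X.antiStep (X.act v (c i l)) (X.tensorData.act t (c l j))) (by simp)
      (fun a b ha hb => by simp only [map_add, LinearMap.add_apply, ha, hb,
        Finset.sum_add_distrib]) ?_ t
  intro n y d hy r s
  simp only [map_smul, LinearMap.smul_apply, ← Finset.smul_sum]
  congr 1
  let Ξ : TensorAlgebra k V ⊗[k] A →ₗ[k] TensorAlgebra k V :=
    LinearMap.mul' k _ ∘ₗ LinearMap.lTensor _ (TensorAlgebra.ι k ∘ₗ X.act v)
  have h0 : ∀ a t, X.antiStep (X.act v a) t = -Ξ ((1 ⊗ₜ a) * X.tensorData.coact t) := by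
    intro a t
    simp only [antiStep, LinearMap.mk₂_apply, Ξ, LinearMap.comp_apply]
    congr 1
    generalize X.tensorData.coact t = z
    induction z with
    | zero => simp
    | add s t hs ht => simp only [mul_add, map_add, hs, ht]
    | tmul y d => simp [hX.act_mul]
  simp only [h0, Finset.sum_neg_distrib, ← map_sum,
    hX.tensorData_isYDAlg.sum_coact_act' hy hc, antiStep_family hy]
  simp [Ξ, hX.tensorData_isYDAlg.mul_act_comatrix hc, tensorData_act_ι, hX.act_mul]
  rw [Finset.sum_comm]

theorem tensorAnti_act (hX : X.IsYD) (t : TensorAlgebra k V) (a : A) :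
    X.tensorAnti (X.tensorData.act t a) = X.tensorData.act (X.tensorAnti t) a := by
  suffices h : X.tensorAnti ∘ₗ X.tensorData.act t = X.tensorData.act (X.tensorAnti t) by
    exact congrArg (fun f => f a) h
  refine comatrix_ext fun n c hc i j => ?_
  rw [LinearMap.comp_apply]
  induction t using tensorAlgebra_left_induction generalizing i j with
  | one => simp [tensorAnti_one, tensorData_act_one, Algebra.algebraMap_eq_smul_one]
  | add a b ha hb => simp only [map_add, LinearMap.add_apply, ha, hb]
  | smul r a ha => simp only [map_smul, LinearMap.smul_apply, ha]
  | mul v t ht =>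
    rw [tensorData_act_ι_mul hc, tensorAnti_ι_mul, act_antiStep hX hc, map_sum]
    simp only [tensorAnti_ι_mul, ht]

theorem antiStep_mul (hX : X.IsYD) {x : ι → TensorAlgebra k V} {c : Matrix ι ι A}
    (hx : IsFamily X.tensorData.coact x c) (v : V) (j : ι) (t : TensorAlgebra k V) :
    X.antiStep v (x j * t) = ∑ i, x i * X.antiStep (X.act v (c i j)) t := by
  refine hX.tensorData_comodule.induction (p := fun t =>
    X.antiStep v (x j * t) = ∑ i, x i * X.antiStep (X.act v (c i j)) t) (by simp)
      (fun a b ha hb => by simp only [map_add, mul_add, ha, hb, Finset.sum_add_distrib]) ?_ t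
  intro n y d hy r s
  simp only [map_smul, mul_smul_comm, ← Finset.smul_sum]
  congr 1
  have := antiStep_family (hX.tensorData_isYDAlg.family_mul hx hy) v (j, s)
  simp only at this
  rw [this, Fintype.sum_prod_type]
  simp [antiStep_family hy, comatrixMul, hX.act_mul, Finset.mul_sum, mul_assoc]

/-- Braided anti-multiplicativity `S(s x) = S(x₀) S(s ◁ x₁)`, by removing letters of `s` from the
left. It is what makes the right antipode axiom accessible, since the recursion itself only sees the
first letter. -/
theorem tensorAnti_mul_family (hX : X.IsYD) {x : ι → TensorAlgebra k V} {c : Matrix ι ι A}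
    (hx : IsFamily X.tensorData.coact x c) (s : TensorAlgebra k V) (j : ι) :
    X.tensorAnti (s * x j) =
      ∑ i, X.tensorAnti (x i) * X.tensorAnti (X.tensorData.act s (c i j)) := by
  induction s using tensorAlgebra_left_induction generalizing j with
  | one =>
    simp only [tensorData_act_one, Algebra.algebraMap_eq_smul_one, map_smul, tensorAnti_one,
      mul_smul_comm, mul_one, one_mul]
    rw [hx.comatrix.counit_smul (fun i => X.tensorAnti (x i))]
  | add a b ha hb => simp only [add_mul, map_add, LinearMap.add_apply, mul_add, ha, hb,
      Finset.sum_add_distrib]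
  | smul r a ha => simp only [smul_mul_assoc, map_smul, LinearMap.smul_apply, mul_smul_comm, ha,
      Finset.smul_sum]
  | mul v s hs =>
    rw [mul_assoc, tensorAnti_ι_mul, hs]
    simp only [map_sum, antiStep_mul hX (family_anti hX hx), tensorData_act_ι_mul hx.comatrix,
      tensorAnti_ι_mul, Finset.mul_sum]
    rw [Finset.sum_comm]

theorem tensorAnti_left (hX : X.IsYD) (t : TensorAlgebra k V) :
    LinearMap.mul' k _ (TensorProduct.map X.tensorAnti LinearMap.id (X.tensorCop t)) =
      algebraMap k _ (ε t) := by
  induction t using tensorAlgebra_left_induction with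
  | one => simp [tensorCop_one, tensorAnti_one]
  | add a b ha hb => simp only [map_add, ha, hb]
  | smul r a ha => simp only [map_smul, ha, Algebra.algebraMap_eq_smul_one, smul_smul]; simp
  | mul v t _ =>
    rw [tensorCop_ι_mul, counit_ι_mul, map_zero]
    refine hX.tensorData_comodule.tensor_induction (p := fun z => LinearMap.mul' k _
      (TensorProduct.map X.tensorAnti LinearMap.id (X.tensorData.bm (prim k V v) z)) = 0) (by simp)
      (fun a b ha hb => by simp only [map_add, ha, hb, add_zero]) ?_ _
    intro n x c hx j y
    rw [bm_prim_family hX hx]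
    simp [tensorAnti_ι_mul, antiStep_family (family_anti hX hx), Finset.sum_mul, mul_assoc]

/-- The induction removes the last letter `v`. The two parts of `Δ(t v)` contribute `s v₀ S(t ◁ v₁)`
and `s S(t v)`, and these cancel by anti-multiplicativity and `S v = -v`. -/
theorem tensorAnti_right (hX : X.IsYD) (t : TensorAlgebra k V) :
    LinearMap.mul' k _ (TensorProduct.map LinearMap.id X.tensorAnti (X.tensorCop t)) =
      algebraMap k _ (ε t) := by
  induction t using tensorAlgebra_right_induction with
  | one => simp [tensorCop_one, tensorAnti_one]
  | add a b ha hb => simp only [map_add, ha, hb]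
  | smul r a ha => simp only [map_smul, ha, Algebra.algebraMap_eq_smul_one, smul_smul]; simp
  | mul t v _ =>
    refine hX.comodule.induction (p := fun v => LinearMap.mul' k _ (TensorProduct.map LinearMap.id
      X.tensorAnti (X.tensorCop (t * 𝓲 v))) = algebraMap k _ (ε (t * 𝓲 v))) (by simp)
      (fun a b ha hb => by simp only [map_add, mul_add, ha, hb]) ?_ v
    intro n x c hx r j
    have h0 : ε (t * 𝓲 (x j)) = 0 := by simp [TensorAlgebra.algebraMapInv]
    simp only [map_smul, mul_smul_comm, h0, smul_zero, map_zero]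
    rw [tensorCop_mul hX, tensorCop_ι hX]
    generalize X.tensorCop t = z
    convert smul_zero r
    induction z with
    | zero => simp
    | add s t hs ht => simp only [map_add, LinearMap.add_apply, hs, ht, add_zero]
    | tmul s t =>
      rw [bm_prim_right hX hx]
      simp [tensorAnti_mul_family hX (family_ι hx), tensorAnti_ι hX, Finset.mul_sum, mul_assoc]

/-- The tensor algebra of a crossed module as a braided Hopf algebra. -/
def IsYD.tensorHopf (hX : X.IsYD) : BraidedHopf k A (TensorAlgebra k V) where
  X := X.tensorData
  cop := X.tensorCop
  counit := (ε).toLinearMap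
  anti := X.tensorAnti
  ydAlg := hX.tensorData_isYDAlg
  cop_one := tensorCop_one
  cop_mul := tensorCop_mul hX
  coassoc := tensorCop_coassoc hX
  counit_left := tensorCop_counit_left hX
  counit_right := tensorCop_counit_right hX
  cop_act t a := by
    suffices h : X.tensorCop ∘ₗ X.tensorData.act t = X.tensorData.actTwo (X.tensorCop t) by
      exact congrArg (fun f => f a) h
    exact comatrix_ext fun n c hc i j => tensorCop_act_comatrix hX hc t i j
  cop_coact := tensorCop_coact hX
  anti_one := tensorAnti_one
  anti_mul s t := by
    refine hX.tensorData_comodule.induction (p := fun t => X.tensorAnti (s * t) =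
      LinearMap.mul' k _ (TensorProduct.map X.tensorAnti (X.tensorAnti ∘ₗ X.tensorData.act s)
        (X.tensorData.coact t))) (by simp)
      (fun a b ha hb => by simp only [map_add, mul_add, ha, hb]) ?_ t
    intro n x c hx r j
    simp only [map_smul, mul_smul_comm]
    rw [tensorAnti_mul_family hX hx, hx.coact]
    simp
  anti_act := tensorAnti_act hX
  anti_coact := tensorAnti_coact hX
  anti_left := tensorAnti_left hX
  anti_right := tensorAnti_right hX

end TensorHopf

end CrossedData

/-! ### Pairings of braided Hopf algebras -/

section Families

variable {k A M : Type*} [Field k] [Ring A] [HopfAlgebra k A] [AddCommGroup M] [Module k M]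
  {ι : Type*} [Fintype ι] [DecidableEq ι]

/-- The matrix of a coaction in a basis. -/
def coeffMatrix (ρ : M →ₗ[k] M ⊗[k] A) (b : Module.Basis ι k M) : Matrix ι ι A :=
  fun i j => TensorProduct.lid k A (LinearMap.rTensor A (b.coord i) (ρ (b j)))

theorem tensor_eq_sum_basis {N : Type*} [AddCommGroup N] [Module k N] (b : Module.Basis ι k M)
    (z : M ⊗[k] N) :
    z = ∑ i, b i ⊗ₜ[k] TensorProduct.lid k N (LinearMap.rTensor N (b.coord i) z) := by
  induction z with
  | zero => simp
  | add x y hx hy =>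
    conv_lhs => rw [hx, hy]
    simp [TensorProduct.tmul_add, Finset.sum_add_distrib]
  | tmul m a =>
    conv_lhs => rw [← b.sum_repr m, TensorProduct.sum_tmul]
    simp [TensorProduct.smul_tmul]

theorem IsComodule.basis_family {ρ : M →ₗ[k] M ⊗[k] A} (h : IsComodule ρ)
    (b : Module.Basis ι k M) : IsFamily ρ b (coeffMatrix ρ b) := by
  have hc : ∀ j, ρ (b j) = ∑ i, b i ⊗ₜ[k] coeffMatrix ρ b i j :=
    fun j => tensor_eq_sum_basis b (ρ (b j))
  refine ⟨⟨fun i j => ?_, fun i j => ?_⟩, hc⟩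
  · have h1 := congrArg (fun z => TensorProduct.lid k _
      (LinearMap.rTensor (A ⊗[k] A) (b.coord i) z)) (h.coassoc (b j))
    simp only [hc, map_sum, LinearMap.rTensor_tmul, LinearMap.lTensor_tmul,
      TensorProduct.sum_tmul, TensorProduct.assoc_tmul, TensorProduct.lid_tmul,
      Module.Basis.coord_apply, Module.Basis.repr_self, Finsupp.single_apply,
      ite_smul, one_smul, zero_smul, Finset.sum_ite_eq', Finset.mem_univ, if_true] at h1
    exact h1.symm
  · have h1 := congrArg (b.coord i) (h.counit (b j))
    simp only [hc, map_sum, LinearMap.lTensor_tmul, TensorProduct.rid_tmul, map_smul,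
      Module.Basis.coord_apply, Module.Basis.repr_self, Finsupp.single_apply] at h1
    simpa [Matrix.one_apply, eq_comm] using h1

end Families

/-- A pairing of braided Hopf algebras, invariant under the action and the coaction. -/
structure HopfPairing {k A C D : Type*} [Field k] [Ring A] [HopfAlgebra k A] [Ring C]
    [Algebra k C] [Ring D] [Algebra k D] (H' : BraidedHopf k A D) (H : BraidedHopf k A C) where
  pair : D →ₗ[k] C →ₗ[k] k
  one_left : ∀ t, pair 1 t = H.counit t
  one_right : ∀ φ, pair φ 1 = H'.counit φ
  mul_left : ∀ φ ψ t, pair (φ * ψ) t =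
    LinearMap.mul' k k (TensorProduct.map (pair ψ) (pair φ) (H.cop t))
  mul_right : ∀ φ s t, pair φ (s * t) =
    LinearMap.mul' k k (TensorProduct.map (pair.flip t) (pair.flip s) (H'.cop φ))
  act : ∀ φ a t, pair (H'.X.act φ (HopfAlgebra.antipode k a)) t = pair φ (H.X.act t a)
  coact : ∀ φ t, TensorProduct.lid k A (LinearMap.rTensor A (pair.flip t) (H'.X.coact φ)) =
    HopfAlgebra.antipode k (TensorProduct.lid k A (LinearMap.rTensor A (pair φ) (H.X.coact t)))

/-! ### Braided partial derivatives and the pairing of the tensor algebras of V^* and V -/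

namespace CrossedData

section TensorPairing

variable {k A V : Type*} [Field k] [Ring A] [HopfAlgebra k A] [AddCommGroup V] [Module k V]
  {ι κ : Type*} [Fintype ι] [Fintype κ] [DecidableEq ι] [DecidableEq κ]

local notation "𝓲" => TensorAlgebra.ι k
local notation "ε" => TensorAlgebra.algebraMapInv (R := k) (M := V)

variable (k V) in
/-- The projection of the tensor algebra to its degree one part. -/
def degOne : TensorAlgebra k V →ₗ[k] V :=
  LinearMap.snd k k V ∘ₗ LinearMap.applyₗ ((1 : k), (0 : V)) ∘ₗ
    (TensorAlgebra.lift k (LinearMap.mk₂ k (fun v (x : k × V) => ((0 : k), x.1 • v))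
      (by simp) (fun r v x => by simp [smul_comm x.1 r v]) (by simp [add_smul])
      (by simp [mul_smul]) : V →ₗ[k] Module.End k (k × V))).toLinearMap

theorem degOne_one : degOne k V 1 = 0 := by simp [degOne]

theorem degOne_ι_mul (v : V) (t : TensorAlgebra k V) : degOne k V (𝓲 v * t) = ε t • v := by
  have h : ∀ t : TensorAlgebra k V, ((TensorAlgebra.lift k (LinearMap.mk₂ k
      (fun v (x : k × V) => ((0 : k), x.1 • v))
      (by simp) (fun r v x => by simp [smul_comm x.1 r v]) (by simp [add_smul])
      (by simp [mul_smul]) : V →ₗ[k] Module.End k (k × V))) t (1, 0)).1 = ε t := by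
    intro t
    induction t using tensorAlgebra_left_induction with
    | one => simp
    | add a b ha hb => simp [ha, hb]
    | smul r a ha => simp [ha]
    | mul v t _ => simp [counit_ι_mul]
  simp [degOne, h]

theorem degOne_mul (s t : TensorAlgebra k V) :
    degOne k V (s * t) = ε t • degOne k V s + ε s • degOne k V t := by
  induction s using tensorAlgebra_left_induction with
  | one => simp [degOne_one]
  | add a b ha hb => simp only [add_mul, map_add, ha, hb, smul_add, add_smul]; abel
  | smul r a ha => simp [ha, smul_smul, mul_comm]
  | mul v s _ => simp [mul_assoc, degOne_ι_mul, counit_ι_mul, smul_smul, mul_comm]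

theorem degOne_ι (v : V) : degOne k V (𝓲 v) = v := by
  simpa using degOne_ι_mul (k := k) v 1

variable {X : CrossedData k A V}

theorem degOne_act (t : TensorAlgebra k V) (a : A) :
    degOne k V (X.tensorData.act t a) = X.act (degOne k V t) a := by
  suffices h : degOne k V ∘ₗ X.tensorData.act t = X.act (degOne k V t) by
    exact congrArg (fun f => f a) h
  refine comatrix_ext fun n c hc i j => ?_
  induction t using tensorAlgebra_left_induction with
  | one => simp [tensorData_act_one, degOne_one, Algebra.algebraMap_eq_smul_one]
  | add a b ha hb => simp_all
  | smul r a ha => simp_all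
  | mul v t _ =>
    simp [tensorData_act_ι_mul hc, degOne_ι_mul, counit_tensorAct, hc.counit, Matrix.one_apply]

theorem degOne_coact (hX : X.IsYD) (t : TensorAlgebra k V) :
    X.coact (degOne k V t) = LinearMap.rTensor A (degOne k V) (X.tensorData.coact t) := by
  induction t using tensorAlgebra_left_induction with
  | one => simp [tensorData_coact_one, degOne_one]
  | add a b ha hb => simp only [map_add, ha, hb]
  | smul r a ha => simp only [map_smul, ha]
  | mul v t _ =>
    refine hX.comodule.induction (p := fun v => X.coact (degOne k V (𝓲 v * t)) =
      LinearMap.rTensor A (degOne k V) (X.tensorData.coact (𝓲 v * t))) (by simp)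
      (fun a b ha hb => by simp only [map_add, add_mul, ha, hb]) ?_ v
    intro n x c hx r j
    have h := counit_tensorCoact hX t
    simp only [map_smul, smul_mul_assoc, degOne_ι_mul, hx.coact, tensorData_coact_mul,
      (family_ι hx).coact, Finset.sum_mul, map_sum]
    congr 1
    rw [Finset.smul_sum]
    refine Finset.sum_congr rfl fun i _ => ?_
    have h2 : ∀ z : TensorAlgebra k V ⊗[k] A, LinearMap.rTensor A (degOne k V)
        (𝓲 (x i) ⊗ₜ[k] c i j * z) = x i ⊗ₜ[k] (c i j *
          TensorProduct.lid k A (LinearMap.rTensor A (ε).toLinearMap z)) := by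
      intro z
      induction z with
      | zero => simp
      | add s t hs ht => simp only [mul_add, map_add, hs, ht, TensorProduct.tmul_add]
      | tmul y d => simp [degOne_ι_mul, TensorProduct.smul_tmul]
    rw [h2, h]
    simp [Algebra.algebraMap_eq_smul_one]

theorem degOne_family (hX : X.IsYD) {x : ι → TensorAlgebra k V} {c : Matrix ι ι A}
    (hx : IsFamily X.tensorData.coact x c) :
    IsFamily X.coact (fun i => degOne k V (x i)) c :=
  ⟨hx.comatrix, fun j => by simp [degOne_coact hX, hx.coact]⟩

theorem coord_degOne_family (hX : X.IsYD) {x : κ → TensorAlgebra k V} {d : Matrix κ κ A}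
    (hx : IsFamily X.tensorData.coact x d) (b : Module.Basis ι k V) (a : ι) (j : κ) :
    ∑ i, b.coord a (degOne k V (x i)) • d i j =
      ∑ l, b.coord l (degOne k V (x j)) • coeffMatrix X.coact b a l := by
  have h := congrArg (fun z => TensorProduct.lid k A (LinearMap.rTensor A (b.coord a) z))
    ((degOne_family hX hx).coact j)
  have h2 : degOne k V (x j) = ∑ l, b.coord l (degOne k V (x j)) • b l := by
    simp [b.sum_repr]
  conv at h => lhs; rw [h2]
  simp only [map_sum, map_smul, LinearMap.rTensor_tmul, TensorProduct.lid_tmul] at h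
  exact h.symm

/-- The total derivative `t ↦ p(t₁) ⊗ t₂`, with `p` the projection to degree one. -/
def tensorDeriv (X : CrossedData k A V) : TensorAlgebra k V →ₗ[k] V ⊗[k] TensorAlgebra k V :=
  LinearMap.rTensor _ (degOne k V) ∘ₗ X.tensorCop

/-- The braided partial derivatives `∂_f t = f(p(t₁)) t₂`. -/
def partialD (X : CrossedData k A V) : Module.Dual k V →ₗ[k] Module.End k (TensorAlgebra k V) :=
  LinearMap.mk₂ k (fun f t => TensorProduct.lid k _ (LinearMap.rTensor _ f (X.tensorDeriv t)))
    (by simp [LinearMap.rTensor_add]) (by simp [LinearMap.rTensor_smul]) (by simp) (by simp)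

theorem partialD_apply (f : Module.Dual k V) (t : TensorAlgebra k V) :
    X.partialD f t = TensorProduct.lid k _
      (LinearMap.rTensor _ (f ∘ₗ degOne k V) (X.tensorCop t)) := by
  simp [partialD, tensorDeriv, LinearMap.rTensor_comp]

theorem partialD_one (f : Module.Dual k V) : X.partialD f 1 = 0 := by
  simp [partialD_apply, tensorCop_one, degOne_one]

theorem tensorDeriv_one : X.tensorDeriv 1 = 0 := by
  simp [tensorDeriv, tensorCop_one, degOne_one]

/-- Either `v` itself is split off, or a letter of `t` is split off and `v` is braided past it. This
is the recursion of the braided integers, `[m+1] = id + Ψ₁ (id ⊗ [m])`. -/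
theorem tensorDeriv_ι_mul (hX : X.IsYD) (v : V) (t : TensorAlgebra k V) :
    X.tensorDeriv (𝓲 v * t) = v ⊗ₜ t + LinearMap.lTensor V (LinearMap.mul' k _ ∘ₗ
      LinearMap.rTensor _ (TensorAlgebra.ι k)) (TensorProduct.assoc k V V _
        (LinearMap.rTensor _ X.braiding
          ((TensorProduct.assoc k V V _).symm (v ⊗ₜ X.tensorDeriv t)))) := by
  -- Replacing `t` by `ε(t₁) t₂` makes both sides linear in `Δ t`, so that they can be compared on
  -- an arbitrary tensor.
  conv_rhs => enter [1]; rw [← tensorCop_counit_left hX t]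
  rw [tensorDeriv, LinearMap.comp_apply, tensorCop_ι_mul, LinearMap.comp_apply]
  refine hX.tensorData_comodule.tensor_induction (p := fun z => LinearMap.rTensor _ (degOne k V)
    (X.tensorData.bm (prim k V v) z) = v ⊗ₜ TensorProduct.lid k _ (LinearMap.rTensor _
    (ε).toLinearMap z) + LinearMap.lTensor V (LinearMap.mul' k _ ∘ₗ
      LinearMap.rTensor _ (TensorAlgebra.ι k)) (TensorProduct.assoc k V V _
        (LinearMap.rTensor _ X.braiding
          ((TensorProduct.assoc k V V _).symm (v ⊗ₜ LinearMap.rTensor _ (degOne k V) z)))))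
    (by simp) (fun a b ha hb => by
      simp only [map_add, ha, hb, TensorProduct.tmul_add]; abel) ?_ _
  intro n x c hx j y
  rw [bm_prim_family hX hx]
  simp [degOne_ι_mul, braiding, braid, (degOne_family hX hx).coact, TensorProduct.smul_tmul,
    TensorProduct.sum_tmul]

/-- The braided Leibniz rule. The projection to degree one is a derivation relative to the counit,
and passing a derivative to the right of `s` acts on `s` by the matrix coefficients of the coaction
on `V`. -/
theorem partialD_mul (hX : X.IsYD) (b : Module.Basis ι k V) (i : ι) (s t : TensorAlgebra k V) :
    X.partialD (b.coord i) (s * t) = X.partialD (b.coord i) s * t +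
      ∑ j, X.tensorData.act s (coeffMatrix X.coact b i j) * X.partialD (b.coord j) t := by
  conv_rhs => enter [1, 2]; rw [← tensorCop_counit_left hX t]
  conv_rhs => enter [2, 2, j, 1, 1]; rw [← tensorCop_counit_left hX s]
  simp only [partialD_apply, tensorCop_mul hX]
  generalize X.tensorCop s = z
  generalize X.tensorCop t = w
  induction z with
  | zero => simp
  | add a b ha hb =>
    simp only [map_add, LinearMap.add_apply, add_mul, ha, hb, Finset.sum_add_distrib]; abel
  | tmul x y =>
    refine hX.tensorData_comodule.tensor_induction (p := fun w => TensorProduct.lid k _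
      (LinearMap.rTensor _ (b.coord i ∘ₗ degOne k V) (X.tensorData.bm (x ⊗ₜ y) w)) =
      TensorProduct.lid k _ (LinearMap.rTensor _ (b.coord i ∘ₗ degOne k V) (x ⊗ₜ y)) *
        TensorProduct.lid k _ (LinearMap.rTensor _ (ε).toLinearMap w) +
      ∑ j, X.tensorData.act (TensorProduct.lid k _ (LinearMap.rTensor _ (ε).toLinearMap (x ⊗ₜ y)))
        (coeffMatrix X.coact b i j) * TensorProduct.lid k _
          (LinearMap.rTensor _ (b.coord j ∘ₗ degOne k V) w)) (by simp) (fun a b ha hb => by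
        simp only [map_add, mul_add, ha, hb, Finset.sum_add_distrib]; abel) ?_ w
    intro n z d hz q w
    rw [bm_family hz]
    have h1 := congrArg (fun a => X.tensorData.act y a * w) (counit_family hX hz q)
    have h2 := congrArg (fun a => X.tensorData.act y a * w) (coord_degOne_family hX hz b i q)
    simp only [map_sum, map_smul, Finset.sum_mul, smul_mul_assoc, Algebra.algebraMap_eq_smul_one,
      hX.tensorData_isYDAlg.act_one] at h1 h2
    simp only [map_sum, LinearMap.rTensor_tmul, TensorProduct.lid_tmul, LinearMap.comp_apply,
      degOne_mul, map_add, map_smul, add_smul, Finset.sum_add_distrib, smul_eq_mul,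
      AlgHom.toLinearMap_apply, LinearMap.smul_apply, smul_mul_assoc, mul_smul_comm]
    congr 1
    · simp only [mul_comm _ (b.coord i (degOne k V x)), mul_smul, ← Finset.smul_sum, h1]
      rw [smul_comm]
    · simp only [mul_smul, ← Finset.smul_sum, h2]
      simp only [smul_comm _ (ε x), Finset.smul_sum]

theorem partialD_act (hX : X.IsYD) {c : Matrix ι ι A} (hc : IsComatrix k c)
    (f : Module.Dual k V) (t : TensorAlgebra k V) (i j : ι) :
    X.partialD f (X.tensorData.act t (c i j)) =
      ∑ l, X.tensorData.act (X.partialD (f ∘ₗ X.act.flip (c i l)) t) (c l j) := by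
  have h := hX.tensorHopf.cop_act t (c i j)
  simp only [IsYD.tensorHopf] at h
  simp only [partialD_apply, h]
  generalize X.tensorCop t = z
  induction z with
  | zero => simp
  | add a b ha hb => simp only [map_add, LinearMap.add_apply, ha, hb, Finset.sum_add_distrib]
  | tmul x y => simp [actTwo_comatrix hc, degOne_act]

theorem partialD_coact (hX : X.IsYD) (b : Module.Basis ι k V) (i : ι) (t : TensorAlgebra k V) :
    LinearMap.rTensor A (X.partialD (b.coord i)) (X.tensorData.coact t) =
      ∑ j, (1 ⊗ₜ coeffMatrix X.coact b i j) * X.tensorData.coact (X.partialD (b.coord j) t) := by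
  have h := congrArg (LinearMap.rTensor A ((TensorProduct.lid k _).toLinearMap ∘ₗ
      LinearMap.rTensor _ (b.coord i ∘ₗ degOne k V))) (tensorCop_coact hX t)
  rw [← LinearMap.rTensor_comp_apply] at h
  have h2 : ((TensorProduct.lid k (TensorAlgebra k V)).toLinearMap ∘ₗ
      LinearMap.rTensor _ (b.coord i ∘ₗ degOne k V)) ∘ₗ X.tensorCop = X.partialD (b.coord i) := by
    ext1 t; exact (partialD_apply _ _).symm
  rw [h2] at h
  rw [← h]
  simp only [partialD_apply]
  generalize X.tensorCop t = z
  refine hX.tensorData_comodule.tensor_induction (p := fun z =>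
    LinearMap.rTensor A ((TensorProduct.lid k _).toLinearMap ∘ₗ
      LinearMap.rTensor _ (b.coord i ∘ₗ degOne k V)) (X.tensorData.coactTwo z) =
    ∑ j, (1 ⊗ₜ coeffMatrix X.coact b i j) * X.tensorData.coact (TensorProduct.lid k _
      (LinearMap.rTensor _ (b.coord j ∘ₗ degOne k V) z))) (by simp) (fun a b ha hb => by
        simp only [map_add, mul_add, ha, hb, Finset.sum_add_distrib]) ?_ z
  intro n x d hx q y
  rw [coactTwo_family hx]
  have h3 := coord_degOne_family hX hx b i q
  have h4 : ∀ p (w : TensorAlgebra k V ⊗[k] A), LinearMap.rTensor A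
      ((TensorProduct.lid k _).toLinearMap ∘ₗ LinearMap.rTensor _ (b.coord i ∘ₗ degOne k V))
      ((TensorProduct.assoc k _ _ A).symm (x p ⊗ₜ w)) = b.coord i (degOne k V (x p)) • w := by
    intro p w
    induction w with
    | zero => simp
    | add a b ha hb => simp only [TensorProduct.tmul_add, map_add, ha, hb, smul_add]
    | tmul y a => simp [TensorProduct.smul_tmul']
  simp only [map_sum, h4, LinearMap.rTensor_tmul, TensorProduct.lid_tmul, LinearMap.comp_apply,
    map_smul, mul_smul_comm]
  simp only [← smul_mul_assoc, ← TensorProduct.tmul_smul, ← Finset.sum_mul,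
    ← TensorProduct.tmul_sum, h3]

/-- A derivative uses only the first leg of the coproduct, so by coassociativity it commutes with
splitting off the last leg. -/
theorem tensorCop_partialD (hX : X.IsYD) (f : Module.Dual k V) (t : TensorAlgebra k V) :
    X.tensorCop (X.partialD f t) = LinearMap.rTensor _ (X.partialD f) (X.tensorCop t) := by
  have h := congrArg (fun z => TensorProduct.lid k _ (LinearMap.rTensor _ (f ∘ₗ degOne k V) z))
    (tensorCop_coassoc hX t)
  have h2 : X.partialD f = (TensorProduct.lid k (TensorAlgebra k V)).toLinearMap ∘ₗ
      LinearMap.rTensor _ (f ∘ₗ degOne k V) ∘ₗ X.tensorCop := by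
    ext1 t; exact partialD_apply _ _
  rw [h2]
  simp only [LinearMap.rTensor_comp, LinearMap.comp_apply, LinearEquiv.coe_coe]
  refine Eq.trans ?_ (h.symm.trans ?_)
  · generalize X.tensorCop t = z
    induction z with
    | zero => simp
    | add a b ha hb => simp only [map_add, ha, hb]
    | tmul x y => simp
  · generalize (LinearMap.rTensor (TensorAlgebra k V) X.tensorCop) (X.tensorCop t) = z
    induction z with
    | zero => simp
    | add a b ha hb => simp only [map_add, ha, hb]
    | tmul x y =>
      induction x with
      | zero => simp
      | add a b ha hb => simp only [map_add, TensorProduct.add_tmul, ha, hb]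
      | tmul x z => simp [TensorProduct.smul_tmul']

/-- The action of `T V^*` on `T V` by braided partial derivatives. -/
def diffOp (X : CrossedData k A V) :
    TensorAlgebra k (Module.Dual k V) →ₐ[k] Module.End k (TensorAlgebra k V) :=
  TensorAlgebra.lift k X.partialD

/-- The pairing `⟨φ, t⟩ = ε(φ(∂) t)` of `T V^*` with `T V`. -/
def diffPairing (X : CrossedData k A V) :
    TensorAlgebra k (Module.Dual k V) →ₗ[k] TensorAlgebra k V →ₗ[k] k :=
  X.diffOp.toLinearMap.compr₂ (ε).toLinearMap

theorem diffPairing_apply (φ : TensorAlgebra k (Module.Dual k V)) (t : TensorAlgebra k V) :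
    X.diffPairing φ t = ε (X.diffOp φ t) := rfl

theorem diffPairing_one (t : TensorAlgebra k V) : X.diffPairing 1 t = ε t := by
  simp [diffPairing_apply]

theorem diffPairing_mul_ι (φ : TensorAlgebra k (Module.Dual k V)) (f : Module.Dual k V)
    (t : TensorAlgebra k V) :
    X.diffPairing (φ * 𝓲 f) t = X.diffPairing φ (X.partialD f t) := by
  simp [diffPairing_apply, diffOp]

/-- Since derivatives commute with the right coaction by Δ, the operator `φ(∂)` is determined by its
composite with the counit, namely by the functional `⟨φ, ·⟩`. -/
theorem diffOp_eq (hX : X.IsYD) (φ : TensorAlgebra k (Module.Dual k V)) (t : TensorAlgebra k V) :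
    X.diffOp φ t = TensorProduct.lid k _ (LinearMap.rTensor _ (X.diffPairing φ)
      (X.tensorCop t)) := by
  induction φ using tensorAlgebra_right_induction generalizing t with
  | one =>
    have h : X.diffPairing 1 = (ε).toLinearMap := by ext1 t; exact diffPairing_one t
    rw [h, tensorCop_counit_left hX]
    simp
  | add a b ha hb => simp [LinearMap.rTensor_add, ha, hb]
  | smul r a ha => simp [LinearMap.rTensor_smul, ha]
  | mul φ f h =>
    have h1 : X.diffPairing (φ * 𝓲 f) = X.diffPairing φ ∘ₗ X.partialD f := by
      ext1 t; exact diffPairing_mul_ι φ f t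
    rw [h1, LinearMap.rTensor_comp, LinearMap.comp_apply, ← tensorCop_partialD hX, ← h]
    simp [diffOp]

theorem diffPairing_mul (hX : X.IsYD) (φ ψ : TensorAlgebra k (Module.Dual k V))
    (t : TensorAlgebra k V) : X.diffPairing (φ * ψ) t = LinearMap.mul' k k
      (TensorProduct.map (X.diffPairing ψ) (X.diffPairing φ) (X.tensorCop t)) := by
  have : X.diffPairing (φ * ψ) t = X.diffPairing φ (X.diffOp ψ t) := by
    simp [diffPairing_apply]
  rw [this, diffOp_eq hX]
  generalize X.tensorCop t = z
  induction z with
  | zero => simp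
  | add a b ha hb => simp only [map_add, ha, hb]
  | tmul x y => simp

/-- `Z` is dual to `X`. -/
structure IsDualOf (Z : CrossedData k A (Module.Dual k V)) (X : CrossedData k A V) : Prop where
  act : ∀ f a v, Z.act f (HopfAlgebra.antipode k a) v = f (X.act v a)
  coact : ∀ f v, TensorProduct.lid k A (LinearMap.rTensor A (Module.Dual.eval k V v) (Z.coact f)) =
    HopfAlgebra.antipode k (TensorProduct.lid k A (LinearMap.rTensor A f (X.coact v)))

variable {Z : CrossedData k A (Module.Dual k V)}

/-- The dual basis coacts through the transpose of `S c`; it is again a comatrix because `S`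
reverses the coproduct. -/
theorem IsDualOf.family (h : Z.IsDualOf X) (hX : X.IsYD) (b : Module.Basis ι k V) :
    IsFamily Z.coact b.coord
      (fun j i => HopfAlgebra.antipode k (coeffMatrix X.coact b i j)) := by
  have hc := (hX.comodule.basis_family b).comatrix
  refine ⟨⟨fun i j => ?_, fun i j => ?_⟩, fun j => ?_⟩
  · rw [hc.comul_antipode]
  · rw [HopfAlgebra.counit_antipode, hc.counit, Matrix.one_apply, Matrix.one_apply]
    simp [eq_comm]
  · have h1 := tensor_eq_sum_basis b.dualBasis (Z.coact (b.coord j))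
    rw [h1]
    refine Finset.sum_congr rfl fun i _ => ?_
    have h2 := h.coact (b.coord j) (b i)
    have h3 : b.dualBasis.coord i = Module.Dual.eval k V (b i) := by
      refine b.dualBasis.ext fun l => ?_
      simp [Finsupp.single_apply]
    rw [h3, h2]
    simp [coeffMatrix]

theorem diffPairing_act (hX : X.IsYD) (hZ : Z.IsYD) (h : Z.IsDualOf X)
    (φ : TensorAlgebra k (Module.Dual k V)) (a : A) (t : TensorAlgebra k V) :
    X.diffPairing (Z.tensorData.act φ (HopfAlgebra.antipode k a)) t =
      X.diffPairing φ (X.tensorData.act t a) := by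
  suffices h : X.diffPairing.flip t ∘ₗ Z.tensorData.act φ ∘ₗ HopfAlgebra.antipode k =
      X.diffPairing φ ∘ₗ X.tensorData.act t by exact congrArg (fun f => f a) h
  refine comatrix_ext fun n c hc i j => ?_
  simp only [LinearMap.comp_apply, LinearMap.flip_apply]
  induction φ using tensorAlgebra_right_induction generalizing t i j with
  | one => simp [tensorData_act_one, diffPairing_one, counit_tensorAct,
      Algebra.algebraMap_eq_smul_one, mul_comm]
  | add a b ha hb => simp only [map_add, LinearMap.add_apply, ha, hb]
  | smul r a ha => simp only [map_smul, LinearMap.smul_apply, ha]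
  | mul φ f ih =>
    have hc' : Z.tensorData.act (φ * 𝓲 f) (HopfAlgebra.antipode k (c i j)) =
        ∑ l, Z.tensorData.act φ (HopfAlgebra.antipode k (c l j)) *
          𝓲 (Z.act f (HopfAlgebra.antipode k (c i l))) := by
      rw [hZ.tensorData_isYDAlg.mul_act, hc.comul_antipode]
      simp [tensorData_act_ι]
    rw [hc', diffPairing_mul_ι, partialD_act hX hc]
    simp only [map_sum, LinearMap.sum_apply, diffPairing_mul_ι, ih]
    refine Finset.sum_congr rfl fun l _ => ?_
    have hf : Z.act f (HopfAlgebra.antipode k (c i l)) = f ∘ₗ X.act.flip (c i l) :=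
      LinearMap.ext fun v => h.act f _ v
    rw [hf]

variable [Module.Finite k V]

theorem diffPairing_coact (hX : X.IsYD) (h : Z.IsDualOf X)
    (φ : TensorAlgebra k (Module.Dual k V)) (t : TensorAlgebra k V) :
    TensorProduct.lid k A (LinearMap.rTensor A (X.diffPairing.flip t) (Z.tensorData.coact φ)) =
      HopfAlgebra.antipode k (TensorProduct.lid k A
        (LinearMap.rTensor A (X.diffPairing φ) (X.tensorData.coact t))) := by
  induction φ using tensorAlgebra_right_induction generalizing t with
  | one =>
    have h : X.diffPairing 1 = (ε).toLinearMap := by ext1 t; exact diffPairing_one t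
    rw [h, counit_tensorCoact hX]
    simp [tensorData_coact_one, diffPairing_one, Algebra.algebraMap_eq_smul_one]
  | add a b ha hb => simp only [map_add, LinearMap.rTensor_add, LinearMap.add_apply, ha, hb]
  | smul r a ha => simp only [map_smul, LinearMap.rTensor_smul, LinearMap.smul_apply, ha]
  | mul φ f ih =>
    let b := Module.finBasis k V
    have hf : f = ∑ i, f (b i) • b.coord i := by
      refine b.ext fun j => ?_
      simp [Finsupp.single_apply]
    rw [hf]
    refine Finset.sum_induction _ (fun f => TensorProduct.lid k A (LinearMap.rTensor A
      (X.diffPairing.flip t) (Z.tensorData.coact (φ * 𝓲 f))) = HopfAlgebra.antipode k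
      (TensorProduct.lid k A (LinearMap.rTensor A (X.diffPairing (φ * 𝓲 f))
        (X.tensorData.coact t)))) (fun a b ha hb => by
          simp only [map_add, mul_add, LinearMap.rTensor_add, LinearMap.add_apply, ha, hb])
      (by simp) fun i _ => ?_
    simp only [map_smul, mul_smul_comm, LinearMap.rTensor_smul, LinearMap.smul_apply]
    congr 1
    have h1 : X.diffPairing (φ * 𝓲 (b.coord i)) = X.diffPairing φ ∘ₗ X.partialD (b.coord i) := by
      refine LinearMap.ext fun t => ?_
      exact diffPairing_mul_ι φ _ t
    have h2 : ∀ (z : TensorAlgebra k (Module.Dual k V) ⊗[k] A) j a, TensorProduct.lid k A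
        (LinearMap.rTensor A (X.diffPairing.flip t) (z * (𝓲 (b.coord j) ⊗ₜ a))) =
        TensorProduct.lid k A (LinearMap.rTensor A (X.diffPairing.flip
          (X.partialD (b.coord j) t)) z) * a := by
      intro z j a
      induction z with
      | zero => simp
      | add x y hx hy => simp only [add_mul, map_add, hx, hy]
      | tmul x y => simp [diffPairing_mul_ι]
    have h3 : ∀ (z : TensorAlgebra k V ⊗[k] A) a, TensorProduct.lid k A (LinearMap.rTensor A
        (X.diffPairing φ) ((1 ⊗ₜ a) * z)) = a * TensorProduct.lid k A (LinearMap.rTensor A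
        (X.diffPairing φ) z) := by
      intro z a
      induction z with
      | zero => simp
      | add x y hx hy => simp only [mul_add, map_add, hx, hy]
      | tmul x y => simp
    rw [tensorData_coact_mul, (family_ι (h.family hX b)).coact, h1, LinearMap.rTensor_comp,
      LinearMap.comp_apply, partialD_coact hX]
    simp only [Finset.mul_sum, map_sum, h2, h3, ih, HopfAlgebra.antipode_mul_antidistrib]

/-- Induction on the last letter of `φ`. The Leibniz rule for the derivative in that letter matches
the coproduct of `φ` times a primitive element; the action on `s` in the former is moved to `φ` by
`diffPairing_act`. -/
theorem diffPairing_mul_right (hX : X.IsYD) (hZ : Z.IsYD) (h : Z.IsDualOf X)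
    (φ : TensorAlgebra k (Module.Dual k V)) (s t : TensorAlgebra k V) :
    X.diffPairing φ (s * t) = LinearMap.mul' k k (TensorProduct.map (X.diffPairing.flip t)
      (X.diffPairing.flip s) (Z.tensorCop φ)) := by
  induction φ using tensorAlgebra_right_induction generalizing s t with
  | one => simp [tensorCop_one, diffPairing_one, mul_comm]
  | add a b ha hb => simp only [map_add, LinearMap.add_apply, ha, hb]
  | smul r a ha => simp only [map_smul, LinearMap.smul_apply, ha]
  | mul φ f ih =>
    let b := Module.finBasis k V
    have hf : f = ∑ i, f (b i) • b.coord i := by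
      refine b.ext fun j => ?_
      simp [Finsupp.single_apply]
    rw [hf]
    refine Finset.sum_induction _ (fun f => X.diffPairing (φ * 𝓲 f) (s * t) = LinearMap.mul' k k
      (TensorProduct.map (X.diffPairing.flip t) (X.diffPairing.flip s)
        (Z.tensorCop (φ * 𝓲 f)))) (fun a b ha hb => by
          simp only [map_add, mul_add, LinearMap.add_apply, ha, hb])
      (by simp) fun i _ => ?_
    simp only [map_smul, mul_smul_comm, LinearMap.smul_apply]
    congr 1
    rw [diffPairing_mul_ι, partialD_mul hX, map_add, map_sum, ih, tensorCop_mul hZ, tensorCop_ι hZ]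
    simp only [ih]
    generalize Z.tensorCop φ = z
    induction z with
    | zero => simp
    | add x y hx hy =>
      simp only [map_add, LinearMap.add_apply, Finset.sum_add_distrib, ← hx, ← hy]
      abel
    | tmul x y =>
      rw [bm_prim_right hZ (h.family hX b)]
      simp only [map_add, map_sum, TensorProduct.map_tmul, LinearMap.mul'_apply,
        LinearMap.flip_apply, diffPairing_mul_ι, diffPairing_act hX hZ h]
      rw [add_comm]

theorem diffPairing_one_right (φ : TensorAlgebra k (Module.Dual k V)) :
    X.diffPairing φ 1 = TensorAlgebra.algebraMapInv φ := by
  induction φ using tensorAlgebra_right_induction with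
  | one => simp [diffPairing_one]
  | add a b ha hb => simp only [map_add, LinearMap.add_apply, ha, hb]
  | smul r a ha => simp only [map_smul, LinearMap.smul_apply, ha]
  | mul φ f _ => simp [diffPairing_mul_ι, partialD_one, TensorAlgebra.algebraMapInv]

/-- The pairing of the tensor algebras of dual crossed modules as a Hopf pairing. -/
def IsDualOf.hopfPairing (h : Z.IsDualOf X) (hX : X.IsYD) (hZ : Z.IsYD) :
    HopfPairing hZ.tensorHopf hX.tensorHopf where
  pair := X.diffPairing
  one_left := diffPairing_one
  one_right := diffPairing_one_right
  mul_left := diffPairing_mul hX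
  mul_right := diffPairing_mul_right hX hZ h
  act := diffPairing_act hX hZ h
  coact := diffPairing_coact hX h

end TensorPairing

end CrossedData

/-! ### Convolution -/

section Convolution

variable {k C E : Type*} [Field k] [AddCommGroup C] [Module k C] [Ring E] [Algebra k E]

/-- Two-sided convolution inverses are unique. -/
theorem eq_of_conv_inverse {Δ : C →ₗ[k] C ⊗[k] C} {e : C →ₗ[k] k}
    (coassoc : ∀ x, TensorProduct.assoc k C C C (LinearMap.rTensor C Δ (Δ x)) =
      LinearMap.lTensor C Δ (Δ x))
    (counit_left : ∀ x, TensorProduct.lid k C (LinearMap.rTensor C e (Δ x)) = x)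
    (counit_right : ∀ x, TensorProduct.rid k C (LinearMap.lTensor C e (Δ x)) = x)
    {F G H : C →ₗ[k] E}
    (hFG : ∀ x, LinearMap.mul' k E (TensorProduct.map F G (Δ x)) = algebraMap k E (e x))
    (hGH : ∀ x, LinearMap.mul' k E (TensorProduct.map G H (Δ x)) = algebraMap k E (e x)) :
    F = H := by
  ext x
  have h1 : LinearMap.mul' k E (TensorProduct.map F (LinearMap.mul' k E ∘ₗ
      TensorProduct.map G H ∘ₗ Δ) (Δ x)) = F x := by
    have h : LinearMap.mul' k E ∘ₗ TensorProduct.map G H ∘ₗ Δ = Algebra.linearMap k E ∘ₗ e :=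
      LinearMap.ext hGH
    rw [h]
    conv_rhs => rw [← counit_right x]
    generalize Δ x = z
    induction z with
    | zero => simp
    | add a b ha hb => simp only [map_add, ha, hb]
    | tmul a b => simp [Algebra.algebraMap_eq_smul_one]
  have h2 : LinearMap.mul' k E (TensorProduct.map (LinearMap.mul' k E ∘ₗ
      TensorProduct.map F G ∘ₗ Δ) H (Δ x)) = H x := by
    have h : LinearMap.mul' k E ∘ₗ TensorProduct.map F G ∘ₗ Δ = Algebra.linearMap k E ∘ₗ e :=
      LinearMap.ext hFG
    rw [h]
    conv_rhs => rw [← counit_left x]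
    generalize Δ x = z
    induction z with
    | zero => simp
    | add a b ha hb => simp only [map_add, ha, hb]
    | tmul a b => simp [Algebra.algebraMap_eq_smul_one]
  rw [← h1, ← h2]
  have h3 := congrArg (LinearMap.mul' k E ∘ₗ TensorProduct.map F (LinearMap.mul' k E ∘ₗ
      TensorProduct.map G H)) (coassoc x)
  refine Eq.trans ?_ (h3.symm.trans ?_)
  · generalize Δ x = z
    induction z with
    | zero => simp
    | add a b ha hb => simp only [map_add, ha, hb]
    | tmul a b => simp
  · generalize Δ x = z
    induction z with
    | zero => simp
    | add a b ha hb => simp only [map_add, ha, hb]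
    | tmul a b =>
      simp only [LinearMap.rTensor_tmul, TensorProduct.map_tmul, LinearMap.comp_apply,
        LinearMap.mul'_apply]
      generalize Δ a = y
      induction y with
      | zero => simp
      | add a b ha hb => simp only [map_add, TensorProduct.add_tmul, ha, hb, add_mul]
      | tmul a b => simp [mul_assoc]

end Convolution

/-! ### Contractions of the coproduct and the actions defined by a Hopf pairing -/

section Contract

variable {k A C : Type*} [Field k] [Ring A] [HopfAlgebra k A] [Ring C] [Algebra k C]

/-- The contraction `x ↦ α(x₁) x₂` with a functional `α`. -/
def BraidedHopf.contract (H : BraidedHopf k A C) : (C →ₗ[k] k) →ₗ[k] Module.End k C :=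
  LinearMap.mk₂ k (fun α x => TensorProduct.lid k C (LinearMap.rTensor C α (H.cop x)))
    (by simp [LinearMap.rTensor_add]) (by simp [LinearMap.rTensor_smul]) (by simp) (by simp)

variable {H : BraidedHopf k A C}

theorem BraidedHopf.contract_apply (α : C →ₗ[k] k) (x : C) :
    H.contract α x = TensorProduct.lid k C (LinearMap.rTensor C α (H.cop x)) := rfl

theorem BraidedHopf.contract_contract (α β : C →ₗ[k] k) (x : C) :
    H.contract β (H.contract α x) =
      H.contract (LinearMap.mul' k k ∘ₗ TensorProduct.map α β ∘ₗ H.cop) x := by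
  have h := congrArg (fun z => TensorProduct.lid k C (LinearMap.rTensor C (LinearMap.mul' k k ∘ₗ
    TensorProduct.map α β) ((TensorProduct.assoc k C C C).symm z))) (H.coassoc x)
  simp only [LinearEquiv.symm_apply_apply] at h
  simp only [contract_apply]
  rw [← LinearMap.rTensor_comp_apply, LinearMap.comp_assoc] at h
  rw [h]
  generalize H.cop x = z
  induction z with
  | zero => simp
  | add a b ha hb => simp only [map_add, ha, hb]
  | tmul a b =>
    simp only [LinearMap.rTensor_tmul, TensorProduct.lid_tmul, map_smul, LinearMap.lTensor_tmul]
    generalize H.cop b = y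
    induction y with
    | zero => simp
    | add a b ha hb => simp only [map_add, TensorProduct.tmul_add, ha, hb, smul_add]
    | tmul c d => simp [smul_smul]

theorem BraidedHopf.counit_contract (α : C →ₗ[k] k) (x : C) :
    H.counit (H.contract α x) = α x := by
  conv_rhs => rw [← H.counit_right x]
  rw [contract_apply]
  generalize H.cop x = z
  induction z with
  | zero => simp
  | add a b ha hb => simp only [map_add, ha, hb]
  | tmul a b => simp [mul_comm]

theorem BraidedHopf.contract_counit (x : C) : H.contract H.counit x = x := H.counit_left x

end Contract

namespace HopfPairing

variable {k A C D : Type*} [Field k] [Ring A] [HopfAlgebra k A] [Ring C] [Algebra k C] [Ring D]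
  [Algebra k D] {H' : BraidedHopf k A D} {H : BraidedHopf k A C} (P : HopfPairing H' H)

/-- The action `φ ▷ t = ⟨φ, t₁⟩ t₂`. -/
def leftOp : D →ₐ[k] Module.End k C :=
  AlgHom.ofLinearMap (H.contract ∘ₗ P.pair)
    (LinearMap.ext fun t => by
      have h : P.pair 1 = H.counit := LinearMap.ext P.one_left
      simp [h, BraidedHopf.contract_counit])
    (fun φ ψ => LinearMap.ext fun t => by
      have h : P.pair (φ * ψ) = LinearMap.mul' k k ∘ₗ
          TensorProduct.map (P.pair ψ) (P.pair φ) ∘ₗ H.cop := LinearMap.ext (P.mul_left φ ψ)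
      simp [h, BraidedHopf.contract_contract])

/-- The action `t ▷ φ = ⟨φ₁, t⟩ φ₂`. -/
def rightOp : C →ₐ[k] Module.End k D :=
  AlgHom.ofLinearMap (H'.contract ∘ₗ P.pair.flip)
    (LinearMap.ext fun t => by
      have h : P.pair.flip 1 = H'.counit := LinearMap.ext P.one_right
      simp [h, BraidedHopf.contract_counit])
    (fun s t => LinearMap.ext fun φ => by
      have h : P.pair.flip (s * t) = LinearMap.mul' k k ∘ₗ
          TensorProduct.map (P.pair.flip t) (P.pair.flip s) ∘ₗ H'.cop :=
        LinearMap.ext fun φ => P.mul_right φ s t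
      simp [h, BraidedHopf.contract_contract])

theorem leftOp_apply (φ : D) (t : C) : P.leftOp φ t = H.contract (P.pair φ) t := rfl

theorem rightOp_apply (φ : D) (t : C) : P.rightOp t φ = H'.contract (P.pair.flip t) φ := rfl

theorem counit_leftOp (φ : D) (t : C) : H.counit (P.leftOp φ t) = P.pair φ t :=
  H.counit_contract _ _

theorem counit_rightOp (φ : D) (t : C) : H'.counit (P.rightOp t φ) = P.pair φ t :=
  H'.counit_contract _ _

theorem pair_leftOp (φ ψ : D) (t : C) : P.pair φ (P.leftOp ψ t) = P.pair (φ * ψ) t := by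
  rw [← counit_leftOp, ← counit_leftOp, map_mul]
  rfl

/-- The right radical is the kernel of an algebra homomorphism, hence a two-sided ideal. This is why
killing the kernels of the braided factorials creates no further relations. -/
theorem rightOp_eq_zero {t : C} : P.rightOp t = 0 ↔ ∀ φ, P.pair φ t = 0 := by
  refine ⟨fun h φ => ?_, fun h => ?_⟩
  · rw [← counit_rightOp, h]
    simp
  · have : P.pair.flip t = 0 := LinearMap.ext h
    ext t
    rw [rightOp_apply, this]
    simp

/-- Uniqueness of convolution inverses in `Hom(D, End C)`: contraction with `⟨φ, S ·⟩` is a left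
inverse of `leftOp`, and `φ ↦ leftOp (S φ)` a right inverse. Applying the counit returns to
functionals. -/
theorem anti (φ : D) (t : C) : P.pair (H'.anti φ) t = P.pair φ (H.anti t) := by
  let M : D →ₗ[k] Module.End k C := H.contract ∘ₗ (P.pair.compl₂ H.anti)
  have h : M = P.leftOp.toLinearMap ∘ₗ H'.anti := by
    refine eq_of_conv_inverse H'.coassoc H'.counit_left H'.counit_right
      (G := P.leftOp.toLinearMap) (fun φ => LinearMap.ext fun t => ?_) (fun φ => ?_)
    -- Successive contractions give contraction with a convolution of functionals. Summed over `Δ φ`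
    -- this functional is `x ⊗ y ↦ ⟨φ, x S(y)⟩`, which collapses on a coproduct by the right
    -- antipode axiom of `H`.
    · obtain ⟨F, hF⟩ := TensorProduct.exists_finset (H'.cop φ)
      have h1 : ∀ χ ψ, M χ (P.leftOp ψ t) = H.contract
          (LinearMap.mul' k k ∘ₗ TensorProduct.map (P.pair ψ) (P.pair χ ∘ₗ H.anti) ∘ₗ H.cop) t :=
        fun χ ψ => H.contract_contract (P.pair ψ) (P.pair χ ∘ₗ H.anti) t
      have h2 : ∑ i ∈ F, LinearMap.mul' k k ∘ₗ
          TensorProduct.map (P.pair i.2) (P.pair i.1 ∘ₗ H.anti) =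
          P.pair φ ∘ₗ LinearMap.mul' k C ∘ₗ TensorProduct.map LinearMap.id H.anti := by
        refine TensorProduct.ext' fun x y => ?_
        simp [P.mul_right, hF, mul_comm]
      have h3 : P.pair φ ∘ₗ LinearMap.mul' k C ∘ₗ TensorProduct.map LinearMap.id H.anti ∘ₗ H.cop =
          H'.counit φ • H.counit := by
        ext x
        simp [H.anti_right, Algebra.algebraMap_eq_smul_one, P.one_right, mul_comm]
      rw [hF]
      simp only [map_sum, TensorProduct.map_tmul, LinearMap.mul'_apply, LinearMap.sum_apply,
        Module.End.mul_apply, AlgHom.toLinearMap_apply, h1]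
      have h4 : ∑ i ∈ F, LinearMap.mul' k k ∘ₗ TensorProduct.map (P.pair i.2)
          (P.pair i.1 ∘ₗ H.anti) ∘ₗ H.cop = H'.counit φ • H.counit := by
        rw [← h3]
        ext x
        have := congrArg (fun f => f (H.cop x)) h2
        simpa [LinearMap.sum_apply] using this
      rw [← LinearMap.sum_apply, ← map_sum, h4, map_smul, LinearMap.smul_apply,
        BraidedHopf.contract_counit]
      simp [Algebra.algebraMap_eq_smul_one]
    · have := congrArg P.leftOp (H'.anti_right φ)
      rw [AlgHom.commutes] at this
      rw [← this]
      generalize H'.cop φ = z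
      induction z with
      | zero => simp
      | add a b ha hb => simp only [map_add, ha, hb]
      | tmul a b => simp
  have h2 := congrArg (fun f => H.counit (f φ t)) h
  simp only [LinearMap.comp_apply, AlgHom.toLinearMap_apply, counit_leftOp] at h2
  rw [← h2]
  exact H.counit_contract _ _

end HopfPairing

/-! ### Quotients of braided Hopf algebras -/

namespace BraidedHopf

variable {k A T C : Type*} [Field k] [Ring A] [HopfAlgebra k A] [Ring T] [Algebra k T] [Ring C]
  [Algebra k C]

/-- The data of a braided Hopf algebra that are compatible with those of `H` under the
homomorphism `π`. -/
structure IsQuotient (H : BraidedHopf k A T) (π : T →ₐ[k] C) (X : CrossedData k A C)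
    (cop : C →ₗ[k] C ⊗[k] C) (counit : C →ₗ[k] k) (anti : C →ₗ[k] C) : Prop where
  surj : Function.Surjective π
  act : ∀ t a, X.act (π t) a = π (H.X.act t a)
  coact : ∀ t, X.coact (π t) = LinearMap.rTensor A π.toLinearMap (H.X.coact t)
  cop : ∀ t, cop (π t) = TensorProduct.map π.toLinearMap π.toLinearMap (H.cop t)
  counit : ∀ t, counit (π t) = H.counit t
  anti : ∀ t, anti (π t) = π (H.anti t)

variable {H : BraidedHopf k A T} {π : T →ₐ[k] C} {X : CrossedData k A C}
    {cop : C →ₗ[k] C ⊗[k] C} {counit : C →ₗ[k] k} {anti : C →ₗ[k] C}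

theorem IsQuotient.isYD (h : IsQuotient H π X cop counit anti) : X.IsYD where
  act_one v := by
    obtain ⟨t, rfl⟩ := h.surj v
    rw [h.act, H.ydAlg.act_one]
  act_mul v a b := by
    obtain ⟨t, rfl⟩ := h.surj v
    simp only [h.act, H.ydAlg.act_mul]
  comodule := by
    refine ⟨fun v => ?_, fun v => ?_⟩
    · obtain ⟨t, rfl⟩ := h.surj v
      rw [h.coact]
      conv_rhs => rw [← H.ydAlg.comodule.counit t]
      generalize H.X.coact t = z
      induction z with
      | zero => simp
      | add a b ha hb => simp only [map_add, ha, hb]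
      | tmul a b => simp
    · obtain ⟨t, rfl⟩ := h.surj v
      have h1 := congrArg (LinearMap.rTensor (A ⊗[k] A) π.toLinearMap)
        (H.ydAlg.comodule.coassoc t)
      rw [h.coact]
      refine Eq.trans ?_ (h1.trans ?_)
      · generalize H.X.coact t = z
        induction z with
        | zero => simp
        | add a b ha hb => simp only [map_add, ha, hb]
        | tmul a b =>
          simp only [LinearMap.rTensor_tmul, AlgHom.toLinearMap_apply, h.coact]
          generalize H.X.coact a = z
          induction z with
          | zero => simp
          | add a b ha hb => simp only [map_add, TensorProduct.add_tmul, ha, hb]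
          | tmul a b => simp
      · generalize H.X.coact t = z
        induction z with
        | zero => simp
        | add a b ha hb => simp only [map_add, ha, hb]
        | tmul a b => simp
  yd v a := by
    obtain ⟨t, rfl⟩ := h.surj v
    have h1 := congrArg (LinearMap.rTensor A π.toLinearMap) (H.ydAlg.yd t a)
    refine Eq.trans ?_ (h1.trans ?_)
    · generalize Coalgebra.comul (R := k) a = z
      induction z with
      | zero => simp
      | add a b ha hb => simp only [map_add, ha, hb]
      | tmul a b =>
        simp only [CrossedData.coactAct, LinearMap.mk₂_apply, LinearMap.lTensor_tmul,
          LinearMap.comp_apply, h.act, h.coact, TensorProduct.lift.tmul,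
          LinearMap.coe_lTensorHom, ← LinearMap.rTensor_comp_lTensor, ← LinearMap.lTensor_comp_rTensor]
        generalize H.X.coact _ = z
        induction z with
        | zero => simp
        | add a b ha hb => simp only [map_add, ha, hb]
        | tmul a b => simp
    · rw [h.coact]
      generalize Coalgebra.comul (R := k) a = w
      generalize H.X.coact t = z
      induction z with
      | zero => simp
      | add a b ha hb => simp only [map_add, LinearMap.add_apply, ha, hb]
      | tmul a b =>
        induction w with
        | zero => simp
        | add a b ha hb => simp only [map_add, ha, hb]
        | tmul c d =>
          simp [CrossedData.actTensor, TensorProduct.homTensorHomMap_apply, h.act]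

theorem IsQuotient.isYDAlg (h : IsQuotient H π X cop counit anti) : X.IsYDAlg where
  toIsYD := h.isYD
  one_act a := by
    rw [← map_one π, h.act, H.ydAlg.one_act, AlgHom.commutes]
  mul_act x y a := by
    obtain ⟨s, rfl⟩ := h.surj x
    obtain ⟨t, rfl⟩ := h.surj y
    rw [← map_mul, h.act, H.ydAlg.mul_act]
    generalize Coalgebra.comul (R := k) a = z
    induction z with
    | zero => simp
    | add a b ha hb => simp only [map_add, ha, hb]
    | tmul a b => simp [h.act]
  coact_one := by
    rw [← map_one π, h.coact, H.ydAlg.coact_one]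
    simp
  coact_mul x y := by
    obtain ⟨s, rfl⟩ := h.surj x
    obtain ⟨t, rfl⟩ := h.surj y
    rw [← map_mul, h.coact, H.ydAlg.coact_mul, h.coact, h.coact]
    generalize H.X.coact s = z
    generalize H.X.coact t = w
    induction z with
    | zero => simp
    | add a b ha hb => simp only [map_add, add_mul, ha, hb]
    | tmul a b =>
      induction w with
      | zero => simp
      | add a b ha hb => simp only [map_add, mul_add, ha, hb]
      | tmul c d => simp

theorem IsQuotient.bm (h : IsQuotient H π X cop counit anti) (z w : T ⊗[k] T) :
    X.bm (TensorProduct.map π.toLinearMap π.toLinearMap z)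
      (TensorProduct.map π.toLinearMap π.toLinearMap w) =
    TensorProduct.map π.toLinearMap π.toLinearMap (H.X.bm z w) := by
  induction z with
  | zero => simp
  | add a b ha hb => simp only [map_add, LinearMap.add_apply, ha, hb]
  | tmul a b =>
    induction w with
    | zero => simp
    | add a b ha hb => simp only [map_add, ha, hb]
    | tmul c d =>
      simp only [TensorProduct.map_tmul, AlgHom.toLinearMap_apply, CrossedData.bm_tmul_tmul,
        h.coact]
      generalize H.X.coact c = z
      induction z with
      | zero => simp
      | add a b ha hb => simp only [map_add, ha, hb]
      | tmul x y => simp [CrossedData.bmAux, h.act]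

/-- The quotient of a braided Hopf algebra. -/
def quotient (H : BraidedHopf k A T) (π : T →ₐ[k] C) (X : CrossedData k A C)
    (cop : C →ₗ[k] C ⊗[k] C) (counit : C →ₗ[k] k) (anti : C →ₗ[k] C)
    (h : IsQuotient H π X cop counit anti) : BraidedHopf k A C where
  X := X
  cop := cop
  counit := counit
  anti := anti
  ydAlg := h.isYDAlg
  cop_one := by
    rw [← map_one π, h.cop, H.cop_one]
    simp
  cop_mul x y := by
    obtain ⟨s, rfl⟩ := h.surj x
    obtain ⟨t, rfl⟩ := h.surj y
    rw [← map_mul, h.cop, H.cop_mul, h.cop, h.cop, h.bm]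
  coassoc x := by
    obtain ⟨t, rfl⟩ := h.surj x
    have h1 := congrArg (TensorProduct.map π.toLinearMap
      (TensorProduct.map π.toLinearMap π.toLinearMap)) (H.coassoc t)
    rw [h.cop]
    refine Eq.trans ?_ (h1.trans ?_)
    · generalize H.cop t = z
      induction z with
      | zero => simp
      | add a b ha hb => simp only [map_add, ha, hb]
      | tmul a b =>
        simp only [TensorProduct.map_tmul, LinearMap.rTensor_tmul, AlgHom.toLinearMap_apply, h.cop]
        generalize H.cop a = z
        induction z with
        | zero => simp
        | add a b ha hb => simp only [map_add, TensorProduct.add_tmul, ha, hb]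
        | tmul a b => simp
    · generalize H.cop t = z
      induction z with
      | zero => simp
      | add a b ha hb => simp only [map_add, ha, hb]
      | tmul a b => simp [h.cop]
  counit_left x := by
    obtain ⟨t, rfl⟩ := h.surj x
    conv_rhs => rw [← H.counit_left t]
    rw [h.cop]
    generalize H.cop t = z
    induction z with
    | zero => simp
    | add a b ha hb => simp only [map_add, ha, hb]
    | tmul a b => simp [h.counit]
  counit_right x := by
    obtain ⟨t, rfl⟩ := h.surj x
    conv_rhs => rw [← H.counit_right t]
    rw [h.cop]
    generalize H.cop t = z
    induction z with
    | zero => simp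
    | add a b ha hb => simp only [map_add, ha, hb]
    | tmul a b => simp [h.counit]
  cop_act x a := by
    obtain ⟨t, rfl⟩ := h.surj x
    rw [h.act, h.cop, H.cop_act, h.cop]
    simp only [CrossedData.actTwo, LinearMap.compl₂_apply]
    generalize Coalgebra.comul (R := k) a = w
    generalize H.cop t = z
    induction z with
    | zero => simp
    | add a b ha hb => simp only [map_add, LinearMap.add_apply, ha, hb]
    | tmul a b =>
      induction w with
      | zero => simp
      | add a b ha hb => simp only [map_add, ha, hb]
      | tmul c d => simp [TensorProduct.homTensorHomMap_apply, h.act]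
  cop_coact x := by
    obtain ⟨t, rfl⟩ := h.surj x
    have h1 := congrArg (LinearMap.rTensor A (TensorProduct.map π.toLinearMap π.toLinearMap))
      (H.cop_coact t)
    rw [h.cop, h.coact]
    refine Eq.trans ?_ (h1.trans ?_)
    · generalize H.cop t = z
      induction z with
      | zero => simp
      | add a b ha hb => simp only [map_add, ha, hb]
      | tmul a b =>
        simp only [CrossedData.coactTwo, LinearMap.comp_apply, TensorProduct.map_tmul,
          AlgHom.toLinearMap_apply, h.coact]
        generalize H.X.coact a = z
        generalize H.X.coact b = w
        induction z with
        | zero => simp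
        | add a b ha hb => simp only [map_add, TensorProduct.add_tmul, ha, hb]
        | tmul a b =>
          induction w with
          | zero => simp
          | add a b ha hb => simp only [map_add, TensorProduct.tmul_add, ha, hb]
          | tmul c d => simp
    · generalize H.X.coact t = z
      induction z with
      | zero => simp
      | add a b ha hb => simp only [map_add, ha, hb]
      | tmul a b => simp [h.cop]
  anti_one := by
    rw [← map_one π, h.anti, H.anti_one]
  anti_mul x y := by
    obtain ⟨s, rfl⟩ := h.surj x
    obtain ⟨t, rfl⟩ := h.surj y
    rw [← map_mul, h.anti, H.anti_mul, h.coact]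
    generalize H.X.coact t = z
    induction z with
    | zero => simp
    | add a b ha hb => simp only [map_add, ha, hb]
    | tmul a b => simp [h.anti, h.act]
  anti_act x a := by
    obtain ⟨t, rfl⟩ := h.surj x
    simp only [h.act, h.anti, H.anti_act]
  anti_coact x := by
    obtain ⟨t, rfl⟩ := h.surj x
    rw [h.anti, h.coact, H.anti_coact, h.coact]
    generalize H.X.coact t = z
    induction z with
    | zero => simp
    | add a b ha hb => simp only [map_add, ha, hb]
    | tmul a b => simp [h.anti]
  anti_left x := by
    obtain ⟨t, rfl⟩ := h.surj x
    rw [h.counit, ← AlgHom.commutes π, ← H.anti_left, h.cop]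
    generalize H.cop t = z
    induction z with
    | zero => simp
    | add a b ha hb => simp only [map_add, ha, hb]
    | tmul a b => simp [h.anti]
  anti_right x := by
    obtain ⟨t, rfl⟩ := h.surj x
    rw [h.counit, ← AlgHom.commutes π, ← H.anti_right, h.cop]
    generalize H.cop t = z
    induction z with
    | zero => simp
    | add a b ha hb => simp only [map_add, ha, hb]
    | tmul a b => simp [h.anti]

end BraidedHopf

/-! ### Separation -/

section Separation

variable {k M N P : Type*} [Field k] [AddCommGroup M] [Module k M] [AddCommGroup N] [Module k N]
  [AddCommGroup P] [Module k P]

/-- A tensor vanishes if its contractions with a separating space of functionals vanish. -/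
theorem tensor_eq_zero_of_separating (β : P →ₗ[k] M →ₗ[k] k)
    (hβ : ∀ m, (∀ p, β p m = 0) → m = 0) (z : M ⊗[k] N)
    (hz : ∀ p, TensorProduct.lid k N (LinearMap.rTensor N (β p) z) = 0) : z = 0 := by
  classical
  let b := Module.Basis.ofVectorSpace k N
  refine (TensorProduct.equivFinsuppOfBasisRight b (M := M)).injective ?_
  rw [map_zero]
  ext i
  refine hβ _ fun p => ?_
  have h1 := congrArg (b.coord i) (hz p)
  rw [map_zero] at h1
  rw [← h1]
  clear h1 hz
  induction z with
  | zero => simp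
  | add x y hx hy => simp only [map_add, Finsupp.add_apply, hx, hy]
  | tmul x y => simp [mul_comm]

end Separation

/-! ### Quotients by the radicals of a pairing -/

namespace HopfPairing

variable {k A T T' C D : Type*} [Field k] [Ring A] [HopfAlgebra k A] [Ring T] [Algebra k T]
  [Ring T'] [Algebra k T'] [Ring C] [Algebra k C] [Ring D] [Algebra k D]
  {H' : BraidedHopf k A T'} {H : BraidedHopf k A T} (P : HopfPairing H' H)

/-- Maps on the quotient are defined through a linear choice of representatives; vanishing on the
kernel makes the choice irrelevant. -/
theorem eq_of_section {M N E : Type*} [AddCommGroup M] [Module k M] [AddCommGroup N] [Module k N]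
    [AddCommGroup E] [Module k E] {π : M →ₗ[k] N} {σ : N →ₗ[k] M} (hσ : ∀ c, π (σ c) = c)
    {φ : M →ₗ[k] E} (hφ : ∀ t, π t = 0 → φ t = 0) (t : M) : φ (σ (π t)) = φ t := by
  rw [← sub_eq_zero, ← map_sub]
  refine hφ _ ?_
  rw [map_sub, hσ, sub_self]

/-- If the kernel of `π` is the radical of `β`, the functionals of `β` separate the points of the
quotient, so a tensor dies in the quotient as soon as all its slices vanish. -/
theorem map_eq_zero_of_separating {M N B : Type*} [AddCommGroup M] [Module k M] [AddCommGroup N]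
    [Module k N] [AddCommGroup B] [Module k B] {π : M →ₗ[k] N} {σ : N →ₗ[k] M}
    (hσ : ∀ c, π (σ c) = c) {E : Type*} [AddCommGroup E] [Module k E]
    (β : B →ₗ[k] M →ₗ[k] k) (hker : ∀ t, π t = 0 ↔ ∀ φ, β φ t = 0) (z : M ⊗[k] E)
    (hz : ∀ φ, TensorProduct.lid k E (LinearMap.rTensor E (β φ) z) = 0) :
    LinearMap.rTensor E π z = 0 := by
  refine tensor_eq_zero_of_separating (β.compl₂ σ) (fun m hm => ?_) _ fun φ => ?_
  · rw [← hσ m, hker]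
    exact hm
  · rw [← LinearMap.rTensor_comp_apply, ← hz φ]
    congr 2
    refine congrArg _ (LinearMap.ext fun t => ?_)
    exact eq_of_section hσ (fun t ht => (hker t).1 ht φ) t

theorem map_map_eq_zero_of_separating {M N B : Type*} [AddCommGroup M] [Module k M]
    [AddCommGroup N] [Module k N] [AddCommGroup B] [Module k B] {π : M →ₗ[k] N} {σ : N →ₗ[k] M}
    (hσ : ∀ c, π (σ c) = c) (β : B →ₗ[k] M →ₗ[k] k) (hker : ∀ t, π t = 0 ↔ ∀ φ, β φ t = 0)
    (z : M ⊗[k] M)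
    (hz : ∀ φ ψ, LinearMap.mul' k k (TensorProduct.map (β φ) (β ψ) z) = 0) :
    TensorProduct.map π π z = 0 := by
  rw [← LinearMap.rTensor_comp_lTensor, LinearMap.comp_apply]
  refine map_eq_zero_of_separating hσ β hker _ fun φ => ?_
  have h : TensorProduct.lid k N (LinearMap.rTensor N (β φ) (LinearMap.lTensor M π z)) =
      π (TensorProduct.lid k M (LinearMap.rTensor M (β φ) z)) := by
    clear hz
    induction z with
    | zero => simp
    | add a b ha hb => simp only [map_add, ha, hb]
    | tmul a b => simp
  rw [h, hker]
  intro ψ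
  rw [← hz φ ψ]
  clear hz h
  induction z with
  | zero => simp
  | add a b ha hb => simp only [map_add, ha, hb]
  | tmul a b => simp

/-- The pairing converts each structure map of `H` into one of `H'`, so each preserves the right
radical: the coproduct is adjoint to the product, the antipode to the antipode, the action and the
coaction to those of the dual up to `S`. -/
theorem isQuotient_right (hS : Function.Injective (HopfAlgebra.antipode k (A := A)))
    (π : T →ₐ[k] C) (σ : C →ₗ[k] T) (hσ : ∀ c, π (σ c) = c)
    (hker : ∀ t, π t = 0 ↔ ∀ φ, P.pair φ t = 0) :
    BraidedHopf.IsQuotient H π ⟨H.X.act.compr₂ π.toLinearMap ∘ₗ σ,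
      LinearMap.rTensor A π.toLinearMap ∘ₗ H.X.coact ∘ₗ σ⟩
      (TensorProduct.map π.toLinearMap π.toLinearMap ∘ₗ H.cop ∘ₗ σ) (H.counit ∘ₗ σ)
      (π.toLinearMap ∘ₗ H.anti ∘ₗ σ) where
  surj c := ⟨σ c, hσ c⟩
  act t a := by
    refine eq_of_section (π := π.toLinearMap) hσ
      (φ := (H.X.act.compr₂ π.toLinearMap).flip a) (fun t ht => ?_) t
    simp only [LinearMap.flip_apply, LinearMap.compr₂_apply, AlgHom.toLinearMap_apply]
    rw [hker]
    intro φ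
    rw [← P.act, (hker t).1 ht]
  coact t := by
    refine eq_of_section (π := π.toLinearMap) hσ
      (φ := LinearMap.rTensor A π.toLinearMap ∘ₗ H.X.coact) (fun t ht => ?_) t
    refine map_eq_zero_of_separating (π := π.toLinearMap) hσ P.pair hker _ fun φ => ?_
    -- The adjunction for coactions carries the antipode of `A`, so injectivity of `S` is what
    -- allows slices to be recovered from it.
    apply hS
    rw [← P.coact, map_zero]
    have h : P.pair.flip t = 0 := LinearMap.ext fun φ => (hker t).1 ht φ
    simp [h]
  cop t := by
    refine eq_of_section (π := π.toLinearMap) hσ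
      (φ := TensorProduct.map π.toLinearMap π.toLinearMap ∘ₗ H.cop) (fun t ht => ?_) t
    refine map_map_eq_zero_of_separating (π := π.toLinearMap) hσ P.pair hker _ fun φ ψ => ?_
    rw [← P.mul_left, (hker t).1 ht]
  counit t := by
    refine eq_of_section (π := π.toLinearMap) hσ (φ := H.counit) (fun t ht => ?_) t
    rw [← P.one_left, (hker t).1 ht]
  anti t := by
    refine eq_of_section (π := π.toLinearMap) hσ (φ := π.toLinearMap ∘ₗ H.anti) (fun t ht => ?_) t
    simp only [LinearMap.comp_apply, AlgHom.toLinearMap_apply]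
    rw [hker]
    intro φ
    rw [← P.anti, (hker t).1 ht]

/-- The pairing of the quotients. -/
def quotient {π' : T' →ₐ[k] D} {π : T →ₐ[k] C} {X : CrossedData k A C}
    {cop : C →ₗ[k] C ⊗[k] C} {counit : C →ₗ[k] k} {anti : C →ₗ[k] C} {X' : CrossedData k A D}
    {cop' : D →ₗ[k] D ⊗[k] D} {counit' : D →ₗ[k] k} {anti' : D →ₗ[k] D}
    (h : BraidedHopf.IsQuotient H π X cop counit anti)
    (h' : BraidedHopf.IsQuotient H' π' X' cop' counit' anti')
    (pair : D →ₗ[k] C →ₗ[k] k) (hp : ∀ φ t, pair (π' φ) (π t) = P.pair φ t) :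
    HopfPairing (H'.quotient π' X' cop' counit' anti' h')
      (H.quotient π X cop counit anti h) where
  pair := pair
  one_left x := by
    obtain ⟨t, rfl⟩ := h.surj x
    rw [← map_one π', hp, P.one_left]
    exact (h.counit t).symm
  one_right x := by
    obtain ⟨φ, rfl⟩ := h'.surj x
    rw [← map_one π, hp, P.one_right]
    exact (h'.counit φ).symm
  mul_left x y z := by
    obtain ⟨φ, rfl⟩ := h'.surj x
    obtain ⟨ψ, rfl⟩ := h'.surj y
    obtain ⟨t, rfl⟩ := h.surj z
    have h1 : ∀ φ, pair (π' φ) ∘ₗ π.toLinearMap = P.pair φ := fun φ => LinearMap.ext (hp φ)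
    change _ = LinearMap.mul' k k (TensorProduct.map _ _ (cop (π t)))
    rw [← map_mul, hp, P.mul_left, h.cop, TensorProduct.map_map, h1, h1]
  mul_right x y z := by
    obtain ⟨φ, rfl⟩ := h'.surj x
    obtain ⟨s, rfl⟩ := h.surj y
    obtain ⟨t, rfl⟩ := h.surj z
    have h1 : ∀ t, pair.flip (π t) ∘ₗ π'.toLinearMap = P.pair.flip t :=
      fun t => LinearMap.ext fun φ => hp φ t
    change _ = LinearMap.mul' k k (TensorProduct.map _ _ (cop' (π' φ)))
    rw [← map_mul, hp, P.mul_right, h'.cop, TensorProduct.map_map, h1, h1]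
  act x a y := by
    obtain ⟨φ, rfl⟩ := h'.surj x
    obtain ⟨t, rfl⟩ := h.surj y
    change pair (X'.act _ _) _ = pair _ (X.act _ _)
    rw [h'.act, h.act, hp, hp, P.act]
  coact x y := by
    obtain ⟨φ, rfl⟩ := h'.surj x
    obtain ⟨t, rfl⟩ := h.surj y
    have h1 : ∀ φ, pair (π' φ) ∘ₗ π.toLinearMap = P.pair φ := fun φ => LinearMap.ext (hp φ)
    have h2 : ∀ t, pair.flip (π t) ∘ₗ π'.toLinearMap = P.pair.flip t :=
      fun t => LinearMap.ext fun φ => hp φ t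
    change TensorProduct.lid k A (LinearMap.rTensor A _ (X'.coact _)) =
      HopfAlgebra.antipode k (TensorProduct.lid k A (LinearMap.rTensor A _ (X.coact _)))
    rw [h'.coact, h.coact, ← LinearMap.rTensor_comp_apply, ← LinearMap.rTensor_comp_apply, h1, h2,
      P.coact]

end HopfPairing

/-! ### Tensor powers -/

section TensorPowers

variable {k V : Type*} [Field k] [AddCommGroup V] [Module k V]

local notation "𝓲" => TensorAlgebra.ι k
local notation "ε" => TensorAlgebra.algebraMapInv (R := k) (M := V)

theorem consEquiv_tmul_tprod (m : ℕ) (v : V) (w : Fin m → V) :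
    consEquiv k V m (v ⊗ₜ PiTensorProduct.tprod k w) =
      PiTensorProduct.tprod k (Fin.cons v w : Fin (m + 1) → V) := by
  have h := TensorPower.tprod_mul_tprod k (fun _ : Fin 1 => v) w
  simp only [consEquiv, LinearEquiv.trans_apply, TensorProduct.congr_tmul,
    LinearEquiv.refl_apply]
  rw [PiTensorProduct.subsingletonEquiv_symm_apply']
  rw [TensorPower.gMul_def] at h
  rw [h, TensorPower.cast_tprod, Fin.append_left_eq_cons]
  congr 1

theorem toTensorAlgebra_consEquiv (m : ℕ) (v : V) (w : ⨂[k]^m V) :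
    TensorPower.toTensorAlgebra (consEquiv k V m (v ⊗ₜ w)) =
      𝓲 v * TensorPower.toTensorAlgebra w := by
  induction w using PiTensorProduct.induction_on with
  | smul_tprod r w =>
    rw [TensorProduct.tmul_smul, map_smul, map_smul, consEquiv_tmul_tprod, map_smul,
      mul_smul_comm]
    simp [TensorPower.toTensorAlgebra_tprod, TensorAlgebra.tprod_apply, List.ofFn_succ]
  | add a b ha hb => simp only [TensorProduct.tmul_add, map_add, ha, hb, mul_add]

theorem tensorPower_succ_induction {m : ℕ} {p : ⨂[k]^(m + 1) V → Prop} (zero : p 0)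
    (add : ∀ a b, p a → p b → p (a + b)) (cons : ∀ v w, p (consEquiv k V m (v ⊗ₜ w)))
    (w : ⨂[k]^(m + 1) V) : p w := by
  rw [← (consEquiv k V m).apply_symm_apply w]
  generalize (consEquiv k V m).symm w = z
  induction z with
  | zero => simpa using zero
  | add a b ha hb => rw [map_add]; exact add _ _ ha hb
  | tmul v w => exact cons v w

theorem counit_toTensorAlgebra_succ {m : ℕ} (w : ⨂[k]^(m + 1) V) :
    ε (TensorPower.toTensorAlgebra w) = 0 := by
  induction w using tensorPower_succ_induction with
  | zero => simp
  | add a b ha hb => simp only [map_add, ha, hb, add_zero]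
  | cons v w => rw [toTensorAlgebra_consEquiv, CrossedData.counit_ι_mul]

theorem toTensorAlgebra_zero (w : ⨂[k]^0 V) :
    TensorPower.toTensorAlgebra w = algebraMap k (TensorAlgebra k V)
      (TensorPower.algebraMap₀.symm w) := by
  obtain ⟨r, rfl⟩ := TensorPower.algebraMap₀.surjective w
  rw [LinearEquiv.symm_apply_apply, TensorPower.algebraMap₀_eq_smul_one, map_smul,
    TensorPower.toTensorAlgebra_gOne, Algebra.algebraMap_eq_smul_one]

theorem ofDirectSum_of {m : ℕ} (w : ⨂[k]^m V) :
    TensorAlgebra.ofDirectSum (DirectSum.of (fun n => ⨂[k]^n V) m w) =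
      TensorPower.toTensorAlgebra w := by
  have h : ∀ w : ⨂[k]^m V, TensorAlgebra.ofDirectSum (DirectSum.lof k ℕ (fun n => ⨂[k]^n V) m w) =
      TensorPower.toTensorAlgebra w := by
    intro w
    induction w using PiTensorProduct.induction_on with
    | smul_tprod r x =>
      rw [map_smul, map_smul, map_smul, DirectSum.lof_eq_of, TensorAlgebra.ofDirectSum_of_tprod,
        TensorPower.toTensorAlgebra_tprod]
    | add a b ha hb => simp only [map_add, ha, hb]
  exact h w

theorem tensorAlgebra_power_induction {p : TensorAlgebra k V → Prop}
    (add : ∀ s t, p s → p t → p (s + t)) (power : ∀ m (w : ⨂[k]^m V),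
      p (TensorPower.toTensorAlgebra w)) (t : TensorAlgebra k V) : p t := by
  rw [← TensorAlgebra.ofDirectSum_toDirectSum t]
  generalize TensorAlgebra.toDirectSum t = x
  induction x using DirectSum.induction_on with
  | zero =>
    have := power 0 0
    simpa using this
  | of m w =>
    rw [ofDirectSum_of]
    exact power m w
  | add a b ha hb => rw [map_add]; exact add _ _ ha hb

theorem toDirectSum_toTensorAlgebra {m : ℕ} (w : ⨂[k]^m V) :
    TensorAlgebra.toDirectSum (TensorPower.toTensorAlgebra w) =
      DirectSum.of (fun n => ⨂[k]^n V) m w := by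
  rw [← TensorAlgebra.toDirectSum_ofDirectSum (DirectSum.of (fun n => ⨂[k]^n V) m w)]
  rw [ofDirectSum_of]

theorem sum_components (t : TensorAlgebra k V) : ∃ s : Finset ℕ, t = ∑ m ∈ s,
    TensorPower.toTensorAlgebra (TensorAlgebra.toDirectSum t m) := by
  classical
  refine ⟨DFinsupp.support (TensorAlgebra.toDirectSum t), ?_⟩
  have h := DirectSum.sum_support_of (TensorAlgebra.toDirectSum t)
  have h2 := congrArg TensorAlgebra.ofDirectSum h
  rw [TensorAlgebra.ofDirectSum_toDirectSum, map_sum] at h2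
  refine h2.symm.trans (Finset.sum_congr rfl fun m _ => ?_)
  rw [ofDirectSum_of]

end TensorPowers

/-! ### Braided factorials compute the pairing -/

namespace CrossedData

section Factorials

variable {k A V : Type*} [Field k] [Ring A] [HopfAlgebra k A] [AddCommGroup V] [Module k V]
  {X : CrossedData k A V}

local notation "𝓲" => TensorAlgebra.ι k
local notation "ε" => TensorAlgebra.algebraMapInv (R := k) (M := V)

/-- The total derivative on a tensor power satisfies the recursion that defines the braided
integers. -/
theorem tensorDeriv_toTensorAlgebra (hX : X.IsYD) (m : ℕ) (w : ⨂[k]^(m + 1) V) :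
    X.tensorDeriv (TensorPower.toTensorAlgebra w) = LinearMap.lTensor V
      TensorPower.toTensorAlgebra ((consEquiv k V m).symm (braidedInt X.braiding (m + 1) w)) := by
  induction m with
  | zero =>
    induction w using tensorPower_succ_induction with
    | zero => simp
    | add a b ha hb => simp only [map_add, ha, hb]
    | cons v w =>
      rw [toTensorAlgebra_consEquiv, tensorDeriv_ι_mul hX, braidedInt, LinearMap.id_apply,
        LinearEquiv.symm_apply_apply, toTensorAlgebra_zero, Algebra.algebraMap_eq_smul_one,
        map_smul, tensorDeriv_one]
      simp [toTensorAlgebra_zero, Algebra.algebraMap_eq_smul_one]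
  | succ m ih =>
    induction w using tensorPower_succ_induction with
    | zero => simp
    | add a b ha hb => simp only [map_add, ha, hb]
    | cons v w =>
      rw [toTensorAlgebra_consEquiv, tensorDeriv_ι_mul hX, ih]
      have h1 : braidedInt X.braiding (m + 1 + 1) = LinearMap.id + braidFirst X.braiding m ∘ₗ
        shift (braidedInt X.braiding (m + 1)) := rfl
      have h2 : ∀ z : (V ⊗[k] V) ⊗[k] (⨂[k]^m V), LinearMap.lTensor V TensorPower.toTensorAlgebra
          (LinearMap.lTensor V (consEquiv k V m).toLinearMap (TensorProduct.assoc k _ _ _ z)) =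
          LinearMap.lTensor V (LinearMap.mul' k _ ∘ₗ LinearMap.rTensor _ (TensorAlgebra.ι k))
            (TensorProduct.assoc k _ _ _
              (LinearMap.lTensor (V ⊗[k] V) TensorPower.toTensorAlgebra z)) := by
        intro z
        induction z with
        | zero => simp
        | add a b ha hb => simp only [map_add, ha, hb]
        | tmul a b =>
          induction a with
          | zero => simp
          | add a b ha hb => simp only [TensorProduct.add_tmul, map_add, ha, hb]
          | tmul x y => simp [toTensorAlgebra_consEquiv]
      rw [h1, LinearMap.add_apply, map_add, map_add, LinearMap.id_apply,
        LinearEquiv.symm_apply_apply, LinearMap.lTensor_tmul]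
      congr 1
      rw [LinearMap.comp_apply, shift]
      simp only [LinearMap.comp_apply, LinearEquiv.coe_coe, LinearEquiv.symm_apply_apply,
        LinearMap.lTensor_tmul]
      obtain ⟨y, hy⟩ := (consEquiv k V m).surjective (braidedInt X.braiding (m + 1) w)
      rw [← hy, LinearEquiv.symm_apply_apply]
      have h3 : (consEquiv k V (m + 1)).symm (braidFirst X.braiding m
          (consEquiv k V (m + 1) (v ⊗ₜ consEquiv k V m y))) =
          LinearMap.lTensor V (consEquiv k V m).toLinearMap (TensorProduct.assoc k _ _ _
            (LinearMap.rTensor _ X.braiding ((TensorProduct.assoc k _ _ _).symm (v ⊗ₜ y)))) := by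
        simp only [braidFirst, LinearMap.comp_apply, LinearEquiv.coe_coe, LinearEquiv.trans_symm,
          LinearEquiv.trans_apply, LinearEquiv.symm_apply_apply, TensorProduct.congr_symm_tmul,
          LinearEquiv.refl_symm, LinearEquiv.refl_apply]
        rfl
      rw [h3, h2]
      congr 2
      rw [← LinearMap.comp_apply (LinearMap.lTensor _ _), LinearMap.lTensor_comp_rTensor,
        ← LinearMap.rTensor_comp_lTensor, LinearMap.comp_apply]
      congr 1
      clear hy h3
      induction y with
      | zero => simp
      | add a b ha hb => simp only [TensorProduct.tmul_add, map_add, ha, hb]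
      | tmul a b => simp

theorem partialD_toTensorAlgebra (hX : X.IsYD) (f : Module.Dual k V) (m : ℕ)
    (w : ⨂[k]^(m + 1) V) : X.partialD f (TensorPower.toTensorAlgebra w) =
      TensorPower.toTensorAlgebra (TensorProduct.lid k _ (LinearMap.rTensor _ f
        ((consEquiv k V m).symm (braidedInt X.braiding (m + 1) w)))) := by
  rw [partialD, LinearMap.mk₂_apply, tensorDeriv_toTensorAlgebra hX]
  generalize (consEquiv k V m).symm (braidedInt X.braiding (m + 1) w) = z
  induction z with
  | zero => simp
  | add a b ha hb => simp only [map_add, ha, hb]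
  | tmul a b => simp

/-- Since `[m+1]! = (id ⊗ [m]!) [m+1]` and functionals on the first factor separate points, the
factorial kills `w` exactly when `[m]!` kills all first derivatives of `w`. Iterating, `w` is in the
radical of the pairing by derivatives. -/
theorem braidedFactorial_eq_zero_iff (hX : X.IsYD) (m : ℕ) (w : ⨂[k]^m V) :
    braidedFactorial X.braiding m w = 0 ↔
      ∀ φ, X.diffPairing φ (TensorPower.toTensorAlgebra w) = 0 := by
  induction m with
  | zero =>
    rw [braidedFactorial, LinearMap.id_apply]
    refine ⟨fun h => by simp [h], fun h => ?_⟩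
    have h1 := h 1
    rw [diffPairing_one, toTensorAlgebra_zero, AlgHom.commutes] at h1
    simpa using h1
  | succ m ih =>
    rw [braidedFactorial, LinearMap.comp_apply, shift, LinearMap.comp_apply, LinearMap.comp_apply,
      LinearEquiv.coe_coe, LinearEquiv.coe_coe, LinearEquiv.map_eq_zero_iff]
    have h1 : ∀ z : V ⊗[k] (⨂[k]^m V), LinearMap.lTensor V (braidedFactorial X.braiding m) z = 0 ↔
        ∀ f : Module.Dual k V, braidedFactorial X.braiding m
          (TensorProduct.lid k _ (LinearMap.rTensor _ f z)) = 0 := by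
      intro z
      have h2 : ∀ f : Module.Dual k V, braidedFactorial X.braiding m
          (TensorProduct.lid k _ (LinearMap.rTensor _ f z)) = TensorProduct.lid k _
          (LinearMap.rTensor _ f (LinearMap.lTensor V (braidedFactorial X.braiding m) z)) := by
        intro f
        induction z with
        | zero => simp
        | add a b ha hb => simp only [map_add, ha, hb]
        | tmul a b => simp
      refine ⟨fun h f => by rw [h2, h]; simp, fun h => ?_⟩
      refine tensor_eq_zero_of_separating (LinearMap.id : Module.Dual k V →ₗ[k] _)
        (fun v hv => ?_) _ fun f => ?_
      · exact (Module.forall_dual_apply_eq_zero_iff k v).1 hv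
      · rw [LinearMap.id_apply, ← h2, h]
    rw [h1]
    simp only [ih, ← partialD_toTensorAlgebra hX, ← diffPairing_mul_ι]
    -- The constant term of `φ` pairs to zero with a tensor of positive degree, so it suffices to
    -- consider `φ` ending in a letter.
    refine ⟨fun h φ => ?_, fun h f φ => h _⟩
    induction φ using tensorAlgebra_right_induction with
    | one => rw [diffPairing_one, counit_toTensorAlgebra_succ]
    | add a b ha hb => rw [map_add, LinearMap.add_apply, ha, hb, add_zero]
    | smul r a ha => rw [map_smul, LinearMap.smul_apply, ha, smul_zero]
    | mul φ f _ => exact h f φ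

theorem toTensorAlgebra_snoc (m : ℕ) (x : Fin m → V) (f : V) :
    TensorPower.toTensorAlgebra (PiTensorProduct.tprod k (Fin.snoc x f : Fin (m + 1) → V)) =
      TensorPower.toTensorAlgebra (PiTensorProduct.tprod k x) * 𝓲 f := by
  rw [TensorPower.toTensorAlgebra_tprod, TensorPower.toTensorAlgebra_tprod,
    TensorAlgebra.tprod_apply, TensorAlgebra.tprod_apply, List.ofFn_succ']
  simp

theorem pairingDual_cons (m : ℕ) (f : Module.Dual k V) (y : Fin m → Module.Dual k V)
    (z : V ⊗[k] (⨂[k]^m V)) :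
    TensorPower.pairingDual k V (m + 1) (PiTensorProduct.tprod k
      (Fin.cons f y : Fin (m + 1) → Module.Dual k V)) (consEquiv k V m z) =
    TensorPower.pairingDual k V m (PiTensorProduct.tprod k y)
      (TensorProduct.lid k _ (LinearMap.rTensor _ f z)) := by
  induction z with
  | zero => simp
  | add a b ha hb => simp only [map_add, ha, hb]
  | tmul v w =>
    induction w using PiTensorProduct.induction_on with
    | smul_tprod r w =>
      rw [TensorProduct.tmul_smul, map_smul, map_smul, consEquiv_tmul_tprod]
      simp [TensorPower.pairingDual, Fin.prod_univ_succ]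
    | add a b ha hb => simp only [TensorProduct.tmul_add, map_add, ha, hb]

theorem diffPairing_tprod_of_ne (hX : X.IsYD) {m n : ℕ} (hmn : m ≠ n)
    (x : Fin m → Module.Dual k V) (w : ⨂[k]^n V) :
    X.diffPairing (TensorPower.toTensorAlgebra (PiTensorProduct.tprod k x))
      (TensorPower.toTensorAlgebra w) = 0 := by
  induction m generalizing n with
  | zero =>
    obtain ⟨n, rfl⟩ := Nat.exists_eq_succ_of_ne_zero hmn.symm
    rw [TensorPower.toTensorAlgebra_tprod, TensorAlgebra.tprod_apply, List.ofFn_zero,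
      List.prod_nil, diffPairing_one, counit_toTensorAlgebra_succ]
  | succ m ih =>
    rw [← Fin.snoc_init_self x, toTensorAlgebra_snoc, diffPairing_mul_ι]
    obtain _ | n := n
    · rw [toTensorAlgebra_zero, Algebra.algebraMap_eq_smul_one, map_smul, partialD_one]
      simp
    · rw [partialD_toTensorAlgebra hX]
      exact ih (by omega) _ _

/-- The last letter of the product differentiates first and so meets the first tensor factor; hence
the reversal of indices, which is the nested evaluation. -/
theorem diffPairing_tprod (hX : X.IsYD) {m : ℕ} (x : Fin m → Module.Dual k V) (w : ⨂[k]^m V) :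
    X.diffPairing (TensorPower.toTensorAlgebra (PiTensorProduct.tprod k x))
      (TensorPower.toTensorAlgebra w) = TensorPower.pairingDual k V m
        (PiTensorProduct.tprod k (fun i => x i.rev)) (braidedFactorial X.braiding m w) := by
  induction m with
  | zero =>
    rw [TensorPower.toTensorAlgebra_tprod, TensorAlgebra.tprod_apply, List.ofFn_zero,
      List.prod_nil, diffPairing_one, braidedFactorial, LinearMap.id_apply]
    induction w using PiTensorProduct.induction_on with
    | smul_tprod r w =>
      simp [TensorPower.pairingDual, TensorPower.toTensorAlgebra_tprod, TensorAlgebra.tprod_apply]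
    | add a b ha hb => simp only [map_add, ha, hb]
  | succ m ih =>
    conv_lhs => rw [← Fin.snoc_init_self x]
    rw [toTensorAlgebra_snoc, diffPairing_mul_ι, partialD_toTensorAlgebra hX, ih]
    have h1 : (fun i : Fin (m + 1) => x i.rev) = Fin.cons (x (Fin.last m))
        (fun i => Fin.init x i.rev) := by
      ext i
      refine Fin.cases ?_ (fun i => ?_) i
      · simp
      · simp [Fin.init, Fin.rev_succ]
    rw [h1, braidedFactorial, LinearMap.comp_apply, shift, LinearMap.comp_apply,
      LinearMap.comp_apply, LinearEquiv.coe_coe, LinearEquiv.coe_coe, pairingDual_cons]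
    congr 1
    generalize (consEquiv k V m).symm (braidedInt X.braiding (m + 1) w) = z
    induction z with
    | zero => simp
    | add a b ha hb => simp only [map_add, ha, hb]
    | tmul a b => simp

end Factorials

/-! ### The relations of the braided exterior algebra form the radical of the pairing -/

section ExtKernel

variable {k A A' V : Type*} [Field k] [Ring A] [HopfAlgebra k A] [Ring A'] [HopfAlgebra k A']
  [AddCommGroup V] [Module k V] {X : CrossedData k A V} {Y : CrossedData k A' V}

/-- Only the braiding enters the factorials, so the crossed module `Y` may live over a different
Hopf algebra. It is used with the super version of `X`, whose braiding is `-Ψ`. -/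
theorem tensorPairing_eq [Module.Finite k V] (hY : Y.IsYD) (h : Y.braiding = -X.braiding) :
    X.tensorPairing = Y.diffPairing := by
  refine LinearMap.ext fun φ => LinearMap.ext fun t => ?_
  induction φ using tensorAlgebra_power_induction with
  | add a b ha hb => simp only [map_add, LinearMap.add_apply, ha, hb]
  | power m φ =>
    induction t using tensorAlgebra_power_induction with
    | add a b ha hb => simp only [map_add, ha, hb]
    | power n w =>
      have h1 : ∀ φ : ⨂[k]^m (Module.Dual k V), X.tensorPairing (TensorPower.toTensorAlgebra φ)
          (TensorPower.toTensorAlgebra w) = TensorPower.pairingDual k V m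
          (PiTensorProduct.reindex k (fun _ => Module.Dual k V) (Fin.revPerm (n := m)) φ)
          (braidedFactorial Y.braiding m (DirectSum.of (fun n => ⨂[k]^n V) n w m)) := by
        intro φ
        rw [h]
        simp only [tensorPairing, LinearMap.comp_apply, AlgHom.toLinearMap_apply,
          toDirectSum_toTensorAlgebra, ← DirectSum.lof_eq_of k, DirectSum.toModule_lof,
          LinearEquiv.coe_coe, LinearMap.lcomp_apply]
        rfl
      rw [h1]
      induction φ using PiTensorProduct.induction_on with
      | smul_tprod r x =>
        simp only [map_smul, LinearMap.smul_apply]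
        congr 1
        rw [PiTensorProduct.reindex_tprod]
        by_cases hmn : n = m
        · subst hmn
          rw [DirectSum.of_eq_same, diffPairing_tprod hY]
          rfl
        · rw [DirectSum.of_eq_of_ne _ _ _ (Ne.symm hmn), map_zero, map_zero,
            diffPairing_tprod_of_ne hY (Ne.symm hmn)]
      | add a b ha hb => simp only [map_add, LinearMap.add_apply, ha, hb]

/-- Different degrees are orthogonal, so the radical is a graded subspace. -/
theorem diffPairing_toTensorAlgebra_component (hY : Y.IsYD) {t : TensorAlgebra k V}
    (ht : ∀ φ, Y.diffPairing φ t = 0) (m : ℕ) (φ : TensorAlgebra k (Module.Dual k V)) :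
    Y.diffPairing φ (TensorPower.toTensorAlgebra (TensorAlgebra.toDirectSum t m)) = 0 := by
  induction φ using tensorAlgebra_power_induction with
  | add a b ha hb => simp only [map_add, LinearMap.add_apply, ha, hb, add_zero]
  | power n φ =>
    induction φ using PiTensorProduct.induction_on with
    | smul_tprod r x =>
      rw [map_smul, map_smul, LinearMap.smul_apply]
      by_cases hmn : n = m
      · subst hmn
        have h1 := ht (TensorPower.toTensorAlgebra (PiTensorProduct.tprod k x))
        have h2 : ∀ t : TensorAlgebra k V, Y.diffPairing
            (TensorPower.toTensorAlgebra (PiTensorProduct.tprod k x)) t = Y.diffPairing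
            (TensorPower.toTensorAlgebra (PiTensorProduct.tprod k x))
              (TensorPower.toTensorAlgebra (TensorAlgebra.toDirectSum t n)) := by
          intro t
          induction t using tensorAlgebra_power_induction with
          | add a b ha hb => rw [map_add, map_add, DirectSum.add_apply, map_add, map_add, ha, hb]
          | power m w =>
            rw [toDirectSum_toTensorAlgebra]
            by_cases hmn : m = n
            · subst hmn
              rw [DirectSum.of_eq_same]
            · rw [DirectSum.of_eq_of_ne _ _ _ (Ne.symm hmn), map_zero, map_zero,
                diffPairing_tprod_of_ne hY (Ne.symm hmn)]
        rw [← h2, h1, smul_zero]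
      · rw [diffPairing_tprod_of_ne hY hmn, smul_zero]
    | add a b ha hb => simp only [map_add, LinearMap.add_apply, ha, hb, add_zero]

/-- The kernel of `T V → B_-(V)` is the radical of the pairing, provided that the radical is the
kernel of an algebra homomorphism. -/
theorem toExt_eq_zero_iff (hY : Y.IsYD) (h : Y.braiding = -X.braiding) {E : Type*} [Ring E]
    [Algebra k E] (ρ : TensorAlgebra k V →ₐ[k] E)
    (hρ : ∀ t, ρ t = 0 ↔ ∀ φ, Y.diffPairing φ t = 0) (t : TensorAlgebra k V) :
    X.toExt t = 0 ↔ ∀ φ, Y.diffPairing φ t = 0 := by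
  constructor
  · intro ht
    rw [← hρ]
    have hrel : ∀ ⦃x y : TensorAlgebra k V⦄, X.ExtRel x y → ρ x = ρ y := by
      rintro _ _ ⟨m, w, hw⟩
      rw [map_zero, hρ, ← braidedFactorial_eq_zero_iff hY, h]
      exact hw
    have h1 : RingQuot.liftAlgHom k ⟨ρ, hrel⟩ (RingQuot.mkAlgHom k X.ExtRel t) = ρ t :=
      RingQuot.liftAlgHom_mkAlgHom_apply k ρ hrel t
    rw [← h1]
    change RingQuot.liftAlgHom k ⟨ρ, hrel⟩ (X.toExt t) = 0
    rw [ht]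
    exact map_zero (RingQuot.liftAlgHom k ⟨ρ, hrel⟩)
  -- An element of the radical has all its homogeneous components in the radical; each is killed by
  -- the factorial of its degree and is therefore a defining relation.
  · intro ht
    obtain ⟨s, hs⟩ := sum_components t
    rw [hs, map_sum]
    refine Finset.sum_eq_zero fun m _ => ?_
    have h1 : X.ExtRel (TensorPower.toTensorAlgebra (TensorAlgebra.toDirectSum t m)) 0 := by
      constructor
      rw [← h, braidedFactorial_eq_zero_iff hY]
      exact diffPairing_toTensorAlgebra_component hY ht m
    have h2 := RingQuot.mkAlgHom_rel k h1
    rw [map_zero] at h2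
    exact h2

theorem toExt_rep (b : X.Ext) : X.toExt (X.rep b) = b :=
  congrArg (fun f => f b) ((X.toExt.toLinearMap.exists_rightInverse_of_surjective
    (LinearMap.range_eq_top.2 (RingQuot.mkAlgHom_surjective k X.ExtRel))).choose_spec)

end ExtKernel

/-! ### Comparison of the left and the right radical -/

section DoubleDual

variable {k A V : Type*} [Field k] [Ring A] [HopfAlgebra k A] [AddCommGroup V] [Module k V]
  [Module.Finite k V] {X : CrossedData k A V} {Z : CrossedData k A (Module.Dual k V)}

theorem diffPairing_ι (hX : X.IsYD) (φ : TensorAlgebra k (Module.Dual k V)) (v : V) :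
    X.diffPairing φ (TensorAlgebra.ι k v) = degOne k (Module.Dual k V) φ v := by
  induction φ using tensorAlgebra_right_induction with
  | one => simp [diffPairing_one, degOne_one, TensorAlgebra.algebraMapInv]
  | add a b ha hb => simp only [map_add, LinearMap.add_apply, ha, hb]
  | smul r a ha => simp only [map_smul, LinearMap.smul_apply, ha]
  | mul φ f _ =>
    rw [diffPairing_mul_ι, partialD_apply, tensorCop_ι hX, prim_apply]
    simp [degOne_ι, degOne_one, degOne_mul,
      diffPairing_one_right, TensorAlgebra.algebraMapInv, mul_comm]

/-- The pairing is symmetric under exchanging `V` with its dual. By multiplicativity in the second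
variable, a last letter `v` of `t` contracts the first leg of `Δ φ` in degree one, which is the
derivative of `φ` along evaluation at `v`. -/
theorem diffPairing_double (hX : X.IsYD) (hZ : Z.IsYD) (h : Z.IsDualOf X)
    (φ : TensorAlgebra k (Module.Dual k V)) (t : TensorAlgebra k V) :
    X.diffPairing φ t = Z.diffPairing
      (TensorAlgebra.lift k (TensorAlgebra.ι k ∘ₗ Module.Dual.eval k V) t) φ := by
  induction t using tensorAlgebra_right_induction generalizing φ with
  | one => simp [diffPairing_one_right, diffPairing_one]
  | add a b ha hb => simp only [map_add, LinearMap.add_apply, ha, hb]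
  | smul r a ha => simp only [map_smul, LinearMap.smul_apply, ha]
  | mul t v ih =>
    rw [map_mul (TensorAlgebra.lift k _), TensorAlgebra.lift_ι_apply, LinearMap.comp_apply,
      diffPairing_mul_ι, ← ih,
      diffPairing_mul_right hX hZ h, partialD_apply]
    generalize Z.tensorCop φ = z
    induction z with
    | zero => simp
    | add a b ha hb => simp only [map_add, LinearMap.add_apply, ha, hb]
    | tmul a b => simp [diffPairing_ι hX]

/-- In finite dimension every element of the double dual is an evaluation. So the left radical is
described by the factorials of the dual crossed module, and the relations of `B_-(V^*)` are exactly
the elements that pair to zero with all of `T V`. -/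
theorem diffPairing_left_radical (hX : X.IsYD) (hZ : Z.IsYD) (h : Z.IsDualOf X)
    (φ : TensorAlgebra k (Module.Dual k V)) :
    (∀ t, X.diffPairing φ t = 0) ↔ ∀ τ, Z.diffPairing τ φ = 0 := by
  simp only [diffPairing_double hX hZ h]
  refine ⟨fun h1 τ => ?_, fun h1 t => h1 _⟩
  suffices hs : Function.Surjective (TensorAlgebra.lift k
      (TensorAlgebra.ι k ∘ₗ Module.Dual.eval k V)) by
    obtain ⟨t, rfl⟩ := hs τ
    exact h1 t
  rw [← AlgHom.range_eq_top, eq_top_iff, ← TensorAlgebra.adjoin_range_ι, Algebra.adjoin_le_iff]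
  rintro _ ⟨f, rfl⟩
  obtain ⟨v, rfl⟩ := (Module.evalEquiv k V).surjective f
  exact ⟨TensorAlgebra.ι k v, by simp⟩

end DoubleDual

end CrossedData

/-! ### Integrals and the Fourier transform -/

section Integrals

variable {k A C : Type*} [Field k] [Ring A] [HopfAlgebra k A] [Ring C] [Algebra k C]
  {ι κ : Type*} [Fintype ι] [Fintype κ] [DecidableEq ι] [DecidableEq κ]

namespace BraidedHopf

variable (H : BraidedHopf k A C)

/-- The identity `1 ⊗ b = (S b₁ ⊗ 1) Δ(b₂)` in the braided tensor square: by coassociativity `S b₁`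
meets the adjacent leg `b₂`, and the antipode axiom contracts the two. -/
theorem sum_anti_cop (b : C) :
    TensorProduct.lift ((H.X.bm ∘ₗ (TensorProduct.mk k C C).flip 1 ∘ₗ H.anti).compl₂ H.cop)
      (H.cop b) = 1 ⊗ₜ b := by
  have h := congrArg (LinearMap.rTensor C (LinearMap.mul' k C ∘ₗ
    TensorProduct.map H.anti LinearMap.id) ∘ₗ (TensorProduct.assoc k C C C).symm.toLinearMap)
    (H.coassoc b)
  have h1 : (1 : C) ⊗ₜ[k] b = LinearMap.rTensor C (LinearMap.mul' k C ∘ₗ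
      TensorProduct.map H.anti LinearMap.id) (LinearMap.rTensor C H.cop (H.cop b)) := by
    have h2 : (LinearMap.mul' k C ∘ₗ TensorProduct.map H.anti LinearMap.id) ∘ₗ H.cop =
        Algebra.linearMap k C ∘ₗ H.counit := LinearMap.ext H.anti_left
    rw [← LinearMap.rTensor_comp_apply, h2]
    conv_lhs => rw [← H.counit_left b]
    generalize H.cop b = z
    induction z with
    | zero => simp
    | add x y hx hy => simp only [map_add, TensorProduct.tmul_add, hx, hy]
    | tmul x y => simp [Algebra.algebraMap_eq_smul_one, TensorProduct.smul_tmul]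
  rw [h1]
  simp only [LinearMap.comp_apply, LinearEquiv.coe_coe, LinearEquiv.symm_apply_apply] at h
  rw [h]
  generalize H.cop b = z
  induction z with
  | zero => simp
  | add x y hx hy => simp only [map_add, hx, hy]
  | tmul x y =>
    simp only [TensorProduct.lift.tmul, LinearMap.compl₂_apply, LinearMap.comp_apply,
      LinearMap.flip_apply, TensorProduct.mk_apply, LinearMap.lTensor_tmul]
    generalize H.cop y = w
    induction w with
    | zero => simp
    | add x y hx hy => simp only [map_add, TensorProduct.tmul_add, hx, hy]
    | tmul y z => simp [H.ydAlg.bm_tmul_one]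

/-- The mirror identity `b ⊗ 1 = Δ(b₁) (1 ⊗ S b₂)`. -/
theorem sum_cop_anti (b : C) :
    TensorProduct.lift ((H.X.bm ∘ₗ H.cop).compl₂ (TensorProduct.mk k C C 1 ∘ₗ H.anti))
      (H.cop b) = b ⊗ₜ 1 := by
  have h := congrArg (LinearMap.lTensor C (LinearMap.mul' k C ∘ₗ
    TensorProduct.map LinearMap.id H.anti)) (H.coassoc b)
  have h1 : b ⊗ₜ[k] (1 : C) = LinearMap.lTensor C (LinearMap.mul' k C ∘ₗ
      TensorProduct.map LinearMap.id H.anti) (LinearMap.lTensor C H.cop (H.cop b)) := by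
    have h2 : (LinearMap.mul' k C ∘ₗ TensorProduct.map LinearMap.id H.anti) ∘ₗ H.cop =
        Algebra.linearMap k C ∘ₗ H.counit := LinearMap.ext H.anti_right
    rw [← LinearMap.lTensor_comp_apply, h2]
    conv_lhs => rw [← H.counit_right b]
    generalize H.cop b = z
    induction z with
    | zero => simp
    | add x y hx hy => simp only [map_add, TensorProduct.add_tmul, hx, hy]
    | tmul x y => simp [Algebra.algebraMap_eq_smul_one, TensorProduct.smul_tmul]
  rw [h1, ← h]
  generalize H.cop b = z
  induction z with
  | zero => simp
  | add x y hx hy => simp only [map_add, hx, hy]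
  | tmul x y =>
    simp only [TensorProduct.lift.tmul, LinearMap.compl₂_apply, LinearMap.comp_apply,
      TensorProduct.mk_apply, LinearMap.rTensor_tmul]
    generalize H.cop x = w
    induction w with
    | zero => simp
    | add x y hx hy =>
      simp only [map_add, LinearMap.add_apply, TensorProduct.add_tmul, hx, hy]
    | tmul y z => simp [H.ydAlg.bm_one_left]

variable {H} {vol : C}

/-- Inserting `1 ⊗ b = (S b₁ ⊗ 1) Δ(b₂)` and multiplicativity of the coproduct produces `Δ(b₂ vol)`,
where `b₂` collapses to its counit. This exchange of a factor on one leg for an antipode on the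
other is the source of all integral identities. -/
theorem bm_one_tmul_cop_vol (hv : ∀ b, b * vol = H.counit b • vol) (b : C) :
    H.X.bm (1 ⊗ₜ b) (H.cop vol) = H.X.bm (H.anti b ⊗ₜ 1) (H.cop vol) := by
  rw [← H.sum_anti_cop b]
  conv_rhs => rw [← H.counit_right b]
  generalize H.cop b = z
  induction z with
  | zero => simp
  | add x y hx hy =>
    simp only [map_add, LinearMap.add_apply, TensorProduct.add_tmul, hx, hy]
  | tmul x y =>
    simp only [TensorProduct.lift.tmul, LinearMap.compl₂_apply, LinearMap.comp_apply,
      LinearMap.flip_apply, TensorProduct.mk_apply, LinearMap.lTensor_tmul, TensorProduct.rid_tmul,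
      map_smul, ← TensorProduct.smul_tmul', LinearMap.smul_apply]
    rw [H.ydAlg.bm_assoc, ← H.cop_mul, hv, map_smul, map_smul]

theorem bm_cop_vol_tmul_one (hv : ∀ b, vol * b = H.counit b • vol) (b : C) :
    H.X.bm (H.cop vol) (b ⊗ₜ 1) = H.X.bm (H.cop vol) (1 ⊗ₜ H.anti b) := by
  rw [← H.sum_cop_anti b]
  conv_rhs => rw [← H.counit_left b]
  generalize H.cop b = z
  induction z with
  | zero => simp
  | add x y hx hy =>
    simp only [map_add, TensorProduct.tmul_add, hx, hy]
  | tmul x y =>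
    simp only [TensorProduct.lift.tmul, LinearMap.compl₂_apply, LinearMap.comp_apply,
      TensorProduct.mk_apply, LinearMap.rTensor_tmul, TensorProduct.lid_tmul,
      map_smul, TensorProduct.tmul_smul]
    rw [← H.ydAlg.bm_assoc, ← H.cop_mul, hv, map_smul, LinearMap.map_smul₂]

/-- The twist `x ↦ x₀ ◁ S x₁`. -/
def twist (H : BraidedHopf k A C) : C →ₗ[k] C :=
  TensorProduct.lift (H.X.act.compl₂ (HopfAlgebra.antipode k)) ∘ₗ H.X.coact

theorem twist_family {x : ι → C} {c : Matrix ι ι A} (hx : IsFamily H.X.coact x c) (j : ι) :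
    H.twist (x j) = ∑ i, H.X.act (x i) (HopfAlgebra.antipode k (c i j)) := by
  simp [twist, hx.coact]

/-- The twist intertwines the action of `a` with that of `S² a`. The crossed module compatibility
gives `(twist (x ◁ a₂)) ◁ S a₁ = ε(a) twist x`, and the matrix `S c` is then inverted by means of
`S² c`. -/
theorem twist_act {x : κ → C} {d : Matrix κ κ A} (hx : IsFamily H.X.coact x d)
    {c : Matrix ι ι A} (hc : IsComatrix k c) (s : κ) (m j : ι) :
    H.twist (H.X.act (x s) (c m j)) =
      H.X.act (H.twist (x s)) (HopfAlgebra.antipode k (HopfAlgebra.antipode k (c m j))) := by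
  have h1 : ∀ a (z : C ⊗[k] A), TensorProduct.lift (H.X.act.compl₂ (HopfAlgebra.antipode k))
      ((1 ⊗ₜ a) * z) = H.X.act (TensorProduct.lift (H.X.act.compl₂ (HopfAlgebra.antipode k)) z)
        (HopfAlgebra.antipode k a) := by
    intro a z
    induction z with
    | zero => simp
    | add x y hx hy => simp only [mul_add, map_add, LinearMap.add_apply, hx, hy]
    | tmul x y => simp [HopfAlgebra.antipode_mul_antidistrib, H.ydAlg.act_mul]
  have h2 : ∀ i, ∑ l, H.X.act (H.twist (H.X.act (x s) (c l j))) (HopfAlgebra.antipode k (c i l)) =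
      (1 : Matrix ι ι k) i j • H.twist (x s) := by
    intro i
    have h := congrArg (TensorProduct.lift (H.X.act.compl₂ (HopfAlgebra.antipode k)))
      (H.ydAlg.sum_coact_act' hx hc s i j)
    rw [map_sum] at h
    simp only [h1] at h
    refine h.trans ?_
    simp only [map_sum, TensorProduct.lift.tmul, LinearMap.compl₂_apply,
      HopfAlgebra.antipode_mul_antidistrib, H.ydAlg.act_mul]
    simp only [← H.ydAlg.act_mul, mul_assoc]
    rw [Finset.sum_comm]
    simp only [← mul_assoc, ← map_sum, ← Finset.sum_mul, hc.mul_antipode]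
    rw [twist_family hx, Finset.smul_sum]
    refine Finset.sum_congr rfl fun r _ => ?_
    rcases eq_or_ne i j with rfl | hij
    · simp
    · simp [hij]
  have h3 : ∀ l, ∑ i, HopfAlgebra.antipode k (c i l) *
      HopfAlgebra.antipode k (HopfAlgebra.antipode k (c m i)) = (1 : Matrix ι ι A) m l := by
    intro l
    simp only [← HopfAlgebra.antipode_mul_antidistrib, ← map_sum, hc.antipode_mul]
    rcases eq_or_ne m l with rfl | hml
    · simp
    · simp [hml]
  have h4 : ∑ i, H.X.act (∑ l, H.X.act (H.twist (H.X.act (x s) (c l j)))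
      (HopfAlgebra.antipode k (c i l))) (HopfAlgebra.antipode k (HopfAlgebra.antipode k (c m i))) =
      H.twist (H.X.act (x s) (c m j)) := by
    simp only [map_sum, LinearMap.sum_apply, ← H.ydAlg.act_mul]
    rw [Finset.sum_comm]
    simp only [← map_sum, h3]
    rw [Finset.sum_eq_single m]
    · simp [H.ydAlg.act_one]
    · intro l _ hl
      simp [Ne.symm hl]
    · simp
  rw [← h4]
  simp only [h2]
  rw [Finset.sum_eq_single j]
  · simp
  · intro l _ hl
    simp [hl]
  · simp

/-- The inverse twist `x ↦ x₀ ◁ S⁻² x₁`. -/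
def twistInv (H : BraidedHopf k A C) : C →ₗ[k] C :=
  TensorProduct.lift (H.X.act.compl₂ (antipodeInv k A ∘ₗ antipodeInv k A)) ∘ₗ H.X.coact

/-- By `twist_act` the twist turns `x₀ ◁ S⁻² x₁` into `twist(x₀) ◁ x₁`, where the remaining factor
`S(x₁) x₂` cancels. Surjectivity of the twist means that twisted functionals suffice to separate
points. -/
theorem twist_twistInv (hA : Function.Bijective (HopfAlgebra.antipode k (A := A))) (x : C) :
    H.twist (H.twistInv x) = x := by
  have hS : ∀ a : A, HopfAlgebra.antipode k (antipodeInv k A a) = a := by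
    intro a
    rw [antipodeInv, linInverse, dif_pos hA]
    exact (LinearEquiv.ofBijective _ hA).apply_symm_apply a
  refine H.ydAlg.comodule.induction (p := fun x => H.twist (H.twistInv x) = x) (by simp)
    (fun a b ha hb => by simp only [map_add, ha, hb]) ?_ x
  intro n x c hx r j
  have h1 : ∀ (s : Fin n) (a : A), H.twist (H.X.act (x s) a) =
      H.X.act (H.twist (x s)) (HopfAlgebra.antipode k (HopfAlgebra.antipode k a)) := by
    intro s a
    have : H.twist ∘ₗ H.X.act (x s) = H.X.act (H.twist (x s)) ∘ₗ HopfAlgebra.antipode k ∘ₗ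
        HopfAlgebra.antipode k := comatrix_ext fun m d hd i j => twist_act hx hd s i j
    exact congrArg (fun f => f a) this
  rw [map_smul, map_smul]
  congr 1
  have h2 : H.twistInv (x j) = ∑ i, H.X.act (x i) (antipodeInv k A (antipodeInv k A (c i j))) := by
    simp [twistInv, hx.coact]
  rw [h2, map_sum]
  simp only [h1, hS, twist_family hx, map_sum, LinearMap.sum_apply, ← H.ydAlg.act_mul]
  rw [Finset.sum_comm]
  simp only [← map_sum, hx.comatrix.antipode_mul]
  rw [Finset.sum_eq_single j]
  · simp [H.ydAlg.act_one]
  · intro l _ hl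
    simp [hl]
  · simp

end BraidedHopf

end Integrals

/-! ### Integral identities and the Fourier transform -/

namespace HopfPairing

variable {k A C D : Type*} [Field k] [Ring A] [HopfAlgebra k A] [Ring C] [Algebra k C] [Ring D]
  [Algebra k D] {H' : BraidedHopf k A D} {H : BraidedHopf k A C} {P : HopfPairing H' H}
  {ι κ : Type*} [Fintype ι] [Fintype κ] [DecidableEq ι] [DecidableEq κ]

theorem sum_pair_family {ψ : ι → D} {d : Matrix ι ι A} (hψ : IsFamily H'.X.coact ψ d)
    {x : κ → C} {c : Matrix κ κ A} (hx : IsFamily H.X.coact x c) (j : ι) (q : κ) :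
    ∑ i, P.pair (ψ i) (x q) • d i j =
      ∑ p, P.pair (ψ j) (x p) • HopfAlgebra.antipode k (c p q) := by
  have h := P.coact (ψ j) (x q)
  simpa [hψ.coact, hx.coact] using h

/-- Invariance of the pairing under the diagonal coaction, obtained from its adjunction form by
cancelling `S c` against `c`. -/
theorem sum_sum_pair_family {ψ : ι → D} {d : Matrix ι ι A} (hψ : IsFamily H'.X.coact ψ d)
    {x : κ → C} {c : Matrix κ κ A} (hx : IsFamily H.X.coact x c) (j : ι) (q : κ) :
    ∑ i, ∑ p, P.pair (ψ i) (x p) • (d i j * c p q) = P.pair (ψ j) (x q) • 1 := by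
  rw [Finset.sum_comm]
  simp only [← smul_mul_assoc, ← Finset.sum_mul, sum_pair_family hψ hx]
  simp only [Finset.sum_mul, smul_mul_assoc]
  rw [Finset.sum_comm]
  simp only [← Finset.smul_sum, hx.comatrix.antipode_mul]
  simp [Matrix.one_apply]

/-- The invariant form of the pairing, `⟨ψ₀, b ◁ ψ₁⟩`. -/
theorem pair_twist_family {ψ : ι → D} {d : Matrix ι ι A} (hψ : IsFamily H'.X.coact ψ d) (j : ι)
    (b : C) : P.pair (H'.twist (ψ j)) b = ∑ i, P.pair (ψ i) (H.X.act b (d i j)) := by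
  rw [BraidedHopf.twist_family hψ, map_sum, LinearMap.sum_apply]
  simp only [P.act]

/-- Δ is colinear and the pairing invariant, so `ψ ↦ ψ ▷ t` is colinear up to the element `c` by
which `t` coacts. -/
theorem leftOp_coact_family {ψ : ι → D} {d : Matrix ι ι A} (hψ : IsFamily H'.X.coact ψ d)
    {t : C} {c : A} (ht : H.X.coact t = t ⊗ₜ c) (j : ι) :
    H.X.coact (P.leftOp (ψ j) t) = ∑ i, P.leftOp (ψ i) t ⊗ₜ (d i j * c) := by
  have h := H.cop_coact t
  rw [ht, LinearMap.rTensor_tmul] at h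
  have h1 : ∀ z : C ⊗[k] C, H.X.coact (TensorProduct.lid k C (LinearMap.rTensor C (P.pair (ψ j)) z))
      = ∑ i, LinearMap.lTensor C (LinearMap.mulLeft k (d i j)) (LinearMap.rTensor A
        ((TensorProduct.lid k C).toLinearMap ∘ₗ LinearMap.rTensor C (P.pair (ψ i)))
          (H.X.coactTwo z)) := by
    intro z
    refine H.ydAlg.comodule.tensor_induction (p := fun z => H.X.coact (TensorProduct.lid k C
      (LinearMap.rTensor C (P.pair (ψ j)) z))
      = ∑ i, LinearMap.lTensor C (LinearMap.mulLeft k (d i j)) (LinearMap.rTensor A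
        ((TensorProduct.lid k C).toLinearMap ∘ₗ LinearMap.rTensor C (P.pair (ψ i)))
          (H.X.coactTwo z))) (by simp) (fun a b ha hb => by
          simp only [map_add, ha, hb, Finset.sum_add_distrib]) ?_ z
    intro n x e hx q y
    rw [CrossedData.coactTwo_family hx]
    have h2 : ∀ i p (w : C ⊗[k] A), LinearMap.lTensor C (LinearMap.mulLeft k (d i j))
        (LinearMap.rTensor A
        ((TensorProduct.lid k C).toLinearMap ∘ₗ LinearMap.rTensor C (P.pair (ψ i)))
          ((TensorProduct.assoc k C C A).symm (x p ⊗ₜ ((1 ⊗ₜ e p q) * w)))) =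
        (1 ⊗ₜ (P.pair (ψ i) (x p) • (d i j * e p q))) * w := by
      intro i p w
      induction w with
      | zero => simp
      | add a b ha hb => simp only [mul_add, TensorProduct.tmul_add, map_add, ha, hb]
      | tmul y a => simp [TensorProduct.smul_tmul', mul_assoc]
    simp only [map_sum, h2, ← Finset.sum_mul, ← TensorProduct.tmul_sum, sum_sum_pair_family hψ hx]
    simp only [LinearMap.rTensor_tmul, TensorProduct.lid_tmul, map_smul, TensorProduct.tmul_smul,
      smul_mul_assoc]
    rw [← Algebra.TensorProduct.one_def, one_mul]
  rw [leftOp_apply, BraidedHopf.contract_apply, h1, h]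
  simp [leftOp_apply, BraidedHopf.contract_apply]

/-- A volume element `vol` and an integral `I` on the second factor of a pairing; `c` and `η`
describe the coaction and the action on `vol`. -/
structure IsIntegral (P : HopfPairing H' H) (vol : C) (I : C →ₗ[k] k) (c : A) (η : A →ₗ[k] k) :
    Prop where
  mul_vol : ∀ b, b * vol = H.counit b • vol
  vol_mul : ∀ b, vol * b = H.counit b • vol
  cop_integral : TensorProduct.rid k C (LinearMap.lTensor C I (H.cop vol)) = 1
  integral_act : ∀ x a, I (H.X.act x a) = η a * I x
  act_vol : ∀ a, H.X.act vol a = η a • vol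
  coact_vol : H.X.coact vol = vol ⊗ₜ c
  char : ∀ b, TensorProduct.rid k C (LinearMap.lTensor C η (H.X.coact b)) = H.X.act b c
  sq : c * c = 1
  left_nondeg : ∀ φ, (∀ t, P.pair φ t = 0) → φ = 0
  right_nondeg : ∀ t, (∀ φ, P.pair φ t = 0) → t = 0

variable {vol : C} {I : C →ₗ[k] k} {c : A} {η : A →ₗ[k] k}

/-- The antipode is recovered from the integral as `S b = (id ⊗ I)((1 ⊗ b) Δ vol)`. Pairing the
first leg with `ψ` gives the left side up to the braiding of `b` past that leg, and invariance of
the pairing converts this braiding into the twist of `ψ`. -/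
theorem IsIntegral.integral_mul_leftOp (h : P.IsIntegral vol I c η) (b : C) (ψ : D) :
    I (b * P.leftOp ψ vol) = P.pair (H'.twist ψ) (H.anti b) := by
  refine H'.ydAlg.comodule.induction (p := fun ψ => I (b * P.leftOp ψ vol) =
    P.pair (H'.twist ψ) (H.anti b)) (by simp) (fun a b ha hb => by
      simp only [map_add, LinearMap.add_apply, mul_add, ha, hb]) ?_ ψ
  intro n ψ d hψ r j
  simp only [map_smul, LinearMap.smul_apply, mul_smul_comm]
  congr 1
  have h0 : ∀ b, H.anti b = TensorProduct.rid k C (LinearMap.lTensor C I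
      (H.X.bm (1 ⊗ₜ b) (H.cop vol))) := by
    intro b
    rw [BraidedHopf.bm_one_tmul_cop_vol h.mul_vol]
    have h1 : ∀ z, TensorProduct.rid k C (LinearMap.lTensor C I (H.X.bm (H.anti b ⊗ₜ 1) z)) =
        H.anti b * TensorProduct.rid k C (LinearMap.lTensor C I z) := by
      intro z
      induction z with
      | zero => simp
      | add x y hx hy => simp only [map_add, mul_add, hx, hy]
      | tmul x y => simp [H.ydAlg.bm_tmul_one]
    rw [h1, h.cop_integral, mul_one]
  rw [pair_twist_family hψ]
  simp only [← H.anti_act]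
  simp only [h0, leftOp_apply, BraidedHopf.contract_apply]
  generalize H.cop vol = z
  refine H.ydAlg.comodule.tensor_induction (p := fun z =>
    I (b * TensorProduct.lid k C (LinearMap.rTensor C (P.pair (ψ j)) z)) =
    ∑ i, P.pair (ψ i) (TensorProduct.rid k C (LinearMap.lTensor C I
      (H.X.bm (1 ⊗ₜ H.X.act b (d i j)) z)))) (by simp) (fun x y hx hy => by
        simp only [map_add, mul_add, hx, hy, Finset.sum_add_distrib]) ?_ z
  intro m x e hx q y
  simp only [CrossedData.bm_family hx]
  -- Here `b` carries the coactions of both `ψ` and the first leg of `Δ vol`; as these two are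
  -- paired with each other, their joint coaction is trivial.
  have h2 := congrArg (fun a => I (H.X.act b a * y)) (sum_sum_pair_family (P := P) hψ hx j q)
  simp only [map_sum, map_smul, Finset.sum_mul, smul_mul_assoc, H.ydAlg.act_one, smul_eq_mul]
    at h2
  simp only [LinearMap.rTensor_tmul, TensorProduct.lid_tmul, mul_smul_comm, map_smul, smul_eq_mul,
    map_sum, LinearMap.lTensor_tmul, TensorProduct.rid_tmul, one_mul, ← H.ydAlg.act_mul]
  rw [← h2]
  simp only [mul_comm]

/-- The mirror of the preceding identity, from `Δ vol (b ⊗ 1) = Δ vol (1 ⊗ S b)`. The second leg of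
`Δ vol` is acted on by the coaction of `b` before being integrated, which gives a character of that
coaction, and this is the action of `c` on `b`. -/
theorem IsIntegral.integral_leftOp_mul (h : P.IsIntegral vol I c η) (b : C) (ψ : D) :
    I (P.leftOp ψ vol * H.anti b) = P.pair ψ (H.X.act b c) := by
  have h1 : TensorProduct.rid k C (LinearMap.lTensor C I (H.X.bm (H.cop vol) (b ⊗ₜ 1))) =
      H.X.act b c := by
    have h2 : ∀ z, TensorProduct.rid k C (LinearMap.lTensor C I (H.X.bm z (b ⊗ₜ 1))) =
        TensorProduct.rid k C (LinearMap.lTensor C I z) * TensorProduct.rid k C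
          (LinearMap.lTensor C η (H.X.coact b)) := by
      intro z
      induction z with
      | zero => simp
      | add x y hx hy => simp only [map_add, LinearMap.add_apply, add_mul, hx, hy]
      | tmul x y =>
        rw [CrossedData.bm_tmul_tmul]
        generalize H.X.coact b = w
        induction w with
        | zero => simp
        | add x y hx hy => simp only [map_add, mul_add, hx, hy]
        | tmul u a => simp [CrossedData.bmAux, h.integral_act, smul_smul]
    rw [h2, h.cop_integral, one_mul, h.char]
  rw [← h1, BraidedHopf.bm_cop_vol_tmul_one h.vol_mul, leftOp_apply, BraidedHopf.contract_apply]
  generalize H.cop vol = z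
  induction z with
  | zero => simp
  | add x y hx hy => simp only [map_add, LinearMap.add_apply, add_mul, hx, hy]
  | tmul x y => simp [H.ydAlg.bm_one_left, mul_comm]

/-- Replacing `t` by `t ◁ c` and using `c² = 1`, every value `⟨ψ, t⟩` is read off from `ψ ▷ vol`. -/
theorem IsIntegral.leftOp_injective (h : P.IsIntegral vol I c η) :
    Function.Injective (fun ψ => P.leftOp ψ vol) := by
  intro ψ χ hψ
  rw [← sub_eq_zero]
  refine h.left_nondeg _ fun t => ?_
  have h1 := h.integral_leftOp_mul (H.X.act t c) (ψ - χ)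
  rw [← H.ydAlg.act_mul, h.sq, H.ydAlg.act_one] at h1
  rw [← h1, map_sub, LinearMap.sub_apply]
  simp only at hψ
  rw [hψ]
  simp

theorem finrank_le_of_nondeg {M N : Type*} [AddCommGroup M] [Module k M] [AddCommGroup N]
    [Module k N] [Module.Finite k N] (β : M →ₗ[k] N →ₗ[k] k)
    (hβ : ∀ m, (∀ n, β m n = 0) → m = 0) :
    Module.Finite k M ∧ Module.finrank k M ≤ Module.finrank k N := by
  have hinj : Function.Injective β := by
    rw [injective_iff_map_eq_zero]
    intro m hm
    exact hβ m fun n => by rw [hm]; rfl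
  have : Module.Finite k M := Module.Finite.of_injective β hinj
  refine ⟨this, ?_⟩
  have h := LinearMap.finrank_le_finrank_of_injective hinj
  rwa [Subspace.dual_finrank_eq] at h

variable [Module.Finite k C]

theorem IsIntegral.finite (h : P.IsIntegral vol I c η) : Module.Finite k D :=
  (finrank_le_of_nondeg P.pair h.left_nondeg).1

theorem IsIntegral.finrank_eq (h : P.IsIntegral vol I c η) :
    Module.finrank k D = Module.finrank k C := by
  have := h.finite
  exact le_antisymm (finrank_le_of_nondeg P.pair h.left_nondeg).2
    (finrank_le_of_nondeg P.pair.flip h.right_nondeg).2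

theorem IsIntegral.leftOp_surjective (h : P.IsIntegral vol I c η) :
    Function.Surjective (fun ψ => P.leftOp ψ vol) := by
  have := h.finite
  have h1 : Function.Injective (LinearMap.applyₗ vol ∘ₗ P.leftOp.toLinearMap) := h.leftOp_injective
  exact (LinearMap.injective_iff_surjective_of_finrank_eq_finrank h.finrank_eq).1 h1

theorem IsIntegral.integral_nondeg (h : P.IsIntegral vol I c η) {x : C}
    (hx : ∀ y, I (x * y) = 0) : x = 0 := by
  obtain ⟨ψ, rfl⟩ := h.leftOp_surjective x
  have : ψ = 0 := h.left_nondeg ψ fun t => by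
    have h1 := h.integral_leftOp_mul (H.X.act t c) ψ
    rw [← H.ydAlg.act_mul, h.sq, H.ydAlg.act_one] at h1
    rw [← h1]
    exact hx _
  simp [this]

/-- Quasi-commutativity of the form. With `y = ψ ▷ vol`, the first integral identity gives `⟨ψ₀, S x
◁ ψ₁⟩`, and the second turns this back into an integral with `S² x` on the right. The coaction of
`y` is `ψ₁ c`, and the extra `c` cancels as `c² = 1`. -/
theorem IsIntegral.integral_mul_comm (h : P.IsIntegral vol I c η) (x y : C) :
    I (x * y) = I (LinearMap.mul' k C (LinearMap.lTensor C (H.X.act (H.anti (H.anti x)))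
      (H.X.coact y))) := by
  obtain ⟨ψ, rfl⟩ := h.leftOp_surjective y
  simp only
  rw [h.integral_mul_leftOp]
  refine H'.ydAlg.comodule.induction (p := fun ψ => P.pair (H'.twist ψ) (H.anti x) =
    I (LinearMap.mul' k C (LinearMap.lTensor C (H.X.act (H.anti (H.anti x)))
      (H.X.coact (P.leftOp ψ vol))))) (by simp) (fun a b ha hb => by
      simp only [map_add, LinearMap.add_apply, ha, hb]) ?_ ψ
  intro n ψ d hψ r j
  simp only [map_smul, LinearMap.smul_apply]
  congr 1
  rw [pair_twist_family hψ, leftOp_coact_family hψ h.coact_vol]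
  simp only [map_sum, LinearMap.lTensor_tmul, LinearMap.mul'_apply, ← H.anti_act,
    h.integral_leftOp_mul]
  simp only [H.anti_act, ← H.ydAlg.act_mul, mul_assoc, h.sq, mul_one]

/-- Integrating `S(S x · y) = S(y₀) S(S x ◁ y₁)` gives the right side of quasi-commutativity for `x`
and `S y`, because `S` commutes with action and coaction. -/
theorem IsIntegral.integral_anti_mul (h : P.IsIntegral vol I c η) {s : k}
    (hs : ∀ x, I (H.anti x) = s * I x) (x y : C) :
    s * I (H.anti x * y) = I (x * H.anti y) := by
  rw [← hs, H.anti_mul, h.integral_mul_comm, H.anti_coact]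
  congr 2
  generalize H.X.coact y = z
  induction z with
  | zero => simp
  | add a b ha hb => simp only [map_add, ha, hb]
  | tmul a b => simp [H.anti_act]

/-- The first integral identity at `b = vol`, for the `ψ` that sends `vol` to 1. Since `vol` spans a
one-dimensional crossed module, the twist contributes only the scalar `η(S c)`. -/
theorem IsIntegral.sign_eq (h : P.IsIntegral vol I c η) {s : k}
    (hs : H.anti vol = s • vol) (hI : I vol = 1) {ψ : D} (hψ : P.leftOp ψ vol = 1) :
    1 = s * η (HopfAlgebra.antipode k c) * P.pair ψ vol := by
  have h1 := h.integral_mul_leftOp vol ψ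
  rw [hψ, mul_one, hI, hs, map_smul, smul_eq_mul] at h1
  rw [h1, mul_assoc]
  congr 1
  clear h1 hψ
  refine H'.ydAlg.comodule.induction (p := fun ψ => P.pair (H'.twist ψ) vol =
    η (HopfAlgebra.antipode k c) * P.pair ψ vol) (by simp) (fun a b ha hb => by
      simp only [map_add, LinearMap.add_apply, ha, hb, mul_add]) ?_ ψ
  intro n ψ d hψ r j
  have h3 := congrArg η (P.coact (ψ j) vol)
  rw [hψ.coact, h.coact_vol] at h3
  simp only [map_sum, LinearMap.rTensor_tmul, TensorProduct.lid_tmul, map_smul,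
    LinearMap.flip_apply, smul_eq_mul] at h3
  simp only [map_smul, LinearMap.smul_apply, smul_eq_mul, pair_twist_family hψ, h.act_vol]
  rw [mul_left_comm, mul_comm (η _), ← h3]
  simp only [mul_comm]

/-- The Fourier transform intertwines the antipodes up to a sign. -/
theorem IsIntegral.fourier_anti (h : P.IsIntegral vol I c η) {s : k} (hs2 : s * s = 1)
    (hs : ∀ x, I (H.anti x) = s * I x) {F : C →ₗ[k] D} (hF : ∀ b t, P.pair (F b) t = I (b * t))
    (b : C) : F (H.anti b) = s • H'.anti (F b) := by
  rw [← sub_eq_zero]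
  refine h.left_nondeg _ fun t => ?_
  rw [map_sub, LinearMap.sub_apply, map_smul, LinearMap.smul_apply, P.anti, hF, hF, smul_eq_mul,
    ← h.integral_anti_mul hs, ← mul_assoc, hs2, one_mul, sub_self]

theorem IsIntegral.fourier_bijective (h : P.IsIntegral vol I c η) {F : C →ₗ[k] D}
    (hF : ∀ b t, P.pair (F b) t = I (b * t)) : Function.Bijective F := by
  have := h.finite
  have h1 : Function.Injective F := by
    rw [injective_iff_map_eq_zero]
    intro b hb
    refine h.integral_nondeg fun t => ?_
    rw [← hF, hb]
    simp
  exact ⟨h1, (LinearMap.injective_iff_surjective_of_finrank_eq_finrank h.finrank_eq.symm).1 h1⟩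

theorem IsIntegral.twistInv_twist (h : P.IsIntegral vol I c η)
    (hA : Function.Bijective (HopfAlgebra.antipode k (A := A))) (ψ : D) :
    H'.twistInv (H'.twist ψ) = ψ := by
  have := h.finite
  have h1 : H'.twist * H'.twistInv = 1 := LinearMap.ext (BraidedHopf.twist_twistInv hA)
  have h2 := mul_eq_one_comm.1 h1
  exact congrArg (fun f => f ψ) h2

/-- The contraction of `Ψ⁻¹ exp` with a functional. -/
theorem IsIntegral.pair_twist_contract (h : P.IsIntegral vol I c η)
    (hA : Function.Bijective (HopfAlgebra.antipode k (A := A))) {e : C ⊗[k] D}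
    (he : ∀ φ, TensorProduct.lid k D (LinearMap.rTensor D (P.pair φ) e) = φ)
    (α : D →ₗ[k] k) (ψ : D) :
    P.pair (H'.twist ψ) (TensorProduct.lid k C (LinearMap.rTensor C α
      (braidInv H'.X.act H.X.coact e))) = α ψ := by
  have hS : ∀ a : A, antipodeInv k A (HopfAlgebra.antipode k a) = a := by
    intro a
    rw [antipodeInv, linInverse, dif_pos hA]
    exact (LinearEquiv.ofBijective _ hA).symm_apply_apply a
  conv_rhs => rw [← h.twistInv_twist hA ψ]
  generalize H'.twist ψ = χ
  refine H'.ydAlg.comodule.induction (p := fun χ => P.pair χ (TensorProduct.lid k C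
    (LinearMap.rTensor C α (braidInv H'.X.act H.X.coact e))) = α (H'.twistInv χ)) (by simp)
    (fun a b ha hb => by simp only [map_add, LinearMap.add_apply, ha, hb]) ?_ χ
  intro n χ d hχ r j
  simp only [map_smul, LinearMap.smul_apply]
  congr 1
  have h1 : H'.twistInv (χ j) = ∑ i, H'.X.act (χ i) (antipodeInv k A (antipodeInv k A (d i j))) := by
    simp [BraidedHopf.twistInv, hχ.coact]
  rw [h1]
  conv_rhs => enter [2, 2, i, 1]; rw [← he (χ i)]
  clear he h1
  refine H.ydAlg.comodule.tensor_induction (p := fun e => P.pair (χ j) (TensorProduct.lid k C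
    (LinearMap.rTensor C α (braidInv H'.X.act H.X.coact e))) =
    α (∑ i, H'.X.act (TensorProduct.lid k D (LinearMap.rTensor D (P.pair (χ i)) e))
      (antipodeInv k A (antipodeInv k A (d i j))))) (by simp)
    (fun a b ha hb => by
      simp only [map_add, LinearMap.add_apply, ha, hb, Finset.sum_add_distrib]) ?_ e
  intro m x b hx q φ
  -- The adjunction for coactions trades the coaction of `χ` for the antipode of that of `b`; this
  -- cancels one of the two `S⁻¹` in the inverse twist and leaves the single `S⁻¹` of the inverse
  -- braiding.
  have h2 := congrArg (fun a => α (H'.X.act φ (antipodeInv k A (antipodeInv k A a))))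
    (sum_pair_family (P := P) hχ hx j q)
  simp only [map_sum, map_smul, hS, smul_eq_mul] at h2
  simp only [LinearMap.rTensor_tmul, TensorProduct.lid_tmul, map_sum, map_smul,
    LinearMap.smul_apply, smul_eq_mul, h2]
  simp [braidInv, braid, hx.coact, mul_comm]

theorem IsIntegral.eq_of_pair_twist (hA : Function.Bijective (HopfAlgebra.antipode k (A := A)))
    (h : P.IsIntegral vol I c η) {x y : C}
    (hxy : ∀ ψ, P.pair (H'.twist ψ) x = P.pair (H'.twist ψ) y) : x = y := by
  rw [← sub_eq_zero]
  refine h.right_nondeg _ fun φ => ?_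
  rw [← BraidedHopf.twist_twistInv hA φ, map_sub, hxy, sub_self]

/-- The adjoint Fourier transform is inverse to the Fourier transform up to the antipode. -/
theorem IsIntegral.fourierStar_fourier (h : P.IsIntegral vol I c η)
    (hA : Function.Bijective (HopfAlgebra.antipode k (A := A))) {F : C →ₗ[k] D}
    (hF : ∀ b t, P.pair (F b) t = I (b * t)) {J : D →ₗ[k] k} {μ : k}
    (hJ : ∀ φ, J φ = μ * P.pair φ vol) {G : D →ₗ[k] C}
    (hG : ∀ φ ψ, P.pair (H'.twist ψ) (G φ) = J (φ * ψ)) (b : C) :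
    G (F b) = μ • H.anti b := by
  refine h.eq_of_pair_twist hA fun ψ => ?_
  rw [hG, hJ, map_smul, smul_eq_mul, ← h.integral_mul_leftOp, ← hF, pair_leftOp]

end HopfPairing

/-! ### Crossed modules, their duals and their super versions -/

namespace CrossedData

section Dual

variable {k A V : Type*} [Field k] [Ring A] [HopfAlgebra k A] [AddCommGroup V] [Module k V]
  {X : CrossedData k A V}

/-- Multiplying the compatibility on the left by `a₁` cancels the factor `S a₂` in the `A`-leg. -/
theorem IsCrossedModule.isYD (hX : X.IsCrossedModule) : X.IsYD := by
  refine isYD_of_sum hX.act_one hX.act_mul ⟨hX.coact_counit, hX.coact_coassoc⟩ ?_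
  intro m x d hx n c hc s i j
  have h1 : ∀ l, X.coact (X.act (x s) (c l j)) = ∑ p, ∑ q, ∑ r, X.act (x r) (c p q) ⊗ₜ[k]
      (HopfAlgebra.antipode k (c l p) * (d r s * c q j)) := by
    intro l
    rw [hX.crossed, crossedRHS, hc.comul, hx.coact]
    simp only [map_sum, LinearMap.lTensor_tmul, hc.comul, TensorProduct.tmul_sum,
      TensorProduct.lift.tmul, LinearMap.compl₂_apply, LinearMap.comp_apply, actTensor,
      LinearMap.sum_apply, TensorProduct.map_tmul, TensorProduct.homTensorHomMap_apply,
      LinearMap.coe_lTensorHom, LinearMap.mul_apply']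
  simp only [h1, map_sum, LinearMap.lTensor_tmul, LinearMap.mul_apply', ← mul_assoc]
  rw [sum_rev₄]
  calc _ = ∑ r, ∑ q, ∑ p, X.act (x r) (c p q) ⊗ₜ[k]
        ((∑ l, c i l * HopfAlgebra.antipode k (c l p)) * d r s * c q j) := by
        simp only [Finset.sum_mul, TensorProduct.tmul_sum]
    _ = _ := by
        simp only [hc.mul_antipode]
        rw [Finset.sum_comm]
        refine Finset.sum_congr rfl fun q _ => Finset.sum_congr rfl fun r _ => ?_
        rw [Finset.sum_eq_single i]
        · simp
        · intro p _ hp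
          simp [Ne.symm hp]
        · simp

theorem antipode_antipodeInv (hA : Function.Bijective (HopfAlgebra.antipode k (A := A))) (a : A) :
    HopfAlgebra.antipode k (antipodeInv k A a) = a := by
  rw [antipodeInv, linInverse, dif_pos hA]
  exact (LinearEquiv.ofBijective _ hA).apply_symm_apply a

theorem antipodeInv_antipode (hA : Function.Bijective (HopfAlgebra.antipode k (A := A))) (a : A) :
    antipodeInv k A (HopfAlgebra.antipode k a) = a := by
  rw [antipodeInv, linInverse, dif_pos hA]
  exact (LinearEquiv.ofBijective _ hA).symm_apply_apply a

variable [Module.Finite k V]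

theorem dual_isDualOf (hA : Function.Bijective (HopfAlgebra.antipode k (A := A))) :
    X.dual.IsDualOf X := by
  constructor
  · intro f a v
    simp [dual, antipodeInv_antipode hA]
  · intro f v
    have h1 : ∀ z : Module.Dual k V ⊗[k] A, TensorProduct.lid k A
        (LinearMap.rTensor A (Module.Dual.eval k V v) z) = dualTensorHomEquiv k V A z v := by
      intro z
      induction z with
      | zero => simp
      | add a b ha hb => simp only [map_add, LinearMap.add_apply, ha, hb]
      | tmul a b => simp
    rw [h1]
    simp [dual]

theorem dual_isYD (hA : Function.Bijective (HopfAlgebra.antipode k (A := A))) (hX : X.IsYD) :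
    X.dual.IsYD := by
  have hinv := antipode_antipodeInv hA
  let b := Module.finBasis k V
  have hD := dual_isDualOf (X := X) hA
  have hfam := hD.family hX b
  have hbf := hX.comodule.basis_family b
  refine ⟨fun f => ?_, fun f x y => ?_, ⟨fun f => ?_, fun f => ?_⟩, fun f a => ?_⟩
  · rw [← HopfAlgebra.antipode_one (R := k)]
    refine LinearMap.ext fun v => ?_
    rw [hD.act, hX.act_one]
  · refine LinearMap.ext fun v => ?_
    rw [← hinv x, ← hinv y, ← HopfAlgebra.antipode_mul_antidistrib, hD.act, hD.act, hD.act,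
      hX.act_mul]
  · have h : (TensorProduct.rid k _).toLinearMap ∘ₗ LinearMap.lTensor _ Coalgebra.counit ∘ₗ
        X.dual.coact = LinearMap.id := by
      refine b.dualBasis.ext fun j => ?_
      rw [b.coe_dualBasis, LinearMap.comp_apply, LinearMap.comp_apply, hfam.coact]
      simp [hbf.comatrix.counit, Matrix.one_apply]
    exact congrArg (fun F => F f) h
  · have h : (TensorProduct.assoc k _ A A).toLinearMap ∘ₗ LinearMap.rTensor A X.dual.coact ∘ₗ
        X.dual.coact = LinearMap.lTensor _ Coalgebra.comul ∘ₗ X.dual.coact := by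
      refine b.dualBasis.ext fun j => ?_
      rw [b.coe_dualBasis, LinearMap.comp_apply, LinearMap.comp_apply, LinearMap.comp_apply,
        hfam.coact]
      simp only [map_sum, LinearMap.rTensor_tmul, LinearMap.lTensor_tmul, hfam.coact,
        hfam.comatrix.comul, TensorProduct.tmul_sum, TensorProduct.sum_tmul,
        LinearEquiv.coe_coe, TensorProduct.assoc_tmul]
      rw [Finset.sum_comm]
    exact congrArg (fun F => F f) h
  -- The action of the dual is adjoint to that of `V` at elements `S a`; surjectivity of `S` allows
  -- only those to be considered.
  · obtain ⟨a, rfl⟩ := hA.2 a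
    suffices h : ∀ s, X.dual.coactAct (b.coord s) ∘ₗ Coalgebra.comul (R := k) ∘ₗ
        HopfAlgebra.antipode k = X.dual.actTensor (X.dual.coact (b.coord s)) ∘ₗ
        Coalgebra.comul (R := k) ∘ₗ HopfAlgebra.antipode k by
      have h2 : X.dual.coactAct.flip (Coalgebra.comul (R := k) (HopfAlgebra.antipode k a)) =
          (X.dual.actTensor ∘ₗ X.dual.coact).flip
            (Coalgebra.comul (R := k) (HopfAlgebra.antipode k a)) := by
        refine b.dualBasis.ext fun j => ?_
        rw [b.coe_dualBasis]
        exact congrArg (fun F => F a) (h j)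
      exact congrArg (fun F => F f) h2
    intro s
    refine comatrix_ext (k := k) (A := A) (N := Module.Dual k V ⊗[k] A) fun n c hc i j => ?_
    simp only [LinearMap.comp_apply, hc.comul_antipode]
    have key : ∀ z w : Module.Dual k V ⊗[k] A, (∀ m, TensorProduct.lid k A
        (LinearMap.rTensor A (Module.Dual.eval k V (b m)) z) = TensorProduct.lid k A
        (LinearMap.rTensor A (Module.Dual.eval k V (b m)) w)) → z = w := by
      intro z w h
      rw [← sub_eq_zero]
      refine tensor_eq_zero_of_separating (k := k) (M := Module.Dual k V) (N := A)
        (Module.Dual.eval k V) (fun f hf => LinearMap.ext hf) _ fun v => ?_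
      have h2 : (TensorProduct.lid k A).toLinearMap ∘ₗ (LinearMap.rTensorHom A).flip (z - w) ∘ₗ
          Module.Dual.eval k V = 0 := by
        refine b.ext fun m => ?_
        simp [h m]
      exact congrArg (fun F => F v) h2
    refine key _ _ fun m => ?_
    -- The compatibility for the dual is the antipode applied to the compatibility for `V`, in
    -- matrix coefficients: `S` reverses products and coproducts, so the two sides are exchanged.
    have hm := congrArg (fun z => HopfAlgebra.antipode k (TensorProduct.lid k A
      (LinearMap.rTensor A (b.coord s) z))) (hX.sum_coact_act hbf hc m i j)
    have h1 : ∀ (x : A) (z : V ⊗[k] A), TensorProduct.lid k A (LinearMap.rTensor A (b.coord s)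
        (LinearMap.lTensor V (LinearMap.mul k A x) z)) =
          x * TensorProduct.lid k A (LinearMap.rTensor A (b.coord s) z) := by
      intro x z
      induction z with
      | zero => simp
      | add a b ha hb => simp only [map_add, ha, hb, mul_add]
      | tmul a b => simp
    have h1' : ∀ (v : V) (x : A) (z : Module.Dual k V ⊗[k] A), TensorProduct.lid k A
        (LinearMap.rTensor A (Module.Dual.eval k V v)
          (LinearMap.lTensor _ (LinearMap.mul k A x) z)) =
          x * TensorProduct.lid k A (LinearMap.rTensor A (Module.Dual.eval k V v) z) := by
      intro v x z
      induction z with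
      | zero => simp
      | add a b ha hb => simp only [map_add, ha, hb, mul_add]
      | tmul a b => simp
    have h3 : ∀ w, TensorProduct.lid k A (LinearMap.rTensor A (b.coord s) (X.coact w)) =
        ∑ r, b.coord r w • coeffMatrix X.coact b s r := by
      intro w
      conv_lhs => rw [← b.sum_repr w]
      simp only [map_sum, map_smul]
      rfl
    have h4 : ∀ f : Module.Dual k V, TensorProduct.lid k A (LinearMap.rTensor A f
        (X.coact (b m))) = ∑ r, f (b r) • coeffMatrix X.coact b r m := by
      intro f
      rw [hbf.coact]
      simp
    simp only [map_sum, h1, h3, LinearMap.rTensor_tmul, TensorProduct.lid_tmul, map_smul,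
      HopfAlgebra.antipode_mul_antidistrib, Finset.sum_mul, smul_mul_assoc] at hm
    simp only [map_sum, hfam.coact, coactAct, LinearMap.mk₂_apply, LinearMap.lTensor_tmul,
      TensorProduct.lift.tmul, LinearMap.comp_apply, LinearMap.coe_lTensorHom, h1', hD.coact, h4,
      hD.act, actTensor, TensorProduct.map_tmul, TensorProduct.homTensorHomMap_apply,
      LinearMap.sum_apply, LinearMap.rTensor_tmul, TensorProduct.lid_tmul, Module.Dual.eval_apply,
      LinearMap.mul_apply', map_smul, Finset.mul_sum, mul_smul_comm]
    exact hm.symm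

end Dual

/-! ### Absorbing the signs: the super version over the group algebra of {1, -1} -/

section Super

variable {k A V : Type*} [Field k] [Ring A] [HopfAlgebra k A] [AddCommGroup V] [Module k V]

variable (k A) in
/-- The algebra homomorphism `u a ↦ u ^ n a` from the group algebra of `{1, -1}` over `A`. -/
def signEval (n : ℕ) : MonoidAlgebra A ℤˣ →ₐ[k] A :=
  MonoidAlgebra.liftNCAlgHom (AlgHom.id k A)
    ((algebraMap k A : k →* A).comp (((Int.castRingHom k : ℤ →* k).comp (Units.coeHom ℤ)).comp
      (powMonoidHom n)))
    (fun x _ => (Algebra.commutes _ x).symm)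

theorem signEval_single (n : ℕ) (u : ℤˣ) (a : A) :
    signEval k A n (MonoidAlgebra.single u a) = (((u : ℤ) : k) ^ n) • a := by
  simp [signEval, MonoidAlgebra.liftNCAlgHom, Algebra.smul_def]
  exact (((u : ℤ).cast_commute a).pow_left n).symm.eq

theorem super_ext {N : Type*} [AddCommGroup N] [Module k N] {f g : MonoidAlgebra A ℤˣ →ₗ[k] N}
    (h : ∀ u a, f (MonoidAlgebra.single u a) = g (MonoidAlgebra.single u a)) : f = g :=
  MonoidAlgebra.lhom_ext' fun u => LinearMap.ext fun a => h u a

/-- The crossed module over the group algebra of `{1, -1}` over `A` whose braiding is `-Ψ`. -/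
def super (X : CrossedData k A V) : CrossedData k (MonoidAlgebra A ℤˣ) V where
  act := X.act.compl₂ (signEval k A 1).toLinearMap
  coact := LinearMap.lTensor V (MonoidAlgebra.lsingle (R := k) (-1)) ∘ₗ X.coact

variable {X : CrossedData k A V}

theorem super_act_single (v : V) (u : ℤˣ) (a : A) :
    X.super.act v (MonoidAlgebra.single u a) = ((u : ℤ) : k) • X.act v a := by
  simp [super, signEval_single]

theorem super_braiding : X.super.braiding = -X.braiding := by
  refine TensorProduct.ext' fun v w => ?_
  simp only [braiding, braid, TensorProduct.lift.tmul, LinearMap.compl₂_apply,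
    LinearMap.comp_apply, LinearMap.neg_apply, super]
  generalize X.coact w = z
  induction z with
  | zero => simp
  | add a b ha hb => simp only [map_add, ha, hb, neg_add]
  | tmul a b => simp [signEval_single, TensorProduct.tmul_neg]

variable {ι : Type*} [Fintype ι] [DecidableEq ι]

theorem IsComatrix.single {c : Matrix ι ι A} (hc : IsComatrix k c) (u : ℤˣ) :
    IsComatrix k (fun i j => MonoidAlgebra.single u (c i j)) :=
  ⟨fun i j => by simp [hc.comul], fun i j => by simp [hc.counit]⟩

theorem super_family {x : ι → V} {c : Matrix ι ι A} (hx : IsFamily X.coact x c) :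
    IsFamily X.super.coact x (fun i j => MonoidAlgebra.single (-1) (c i j)) :=
  ⟨IsComatrix.single hx.comatrix _, fun j => by simp [super, hx.coact]⟩

theorem IsYD.super (hX : X.IsYD) : X.super.IsYD := by
  refine ⟨fun v => ?_, fun v a b => ?_, ⟨fun v => ?_, fun v => ?_⟩, fun v a => ?_⟩
  · simp [CrossedData.super, hX.act_one]
  · simp [CrossedData.super, hX.act_mul]
  · refine hX.comodule.induction (p := fun v => TensorProduct.rid k V (LinearMap.lTensor V
      Coalgebra.counit (X.super.coact v)) = v) (by simp)
      (fun a b ha hb => by simp only [map_add, ha, hb]) ?_ v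
    intro n x c hx r j
    rw [map_smul, map_smul, map_smul, (super_family hx).coact]
    simp [hx.comatrix.counit, Matrix.one_apply]
  · refine hX.comodule.induction (p := fun v => TensorProduct.assoc k V _ _
      (LinearMap.rTensor _ X.super.coact (X.super.coact v)) =
      LinearMap.lTensor V Coalgebra.comul (X.super.coact v)) (by simp)
      (fun a b ha hb => by simp only [map_add, ha, hb]) ?_ v
    intro n x c hx r j
    have hs := super_family hx
    simp only [map_smul, hs.coact, map_sum, LinearMap.rTensor_tmul, LinearMap.lTensor_tmul,
      hs.comatrix.comul, TensorProduct.tmul_sum, TensorProduct.sum_tmul, TensorProduct.assoc_tmul]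
    rw [Finset.sum_comm]
  · suffices h : X.super.coactAct v ∘ₗ Coalgebra.comul (R := k) =
        X.super.actTensor (X.super.coact v) ∘ₗ Coalgebra.comul (R := k) from
      congrArg (fun F => F a) h
    refine MonoidAlgebra.lhom_ext' fun u => comatrix_ext fun n c hc i j => ?_
    refine hX.comodule.induction (p := fun v => ((X.super.coactAct v ∘ₗ Coalgebra.comul (R := k)) ∘ₗ
      MonoidAlgebra.lsingle u) (c i j) = ((X.super.actTensor (X.super.coact v) ∘ₗ
      Coalgebra.comul (R := k)) ∘ₗ MonoidAlgebra.lsingle u) (c i j)) (by simp)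
      (fun a b ha hb => by
        simp only [LinearMap.comp_apply, map_add, LinearMap.add_apply] at ha hb ⊢
        rw [ha, hb]) ?_ v
    intro m x d hx r s
    have h1 := congrArg (LinearMap.lTensor V (MonoidAlgebra.lsingle (R := k) (-u)))
      (hX.sum_coact_act hx hc s i j)
    have h2 := congrArg (fun z => r • ((u : ℤ) : k) • z) h1
    simp only [map_smul, LinearMap.smul_apply, LinearMap.comp_apply, MonoidAlgebra.lsingle_apply,
      (IsComatrix.single hc u).comul, (super_family hx).coact, map_sum, LinearMap.sum_apply,
      actTensor, TensorProduct.map_tmul, TensorProduct.homTensorHomMap_apply,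
      LinearMap.mul_apply', MonoidAlgebra.single_mul_single, super_act_single]
    simp only [map_sum, LinearMap.lTensor_tmul, MonoidAlgebra.lsingle_apply, Finset.smul_sum] at h2
    simp only [coactAct, LinearMap.mk₂_apply, LinearMap.lTensor_tmul, LinearMap.comp_apply,
      super_act_single, map_smul, TensorProduct.lift.tmul, LinearMap.coe_lTensorHom]
    simp only [Finset.smul_sum, neg_mul, one_mul, TensorProduct.smul_tmul']
    refine Eq.trans ?_ (h2.trans ?_)
    · refine Finset.sum_congr rfl fun l _ => ?_
      congr 2
      simp only [CrossedData.super, LinearMap.comp_apply]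
      generalize X.coact _ = z
      induction z with
      | zero => simp
      | add a b ha hb => simp only [map_add, ha, hb]
      | tmul a b => simp
    · simp only [TensorProduct.smul_tmul']

theorem super_antipode_bijective (hA : Function.Bijective (HopfAlgebra.antipode k (A := A))) :
    Function.Bijective (HopfAlgebra.antipode k (A := MonoidAlgebra A ℤˣ)) := by
  constructor
  · rw [injective_iff_map_eq_zero]
    intro h hh
    have h1 : ∀ (u : ℤˣ) (h : MonoidAlgebra A ℤˣ),
        (HopfAlgebra.antipode k h).coeff u = HopfAlgebra.antipode k (h.coeff u) := by
      intro u h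
      induction h using MonoidAlgebra.induction_linear with
      | zero => simp
      | add a b ha hb => simp [ha, hb]
      | single v a =>
        by_cases huv : v = u
        · simp [huv]
        · simp [huv]
    ext u
    refine hA.1 ?_
    rw [← h1, hh]
    simp
  · intro h
    induction h using MonoidAlgebra.induction_linear with
    | zero => exact ⟨0, map_zero _⟩
    | add a b ha hb =>
      obtain ⟨x, rfl⟩ := ha
      obtain ⟨y, rfl⟩ := hb
      exact ⟨x + y, map_add _ _ _⟩
    | single v a =>
      obtain ⟨b, rfl⟩ := hA.2 a
      exact ⟨MonoidAlgebra.single v b, by simp⟩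

theorem antipodeInv_single (hA : Function.Bijective (HopfAlgebra.antipode k (A := A))) (u : ℤˣ)
    (a : A) : antipodeInv k (MonoidAlgebra A ℤˣ) (MonoidAlgebra.single u a) =
      MonoidAlgebra.single u (antipodeInv k A a) := by
  refine (super_antipode_bijective hA).1 ?_
  rw [antipode_antipodeInv (super_antipode_bijective hA)]
  simp [antipode_antipodeInv hA]

/-- Duality is kept as a relation because the super version of the dual carries the structure used
here, whereas the dual of the super version would be a different construction. -/
theorem IsDualOf.super {Z : CrossedData k A (Module.Dual k V)} (h : Z.IsDualOf X) :
    Z.super.IsDualOf X.super := by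
  constructor
  · intro f a v
    suffices hs : Module.Dual.eval k V v ∘ₗ Z.super.act f ∘ₗ HopfAlgebra.antipode k =
        f ∘ₗ X.super.act v from congrArg (fun F => F a) hs
    refine super_ext fun u a => ?_
    simp [super_act_single, h.act]
  · intro f v
    have h1 := congrArg (MonoidAlgebra.lsingle (R := k) (-1 : ℤˣ)) (h.coact f v)
    simp only [CrossedData.super, LinearMap.comp_apply]
    refine Eq.trans ?_ (h1.trans ?_)
    · generalize Z.coact f = z
      induction z with
      | zero => simp
      | add a b ha hb => simp only [map_add, ha, hb]
      | tmul a b => simp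
    · generalize X.coact v = z
      induction z with
      | zero => simp
      | add a b ha hb => simp only [map_add, ha, hb]
      | tmul a b => simp

end Super

end CrossedData

/-! ### Morphisms of crossed modules and the metric -/

namespace CrossedData

section Morphisms

variable {k A V W : Type*} [Field k] [Ring A] [HopfAlgebra k A] [AddCommGroup V] [Module k V]
  [AddCommGroup W] [Module k W] {ι : Type*} [Fintype ι] [DecidableEq ι]

/-- Morphisms of crossed modules. -/
structure IsMorphism (Z : CrossedData k A W) (X : CrossedData k A V) (θ : W →ₗ[k] V) : Prop where
  act : ∀ w a, θ (Z.act w a) = X.act (θ w) a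
  coact : ∀ w, X.coact (θ w) = LinearMap.rTensor A θ (Z.coact w)

/-- The functoriality of the tensor algebra. -/
def tensorMap (θ : W →ₗ[k] V) : TensorAlgebra k W →ₐ[k] TensorAlgebra k V :=
  TensorAlgebra.lift k (TensorAlgebra.ι k ∘ₗ θ)

local notation "𝓲" => TensorAlgebra.ι k

theorem tensorMap_ι (θ : W →ₗ[k] V) (w : W) : tensorMap θ (𝓲 w) = 𝓲 (θ w) := by
  simp [tensorMap]

theorem tensorMap_comp {U : Type*} [AddCommGroup U] [Module k U] (θ : W →ₗ[k] V) (χ : U →ₗ[k] W)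
    (t : TensorAlgebra k U) : tensorMap θ (tensorMap χ t) = tensorMap (θ ∘ₗ χ) t := by
  suffices h : (tensorMap θ).comp (tensorMap χ) = tensorMap (θ ∘ₗ χ) from
    congrArg (fun f => f t) h
  ext u
  simp [tensorMap_ι]

theorem tensorMap_id (t : TensorAlgebra k V) : tensorMap LinearMap.id t = t := by
  suffices h : tensorMap LinearMap.id = AlgHom.id k (TensorAlgebra k V) from
    congrArg (fun f => f t) h
  ext u
  simp [tensorMap_ι]

theorem tensorMap_toTensorAlgebra (θ : W →ₗ[k] V) {m : ℕ} (w : ⨂[k]^m W) :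
    tensorMap θ (TensorPower.toTensorAlgebra w) =
      TensorPower.toTensorAlgebra (PiTensorProduct.map (fun _ => θ) w) := by
  suffices h : (tensorMap θ).toLinearMap ∘ₗ TensorPower.toTensorAlgebra =
      TensorPower.toTensorAlgebra ∘ₗ PiTensorProduct.map (fun _ : Fin m => θ) from
    congrArg (fun f => f w) h
  refine PiTensorProduct.ext ?_
  ext x
  simp [TensorPower.toTensorAlgebra_tprod, TensorAlgebra.tprod_apply, map_list_prod,
    List.map_ofFn, Function.comp_def, tensorMap_ι]

theorem counit_tensorMap (θ : W →ₗ[k] V) (t : TensorAlgebra k W) :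
    TensorAlgebra.algebraMapInv (tensorMap θ t) = TensorAlgebra.algebraMapInv t := by
  suffices h : (TensorAlgebra.algebraMapInv (R := k)).comp (tensorMap θ) =
      TensorAlgebra.algebraMapInv from congrArg (fun f => f t) h
  ext u
  simp [tensorMap_ι, TensorAlgebra.algebraMapInv]

theorem degOne_tensorMap (θ : W →ₗ[k] V) (t : TensorAlgebra k W) :
    degOne k V (tensorMap θ t) = θ (degOne k W t) := by
  induction t using tensorAlgebra_left_induction with
  | one => simp [degOne_one]
  | add s t hs ht => simp only [map_add, hs, ht]
  | smul r t ht => simp only [map_smul, ht]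
  | mul v t _ => rw [map_mul, tensorMap_ι, degOne_ι_mul, degOne_ι_mul, counit_tensorMap, map_smul]

variable {Z : CrossedData k A W} {X : CrossedData k A V} {θ : W →ₗ[k] V}

namespace IsMorphism

theorem tensorCoact (h : IsMorphism Z X θ) (t : TensorAlgebra k W) :
    X.tensorData.coact (tensorMap θ t) =
      LinearMap.rTensor A (tensorMap θ).toLinearMap (Z.tensorData.coact t) := by
  suffices hs : X.tensorCoact.comp (tensorMap θ) =
      (Algebra.TensorProduct.map (tensorMap θ) (AlgHom.id k A)).comp Z.tensorCoact from
    congrArg (fun f => f t) hs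
  ext w
  simp only [LinearMap.comp_apply, AlgHom.toLinearMap_apply, AlgHom.comp_apply, tensorMap_ι]
  rw [CrossedData.tensorCoact, CrossedData.tensorCoact, TensorAlgebra.lift_ι_apply,
    TensorAlgebra.lift_ι_apply, LinearMap.comp_apply, LinearMap.comp_apply, h.coact]
  generalize Z.coact w = z
  induction z with
  | zero => simp
  | add a b ha hb => simp only [map_add, ha, hb]
  | tmul a b => simp [tensorMap_ι]

theorem family (h : IsMorphism Z X θ) {x : ι → TensorAlgebra k W} {c : Matrix ι ι A}
    (hx : IsFamily Z.tensorData.coact x c) :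
    IsFamily X.tensorData.coact (fun i => tensorMap θ (x i)) c :=
  ⟨hx.comatrix, fun j => by rw [h.tensorCoact, hx.coact]; simp⟩

theorem tensorCop (h : IsMorphism Z X θ) (hX : X.IsYD) (hZ : Z.IsYD) (t : TensorAlgebra k W) :
    X.tensorCop (tensorMap θ t) =
      TensorProduct.map (tensorMap θ).toLinearMap (tensorMap θ).toLinearMap (Z.tensorCop t) := by
  induction t using tensorAlgebra_left_induction with
  | one => simp [tensorCop_one]
  | add s t hs ht => simp only [map_add, hs, ht]
  | smul r t ht => simp only [map_smul, ht]
  | mul v t ht =>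
    rw [map_mul, tensorMap_ι, tensorCop_ι_mul, tensorCop_ι_mul, ht]
    refine hZ.tensorData_comodule.tensor_induction (p := fun z => X.tensorData.bm (prim k V (θ v))
      (TensorProduct.map (tensorMap θ).toLinearMap (tensorMap θ).toLinearMap z) =
      TensorProduct.map (tensorMap θ).toLinearMap (tensorMap θ).toLinearMap
        (Z.tensorData.bm (prim k W v) z)) (by simp)
      (fun a b ha hb => by simp only [map_add, ha, hb]) ?_ _
    intro n x c hx j y
    rw [TensorProduct.map_tmul, bm_prim_family hZ hx]
    refine (bm_prim_family hX (h.family hx) (θ v) _ j).trans ?_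
    simp [tensorMap_ι, h.act]

theorem tensorAnti (h : IsMorphism Z X θ) (hZ : Z.IsYD) (t : TensorAlgebra k W) :
    X.tensorAnti (tensorMap θ t) = tensorMap θ (Z.tensorAnti t) := by
  induction t using tensorAlgebra_left_induction with
  | one => simp [tensorAnti_one]
  | add s t hs ht => simp only [map_add, hs, ht]
  | smul r t ht => simp only [map_smul, ht]
  | mul v t ht =>
    rw [map_mul, tensorMap_ι, tensorAnti_ι_mul, tensorAnti_ι_mul, ht]
    refine hZ.tensorData_comodule.induction (p := fun t => X.antiStep (θ v) (tensorMap θ t) =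
      tensorMap θ (Z.antiStep v t)) (by simp)
      (fun a b ha hb => by simp only [map_add, ha, hb]) ?_ _
    intro n x c hx r j
    rw [map_smul, map_smul, map_smul, map_smul, antiStep_family hx,
      antiStep_family (h.family hx)]
    simp [tensorMap_ι, h.act]

theorem partialD (h : IsMorphism Z X θ) (hX : X.IsYD) (hZ : Z.IsYD) (f : Module.Dual k V)
    (t : TensorAlgebra k W) :
    X.partialD f (tensorMap θ t) = tensorMap θ (Z.partialD (f ∘ₗ θ) t) := by
  rw [partialD_apply, partialD_apply, h.tensorCop hX hZ]
  generalize Z.tensorCop t = z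
  induction z with
  | zero => simp
  | add a b ha hb => simp only [map_add, ha, hb]
  | tmul a b => simp [degOne_tensorMap]

theorem diffPairing (h : IsMorphism Z X θ) (hX : X.IsYD) (hZ : Z.IsYD)
    (φ : TensorAlgebra k (Module.Dual k V)) (t : TensorAlgebra k W) :
    X.diffPairing φ (tensorMap θ t) = Z.diffPairing (tensorMap θ.dualMap φ) t := by
  induction φ using tensorAlgebra_right_induction generalizing t with
  | one => simp [diffPairing_one, counit_tensorMap]
  | add s t hs ht => simp only [map_add, LinearMap.add_apply, hs, ht]
  | smul r t ht => simp only [map_smul, LinearMap.smul_apply, ht]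
  | mul φ f hφ =>
    rw [diffPairing_mul_ι, h.partialD hX hZ, hφ, map_mul, tensorMap_ι, diffPairing_mul_ι]
    rfl

/-- A morphism is adjoint, for the pairings, to the algebra map induced by its transpose; when it is
bijective this adjoint is surjective. -/
theorem radical (h : IsMorphism Z X θ) (hX : X.IsYD) (hZ : Z.IsYD)
    (hθ : Function.Bijective θ) (t : TensorAlgebra k W) :
    (∀ φ, X.diffPairing φ (tensorMap θ t) = 0) ↔ ∀ φ, Z.diffPairing φ t = 0 := by
  refine ⟨fun ht φ => ?_, fun ht φ => by rw [h.diffPairing hX hZ, ht]⟩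
  let e := LinearEquiv.ofBijective θ hθ
  have h1 := ht (tensorMap (e.symm : V →ₗ[k] W).dualMap φ)
  rw [h.diffPairing hX hZ, tensorMap_comp] at h1
  have h2 : θ.dualMap ∘ₗ (e.symm : V →ₗ[k] W).dualMap = LinearMap.id := by
    ext f w
    simp only [LinearMap.comp_apply, LinearMap.dualMap_apply, LinearMap.id_apply]
    congr 1
    exact e.symm_apply_apply w
  rwa [h2, tensorMap_id] at h1

theorem super (h : IsMorphism Z X θ) : IsMorphism Z.super X.super θ := by
  refine ⟨fun w a => h.act w _, fun w => ?_⟩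
  simp only [CrossedData.super, LinearMap.comp_apply, h.coact]
  generalize Z.coact w = z
  induction z with
  | zero => simp
  | add a b ha hb => simp only [map_add, ha, hb]
  | tmul a b => simp

end IsMorphism

end Morphisms

/-! ### The metric as an isomorphism of crossed modules -/

section MetricMap

variable {k A V : Type*} [Field k] [Ring A] [HopfAlgebra k A] [AddCommGroup V] [Module k V]
  [Module.Finite k V] {X : CrossedData k A V} {g : V ⊗[k] V}
  {ι : Type*} [Fintype ι] [DecidableEq ι]

theorem metric_eq_sum (b : Module.Basis ι k V) : g = ∑ i, b i ⊗ₜ[k] metricMap g (b.coord i) :=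
  tensor_eq_sum_basis b g

variable {β : A ⊗[k] V →ₗ[k] A ⊗[k] V →ₗ[k] A}

/-- Applying the counit to `(v, g₁) g₂ = v` displays `v` in the image; dimensions of `V` and its
dual agree. -/
theorem IsInverseMetric.metricMap_bijective (h : X.IsInverseMetric g β) :
    Function.Bijective (metricMap g) := by
  have hsurj : Function.Surjective (metricMap g) := by
    intro v
    let b := Module.finBasis k V
    have h1 := h.left_inverse (1 ⊗ₜ v)
    rw [metric_eq_sum (g := g) b] at h1
    have h2 := congrArg (fun z => TensorProduct.lid k V
      (LinearMap.rTensor V (Coalgebra.counit (R := k) (A := A)) z)) h1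
    simp only [map_sum, TensorProduct.map_tmul, LinearMap.rTensor_tmul, TensorProduct.lid_tmul,
      Bialgebra.counit_one, one_smul, LinearMap.id_apply] at h2
    refine ⟨∑ i, Coalgebra.counit (R := k) (((β (1 ⊗ₜ v)) ∘ₗ TensorProduct.mk k A V 1) (b i)) •
      b.coord i, ?_⟩
    refine Eq.trans ?_ h2
    simp only [map_sum, map_smul]
  refine ⟨?_, hsurj⟩
  exact (LinearMap.injective_iff_surjective_of_finrank_eq_finrank Subspace.dual_finrank_eq).2 hsurj

/-- The identity `(ω, g₁) g₂ = ω` at `ω = g(f)` expands `g(f)` in the elements `g(bⁱ)`, where `bⁱ`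
is the dual basis; comparing coefficients shows that the inverse metric is scalar-valued on `V`. -/
theorem IsInverseMetric.apply_metricMap (h : X.IsInverseMetric g β) (f : Module.Dual k V)
    (w : V) : β (1 ⊗ₜ metricMap g f) (1 ⊗ₜ w) = algebraMap k A (f w) := by
  let b := Module.finBasis k V
  let e := LinearEquiv.ofBijective _ h.metricMap_bijective
  have he : ∀ f, e.symm (metricMap g f) = f := fun f => e.symm_apply_apply f
  have h1 := h.left_inverse (1 ⊗ₜ metricMap g f)
  conv_lhs at h1 => arg 2; rw [metric_eq_sum (g := g) b]
  have h2 := congrArg (fun z => TensorProduct.rid k A (LinearMap.lTensor A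
    (Module.Dual.eval k V w ∘ₗ (e.symm : V →ₗ[k] Module.Dual k V)) z)) h1
  simp only [map_sum, TensorProduct.map_tmul, LinearMap.lTensor_tmul, LinearMap.id_apply,
    LinearMap.comp_apply, LinearEquiv.coe_coe, he, TensorProduct.rid_tmul,
    Module.Dual.eval_apply] at h2
  rw [Algebra.algebraMap_eq_smul_one, ← h2]
  conv_lhs => rw [← b.sum_repr w]
  simp only [TensorProduct.tmul_sum, TensorProduct.tmul_smul, map_sum, map_smul]
  rfl

theorem formMul_comatrix {c : Matrix ι ι A} (hc : IsComatrix k c) (v : V) (i j : ι) :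
    X.formMul (c i j) (1 ⊗ₜ v) = ∑ l, c i l • (1 ⊗ₜ[k] X.act v (c l j)) := by
  simp [formMul, hc.comul, TensorProduct.homTensorHomMap_apply, TensorProduct.smul_tmul']

/-- Moving `a` through `( , )` from the right, across the tensor product over `A` and out on the
left gives invariance of the form; the counit removes the remaining elements of `A`. -/
theorem IsInverseMetric.sum_act_act (h : X.IsInverseMetric g β) {c : Matrix ι ι A}
    (hc : IsComatrix k c) {η : V →ₗ[k] V →ₗ[k] k}
    (hη : ∀ v w, β (1 ⊗ₜ v) (1 ⊗ₜ w) = algebraMap k A (η v w)) (v w : V) (i j : ι) :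
    ∑ l, η (X.act v (c i l)) (X.act w (c l j)) = (1 : Matrix ι ι k) i j * η v w := by
  have h1 := h.right_linear (1 ⊗ₜ v) (1 ⊗ₜ w) (c i j)
  simp only [formMul_comatrix hc, map_sum, ← h.balanced, LinearMap.sum_apply, h.left_linear,
    hη] at h1
  have h2 := congrArg (Coalgebra.counit (R := k)) h1
  simp only [map_sum, Bialgebra.counit_mul, hc.counit, Bialgebra.counit_algebraMap] at h2
  rw [mul_comm, ← h2]
  refine Finset.sum_congr rfl fun l _ => ?_
  simp [Matrix.one_apply]

theorem IsInverseMetric.form_act (h : X.IsInverseMetric g β) (hX : X.IsYD)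
    {η : V →ₗ[k] V →ₗ[k] k} (hη : ∀ v w, β (1 ⊗ₜ v) (1 ⊗ₜ w) = algebraMap k A (η v w)) (v w : V)
    (a : A) : η (X.act v (HopfAlgebra.antipode k a)) w = η v (X.act w a) := by
  suffices hs : η.flip w ∘ₗ X.act v ∘ₗ HopfAlgebra.antipode k = η v ∘ₗ X.act w from
    congrArg (fun f => f a) hs
  refine comatrix_ext (k := k) (A := A) (N := k) fun n c hc i j => ?_
  -- Invariance is applied to `v ◁ S a₁`, and the product `S(a₁) a₂` then cancels on the first
  -- argument.
  have h1 := fun q => h.sum_act_act hc hη (X.act v (HopfAlgebra.antipode k (c i q))) w q j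
  have h2 := Finset.sum_congr (s₁ := Finset.univ) rfl fun q _ => h1 q
  rw [Finset.sum_comm] at h2
  simp only [← hX.act_mul, ← LinearMap.sum_apply, ← map_sum, hc.antipode_mul] at h2
  have h3 : ∀ l, η (X.act v ((1 : Matrix (Fin n) (Fin n) A) i l)) (X.act w (c l j)) =
      if i = l then η v (X.act w (c l j)) else 0 := by
    intro l
    rw [Matrix.one_apply]
    split_ifs <;> simp [hX.act_one]
  simp only [h3] at h2
  simpa [Matrix.one_apply] using h2.symm

/-- Both the evaluation and the form have `S` as the adjoint of the action; since the form is
evaluation through `g⁻¹`, the map `g` is equivariant. -/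
theorem IsInverseMetric.metricMap_act (h : X.IsInverseMetric g β) (hX : X.IsYD)
    (hA : Function.Bijective (HopfAlgebra.antipode k (A := A))) (f : Module.Dual k V) (a : A) :
    metricMap g (X.dual.act f a) = X.act (metricMap g f) a := by
  obtain ⟨a, rfl⟩ := hA.2 a
  let e := LinearEquiv.ofBijective _ h.metricMap_bijective
  have he : ∀ f, e.symm (metricMap g f) = f := fun f => e.symm_apply_apply f
  have he' : ∀ v, metricMap g (e.symm v) = v := fun v => e.apply_symm_apply v
  let η : V →ₗ[k] V →ₗ[k] k := (e.symm : V →ₗ[k] Module.Dual k V)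
  have hη : ∀ v w, β (1 ⊗ₜ v) (1 ⊗ₜ w) = algebraMap k A (η v w) := by
    intro v w
    conv_lhs => rw [← he' v]
    exact h.apply_metricMap _ w
  rw [← he' (X.act _ _)]
  congr 1
  refine LinearMap.ext fun w => ?_
  rw [(dual_isDualOf hA).act]
  refine Eq.trans ?_ (h.form_act hX hη (metricMap g f) w a).symm
  change _ = e.symm (metricMap g f) _
  rw [he]

/-- Slicing the invariance of `g` by the dual basis gives a linear system for the coactions of the
`g(bⁱ)`, with the matrix of the coaction as coefficients; it is solved by multiplying with its
antipode. -/
theorem metricMap_coact (hX : X.IsYD)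
    (hA : Function.Bijective (HopfAlgebra.antipode k (A := A)))
    (hg : X.coactTwo g = g ⊗ₜ[k] 1) (f : Module.Dual k V) :
    X.coact (metricMap g f) = LinearMap.rTensor A (metricMap g) (X.dual.coact f) := by
  let b := Module.finBasis k V
  have hb := hX.comodule.basis_family b
  have hf := (dual_isDualOf (X := X) hA).family hX b
  suffices hs : X.coact ∘ₗ metricMap g = LinearMap.rTensor A (metricMap g) ∘ₗ X.dual.coact from
    congrArg (fun F => F f) hs
  refine b.dualBasis.ext fun m => ?_
  rw [b.coe_dualBasis, LinearMap.comp_apply, LinearMap.comp_apply, hf.coact]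
  simp only [map_sum, LinearMap.rTensor_tmul]
  have h1 : ∀ p, ∑ i, LinearMap.lTensor V (LinearMap.mulLeft k (coeffMatrix X.coact b p i))
      (X.coact (metricMap g (b.coord i))) = metricMap g (b.coord p) ⊗ₜ 1 := by
    intro p
    have h2 := congrArg (fun z => TensorProduct.lid k (V ⊗[k] A) (LinearMap.rTensor (V ⊗[k] A)
      (b.coord p) (TensorProduct.assoc k V V A z))) hg
    rw [metric_eq_sum (g := g) b] at h2
    simp only [map_sum, TensorProduct.sum_tmul, TensorProduct.assoc_tmul, LinearMap.rTensor_tmul,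
      TensorProduct.lid_tmul] at h2
    have h3 : ∀ i (z : V), TensorProduct.lid k (V ⊗[k] A) (LinearMap.rTensor (V ⊗[k] A)
        (b.coord p) (TensorProduct.assoc k V V A (X.coactTwo (b i ⊗ₜ z)))) =
        LinearMap.lTensor V (LinearMap.mulLeft k (coeffMatrix X.coact b p i)) (X.coact z) := by
      intro i z
      simp only [coactTwo, LinearMap.comp_apply, TensorProduct.map_tmul, hb.coact]
      generalize X.coact z = y
      induction y with
      | zero => simp
      | add x y hx hy => simp only [map_add, TensorProduct.tmul_add, hx, hy]
      | tmul x y =>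
        simp [TensorProduct.sum_tmul, Finsupp.single_apply, ite_smul]
    simp only [h3] at h2
    rw [h2]
    simp [Finsupp.single_apply, ite_smul]
  have h4 := congrArg (fun F : _ → V ⊗[k] A => ∑ p, LinearMap.lTensor V (LinearMap.mulLeft k
    (HopfAlgebra.antipode k (coeffMatrix X.coact b m p))) (F p)) (funext h1)
  simp only [map_sum, LinearMap.lTensor_tmul, LinearMap.mulLeft_apply, mul_one] at h4
  rw [← h4, Finset.sum_comm]
  have h5 : ∀ (i) (z : V ⊗[k] A), ∑ p, LinearMap.lTensor V (LinearMap.mulLeft k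
      (HopfAlgebra.antipode k (coeffMatrix X.coact b m p))) (LinearMap.lTensor V
      (LinearMap.mulLeft k (coeffMatrix X.coact b p i)) z) =
      if m = i then z else 0 := by
    intro i z
    induction z with
    | zero => simp
    | add x y hx hy =>
      simp only [map_add, Finset.sum_add_distrib, hx, hy]
      split_ifs <;> simp
    | tmul x y =>
      simp only [LinearMap.lTensor_tmul, LinearMap.mulLeft_apply, ← mul_assoc,
        ← TensorProduct.tmul_sum, ← Finset.sum_mul, hb.comatrix.antipode_mul, Matrix.one_apply]
      split_ifs <;> simp
  simp [h5]

theorem IsBiinvariantMetric.isMorphism (hg : X.IsBiinvariantMetric g) (hX : X.IsYD)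
    (hA : Function.Bijective (HopfAlgebra.antipode k (A := A))) :
    IsMorphism X.dual X (metricMap g) := by
  obtain ⟨h1, β, h2⟩ := hg
  exact ⟨h2.metricMap_act hX hA, metricMap_coact hX hA h1⟩

theorem IsBiinvariantMetric.bijective (hg : X.IsBiinvariantMetric g) :
    Function.Bijective (metricMap g) := by
  obtain ⟨_, β, h2⟩ := hg
  exact h2.metricMap_bijective

end MetricMap

end CrossedData

/-! ### The braided exterior algebra as a quotient Hopf algebra -/

namespace CrossedData

section ExtHopf

variable {k A V : Type*} [Field k] [Ring A] [HopfAlgebra k A] [AddCommGroup V] [Module k V]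
  {X : CrossedData k A V}

local notation "𝓲" => TensorAlgebra.ι k

theorem super_tensorAct (t : TensorAlgebra k V) (a : A) :
    X.super.tensorData.act t (MonoidAlgebra.single 1 a) = X.tensorData.act t a := by
  suffices h : X.super.tensorData.act t ∘ₗ MonoidAlgebra.lsingle (R := k) 1 =
      X.tensorData.act t from congrArg (fun f => f a) h
  refine comatrix_ext (k := k) (A := A) (N := TensorAlgebra k V) fun n c hc i j => ?_
  have hs := IsComatrix.single hc 1
  induction t using tensorAlgebra_left_induction generalizing i j with
  | one => simp [tensorData_act_one]
  | add s t hs ht => simp only [LinearMap.comp_apply, map_add, LinearMap.add_apply] at hs ht ⊢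
                     rw [hs, ht]
  | smul r t ht => simp only [LinearMap.comp_apply, map_smul, LinearMap.smul_apply] at ht ⊢
                   rw [ht]
  | mul v t ht =>
    refine (tensorData_act_ι_mul hs v t i j).trans ?_
    rw [tensorData_act_ι_mul hc]
    refine Finset.sum_congr rfl fun l _ => ?_
    congr 1
    · rw [super_act_single]
      simp
    · exact ht l j

/-- Evaluating the group element at 1 forgets the sign and returns the coaction over `A`; evaluating
it at its value ±1 in `k` instead gives the sign (-1)^D, as in the next lemma. -/
theorem super_tensorCoact (t : TensorAlgebra k V) :
    LinearMap.lTensor _ (signEval k A 0).toLinearMap (X.super.tensorData.coact t) =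
      X.tensorData.coact t := by
  suffices h : (Algebra.TensorProduct.map (AlgHom.id k _) (signEval k A 0)).comp
      X.super.tensorCoact = X.tensorCoact from congrArg (fun f => f t) h
  ext v
  simp only [LinearMap.comp_apply, AlgHom.toLinearMap_apply, AlgHom.comp_apply]
  rw [tensorCoact, tensorCoact, TensorAlgebra.lift_ι_apply, TensorAlgebra.lift_ι_apply]
  simp only [super, LinearMap.comp_apply]
  generalize X.coact v = z
  induction z with
  | zero => simp
  | add a b ha hb => simp only [map_add, ha, hb]
  | tmul a b => simp [signEval_single]

theorem super_tensorCoact_sign (t : TensorAlgebra k V) :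
    LinearMap.lTensor _ (signEval k A 1).toLinearMap (X.super.tensorData.coact t) =
      X.tensorCoact (tensorSign k V t) := by
  suffices h : (Algebra.TensorProduct.map (AlgHom.id k _) (signEval k A 1)).comp
      X.super.tensorCoact = X.tensorCoact.comp (tensorSign k V) from congrArg (fun f => f t) h
  ext v
  simp only [LinearMap.comp_apply, AlgHom.toLinearMap_apply, AlgHom.comp_apply]
  rw [tensorSign, TensorAlgebra.lift_ι_apply, LinearMap.neg_apply, map_neg]
  rw [tensorCoact, tensorCoact, TensorAlgebra.lift_ι_apply, TensorAlgebra.lift_ι_apply]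
  simp only [super, LinearMap.comp_apply]
  generalize X.coact v = z
  induction z with
  | zero => simp
  | add a b ha hb => simp only [map_add, ha, hb, neg_add]
  | tmul a b => simp [signEval_single, TensorProduct.tmul_neg]

/-- The explicit sign in the super-braided coproduct is produced by the group element in the
coaction of the first leg, which acts on `v` by its value. -/
theorem tensorCoprod_eq (hX : X.IsYD) : X.tensorCoprod = X.super.tensorCop := by
  have h : X.coprodStep = X.super.tensorData.bm ∘ₗ prim k V := by
    refine LinearMap.ext fun v => LinearMap.ext fun z => ?_
    refine hX.super.tensorData_comodule.tensor_induction (p := fun z => X.coprodStep v z =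
      (X.super.tensorData.bm ∘ₗ prim k V) v z) (by simp)
      (fun a b ha hb => by simp only [map_add, ha, hb]) ?_ z
    intro n x c hx j y
    rw [LinearMap.comp_apply, bm_prim_family hX.super hx]
    simp only [coprodStep, LinearMap.coe_mk, AddHom.coe_mk, LinearMap.add_apply,
      LinearMap.comp_apply, LinearMap.rTensor_tmul, AlgHom.toLinearMap_apply,
      ← super_tensorCoact_sign, hx.coact]
    simp [TensorProduct.sum_tmul, super]
  rw [tensorCoprod, h, tensorCop]

theorem toExt_surjective : Function.Surjective X.toExt := fun b => ⟨X.rep b, toExt_rep b⟩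

/-- A crossed module over a Hopf algebra with bijective antipode. -/
structure IsRegular (X : CrossedData k A V) : Prop where
  antipode_bijective : Function.Bijective (HopfAlgebra.antipode k (A := A))
  isYD : X.IsYD

namespace IsRegular

variable [Module.Finite k V]

theorem dual (h : X.IsRegular) : X.dual.IsRegular :=
  ⟨h.antipode_bijective, dual_isYD h.antipode_bijective h.isYD⟩

/-- The pairing of the tensor algebras of the super versions of `V^*` and `V`. -/
def tensorPairing (h : X.IsRegular) :
    HopfPairing h.dual.isYD.super.tensorHopf h.isYD.super.tensorHopf :=
  (dual_isDualOf h.antipode_bijective).super.hopfPairing h.isYD.super h.dual.isYD.super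

/-- The algebra homomorphism required by `toExt_eq_zero_iff` is the action of `T V` on `T V^*` by
contraction. -/
theorem toExt_eq_zero (h : X.IsRegular) (t : TensorAlgebra k V) :
    X.toExt t = 0 ↔ ∀ φ, X.super.diffPairing φ t = 0 :=
  toExt_eq_zero_iff h.isYD.super super_braiding h.tensorPairing.rightOp
    (fun _ => h.tensorPairing.rightOp_eq_zero) t

theorem toExt_dual_eq_zero (h : X.IsRegular) (φ : TensorAlgebra k (Module.Dual k V)) :
    X.dual.toExt φ = 0 ↔ ∀ t, X.super.diffPairing φ t = 0 := by
  rw [h.dual.toExt_eq_zero, diffPairing_left_radical h.isYD.super h.dual.isYD.super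
    (dual_isDualOf h.antipode_bijective).super]

/-- The structure of `B_-(V)` induced by that of the tensor algebra. -/
theorem isQuotient (h : X.IsRegular) : h.isYD.super.tensorHopf.IsQuotient X.toExt
    ⟨X.super.tensorData.act.compr₂ X.toExt.toLinearMap ∘ₗ X.rep,
      LinearMap.rTensor _ X.toExt.toLinearMap ∘ₗ X.super.tensorData.coact ∘ₗ X.rep⟩
    (TensorProduct.map X.toExt.toLinearMap X.toExt.toLinearMap ∘ₗ X.super.tensorCop ∘ₗ X.rep)
    X.counit (X.toExt.toLinearMap ∘ₗ X.super.tensorAnti ∘ₗ X.rep) :=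
  h.tensorPairing.isQuotient_right (super_antipode_bijective h.antipode_bijective).1
    X.toExt X.rep toExt_rep h.toExt_eq_zero

/-- The braided exterior algebra as a braided Hopf algebra over the group algebra of `{1, -1}`
over `A`. -/
def hopf (h : X.IsRegular) : BraidedHopf k (MonoidAlgebra A ℤˣ) X.Ext :=
  h.isYD.super.tensorHopf.quotient X.toExt _ _ _ _ h.isQuotient

theorem hopf_act_toExt (h : X.IsRegular) (t : TensorAlgebra k V) (a : MonoidAlgebra A ℤˣ) :
    h.hopf.X.act (X.toExt t) a = X.toExt (X.super.tensorData.act t a) :=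
  h.isQuotient.act t a

theorem hopf_coact_toExt (h : X.IsRegular) (t : TensorAlgebra k V) :
    h.hopf.X.coact (X.toExt t) =
      LinearMap.rTensor _ X.toExt.toLinearMap (X.super.tensorData.coact t) :=
  h.isQuotient.coact t

theorem counit_toExt (h : X.IsRegular) (t : TensorAlgebra k V) :
    X.counit (X.toExt t) = TensorAlgebra.algebraMapInv t :=
  h.isQuotient.counit t

theorem hopf_anti_toExt (h : X.IsRegular) (t : TensorAlgebra k V) :
    h.hopf.anti (X.toExt t) = X.toExt (X.super.tensorAnti t) :=
  h.isQuotient.anti t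

theorem hopf_cop (h : X.IsRegular) : h.hopf.cop = X.coprod := by
  rw [coprod, tensorCoprod_eq h.isYD]
  rfl

theorem extAct_eq (h : X.IsRegular) (b : X.Ext) (a : A) :
    X.extAct b a = h.hopf.X.act b (MonoidAlgebra.single 1 a) := by
  refine Eq.trans ?_ (congrArg X.toExt (super_tensorAct (X.rep b) a).symm)
  rfl

theorem extCoact_eq (h : X.IsRegular) (b : X.Ext) : X.extCoact b =
    LinearMap.lTensor _ (signEval k A 0).toLinearMap (h.hopf.X.coact b) := by
  refine Eq.trans (congrArg (LinearMap.rTensor A X.toExt.toLinearMap)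
    (super_tensorCoact (X.rep b)).symm) ?_
  change _ = LinearMap.lTensor _ _ (LinearMap.rTensor _ X.toExt.toLinearMap
    (X.super.tensorData.coact (X.rep b)))
  generalize X.super.tensorData.coact (X.rep b) = z
  induction z with
  | zero => simp
  | add a b ha hb => simp only [map_add, ha, hb]
  | tmul a b => simp

/-- The antipode is chosen by its axioms; convolution inverses of the identity are unique, so the
choice is the antipode induced from the tensor algebra. -/
theorem antipode_eq (h : X.IsRegular) : X.antipode = h.hopf.anti := by
  have hc := h.hopf_cop
  have h1 : X.IsAntipode h.hopf.anti := by
    refine ⟨LinearMap.ext fun b => ?_, LinearMap.ext fun b => ?_⟩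
    · rw [← hc]
      exact h.hopf.anti_left b
    · rw [← hc]
      exact h.hopf.anti_right b
  have hex : ∃ S, X.IsAntipode S := ⟨_, h1⟩
  have h2 : X.IsAntipode X.antipode := by
    rw [antipode, theElement, dif_pos hex]
    exact hex.choose_spec
  refine eq_of_conv_inverse h.hopf.coassoc h.hopf.counit_left h.hopf.counit_right
    (G := LinearMap.id) (fun b => ?_) h.hopf.anti_right
  rw [hc]
  exact congrArg (fun f => f b) h2.1

theorem pairing_toExt (h : X.IsRegular) (φ : TensorAlgebra k (Module.Dual k V))
    (t : TensorAlgebra k V) :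
    X.pairing (X.dual.toExt φ) (X.toExt t) = X.super.diffPairing φ t := by
  rw [CrossedData.pairing, LinearMap.compl₁₂_apply, tensorPairing_eq h.isYD.super super_braiding]
  refine (HopfPairing.eq_of_section (π := X.toExt.toLinearMap) (σ := X.rep) toExt_rep
    (φ := X.super.diffPairing _) (fun t ht => (h.toExt_eq_zero t).1 ht _) t).trans ?_
  exact congrArg (fun F => F t) (HopfPairing.eq_of_section (π := X.dual.toExt.toLinearMap)
    (σ := X.dual.rep) toExt_rep (φ := X.super.diffPairing) (fun φ hφ => LinearMap.ext
      ((h.toExt_dual_eq_zero φ).1 hφ)) φ)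

/-- The pairing of `B_-(V^*)` and `B_-(V)` as a Hopf pairing. -/
def pairing (h : X.IsRegular) : HopfPairing h.dual.hopf h.hopf :=
  h.tensorPairing.quotient h.isQuotient h.dual.isQuotient X.pairing h.pairing_toExt

theorem pairing_pair (h : X.IsRegular) : h.pairing.pair = X.pairing := rfl

theorem pairing_left_nondeg (h : X.IsRegular) (φ : X.dual.Ext) (hφ : ∀ t, X.pairing φ t = 0) :
    φ = 0 := by
  obtain ⟨φ, rfl⟩ := toExt_surjective φ
  rw [h.toExt_dual_eq_zero]
  intro t
  rw [← h.pairing_toExt, hφ]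

theorem pairing_right_nondeg (h : X.IsRegular) (t : X.Ext) (ht : ∀ φ, X.pairing φ t = 0) :
    t = 0 := by
  obtain ⟨t, rfl⟩ := toExt_surjective t
  rw [h.toExt_eq_zero]
  intro φ
  rw [← h.pairing_toExt, ht]

end IsRegular

end ExtHopf

end CrossedData

/-! ### The grading of the braided exterior algebra -/

namespace CrossedData

section Degree

variable {k A V : Type*} [Field k] [Ring A] [HopfAlgebra k A] [AddCommGroup V] [Module k V]
  {X : CrossedData k A V}

theorem toExt_mem_degree {m : ℕ} (w : ⨂[k]^m V) :
    X.toExt (TensorPower.toTensorAlgebra w) ∈ X.degree m := ⟨w, rfl⟩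

theorem mul_mem_degree {m n : ℕ} {x y : X.Ext} (hx : x ∈ X.degree m) (hy : y ∈ X.degree n) :
    x * y ∈ X.degree (m + n) := by
  obtain ⟨v, rfl⟩ := hx
  obtain ⟨w, rfl⟩ := hy
  refine ⟨@GradedMonoid.GMul.mul _ (fun n => ⨂[k]^n V) _ _ _ _ v w, ?_⟩
  simp [TensorPower.toTensorAlgebra_gMul]

theorem algebraMap_mem_degree (r : k) : algebraMap k X.Ext r ∈ X.degree 0 := by
  refine ⟨TensorPower.algebraMap₀ r, ?_⟩
  simp [toTensorAlgebra_zero]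

theorem one_mem_degree : (1 : X.Ext) ∈ X.degree 0 := by
  simpa using algebraMap_mem_degree (X := X) 1

theorem incl_mem_degree (v : V) : X.incl v ∈ X.degree 1 := by
  refine ⟨PiTensorProduct.tprod k (fun _ => v), ?_⟩
  simp [incl, TensorPower.toTensorAlgebra_tprod, TensorAlgebra.tprod_apply]

theorem exists_of_mem_degree_zero {b : X.Ext} (hb : b ∈ X.degree 0) :
    ∃ r, b = algebraMap k X.Ext r := by
  obtain ⟨w, rfl⟩ := hb
  exact ⟨TensorPower.algebraMap₀.symm w, by simp [toTensorAlgebra_zero]⟩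

theorem degree_left_induction {p : ℕ → X.Ext → Prop} (zero : ∀ m, p m 0)
    (add : ∀ m a b, p m a → p m b → p m (a + b)) (scalar : ∀ r, p 0 (algebraMap k X.Ext r))
    (cons : ∀ m v b, b ∈ X.degree m → p m b → p (m + 1) (X.incl v * b)) {m : ℕ} {b : X.Ext}
    (hb : b ∈ X.degree m) : p m b := by
  induction m generalizing b with
  | zero =>
    obtain ⟨r, rfl⟩ := exists_of_mem_degree_zero hb
    exact scalar r
  | succ m ih =>
    obtain ⟨w, rfl⟩ := hb
    induction w using tensorPower_succ_induction with
    | zero => simpa using zero (m + 1)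
    | add a b ha hb => simpa using add _ _ _ ha hb
    | cons v w =>
      have := cons m v _ (toExt_mem_degree w) (ih (toExt_mem_degree w))
      simpa [toTensorAlgebra_consEquiv, incl] using this

theorem exists_of_mem_degree_one {b : X.Ext} (hb : b ∈ X.degree 1) : ∃ v, b = X.incl v := by
  have := degree_left_induction (X := X) (p := fun m b => m = 1 → ∃ v, b = X.incl v)
    (fun _ _ => ⟨0, by simp⟩)
    (fun m a b ha hb hm => by
      obtain ⟨v, rfl⟩ := ha hm
      obtain ⟨w, rfl⟩ := hb hm
      exact ⟨v + w, by simp⟩)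
    (fun r hr => by simp at hr)
    (fun m v b hb _ hm => by
      obtain rfl : m = 0 := by omega
      obtain ⟨r, rfl⟩ := exists_of_mem_degree_zero hb
      exact ⟨r • v, by rw [← Algebra.commutes, ← Algebra.smul_def, map_smul]⟩) hb
  exact this rfl

theorem degree_induction {p : X.Ext → Prop} (add : ∀ a b, p a → p b → p (a + b))
    (mem : ∀ m b, b ∈ X.degree m → p b) (b : X.Ext) : p b := by
  obtain ⟨t, rfl⟩ := toExt_surjective b
  induction t using tensorAlgebra_power_induction with
  | add s t hs ht => rw [map_add]; exact add _ _ hs ht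
  | power m w => exact mem m _ (toExt_mem_degree w)

theorem linearMap_ext_degree {M : Type*} [AddCommMonoid M] [Module k M] {f g : X.Ext →ₗ[k] M}
    (h : ∀ m, ∀ b ∈ X.degree m, f b = g b) : f = g := by
  refine LinearMap.ext fun b => ?_
  induction b using degree_induction with
  | add a b ha hb => rw [map_add, map_add, ha, hb]
  | mem m b hb => exact h m b hb

namespace IsRegular

variable [Module.Finite k V]

theorem toExt_component (h : X.IsRegular) {t : TensorAlgebra k V} (ht : X.toExt t = 0) (m : ℕ) :
    X.toExt (TensorPower.toTensorAlgebra (TensorAlgebra.toDirectSum t m)) = 0 := by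
  rw [h.toExt_eq_zero] at ht ⊢
  exact diffPairing_toTensorAlgebra_component h.isYD.super ht m

theorem proj_toExt (h : X.IsRegular) (m : ℕ) (t : TensorAlgebra k V) : X.proj m (X.toExt t) =
    X.toExt (TensorPower.toTensorAlgebra (TensorAlgebra.toDirectSum t m)) :=
  HopfPairing.eq_of_section (π := X.toExt.toLinearMap) (σ := X.rep) toExt_rep
    (φ := X.toExt.toLinearMap ∘ₗ TensorPower.toTensorAlgebra ∘ₗ
    DirectSum.component k ℕ (fun n => ⨂[k]^n V) m ∘ₗ TensorAlgebra.toDirectSum.toLinearMap)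
    (fun _ ht => h.toExt_component ht m) t

theorem proj_mem (h : X.IsRegular) (m : ℕ) (b : X.Ext) : X.proj m b ∈ X.degree m := by
  obtain ⟨t, rfl⟩ := toExt_surjective b
  rw [h.proj_toExt]
  exact toExt_mem_degree _

theorem sum_proj (h : X.IsRegular) (b : X.Ext) : ∃ s : Finset ℕ, b = ∑ m ∈ s, X.proj m b := by
  obtain ⟨t, rfl⟩ := toExt_surjective b
  obtain ⟨s, hs⟩ := sum_components t
  refine ⟨s, ?_⟩
  conv_lhs => rw [hs]
  rw [map_sum]
  exact Finset.sum_congr rfl fun m _ => (h.proj_toExt m t).symm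

theorem proj_of_mem (h : X.IsRegular) {m : ℕ} {b : X.Ext} (hb : b ∈ X.degree m) :
    X.proj m b = b := by
  obtain ⟨w, rfl⟩ := hb
  refine (h.proj_toExt m _).trans ?_
  rw [toDirectSum_toTensorAlgebra, DirectSum.of_eq_same]
  rfl

theorem proj_of_ne (h : X.IsRegular) {m n : ℕ} (hmn : m ≠ n) {b : X.Ext} (hb : b ∈ X.degree m) :
    X.proj n b = 0 := by
  obtain ⟨w, rfl⟩ := hb
  refine (h.proj_toExt n _).trans ?_
  rw [toDirectSum_toTensorAlgebra, DirectSum.of_eq_of_ne _ _ _ hmn.symm, map_zero, map_zero]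

theorem mem_degree_of_proj (h : X.IsRegular) {d : ℕ} {b : X.Ext}
    (hb : ∀ m, m ≠ d → X.proj m b = 0) : b ∈ X.degree d := by
  obtain ⟨s, hs⟩ := h.sum_proj b
  rw [hs]
  refine Submodule.sum_mem _ fun m _ => ?_
  by_cases hm : m = d
  · rw [← hm]
    exact h.proj_mem m b
  · rw [hb m hm]
    exact zero_mem _

theorem signD_toExt (h : X.IsRegular) (t : TensorAlgebra k V) :
    X.signD (X.toExt t) = X.toExt (tensorSign k V t) := by
  have hw : ∀ (m : ℕ) (w : ⨂[k]^m V), tensorSign k V (TensorPower.toTensorAlgebra w) =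
      (-1 : k) ^ m • TensorPower.toTensorAlgebra w := by
    intro m
    induction m with
    | zero =>
      intro w
      rw [toTensorAlgebra_zero, AlgHom.commutes]
      simp
    | succ m ih =>
      intro w
      induction w using tensorPower_succ_induction with
      | zero => simp
      | add a b ha hb => simp only [map_add, ha, hb, smul_add]
      | cons v w =>
        rw [toTensorAlgebra_consEquiv, map_mul, ih, tensorSign, TensorAlgebra.lift_ι_apply]
        simp [pow_succ]
  refine HopfPairing.eq_of_section (π := X.toExt.toLinearMap) (σ := X.rep) toExt_rep
    (φ := X.toExt.toLinearMap ∘ₗ (tensorSign k V).toLinearMap) (fun t ht => ?_) t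
  obtain ⟨s, hs⟩ := sum_components t
  rw [hs]
  simp only [map_sum, LinearMap.comp_apply, AlgHom.toLinearMap_apply, hw, map_smul]
  exact Finset.sum_eq_zero fun m _ => by rw [h.toExt_component ht, smul_zero]

theorem signD_of_mem (h : X.IsRegular) {m : ℕ} {b : X.Ext} (hb : b ∈ X.degree m) :
    X.signD b = (-1 : k) ^ m • b := by
  have hs : ∀ x y, X.signD (x * y) = X.signD x * X.signD y := by
    intro x y
    obtain ⟨s, rfl⟩ := toExt_surjective x
    obtain ⟨t, rfl⟩ := toExt_surjective y
    simp only [← map_mul, h.signD_toExt]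
  refine degree_left_induction (X := X) (p := fun m b => X.signD b = (-1 : k) ^ m • b) (by simp)
    (fun m a b ha hb => by rw [map_add, ha, hb, smul_add]) (fun r => ?_) (fun m v b _ hb => ?_) hb
  · rw [← AlgHom.commutes X.toExt, h.signD_toExt]
    simp
  · have hv : X.signD (X.incl v) = -X.incl v := by
      refine (h.signD_toExt _).trans ?_
      simp [tensorSign, incl]
    rw [hs, hb, hv]
    simp [pow_succ]

theorem counit_of_ne (h : X.IsRegular) {m : ℕ} (hm : m ≠ 0) {b : X.Ext} (hb : b ∈ X.degree m) :
    X.counit b = 0 := by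
  obtain ⟨w, rfl⟩ := hb
  obtain ⟨m, rfl⟩ := Nat.exists_eq_succ_of_ne_zero hm
  exact (h.counit_toExt _).trans (counit_toTensorAlgebra_succ w)

theorem counit_algebraMap (h : X.IsRegular) (r : k) : X.counit (algebraMap k X.Ext r) = r := by
  rw [← AlgHom.commutes X.toExt, h.counit_toExt, AlgHom.commutes]
  rfl

theorem act_incl (h : X.IsRegular) (v : V) (u : ℤˣ) (a : A) :
    h.hopf.X.act (X.incl v) (MonoidAlgebra.single u a) = ((u : ℤ) : k) • X.incl (X.act v a) := by
  refine (h.hopf_act_toExt _ _).trans ?_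
  rw [tensorData_act_ι, super_act_single, map_smul, map_smul]
  rfl

/-- The group element scales each letter by `u`, hence degree `m` by `u ^ m`: the grading modulo 2
is part of the action. -/
theorem act_single (h : X.IsRegular) {m : ℕ} {b : X.Ext} (hb : b ∈ X.degree m) (u : ℤˣ) (a : A) :
    h.hopf.X.act b (MonoidAlgebra.single u a) = ((u : ℤ) : k) ^ m • X.extAct b a := by
  simp only [h.extAct_eq]
  refine degree_left_induction (X := X) (p := fun m b => ∀ a,
    h.hopf.X.act b (MonoidAlgebra.single u a) =
      ((u : ℤ) : k) ^ m • h.hopf.X.act b (MonoidAlgebra.single 1 a)) (by simp)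
    (fun m a b ha hb c => by simp only [map_add, LinearMap.add_apply, ha, hb, smul_add])
    (fun r a => ?_) (fun m v b _ hb a => ?_) hb a
  · rw [Algebra.algebraMap_eq_smul_one, map_smul, LinearMap.smul_apply, LinearMap.smul_apply,
      h.hopf.ydAlg.one_act, h.hopf.ydAlg.one_act]
    simp
  · rw [h.hopf.ydAlg.mul_act, h.hopf.ydAlg.mul_act]
    simp only [MonoidAlgebra.comul_single]
    generalize Coalgebra.comul (R := k) a = z
    induction z with
    | zero => simp
    | add x y hx hy => simp only [map_add, hx, hy, smul_add]
    | tmul x y => simp [hb, h.act_incl, pow_succ, smul_smul]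

theorem act_mem (h : X.IsRegular) {m : ℕ} {b : X.Ext} (hb : b ∈ X.degree m)
    (a : MonoidAlgebra A ℤˣ) : h.hopf.X.act b a ∈ X.degree m := by
  refine degree_left_induction (X := X) (p := fun m b => ∀ a, h.hopf.X.act b a ∈ X.degree m)
    (by simp) (fun m a b ha hb c => by
      rw [map_add, LinearMap.add_apply]; exact add_mem (ha c) (hb c)) (fun r a => ?_)
    (fun m v b _ hb a => ?_) hb a
  · rw [Algebra.algebraMap_eq_smul_one, map_smul, LinearMap.smul_apply, h.hopf.ydAlg.one_act]
    exact Submodule.smul_mem _ _ (algebraMap_mem_degree _)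
  · rw [h.hopf.ydAlg.mul_act]
    generalize Coalgebra.comul (R := k) a = z
    induction z with
    | zero => simp
    | add x y hx hy => simpa only [map_add] using add_mem hx hy
    | tmul x y =>
      rw [TensorProduct.map_tmul, LinearMap.mul'_apply, add_comm m 1]
      refine mul_mem_degree ?_ (hb y)
      induction x using MonoidAlgebra.induction_linear with
      | zero => simp
      | add x y hx hy => simpa only [map_add] using add_mem hx hy
      | single u a =>
        rw [h.act_incl]
        exact Submodule.smul_mem _ _ (incl_mem_degree _)

theorem coact_incl (h : X.IsRegular) (v : V) : h.hopf.X.coact (X.incl v) =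
    TensorProduct.map X.incl (MonoidAlgebra.lsingle (R := k) (-1)) (X.coact v) := by
  refine (h.hopf_coact_toExt _).trans ?_
  rw [tensorData_coact_ι, super, LinearMap.comp_apply]
  generalize X.coact v = z
  induction z with
  | zero => simp
  | add x y hx hy => simp only [map_add, hx, hy]
  | tmul x y => simp [incl]

/-- The coaction preserves the degree, and carries the sign given by it. -/
theorem coact_of_mem (h : X.IsRegular) {m : ℕ} {b : X.Ext} (hb : b ∈ X.degree m) :
    ∃ z : X.degree m ⊗[k] A, h.hopf.X.coact b =
      TensorProduct.map (X.degree m).subtype (MonoidAlgebra.lsingle (R := k) ((-1) ^ m)) z := by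
  refine degree_left_induction (X := X) (p := fun m b => ∃ z : X.degree m ⊗[k] A,
    h.hopf.X.coact b = TensorProduct.map (X.degree m).subtype
      (MonoidAlgebra.lsingle (R := k) ((-1) ^ m)) z) (fun m => ⟨0, by simp⟩)
    (fun m a b ⟨z, hz⟩ ⟨w, hw⟩ => ⟨z + w, by simp only [map_add, hz, hw]⟩)
    (fun r => ⟨(⟨_, algebraMap_mem_degree r⟩ : X.degree 0) ⊗ₜ 1, ?_⟩)
    (fun m v b _ ⟨z, hz⟩ => ?_) hb
  · change h.hopf.X.coact (algebraMap k X.Ext r) =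
      algebraMap k X.Ext r ⊗ₜ[k] MonoidAlgebra.single ((-1) ^ 0) 1
    rw [Algebra.algebraMap_eq_smul_one, map_smul, h.hopf.ydAlg.coact_one]
    simp [TensorProduct.smul_tmul', MonoidAlgebra.one_def]
  · rw [h.hopf.ydAlg.coact_mul, hz, h.coact_incl]
    clear hz
    generalize X.coact v = y
    induction y with
    | zero => exact ⟨0, by simp⟩
    | add x y hx hy =>
      obtain ⟨a, ha⟩ := hx
      obtain ⟨b, hb⟩ := hy
      exact ⟨a + b, by simp only [map_add, add_mul, ha, hb]⟩
    | tmul v a =>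
      induction z with
      | zero => exact ⟨0, by simp⟩
      | add x y hx hy =>
        obtain ⟨a, ha⟩ := hx
        obtain ⟨b, hb⟩ := hy
        exact ⟨a + b, by simp only [map_add, mul_add, ha, hb]⟩
      | tmul x c =>
        refine ⟨(⟨X.incl v * x, by
          rw [add_comm]; exact mul_mem_degree (incl_mem_degree v) x.2⟩ : X.degree (m + 1)) ⊗ₜ
            (a * c), ?_⟩
        simp [MonoidAlgebra.single_mul_single, pow_succ]

theorem extCoact_of_coact (h : X.IsRegular) {m : ℕ} {b : X.Ext} {z : X.degree m ⊗[k] A}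
    (hz : h.hopf.X.coact b =
      TensorProduct.map (X.degree m).subtype (MonoidAlgebra.lsingle (R := k) ((-1) ^ m)) z) :
    X.extCoact b = LinearMap.rTensor A (X.degree m).subtype z := by
  rw [h.extCoact_eq, hz]
  generalize z = y
  induction y with
  | zero => simp
  | add x y hx hy => simp only [map_add, hx, hy]
  | tmul x y => simp [signEval_single]

theorem anti_incl (h : X.IsRegular) (v : V) : h.hopf.anti (X.incl v) = -X.incl v := by
  refine (h.hopf_anti_toExt _).trans ?_
  rw [tensorAnti_ι h.isYD.super, map_neg]
  rfl

theorem anti_mem (h : X.IsRegular) {m : ℕ} {b : X.Ext} (hb : b ∈ X.degree m) :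
    h.hopf.anti b ∈ X.degree m := by
  induction m generalizing b with
  | zero =>
    obtain ⟨r, rfl⟩ := exists_of_mem_degree_zero hb
    rw [Algebra.algebraMap_eq_smul_one, map_smul, h.hopf.anti_one]
    exact Submodule.smul_mem _ _ one_mem_degree
  | succ m ih =>
    refine degree_left_induction (X := X) (p := fun j b => j = m + 1 → h.hopf.anti b ∈ X.degree j)
      (by simp) (fun m a b ha hb hm => by rw [map_add]; exact add_mem (ha hm) (hb hm))
      (fun r hr => by simp at hr) (fun j v b hm _ hj => ?_) hb rfl
    obtain rfl : j = m := by omega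
    rw [h.hopf.anti_mul]
    obtain ⟨z, hz⟩ := h.coact_of_mem hm
    rw [hz]
    clear hz
    induction z with
    | zero => simp
    | add x y hx hy => simpa only [map_add] using add_mem hx hy
    | tmul x a =>
      simp only [TensorProduct.map_tmul, LinearMap.mul'_apply, LinearMap.comp_apply,
        MonoidAlgebra.lsingle_apply, h.act_incl, map_smul, h.anti_incl]
      exact mul_mem_degree (ih x.2) (Submodule.smul_mem _ _ (neg_mem (incl_mem_degree _)))

theorem pairing_of_ne (h : X.IsRegular) {i j : ℕ} (hij : i ≠ j) {φ : X.dual.Ext}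
    (hφ : φ ∈ X.dual.degree i) {b : X.Ext} (hb : b ∈ X.degree j) : X.pairing φ b = 0 := by
  obtain ⟨v, rfl⟩ := hφ
  obtain ⟨w, rfl⟩ := hb
  refine (h.pairing_toExt _ _).trans ?_
  induction v using PiTensorProduct.induction_on with
  | smul_tprod r x =>
    rw [map_smul, map_smul, LinearMap.smul_apply, diffPairing_tprod_of_ne h.isYD.super hij,
      smul_zero]
  | add a b ha hb => rw [map_add, map_add, LinearMap.add_apply, ha, hb, add_zero]

theorem pairing_proj (h : X.IsRegular) (m : ℕ) (φ : X.dual.Ext) (b : X.Ext) :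
    X.pairing (X.dual.proj m φ) b = X.pairing φ (X.proj m b) := by
  induction b using degree_induction with
  | add a b ha hb => simp only [map_add, ha, hb]
  | mem j b hb =>
    induction φ using degree_induction with
    | add a b ha hb => simp only [map_add, LinearMap.add_apply, ha, hb]
    | mem i φ hφ =>
      by_cases hi : i = m
      · subst hi
        rw [h.dual.proj_of_mem hφ]
        by_cases hj : j = i
        · subst hj
          rw [h.proj_of_mem hb]
        · rw [h.proj_of_ne hj hb, map_zero, h.pairing_of_ne (Ne.symm hj) hφ hb]
      · rw [h.dual.proj_of_ne hi hφ, map_zero, LinearMap.zero_apply]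
        by_cases hj : j = m
        · subst hj
          rw [h.proj_of_mem hb, h.pairing_of_ne hi hφ hb]
        · rw [h.proj_of_ne hj hb, map_zero]

/-- By nondegeneracy and orthogonality of degrees, the degree of an element of the dual is detected
by what it pairs with. This gives the degree of a Fourier transform. -/
theorem mem_dual_degree (h : X.IsRegular) {d : ℕ} {φ : X.dual.Ext}
    (hφ : ∀ m, m ≠ d → ∀ b ∈ X.degree m, X.pairing φ b = 0) : φ ∈ X.dual.degree d := by
  refine h.dual.mem_degree_of_proj fun m hm => h.pairing_left_nondeg _ fun b => ?_
  rw [h.pairing_proj]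
  exact hφ m hm _ (h.proj_mem m b)

end IsRegular

end Degree

end CrossedData

/-! ### The metric on the braided exterior algebra, integrals and the coevaluation -/

section LinearAlgebra

variable {k M N : Type*} [Field k] [AddCommGroup M] [Module k M] [AddCommGroup N] [Module k N]

theorem linInverse_apply {f : M →ₗ[k] N} (hf : Function.Bijective f) (x : M) :
    linInverse f (f x) = x := by
  rw [linInverse, dif_pos hf]
  exact (LinearEquiv.ofBijective f hf).symm_apply_apply x

theorem apply_linInverse {f : M →ₗ[k] N} (hf : Function.Bijective f) (y : N) :
    f (linInverse f y) = y := by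
  rw [linInverse, dif_pos hf]
  exact (LinearEquiv.ofBijective f hf).apply_symm_apply y

theorem theElement_spec {M : Type*} [Zero M] {P : M → Prop} (h : ∃ x, P x) : P (theElement P) := by
  rw [theElement, dif_pos h]
  exact h.choose_spec

/-- A pairing that is nondegenerate on both sides is perfect in the finite-dimensional case. -/
theorem exists_pair_eq [Module.Finite k N] (β : M →ₗ[k] N →ₗ[k] k)
    (hl : ∀ m, (∀ n, β m n = 0) → m = 0) (hr : ∀ n, (∀ m, β m n = 0) → n = 0)
    (α : N →ₗ[k] k) : ∃ m, β m = α := by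
  have h1 := HopfPairing.finrank_le_of_nondeg β hl
  have := h1.1
  have h2 := HopfPairing.finrank_le_of_nondeg β.flip hr
  have h3 : Function.Injective β := by
    rw [injective_iff_map_eq_zero]
    intro m hm
    exact hl m fun n => by rw [hm]; rfl
  have h4 : Module.finrank k M = Module.finrank k (N →ₗ[k] k) :=
    (le_antisymm h1.2 h2.2).trans (Subspace.dual_finrank_eq (K := k) (V := N)).symm
  exact (LinearMap.injective_iff_surjective_of_finrank_eq_finrank h4).1 h3 α

/-- The canonical element of a basis and the family dual to it under the pairing. -/
theorem exists_coevaluation [Module.Finite k N] (β : M →ₗ[k] N →ₗ[k] k)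
    (hl : ∀ m, (∀ n, β m n = 0) → m = 0) (hr : ∀ n, (∀ m, β m n = 0) → n = 0) :
    ∃ e : N ⊗[k] M, (∀ n, TensorProduct.rid k N (LinearMap.lTensor N (β.flip n) e) = n) ∧
      ∀ m, TensorProduct.lid k M (LinearMap.rTensor M (β m) e) = m := by
  let b := Module.finBasis k N
  choose φ hφ using fun i => exists_pair_eq β hl hr (b.coord i)
  have h1 : ∀ n, n = ∑ i, β (φ i) n • b i := by
    intro n
    simp only [hφ]
    exact (b.sum_repr n).symm
  refine ⟨∑ i, b i ⊗ₜ φ i, fun n => ?_, fun m => ?_⟩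
  · conv_rhs => rw [h1 n]
    simp
  · rw [← sub_eq_zero]
    refine hl _ fun n => ?_
    conv_lhs => rw [h1 n]
    have h2 : ∀ j, β m (b j) = ∑ i, β m (b i) * β (φ i) (b j) := by
      intro j
      conv_lhs => rw [h1 (b j)]
      simp [mul_comm]
    simp only [map_sum, map_smul, map_sub, LinearMap.sub_apply, LinearMap.rTensor_tmul,
      TensorProduct.lid_tmul, LinearMap.sum_apply, LinearMap.smul_apply, smul_eq_mul]
    refine Finset.sum_eq_zero fun j _ => ?_
    rw [h2 j, sub_self, mul_zero]

end LinearAlgebra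

namespace CrossedData

variable {k A V : Type*} [Field k] [Ring A] [HopfAlgebra k A] [AddCommGroup V] [Module k V]
  [Module.Finite k V] {X : CrossedData k A V} {g : V ⊗[k] V} {n : ℕ} {vol : X.Ext}

section MetricExt

theorem IsRegular.isMorphism (h : X.IsRegular) (hg : X.IsBiinvariantMetric g) :
    IsMorphism X.dual.super X.super (metricMap g) :=
  (hg.isMorphism h.isYD h.antipode_bijective).super

theorem IsRegular.toExt_tensorMap_eq_zero (h : X.IsRegular) (hg : X.IsBiinvariantMetric g)
    (φ : TensorAlgebra k (Module.Dual k V)) :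
    X.toExt (tensorMap (metricMap g) φ) = 0 ↔ X.dual.toExt φ = 0 := by
  rw [h.toExt_eq_zero, h.dual.toExt_eq_zero]
  exact (h.isMorphism hg).radical h.isYD.super h.dual.isYD.super hg.bijective φ

theorem IsRegular.metricExt_toExt (h : X.IsRegular) (hg : X.IsBiinvariantMetric g)
    (φ : TensorAlgebra k (Module.Dual k V)) :
    X.metricExt g (X.dual.toExt φ) = X.toExt (tensorMap (metricMap g) φ) :=
  HopfPairing.eq_of_section (π := X.dual.toExt.toLinearMap) (σ := X.dual.rep) toExt_rep
    (φ := X.toExt.toLinearMap ∘ₗ (tensorMap (metricMap g)).toLinearMap)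
    (fun φ hφ => (h.toExt_tensorMap_eq_zero hg φ).2 hφ) φ

theorem IsRegular.metricExt_mul (h : X.IsRegular) (hg : X.IsBiinvariantMetric g)
    (φ ψ : X.dual.Ext) : X.metricExt g (φ * ψ) = X.metricExt g φ * X.metricExt g ψ := by
  obtain ⟨φ, rfl⟩ := toExt_surjective φ
  obtain ⟨ψ, rfl⟩ := toExt_surjective ψ
  simp only [← map_mul, h.metricExt_toExt hg]

theorem IsRegular.metricExt_one (h : X.IsRegular) (hg : X.IsBiinvariantMetric g) :
    X.metricExt g 1 = 1 := by
  rw [← map_one X.dual.toExt, h.metricExt_toExt hg, map_one, map_one]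

theorem IsRegular.metricExt_incl (h : X.IsRegular) (hg : X.IsBiinvariantMetric g)
    (f : Module.Dual k V) : X.metricExt g (X.dual.incl f) = X.incl (metricMap g f) := by
  refine (h.metricExt_toExt hg _).trans ?_
  rw [tensorMap_ι]
  rfl

theorem IsRegular.metricExt_mem (h : X.IsRegular) (hg : X.IsBiinvariantMetric g) {m : ℕ}
    {φ : X.dual.Ext} (hφ : φ ∈ X.dual.degree m) : X.metricExt g φ ∈ X.degree m := by
  obtain ⟨w, rfl⟩ := hφ
  refine ⟨PiTensorProduct.map (fun _ => metricMap g) w, ?_⟩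
  refine Eq.trans ?_ (h.metricExt_toExt hg _).symm
  rw [tensorMap_toTensorAlgebra]
  rfl

/-- The metric is a bijective morphism of crossed modules, so it matches the radicals of the two
tensor algebras and induces an isomorphism of the quotients. -/
theorem IsRegular.metricExt_bijective (h : X.IsRegular) (hg : X.IsBiinvariantMetric g) :
    Function.Bijective (X.metricExt g) := by
  constructor
  · rw [injective_iff_map_eq_zero]
    intro φ hφ
    obtain ⟨φ, rfl⟩ := toExt_surjective φ
    rwa [h.metricExt_toExt hg, h.toExt_tensorMap_eq_zero hg] at hφ
  · intro b
    obtain ⟨t, rfl⟩ := toExt_surjective b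
    let e := LinearEquiv.ofBijective _ hg.bijective
    refine ⟨X.dual.toExt (tensorMap (e.symm : V →ₗ[k] Module.Dual k V) t), ?_⟩
    rw [h.metricExt_toExt hg, tensorMap_comp]
    have : metricMap g ∘ₗ (e.symm : V →ₗ[k] Module.Dual k V) = LinearMap.id :=
      LinearMap.ext fun v => e.apply_symm_apply v
    rw [this, tensorMap_id]

theorem IsRegular.mem_of_metricExt_mem (h : X.IsRegular) (hg : X.IsBiinvariantMetric g) {m : ℕ}
    {φ : X.dual.Ext} (hφ : X.metricExt g φ ∈ X.degree m) : φ ∈ X.dual.degree m := by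
  refine h.dual.mem_degree_of_proj fun j hj => (h.metricExt_bijective hg).1 ?_
  have h1 : ∀ φ, X.metricExt g (X.dual.proj j φ) = X.proj j (X.metricExt g φ) := by
    intro φ
    induction φ using degree_induction with
    | add a b ha hb => simp only [map_add, ha, hb]
    | mem i φ hφ =>
      by_cases hi : i = j
      · subst hi
        rw [h.dual.proj_of_mem hφ, h.proj_of_mem (h.metricExt_mem hg hφ)]
      · rw [h.dual.proj_of_ne hi hφ, h.proj_of_ne hi (h.metricExt_mem hg hφ), map_zero]
  rw [h1, h.proj_of_ne hj.symm hφ, map_zero]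

theorem IsRegular.metricExt_anti (h : X.IsRegular) (hg : X.IsBiinvariantMetric g)
    (φ : X.dual.Ext) : X.metricExt g (h.dual.hopf.anti φ) = h.hopf.anti (X.metricExt g φ) := by
  obtain ⟨φ, rfl⟩ := toExt_surjective φ
  rw [h.dual.hopf_anti_toExt, h.metricExt_toExt hg, h.metricExt_toExt hg, h.hopf_anti_toExt,
    (h.isMorphism hg).tensorAnti h.dual.isYD.super]

end MetricExt

/-! ### Consequences of a one-dimensional top degree -/

section TopDegree

theorem HasTopDegree.finite (hn : X.HasTopDegree n) : Module.Finite k X.Ext := by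
  have h1 : ∀ m, Module.Finite k (X.degree m) := by
    intro m
    rw [degree]
    infer_instance
  have h2 : (⊤ : Submodule k X.Ext) = ⨆ m : Fin (n + 1), X.degree m := by
    refine le_antisymm (fun b _ => ?_) le_top
    induction b using degree_induction with
    | add a b ha hb => exact add_mem (ha trivial) (hb trivial)
    | mem m b hb =>
      by_cases hm : m < n + 1
      · exact (le_iSup (fun m : Fin (n + 1) => X.degree m) ⟨m, hm⟩) hb
      · rw [hn.2 m (by omega)] at hb
        rw [(Submodule.mem_bot k).1 hb]
        exact zero_mem _
  refine Module.finite_def.2 ?_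
  rw [h2]
  exact Submodule.fg_iSup _ fun m => Module.Finite.iff_fg.1 (h1 m)

theorem IsRegular.dual_degree_eq_bot (h : X.IsRegular) (hn : X.HasTopDegree n) {m : ℕ}
    (hm : n < m) : X.dual.degree m = ⊥ := by
  rw [Submodule.eq_bot_iff]
  intro φ hφ
  refine h.pairing_left_nondeg _ fun b => ?_
  induction b using degree_induction with
  | add a b ha hb => rw [map_add, ha, hb, add_zero]
  | mem j b hb =>
    by_cases hj : j = m
    · rw [hj, hn.2 m hm] at hb
      rw [(Submodule.mem_bot k).1 hb, map_zero]
    · exact h.pairing_of_ne (Ne.symm hj) hφ hb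

theorem HasTopDegree.exists_smul (hn : X.HasTopDegree n) (hvol : vol ∈ X.degree n)
    (hvol0 : vol ≠ 0) {b : X.Ext} (hb : b ∈ X.degree n) : ∃ r : k, b = r • vol := by
  have h0 : (⟨vol, hvol⟩ : X.degree n) ≠ 0 := fun h => hvol0 (congrArg Subtype.val h)
  obtain ⟨r, hr⟩ := exists_smul_eq_of_finrank_eq_one hn.1 h0 ⟨b, hb⟩
  exact ⟨r, (congrArg Subtype.val hr).symm⟩

theorem IsRegular.integral_spec (h : X.IsRegular) (hvol : vol ∈ X.degree n) (hvol0 : vol ≠ 0) :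
    X.integral n vol vol = 1 ∧ ∀ m, m ≠ n → ∀ x ∈ X.degree m, X.integral n vol x = 0 := by
  obtain ⟨f, hf⟩ := Module.Projective.exists_dual_ne_zero k hvol0
  refine theElement_spec (P := fun I : X.Ext →ₗ[k] k => I vol = 1 ∧
    ∀ m, m ≠ n → ∀ x ∈ X.degree m, I x = 0) ⟨(f vol)⁻¹ • (f ∘ₗ X.proj n), ?_, fun m hm x hx => ?_⟩
  · simp [h.proj_of_mem hvol, hf]
  · simp [h.proj_of_ne hm hx]

theorem IsRegular.exp_spec (h : X.IsRegular) (hn : X.HasTopDegree n) :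
    (∀ b, TensorProduct.rid k X.Ext (LinearMap.lTensor X.Ext (X.pairing.flip b) X.exp) = b) ∧
    ∀ φ, TensorProduct.lid k X.dual.Ext (LinearMap.rTensor X.dual.Ext (X.pairing φ) X.exp) = φ := by
  have := hn.finite
  exact theElement_spec (exists_coevaluation X.pairing h.pairing_left_nondeg
    h.pairing_right_nondeg)

/-- The sign (-1)^(ij) is the action on degree `j` of the group element (-1)^i in the coaction on
degree `i`. Truncating the sums at `n` loses nothing, since higher degrees vanish in `B` and, by
duality, in `B^⋆`. -/
theorem IsRegular.superBraidInv_eq (h : X.IsRegular) (hn : X.HasTopDegree n) :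
    X.superBraidInv n = braidInv h.dual.hopf.X.act h.hopf.X.coact := by
  refine TensorProduct.ext ?_
  refine linearMap_ext_degree fun i b hb => linearMap_ext_degree fun j φ hφ => ?_
  change X.superBraidInv n (b ⊗ₜ φ) = braidInv h.dual.hopf.X.act h.hopf.X.coact (b ⊗ₜ φ)
  by_cases hi : n < i
  · rw [hn.2 i hi, Submodule.mem_bot] at hb
    rw [hb, TensorProduct.zero_tmul, map_zero, map_zero]
  by_cases hj : n < j
  · rw [h.dual_degree_eq_bot hn hj, Submodule.mem_bot] at hφ
    rw [hφ, TensorProduct.tmul_zero, map_zero, map_zero]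
  have h1 : X.superBraidInv n (b ⊗ₜ φ) =
      (-1 : k) ^ (i * j) • braidInv X.dual.extAct X.extCoact (b ⊗ₜ φ) := by
    rw [superBraidInv]
    simp only [LinearMap.sum_apply, LinearMap.smul_apply, LinearMap.comp_apply,
      TensorProduct.map_tmul]
    rw [Finset.sum_eq_single i, Finset.sum_eq_single j]
    · rw [h.proj_of_mem hb, h.dual.proj_of_mem hφ]
    · intro j' _ hj'
      rw [h.dual.proj_of_ne hj'.symm hφ, TensorProduct.tmul_zero, map_zero, smul_zero]
    · intro hj'
      exact absurd (Finset.mem_range.2 (by omega)) hj'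
    · intro i' _ hi'
      refine Finset.sum_eq_zero fun j' _ => ?_
      rw [h.proj_of_ne hi'.symm hb, TensorProduct.zero_tmul, map_zero, smul_zero]
    · intro hi'
      exact absurd (Finset.mem_range.2 (by omega)) hi'
  rw [h1]
  obtain ⟨z, hz⟩ := h.coact_of_mem hb
  simp only [braidInv, LinearMap.comp_apply, LinearEquiv.coe_coe, TensorProduct.comm_tmul, braid,
    TensorProduct.lift.tmul, LinearMap.compl₂_apply, h.extCoact_of_coact hz, hz]
  clear hz
  induction z with
  | zero => simp
  | add x y hx hy => simp only [map_add, smul_add, hx, hy]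
  | tmul x a =>
    simp [antipodeInv_single h.antipode_bijective, h.dual.act_single hφ, pow_mul]

end TopDegree

end CrossedData

/-! ### The Hodge star -/

namespace CrossedData

variable {k A V : Type*} [Field k] [Ring A] [HopfAlgebra k A] [AddCommGroup V] [Module k V]
  [Module.Finite k V] {X : CrossedData k A V} {g : V ⊗[k] V} {n : ℕ} {vol : X.Ext}

/-- A crossed module with a bi-invariant metric and a bi-invariant central top form. -/
structure IsHodge (X : CrossedData k A V) (g : V ⊗[k] V) (n : ℕ) (vol : X.Ext) : Prop
    extends X.IsRegular where
  metric : X.IsBiinvariantMetric g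
  top : X.HasTopDegree n
  vol_mem : vol ∈ X.degree n
  vol_ne : vol ≠ 0
  central : X.IsCentralBiinvariant vol

namespace IsHodge

theorem integral_vol (h : X.IsHodge g n vol) : X.integral n vol vol = 1 :=
  (h.integral_spec h.vol_mem h.vol_ne).1

theorem integral_of_ne (h : X.IsHodge g n vol) {m : ℕ} (hm : m ≠ n) {b : X.Ext}
    (hb : b ∈ X.degree m) : X.integral n vol b = 0 :=
  (h.integral_spec h.vol_mem h.vol_ne).2 m hm b hb

theorem eq_integral_smul (h : X.IsHodge g n vol) {b : X.Ext} (hb : b ∈ X.degree n) :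
    b = X.integral n vol b • vol := by
  obtain ⟨r, rfl⟩ := h.top.exists_smul h.vol_mem h.vol_ne hb
  rw [map_smul, h.integral_vol, smul_eq_mul, mul_one]

theorem pairing_contract_exp (h : X.IsHodge g n vol) (α : X.Ext →ₗ[k] k) (t : X.Ext) :
    X.pairing (TensorProduct.lid k _ (LinearMap.rTensor X.dual.Ext α X.exp)) t = α t := by
  conv_rhs => rw [← (h.exp_spec h.top).1 t]
  generalize X.exp = z
  induction z with
  | zero => simp
  | add x y hx hy => simp only [map_add, LinearMap.add_apply, hx, hy]
  | tmul x y => simp [mul_comm]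

theorem pairing_fourier (h : X.IsHodge g n vol) (I : X.Ext →ₗ[k] k) (b t : X.Ext) :
    X.pairing (X.fourier I b) t = I (b * t) :=
  h.pairing_contract_exp ((LinearMap.mul k X.Ext).compr₂ I b) t

theorem fourier_mem (h : X.IsHodge g n vol) {m d : ℕ} (hm : m + d = n) {b : X.Ext}
    (hb : b ∈ X.degree m) : X.fourier (X.integral n vol) b ∈ X.dual.degree d := by
  refine h.mem_dual_degree fun j hj t ht => ?_
  rw [h.pairing_fourier]
  exact h.integral_of_ne (by omega) (mul_mem_degree hb ht)

theorem pairing_fourier_one (h : X.IsHodge g n vol) :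
    X.pairing (X.fourier (X.integral n vol) 1) = X.integral n vol :=
  LinearMap.ext fun t => by rw [h.pairing_fourier, one_mul]

/-- Centrality says `a₁ ⊗ (vol ◁ a₂) = a ⊗ vol`; the counit on the first factor gives the action. -/
theorem extAct_vol (h : X.IsHodge g n vol) (a : A) :
    X.extAct vol a = Coalgebra.counit (R := k) a • vol := by
  have h1 := congrArg (fun z => TensorProduct.lid k X.Ext
    (LinearMap.rTensor X.Ext (Coalgebra.counit (R := k) (A := A)) z)) (h.central.2 a)
  simp only [LinearMap.rTensor_tmul, TensorProduct.lid_tmul] at h1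
  rw [← h1]
  have h2 := congrArg (fun z => TensorProduct.lid k X.Ext (LinearMap.lTensor k (X.extAct vol) z))
    (Coalgebra.rTensor_counit_comul (R := k) a)
  simp only [LinearMap.lTensor_tmul, TensorProduct.lid_tmul, one_smul] at h2
  rw [← h2]
  generalize Coalgebra.comul (R := k) a = z
  induction z with
  | zero => simp
  | add x y hx hy => simp only [map_add, hx, hy]
  | tmul x y => simp

theorem coact_vol (h : X.IsHodge g n vol) :
    h.hopf.X.coact vol = vol ⊗ₜ MonoidAlgebra.single ((-1) ^ n) 1 := by
  obtain ⟨z, hz⟩ := h.coact_of_mem h.vol_mem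
  have h1 := congrArg (LinearMap.lTensor X.Ext (MonoidAlgebra.lsingle (R := k) ((-1 : ℤˣ) ^ n)))
    ((h.extCoact_of_coact hz).symm.trans h.central.1)
  rw [LinearMap.lTensor_tmul] at h1
  refine Eq.trans ?_ h1
  rw [hz, ← LinearMap.comp_apply, LinearMap.lTensor_comp_rTensor]

variable (k A n) in
/-- The character by which the group algebra acts on the top form. -/
def volChar : MonoidAlgebra A ℤˣ →ₗ[k] k := Coalgebra.counit ∘ₗ (signEval k A n).toLinearMap

theorem volChar_single (u : ℤˣ) (a : A) : volChar k A n (MonoidAlgebra.single u a) =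
    ((u : ℤ) : k) ^ n * Coalgebra.counit (R := k) a := by
  simp [volChar, signEval_single]

theorem act_vol (h : X.IsHodge g n vol) (a : MonoidAlgebra A ℤˣ) :
    h.hopf.X.act vol a = volChar k A n a • vol := by
  suffices hs : h.hopf.X.act vol = (volChar k A n).smulRight vol from congrArg (fun F => F a) hs
  refine super_ext fun u a => ?_
  rw [h.act_single h.vol_mem, h.extAct_vol, LinearMap.smulRight_apply, volChar_single, smul_smul]

/-- An element that represents the integral has degree `n`, so for reasons of degree only the scalar
part of the other factor can pair with `vol`. -/
theorem pairing_mul_vol (h : X.IsHodge g n vol) {ψ : X.dual.Ext} (hψ : X.pairing ψ = X.integral n vol)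
    (φ : X.dual.Ext) : X.pairing (ψ * φ) vol = X.dual.counit φ ∧
      X.pairing (φ * ψ) vol = X.dual.counit φ := by
  have hmem : ψ ∈ X.dual.degree n := h.mem_dual_degree fun m hm b hb => by
    rw [hψ, h.integral_of_ne hm hb]
  induction φ using degree_induction with
  | add a b ha hb =>
    simp only [map_add, mul_add, add_mul, LinearMap.add_apply, ha, hb, and_self]
  | mem m φ hφ =>
    by_cases hm : m = 0
    · subst hm
      obtain ⟨r, rfl⟩ := exists_of_mem_degree_zero hφ
      rw [h.dual.counit_algebraMap, Algebra.algebraMap_eq_smul_one, mul_smul_comm, smul_mul_assoc,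
        mul_one, one_mul, map_smul, LinearMap.smul_apply, hψ, h.integral_vol]
      simp
    · rw [h.dual.counit_of_ne hm hφ]
      exact ⟨h.pairing_of_ne (by omega) (mul_mem_degree hmem hφ) h.vol_mem,
        h.pairing_of_ne (by omega) (mul_mem_degree hφ hmem) h.vol_mem⟩

theorem isIntegral (h : X.IsHodge g n vol) : h.pairing.IsIntegral vol (X.integral n vol)
    (MonoidAlgebra.single ((-1) ^ n) 1) (volChar k A n) where
  mul_vol b := by
    change b * vol = X.counit b • vol
    induction b using degree_induction with
    | add a b ha hb => rw [add_mul, ha, hb, map_add, add_smul]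
    | mem m b hb =>
      by_cases hm : m = 0
      · subst hm
        obtain ⟨r, rfl⟩ := exists_of_mem_degree_zero hb
        rw [h.counit_algebraMap, Algebra.smul_def]
      · have h1 := mul_mem_degree hb h.vol_mem
        rw [h.top.2 _ (by omega), Submodule.mem_bot] at h1
        -- A factor of positive degree carries `vol` beyond the top degree.
        rw [h1, h.counit_of_ne hm hb, zero_smul]
  vol_mul b := by
    change vol * b = X.counit b • vol
    induction b using degree_induction with
    | add a b ha hb => rw [mul_add, ha, hb, map_add, add_smul]
    | mem m b hb =>
      by_cases hm : m = 0
      · subst hm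
        obtain ⟨r, rfl⟩ := exists_of_mem_degree_zero hb
        rw [h.counit_algebraMap, Algebra.smul_def, Algebra.commutes]
      · have h1 := mul_mem_degree h.vol_mem hb
        rw [h.top.2 _ (by omega), Submodule.mem_bot] at h1
        rw [h1, h.counit_of_ne hm hb, zero_smul]
  -- Paired with `φ`, the contraction of `Δ vol` with the integral is `⟨F(1) φ, vol⟩`, because
  -- `F(1)` represents the integral; this equals `ε(φ) = ⟨φ, 1⟩`.
  cop_integral := by
    rw [← sub_eq_zero]
    refine h.pairing_right_nondeg _ fun φ => ?_
    have h1 := h.pairing.one_right φ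
    have h2 := h.pairing.mul_left (X.fourier (X.integral n vol) 1) φ vol
    rw [h.pairing_pair] at h1 h2
    rw [(h.pairing_mul_vol h.pairing_fourier_one φ).1, h.pairing_fourier_one] at h2
    rw [map_sub, h1, sub_eq_zero]
    refine Eq.trans ?_ h2.symm
    generalize h.hopf.cop vol = z
    induction z with
    | zero => simp
    | add x y hx hy => simp only [map_add, hx, hy]
    | tmul x y => simp [mul_comm]
  integral_act x a := by
    induction x using degree_induction with
    | add x y hx hy => simp only [map_add, LinearMap.add_apply, hx, hy, mul_add]
    | mem m x hx =>
      by_cases hm : m = n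
      · subst hm
        rw [h.eq_integral_smul hx, map_smul, LinearMap.smul_apply, h.act_vol]
        simp [h.integral_vol, mul_comm]
      · rw [h.integral_of_ne hm hx, h.integral_of_ne hm (h.act_mem hx a), mul_zero]
  act_vol := h.act_vol
  coact_vol := h.coact_vol
  -- Both sides are the sign (-1)^(mn) on degree `m`, computed as ((-1)^m)^n on the left and
  -- ((-1)^n)^m on the right.
  char b := by
    induction b using degree_induction with
    | add x y hx hy => simp only [map_add, LinearMap.add_apply, hx, hy]
    | mem m b hb =>
      obtain ⟨z, hz⟩ := h.coact_of_mem hb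
      have h1 := h.hopf.ydAlg.comodule.counit b
      rw [h.act_single hb, h.extAct_eq, ← MonoidAlgebra.one_def, h.hopf.ydAlg.act_one]
      conv_rhs => rw [← h1]
      rw [hz]
      clear hz h1
      induction z with
      | zero => simp
      | add x y hx hy => simp only [map_add, hx, hy, smul_add]
      | tmul x a =>
        simp [volChar_single, smul_smul, ← pow_mul, mul_comm]
  sq := by
    rw [MonoidAlgebra.single_mul_single, ← mul_pow]
    simp [MonoidAlgebra.one_def]
  left_nondeg := h.pairing_left_nondeg
  right_nondeg := h.pairing_right_nondeg

theorem metricExt_volStar (h : X.IsHodge g n vol) : X.metricExt g (X.volStar g vol) = vol :=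
  apply_linInverse (h.metricExt_bijective h.metric) vol

theorem volStar_mem (h : X.IsHodge g n vol) : X.volStar g vol ∈ X.dual.degree n := by
  refine h.mem_of_metricExt_mem h.metric ?_
  rw [h.metricExt_volStar]
  exact h.vol_mem

theorem volStar_ne (h : X.IsHodge g n vol) : X.volStar g vol ≠ 0 := by
  intro h0
  have h1 := h.metricExt_volStar
  rw [h0, map_zero] at h1
  exact h.vol_ne h1.symm

theorem integralStar_eq (h : X.IsHodge g n vol) (φ : X.dual.Ext) :
    X.integralStar g n vol φ = X.integral n vol (X.metricExt g φ) := by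
  have hs := h.dual.integral_spec h.volStar_mem h.volStar_ne
  change X.dual.integral n (X.volStar g vol) φ = _
  induction φ using degree_induction with
  | add a b ha hb => simp only [map_add, ha, hb]
  | mem m φ hφ =>
    by_cases hm : m = n
    · subst hm
      obtain ⟨r, hr⟩ := h.top.exists_smul h.vol_mem h.vol_ne (h.metricExt_mem h.metric hφ)
      have h1 : φ = r • X.volStar g vol := by
        refine (h.metricExt_bijective h.metric).1 ?_
        rw [hr, map_smul, h.metricExt_volStar]
      rw [hr, h1, map_smul, map_smul, hs.1, h.integral_vol]
    · rw [hs.2 m hm φ hφ, h.integral_of_ne hm (h.metricExt_mem h.metric hφ)]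

/-- The element `F(1)` has degree `n`, so it is a multiple `r` of the dual volume form; pairing with
`vol` gives `r ⟨Vol, Vol⟩ = 1`, which also shows that `⟨Vol, Vol⟩` is nonzero. -/
theorem fourier_one (h : X.IsHodge g n vol) :
    X.metricPairing g vol vol ≠ 0 ∧ X.fourier (X.integral n vol) 1 =
      (X.metricPairing g vol vol)⁻¹ • X.volStar g vol := by
  have h1 := h.fourier_mem (zero_add n) one_mem_degree
  obtain ⟨r, hr⟩ := h.top.exists_smul h.vol_mem h.vol_ne (h.metricExt_mem h.metric h1)
  have h2 : X.fourier (X.integral n vol) 1 = r • X.volStar g vol := by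
    refine (h.metricExt_bijective h.metric).1 ?_
    rw [hr, map_smul, h.metricExt_volStar]
  have h3 : r * X.metricPairing g vol vol = 1 := by
    have h4 : X.pairing (X.fourier (X.integral n vol) 1) vol = X.integral n vol vol := by
      rw [h.pairing_fourier_one]
    rw [h2, map_smul, LinearMap.smul_apply, h.integral_vol] at h4
    exact h4
  refine ⟨right_ne_zero_of_mul (h3.trans_ne one_ne_zero), ?_⟩
  rw [h2, eq_inv_of_mul_eq_one_left h3]

/-- By definition of the Fourier transform, `μ` is the dual integral of `F(1)`. -/
theorem mu_eq (h : X.IsHodge g n vol) :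
    X.mu g n vol = (X.metricPairing g vol vol)⁻¹ := by
  have h1 : X.mu g n vol = X.integralStar g n vol (X.fourier (X.integral n vol) 1) := by
    have h2 : (LinearMap.mul k X.Ext).compr₂ (X.integral n vol) 1 = X.integral n vol :=
      LinearMap.ext fun b => by simp
    simp only [mu, fourier, LinearMap.comp_apply, h2, LinearMap.flip_apply,
      LinearMap.coe_rTensorHom, LinearEquiv.coe_coe]
    generalize X.exp = z
    induction z with
    | zero => simp
    | add x y hx hy => simp only [map_add, hx, hy]
    | tmul x y => simp
  rw [h1, h.fourier_one.2, map_smul, h.integralStar_eq, h.metricExt_volStar, h.integral_vol,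
    smul_eq_mul, mul_one]

theorem integralStar_eq_pairing (h : X.IsHodge g n vol) (φ : X.dual.Ext) :
    X.integralStar g n vol φ = X.mu g n vol * X.pairing φ vol := by
  rw [h.integralStar_eq, h.mu_eq]
  induction φ using degree_induction with
  | add a b ha hb => simp only [map_add, LinearMap.add_apply, ha, hb, mul_add]
  | mem m φ hφ =>
    by_cases hm : m = n
    · subst hm
      obtain ⟨r, hr⟩ := h.top.exists_smul h.vol_mem h.vol_ne (h.metricExt_mem h.metric hφ)
      have h1 : φ = r • X.volStar g vol := by
        refine (h.metricExt_bijective h.metric).1 ?_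
        rw [hr, map_smul, h.metricExt_volStar]
      have h2 : X.pairing (X.volStar g vol) vol = X.metricPairing g vol vol := rfl
      rw [hr, h1, map_smul, map_smul, LinearMap.smul_apply, h.integral_vol, h2, smul_eq_mul,
        smul_eq_mul, mul_left_comm, inv_mul_cancel₀ h.fourier_one.1]
    · rw [h.integral_of_ne hm (h.metricExt_mem h.metric hφ), h.pairing_of_ne hm hφ h.vol_mem,
        mul_zero]

/-- The top degree is a line, so `S` acts on `vol` by a scalar `s`, and `sign_eq` determines it:
`F(1)` contracts `vol` to 1 and pairs with `vol` to 1. -/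
theorem anti_vol (h : X.IsHodge g n vol) : h.hopf.anti vol = (-1 : k) ^ n • vol := by
  have := h.top.finite
  obtain ⟨s, hs⟩ := h.top.exists_smul h.vol_mem h.vol_ne (h.anti_mem h.vol_mem)
  have hψ : h.pairing.leftOp (X.fourier (X.integral n vol) 1) vol = 1 := by
    rw [← sub_eq_zero]
    refine h.pairing_right_nondeg _ fun φ => ?_
    have h1 := h.pairing.one_right φ
    have h2 := h.pairing.pair_leftOp φ (X.fourier (X.integral n vol) 1) vol
    rw [h.pairing_pair] at h1 h2
    rw [map_sub, h2, (h.pairing_mul_vol h.pairing_fourier_one φ).2, h1, sub_eq_zero]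
    rfl
  have h3 := h.isIntegral.sign_eq hs h.integral_vol hψ
  rw [h.pairing_pair, h.pairing_fourier_one, h.integral_vol, mul_one] at h3
  -- The group element (-1)^n is its own inverse and acts on degree `n` by (-1)^(n²), which equals
  -- (-1)^n.
  have h4 : volChar k A n (HopfAlgebra.antipode k (MonoidAlgebra.single ((-1 : ℤˣ) ^ n) (1 : A))) =
      (-1 : k) ^ n := by
    rw [MonoidAlgebra.antipode_single, volChar_single]
    rcases Nat.even_or_odd n with hn | hn <;> simp [hn.neg_one_pow]
  rw [h4] at h3
  rw [hs]
  congr 1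
  have h5 : (-1 : k) ^ n * (-1 : k) ^ n = 1 := by rw [← mul_pow]; simp
  calc s = s * ((-1 : k) ^ n * (-1 : k) ^ n) := by rw [h5, mul_one]
    _ = (-1 : k) ^ n := by rw [← mul_assoc, ← h3, one_mul]

theorem integral_anti (h : X.IsHodge g n vol) (x : X.Ext) :
    X.integral n vol (h.hopf.anti x) = (-1 : k) ^ n * X.integral n vol x := by
  induction x using degree_induction with
  | add a b ha hb => simp only [map_add, ha, hb, mul_add]
  | mem m x hx =>
    by_cases hm : m = n
    · subst hm
      rw [h.eq_integral_smul hx, map_smul, h.anti_vol]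
      simp [h.integral_vol, mul_comm]
    · rw [h.integral_of_ne hm hx, h.integral_of_ne hm (h.anti_mem hx), mul_zero]

theorem hodge_bijective (h : X.IsHodge g n vol) : Function.Bijective (X.hodge g n vol) := by
  have := h.top.finite
  exact (h.metricExt_bijective h.metric).comp
    (h.isIntegral.fourier_bijective (h.pairing_fourier _))

theorem hodge_anti (h : X.IsHodge g n vol) (b : X.Ext) :
    X.hodge g n vol (h.hopf.anti b) = (-1 : k) ^ n • h.hopf.anti (X.hodge g n vol b) := by
  have := h.top.finite
  have h1 := h.isIntegral.fourier_anti (s := (-1 : k) ^ n) (by rw [← mul_pow]; simp)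
    h.integral_anti (h.pairing_fourier _) b
  rw [hodge, LinearMap.comp_apply, LinearMap.comp_apply, h1, map_smul,
    h.metricExt_anti h.metric]

theorem pairing_fourierStar (h : X.IsHodge g n vol) (J : X.dual.Ext →ₗ[k] k) (φ ψ : X.dual.Ext) :
    X.pairing (h.dual.hopf.twist ψ) (X.fourierStar n J φ) = J (φ * ψ) := by
  have := h.top.finite
  have h1 := h.isIntegral.pair_twist_contract (super_antipode_bijective h.antipode_bijective)
    (h.exp_spec h.top).2 ((LinearMap.mul k X.dual.Ext).compr₂ J φ) ψ
  rw [← h.superBraidInv_eq h.top] at h1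
  exact h1

theorem hodgeStar_hodge (h : X.IsHodge g n vol) (b : X.Ext) :
    X.hodgeStar g n vol (X.hodge g n vol b) = X.mu g n vol • X.signD (h.hopf.anti b) := by
  have := h.top.finite
  have h1 := h.isIntegral.fourierStar_fourier (super_antipode_bijective h.antipode_bijective)
    (h.pairing_fourier _) h.integralStar_eq_pairing (h.pairing_fourierStar _) b
  rw [hodgeStar, hodge, LinearMap.comp_apply, LinearMap.comp_apply, LinearMap.comp_apply,
    linInverse_apply (h.metricExt_bijective h.metric), h1, map_smul]

theorem hodge_mem (h : X.IsHodge g n vol) {m d : ℕ} (hm : m + d = n) {b : X.Ext}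
    (hb : b ∈ X.degree m) : X.hodge g n vol b ∈ X.degree d :=
  h.metricExt_mem h.metric (h.fourier_mem hm hb)

/-- Since ♯ sends degree `j` to degree `n - j`, only the degree `m` component of a preimage
contributes to degree `d`. -/
theorem exists_hodge_eq (h : X.IsHodge g n vol) {m d : ℕ} (hm : m + d = n) {b : X.Ext}
    (hb : b ∈ X.degree d) : ∃ c ∈ X.degree m, X.hodge g n vol c = b := by
  obtain ⟨c, rfl⟩ := h.hodge_bijective.2 b
  refine ⟨X.proj m c, h.proj_mem m c, ?_⟩
  conv_rhs => rw [← h.proj_of_mem hb]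
  clear hb
  induction c using degree_induction with
  | add a b ha hb => simp only [map_add, ha, hb]
  | mem j c hc =>
    by_cases hj : j = m
    · subst hj
      rw [h.proj_of_mem hc, h.proj_of_mem (h.hodge_mem hm hc)]
    · rw [h.proj_of_ne hj hc, map_zero]
      by_cases hjn : n < j
      · rw [h.top.2 j hjn, Submodule.mem_bot] at hc
        rw [hc, map_zero, map_zero]
      · rw [h.proj_of_ne (m := n - j) (by omega) (h.hodge_mem (by omega) hc)]

theorem hodge_one (h : X.IsHodge g n vol) : X.hodge g n vol 1 = X.mu g n vol • vol := by
  rw [hodge, LinearMap.comp_apply, h.fourier_one.2, map_smul, h.metricExt_volStar, h.mu_eq]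

theorem hodge_vol (h : X.IsHodge g n vol) : X.hodge g n vol vol = 1 := by
  have h1 : X.fourier (X.integral n vol) vol = 1 := by
    rw [← sub_eq_zero]
    refine h.pairing_left_nondeg _ fun t => ?_
    have h2 := h.pairing.one_left t
    rw [h.pairing_pair] at h2
    rw [map_sub, LinearMap.sub_apply, h.pairing_fourier, h2, h.isIntegral.vol_mul, map_smul,
      h.integral_vol]
    simp
  rw [hodge, LinearMap.comp_apply, h1, h.metricExt_one h.metric]

end IsHodge

end CrossedData

/-! ### Quantum symmetric metrics -/

namespace CrossedData

variable {k A V : Type*} [Field k] [Ring A] [HopfAlgebra k A] [AddCommGroup V] [Module k V]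
  [Module.Finite k V] {X : CrossedData k A V} {g : V ⊗[k] V} {n : ℕ} {vol : X.Ext}

theorem IsRegular.pairing_incl (h : X.IsRegular) (f : Module.Dual k V) (v : V) :
    X.pairing (X.dual.incl f) (X.incl v) = f v := by
  refine (h.pairing_toExt _ _).trans ?_
  rw [diffPairing_ι h.isYD.super, degOne_ι]

/-- In degree two the factorial is `[2,-Ψ]! = id - Ψ`. -/
theorem IsRegular.pairing_incl_mul_incl (h : X.IsRegular) (f p : Module.Dual k V) (z : V ⊗[k] V) :
    X.pairing (X.dual.incl p * X.dual.incl f)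
      (LinearMap.mul' k X.Ext (TensorProduct.map X.incl X.incl z)) =
    LinearMap.mul' k k (TensorProduct.map f p (z - X.braiding z)) := by
  induction z with
  | zero => simp
  | add x y hx hy =>
    rw [map_add, map_add, map_add, hx, hy, ← map_add, ← map_add, map_add X.braiding,
      add_sub_add_comm]
  | tmul v w =>
    rw [TensorProduct.map_tmul, LinearMap.mul'_apply]
    have h1 : X.dual.incl p * X.dual.incl f = X.dual.toExt
        (TensorAlgebra.ι k p * TensorAlgebra.ι k f) := by simp [incl]
    have h2 : X.incl v * X.incl w = X.toExt (TensorAlgebra.ι k v * TensorAlgebra.ι k w) := by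
      simp [incl]
    have h3 : X.super.tensorDeriv (TensorAlgebra.ι k w) = w ⊗ₜ 1 := by
      rw [tensorDeriv, LinearMap.comp_apply, tensorCop_ι h.isYD.super, prim_apply]
      simp [degOne_ι, degOne_one]
    rw [h1, h2, h.pairing_toExt, diffPairing_mul_ι]
    have h4 : X.super.partialD f (TensorAlgebra.ι k v * TensorAlgebra.ι k w) =
        TensorAlgebra.ι k (TensorProduct.lid k V (LinearMap.rTensor V f
          (v ⊗ₜ w - X.braiding (v ⊗ₜ w)))) := by
      change TensorProduct.lid k _ (LinearMap.rTensor _ f (X.super.tensorDeriv _)) = _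
      rw [tensorDeriv_ι_mul h.isYD.super, h3, TensorProduct.assoc_symm_tmul,
        LinearMap.rTensor_tmul, super_braiding, LinearMap.neg_apply]
      generalize X.braiding (v ⊗ₜ w) = y
      have h5 : ∀ y : V ⊗[k] V, TensorProduct.lid k _ (LinearMap.rTensor _ f (LinearMap.lTensor V
          (LinearMap.mul' k _ ∘ₗ LinearMap.rTensor (TensorAlgebra k V) (TensorAlgebra.ι k))
          (TensorProduct.assoc k V V (TensorAlgebra k V) (y ⊗ₜ 1)))) =
          TensorAlgebra.ι k (TensorProduct.lid k V (LinearMap.rTensor V f y)) := by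
        intro y
        induction y with
        | zero => simp
        | add a b ha hb => simp only [TensorProduct.add_tmul, map_add, ha, hb]
        | tmul a b => simp
      rw [map_add, map_add, h5]
      simp [sub_eq_add_neg]
    rw [h4, diffPairing_ι h.isYD.super, degOne_ι]
    generalize v ⊗ₜ w - X.braiding (v ⊗ₜ w) = y
    induction y with
    | zero => simp
    | add a b ha hb => simp only [map_add, ha, hb]
    | tmul a b => simp

/-- Quantum symmetry says that `g` lies in the kernel of `[2,-Ψ]!`, that is `Ψ(g) = g`, here tested
on pairs of functionals. -/
theorem IsRegular.map_braiding_metric (h : X.IsRegular) (hq : X.IsQuantumSymmetric g)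
    (f p : Module.Dual k V) : LinearMap.mul' k k (TensorProduct.map f p (X.braiding g)) =
      LinearMap.mul' k k (TensorProduct.map f p g) := by
  have h1 := h.pairing_incl_mul_incl f p g
  rw [hq, map_zero, map_sub, map_sub] at h1
  exact (sub_eq_zero.1 h1.symm).symm

theorem apply_metricMap (f p : Module.Dual k V) :
    p (metricMap g f) = LinearMap.mul' k k (TensorProduct.map f p g) := by
  simp only [metricMap, LinearMap.comp_apply, LinearMap.flip_apply, LinearMap.coe_rTensorHom,
    LinearEquiv.coe_coe]
  generalize g = y
  induction y with
  | zero => simp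
  | add a b ha hb => simp only [map_add, ha, hb]
  | tmul a b => simp

/-- The twist acts by the antipode of the coaction. Equivariance of the metric moves that action
onto `p`, duality moves it onto the first leg of `g`, and summing over the dual basis assembles the
braiding of `g`. The minus sign is that of the super structure in degree one. -/
theorem IsRegular.pairing_twist_incl (h : X.IsRegular) (hg : X.IsBiinvariantMetric g)
    (f p : Module.Dual k V) :
    X.pairing (h.dual.hopf.twist (X.dual.incl f)) (X.incl (metricMap g p)) =
      -LinearMap.mul' k k (TensorProduct.map f p (X.braiding g)) := by
  let b := Module.finBasis k V
  let c := coeffMatrix X.coact b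
  have hD := dual_isDualOf (X := X) h.antipode_bijective
  have hb := h.isYD.comodule.basis_family b
  have hfam : IsFamily h.dual.hopf.X.coact (fun i => X.dual.incl (b.coord i))
      (fun j i => MonoidAlgebra.single (-1 : ℤˣ) (HopfAlgebra.antipode k (c i j))) := by
    have h1 := family_ι (super_family (hD.family h.isYD b))
    refine ⟨h1.comatrix, fun j => ?_⟩
    refine (h.dual.hopf_coact_toExt _).trans ?_
    rw [h1.coact]
    simp [incl, c]
  have hR : ∀ f : Module.Dual k V, LinearMap.mul' k k (TensorProduct.map f p (X.braiding g)) =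
      f (TensorProduct.rid k V (LinearMap.lTensor V p (X.braiding g))) := by
    intro f
    generalize X.braiding g = y
    induction y with
    | zero => simp
    | add x y hx hy => simp only [map_add, hx, hy]
    | tmul x y => simp [mul_comm]
  rw [hR]
  suffices hs : X.pairing.flip (X.incl (metricMap g p)) ∘ₗ h.dual.hopf.twist ∘ₗ X.dual.incl =
      -Module.Dual.eval k V (TensorProduct.rid k V (LinearMap.lTensor V p (X.braiding g))) from
    congrArg (fun F => F f) hs
  refine b.dualBasis.ext fun j => ?_
  rw [b.coe_dualBasis, LinearMap.comp_apply, LinearMap.comp_apply,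
    BraidedHopf.twist_family hfam j, LinearMap.neg_apply, Module.Dual.eval_apply, ← hR]
  simp only [MonoidAlgebra.antipode_single, h.dual.act_incl, map_sum, map_smul,
    LinearMap.flip_apply, h.pairing_incl, hD.act]
  simp only [← (hg.isMorphism h.isYD h.antipode_bijective).act, apply_metricMap]
  have h2 : ∑ i, LinearMap.mul' k k (TensorProduct.map (X.dual.act p
      (HopfAlgebra.antipode k (c j i))) (b.coord i) g) =
      LinearMap.mul' k k (TensorProduct.map (b.coord j) p (X.braiding g)) := by
    generalize g = y
    induction y with
    | zero => simp
    | add x y hx hy => simp only [map_add, Finset.sum_add_distrib, hx, hy]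
    | tmul x y =>
      have h3 : X.braiding (x ⊗ₜ y) =
          ∑ i, ∑ l, b.coord i y • (b l ⊗ₜ[k] X.act x (c l i)) := by
        conv_lhs => rw [← b.sum_repr y]
        simp only [braiding, braid, TensorProduct.lift.tmul, LinearMap.compl₂_apply,
          LinearMap.comp_apply, LinearMap.coe_lTensorHom, map_sum, map_smul, hb.coact,
          LinearMap.lTensor_tmul, Finset.smul_sum]
        rfl
      rw [h3]
      simp [hD.act, Finsupp.single_apply, mul_comm]
  rw [← h2]
  simp [c]

theorem IsRegular.twist_mem (h : X.IsRegular) {m : ℕ} {b : X.Ext} (hb : b ∈ X.degree m) :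
    h.hopf.twist b ∈ X.degree m := by
  obtain ⟨z, hz⟩ := h.coact_of_mem hb
  rw [BraidedHopf.twist, LinearMap.comp_apply, hz]
  clear hz
  induction z with
  | zero => simp
  | add x y hx hy => simpa only [map_add] using add_mem hx hy
  | tmul x a =>
    rw [TensorProduct.map_tmul, TensorProduct.lift.tmul, LinearMap.compl₂_apply]
    exact h.act_mem x.2 _

namespace IsHodge

theorem anti_of_mem (h : X.IsHodge g n vol) {m : ℕ}
    (hm : m = 0 ∨ m = 1 ∨ m + 1 = n ∨ m = n) {ω : X.Ext} (hω : ω ∈ X.degree m) :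
    h.hopf.anti ω = (-1 : k) ^ m • ω := by
  have hone : ∀ ω ∈ X.degree 1, h.hopf.anti ω = (-1 : k) ^ 1 • ω := by
    intro ω hω
    obtain ⟨v, rfl⟩ := exists_of_mem_degree_one hω
    rw [h.anti_incl, pow_one, neg_one_smul]
  rcases hm with rfl | rfl | hm | rfl
  · obtain ⟨r, rfl⟩ := exists_of_mem_degree_zero hω
    rw [Algebra.algebraMap_eq_smul_one, map_smul, h.hopf.anti_one, pow_zero, one_smul]
  · exact hone ω hω
  -- Just below the top, ♯ maps into degree one, where `S = -1`; commuting `S` past ♯ costs (-1)^n,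
  -- and (-1)^n · (-1) = (-1)^(n-1).
  · refine h.hodge_bijective.1 ?_
    rw [h.hodge_anti, hone _ (h.hodge_mem hm hω), map_smul, smul_smul, ← hm]
    congr 1
    rw [← pow_add, show m + 1 + 1 = m + 2 by rfl, pow_add]
    simp
  · rw [h.eq_integral_smul hω, map_smul, h.anti_vol, smul_comm]

theorem hodgeStar_hodge_of_mem (h : X.IsHodge g n vol) {m : ℕ}
    (hm : m = 0 ∨ m = 1 ∨ m + 1 = n ∨ m = n) {ω : X.Ext} (hω : ω ∈ X.degree m) :
    X.hodgeStar g n vol (X.hodge g n vol ω) = X.mu g n vol • ω := by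
  rw [h.hodgeStar_hodge, h.anti_of_mem hm hω, map_smul, h.signD_of_mem hω, smul_smul (_ ^ m), ← mul_pow]
  simp

theorem mu_ne_zero (h : X.IsHodge g n vol) : X.mu g n vol ≠ 0 := by
  rw [h.mu_eq]
  exact inv_ne_zero h.fourier_one.1

/-- The adjoint Hodge star agrees with the Hodge star just below the top degree. -/
theorem hodgeStar_eq_pred (h : X.IsHodge g n vol) (hq : X.IsQuantumSymmetric g) {m : ℕ}
    (hm : m + 1 = n) {ω : X.Ext} (hω : ω ∈ X.degree m) :
    X.hodgeStar g n vol ω = X.hodge g n vol ω := by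
  have := h.top.finite
  obtain ⟨φ, rfl⟩ := (h.metricExt_bijective h.metric).2 ω
  have hφ := h.mem_of_metricExt_mem h.metric hω
  have h1 := h.fourier_mem hm hω
  have h2 := h.hodge_mem hm hω
  obtain ⟨p, hp⟩ := exists_of_mem_degree_one h1
  have h3 : X.hodge g n vol (X.metricExt g φ) = X.incl (metricMap g p) := by
    rw [hodge, LinearMap.comp_apply, hp, h.metricExt_incl h.metric]
  -- On a twisted functional from degree one, the left side gives `(f ⊗ p)(g)` and the right side
  -- `(f ⊗ p)(Ψ(g))`, which agree by quantum symmetry. The sign is absorbed afterwards by (-1)^D in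
  -- degree one.
  have h4 : X.fourierStar n (X.integralStar g n vol) φ = -X.hodge g n vol (X.metricExt g φ) := by
    refine h.isIntegral.eq_of_pair_twist (super_antipode_bijective h.antipode_bijective)
      fun ψ => ?_
    rw [h.pairing_pair, h.pairing_fourierStar, map_neg]
    induction ψ using degree_induction with
    | add a b ha hb => simp only [map_add, mul_add, LinearMap.add_apply, ha, hb, neg_add]
    | mem j ψ hψ =>
      by_cases hj : j = 1
      · subst hj
        obtain ⟨f, rfl⟩ := exists_of_mem_degree_one hψ
        rw [h3, h.pairing_twist_incl h.metric, neg_neg, h.map_braiding_metric hq,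
          h.integralStar_eq, h.metricExt_mul h.metric, h.metricExt_incl h.metric,
          ← h.pairing_fourier, hp, h.pairing_incl, apply_metricMap]
      · rw [h.pairing_of_ne hj (h.dual.twist_mem hψ) h2, neg_zero, h.integralStar_eq]
        exact h.integral_of_ne (by omega) (h.metricExt_mem h.metric (mul_mem_degree hφ hψ))
  rw [hodgeStar, LinearMap.comp_apply, LinearMap.comp_apply,
    linInverse_apply (h.metricExt_bijective h.metric), h4, map_neg, h.signD_of_mem h2]
  simp

/-- The relation `♯^⋆ ♯ = μ` holds in all four degrees. It becomes a statement about ♯ alone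
wherever `♯^⋆ = ♯` is known, first in degree `n - 1`, and is then moved around by ♯. -/
theorem hodge_hodge (h : X.IsHodge g n vol) (hq : X.IsQuantumSymmetric g) {m : ℕ}
    (hm : m = 0 ∨ m = 1 ∨ m + 1 = n ∨ m = n) {ω : X.Ext} (hω : ω ∈ X.degree m) :
    X.hodgeStar g n vol ω = X.hodge g n vol ω ∧
      X.hodge g n vol (X.hodge g n vol ω) = X.mu g n vol • ω := by
  -- As `♯1 = μ Vol`, the relation `♯^⋆ ♯ 1 = μ` can be divided by `μ`.
  have hv : X.hodgeStar g n vol vol = 1 := by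
    have h1 := h.hodgeStar_hodge_of_mem (Or.inl rfl) one_mem_degree
    rw [h.hodge_one, map_smul] at h1
    exact smul_right_injective _ h.mu_ne_zero h1
  have ho : X.hodgeStar g n vol 1 = X.mu g n vol • vol := by
    have h1 := h.hodgeStar_hodge_of_mem (Or.inr (Or.inr (Or.inr rfl))) h.vol_mem
    rwa [h.hodge_vol] at h1
  have hone : ∀ d, d + 1 = n → ∀ ω ∈ X.degree 1,
      X.hodge g n vol (X.hodge g n vol ω) = X.mu g n vol • ω := by
    intro d hd ω hω
    rw [← h.hodgeStar_eq_pred hq hd (h.hodge_mem (by omega) hω)]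
    exact h.hodgeStar_hodge_of_mem (Or.inr (Or.inl rfl)) hω
  have hpred : ∀ d, d + 1 = n → ∀ ω ∈ X.degree d,
      X.hodge g n vol (X.hodge g n vol ω) = X.mu g n vol • ω := by
    intro d hd ω hω
    -- An element of degree `n - 1` is `♯c` with `c` of degree one, and `♯²♯c = ♯♯²c`.
    obtain ⟨c, hc, rfl⟩ := h.exists_hodge_eq (m := 1) (by omega) hω
    rw [hone d hd c hc, map_smul]
  rcases hm with rfl | rfl | hm | rfl
  · obtain ⟨r, rfl⟩ := exists_of_mem_degree_zero hω
    rw [Algebra.algebraMap_eq_smul_one]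
    simp only [map_smul, ho, h.hodge_one, h.hodge_vol, true_and]
    rw [smul_comm]
  -- If `n = 0` there is nothing in degree one; otherwise an element of degree one is `♯c` with `c`
  -- of degree `n - 1`, and both `♯^⋆♯c` and `♯♯c` equal `μ c`.
  · rcases n with _ | d
    · rw [h.top.2 1 one_pos, Submodule.mem_bot] at hω
      simp [hω]
    · refine ⟨?_, hone d rfl ω hω⟩
      obtain ⟨c, hc, rfl⟩ := h.exists_hodge_eq rfl hω
      rw [hpred d rfl c hc]
      exact h.hodgeStar_hodge_of_mem (Or.inr (Or.inr (Or.inl rfl))) hc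
  · exact ⟨h.hodgeStar_eq_pred hq hm hω, hpred m hm ω hω⟩
  · rw [h.eq_integral_smul hω]
    simp only [map_smul, hv, h.hodge_one, h.hodge_vol, true_and]
    rw [smul_comm]

end IsHodge

end CrossedData

end

end BraidedHodge

theorem proposition3p9 {k A V : Type*} [Field k] [Ring A] [HopfAlgebra k A]
    (hA : Function.Bijective (HopfAlgebra.antipode k (A := A)))
    [AddCommGroup V] [Module k V] [Module.Finite k V]
    (X : BraidedHodge.CrossedData k A V) (hX : X.IsCrossedModule)
    (g : TensorProduct k V V) (hg : X.IsBiinvariantMetric g)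
    (n : ℕ) (hn : X.HasTopDegree n)
    (vol : X.Ext) (hvol : vol ∈ X.degree n) (hvol0 : vol ≠ 0)
    (hinv : X.IsCentralBiinvariant vol) :
    (X.metricPairing g vol vol ≠ 0 ∧ X.mu g n vol = (X.metricPairing g vol vol)⁻¹ ∧
      X.mu g n vol ≠ 0) ∧
    Function.Bijective (X.hodge g n vol) ∧
    X.hodge g n vol ∘ₗ X.antipode = (-1 : k) ^ n • (X.antipode ∘ₗ X.hodge g n vol) ∧
    (X.IsQuantumSymmetric g →
      ∀ m : ℕ, m = 0 ∨ m = 1 ∨ m + 1 = n ∨ m = n → ∀ ω ∈ X.degree m,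
        X.antipode ω = (-1 : k) ^ m • ω ∧
        X.hodgeStar g n vol ω = X.hodge g n vol ω ∧
        X.hodge g n vol (X.hodge g n vol ω) = X.mu g n vol • ω) := by
  have h : X.IsHodge g n vol := ⟨⟨hA, hX.isYD⟩, hg, hn, hvol, hvol0, hinv⟩
  refine ⟨⟨h.fourier_one.1, h.mu_eq, h.mu_ne_zero⟩, h.hodge_bijective, ?_, fun hq m hm ω hω => ?_⟩
  · rw [h.antipode_eq]
    exact LinearMap.ext h.hodge_anti
  · rw [h.antipode_eq]
    exact ⟨h.anti_of_mem hm hω, h.hodge_hodge hq hm hω⟩
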